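/- A \emph{marriage instance} $T$ consists of disjoint finite sets of agents $X=\{x_1,\dots,x_p\}$ and $Y=\{y_1,\dots,y_q\}$, where each agent has a strictly ordered preference list of agents of the other side, and $y$ is on the list of $x$ if and only if $x$ is on the list of $y$; then $xy$ is an \emph{edge} of $T$. Agents prefer every agent on their list to being unmatched ($\emptyset$). A \emph{subtable} $T'\subseteq T$ is obtained by keeping a subset of the edges and the induced orders. A \emph{matching} $M$ of $T'$ is a set of pairwise disjoint edges of $T'$, and $M(z)$ is the partner of $z$ or $\emptyset$. An edge $xy$ \emph{blocks} $M$ if $y>_xM(x)$ and $x>_yM(y)$; $\mathcal S(T')$ is the set of matchings of $T'$ blocked by no edge of $T'$; $T'$ is \emph{stable} if each of its edges lies in some $M\in\mathcal S(T')$. A set $\mathcal M'$ of matchings of $T$ is \emph{internally stable} if no edge of a member of $\mathcal M'$ blocks a member of $\mathcal M'$. An internally stable $\mathcal M'$ is \emph{internally closed} if every matching $M$ of $T$ with $\mathcal M'\cup\{M\}$ internally stable lies in $\mathcal M'$; an \emph{internal closure} of an internally stable set is an internally closed set containing it. A \emph{generalized $X$-rotation exposed in} a matching $M$ \emph{within}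 a subtable $E$ is a sequence $\rho=(x_0,y_0),\dots,(x_{r-1},y_{r-1})$ of distinct pairs, taken up to cyclic shifts (indices modulo $r$), with $x_iy_i\in M\cap E$, $x_iy_{i+1}\in E$, $x_i>_{y_{i+1}}x_{i+1}$ and $y_i>_{x_i}y_{i+1}$ for all $i$. Put $E(\rho)=\{x_iy_i,\,x_iy_{i+1}\}_i$ and $M/\rho=(M\setminus\{x_iy_i\}_i)\cup\{x_iy_{i+1}\}_i$. It is an \emph{$X$-rotation} of $E$ exposed in $M$ if moreover $M\in\mathcal S(E)$ and $M(y)>_yx_i$ for all $i$ and all $x_iy\in E$ with $y_i>_{x_i}y>_{x_i}y_{i+1}$; $R_X(E)$ is the set of $X$-rotations of $E$ exposed in some $M\in\mathcal S(E)$. $Y$-rotations are defined by exchanging the two sides. For $\rho\in R_X(E)$ let $R(\rho)$ be the set of those $\rho'\in R_X(E)$, $\rho'\neq\rho$, that are eliminated before $\rho$ in every sequence of successive eliminations of exposed $X$-rotations of $E$ that starts from the $X$-optimal stable matching $M_X$ of $E$ and contains both. \emph{Dissect\_Rotation}$(T,E,\rho)$, for $\rho\in R_X(E)$: let $M^0=M_X/R(\rho)$,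 $M^*=M^0/\rho$, and let $\widetilde T$ consist of the edges $xy$ of $T$ with $M^*(y)\ge_yx\ge_yM^0(y)$ and $M^0(x)\ge_xy\ge_xM^*(x)$. If exactly one generalized $X$-rotation is exposed in $M^0$ within $\widetilde T$, return $\{\rho\}$. Otherwise choose such a generalized rotation $\rho_1\ne\rho$, put $M^1=M^0/\rho_1$, and return $\rho_1$ together with all the sequences $(x_0,y_0),\dots,(x_{r-1},y_{r-1})$ that come from the cycles of $M^1\triangle M^*$, where $x_iy_i\in M^1$ and $x_iy_{i+1}\in M^*$. \emph{Dissect\_All}$(Q)$, acting on the current table $T'$: while $Q\ne\emptyset$, remove some $\rho$ from $Q$ and let $R'$ be an output of Dissect\_Rotation$(T,T',\rho)$; if $|R'|\ge2$, replace $T'$ by $T'\cup\bigcup_{\rho'\in R'}E(\rho')$ and $Q$ by $Q\cup R'$. \emph{Internal\_Closure}$(T,T^0)$: set $T'=T^0$ and run Dissect\_All$(R_X(T'))$. Then, first for $Z=X$ and afterwards for $Z=Y$: while some generalized $Z$-rotation $\rho$ is exposed within $T$ in the stable matching of $T'$ that is optimal for the side other than $Z$, choose such a $\rho$, replace $T'$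 by $T'\cup E(\rho)$, and run Dissect\_All$(\{\rho\})$, where for $Z=Y$ the rotation $\rho=(y_0,x_0),\dots,(y_{r-1},x_{r-1})$ enters the queue as the $X$-rotation $(x_1,y_0),(x_2,y_1),\dots,(x_0,y_{r-1})$ that undoes it. Return $T'$. \textbf{Theorem.} Let $T$ be a marriage instance with $n=p+q$ agents and let $T^0\subseteq T$ be a stable subtable. Whatever choices are made, Internal\_Closure$(T,T^0)$ halts, and every output is a subtable $T'\subseteq T$ such that $\mathcal S(T')$ is an internal closure of $\mathcal S(T^0)$. It can be carried out in time $O(n^4)$: there are a fixed program for a unit-cost random access machine (with addition, subtraction, comparison and indirect addressing) and a constant $C$ such that, for all $T$ and $T^0$ as above, given by the preference lists of $T$ and the incidence matrix of $T^0$, the program halts after at most $Cn^4+C$ steps with the incidence matrix of an output $T'$ of Internal\_Closure$(T,T^0)$. In particular, the problem of finding, for a given marriage instance $T$ and a stable $T^0\subseteq T$, a subtable $T'\subseteq T$ such that $\mathcal S(T')$ is an internal closure of $\mathcal S(T^0)$ can be solved in time $O(n^4)$. -/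

import Mathlib

namespace Marriage

/-! ### Marriage instances, subtables and matchings -/

/-- `a` stands strictly before `b` in the preference list `l`. -/
def Pref {α : Type*} [DecidableEq α] (l : List α) (a b : α) : Prop :=
  a ∈ l ∧ b ∈ l ∧ l.idxOf a < l.idxOf b

/-- Weak preference. -/
def WPref {α : Type*} [DecidableEq α] (l : List α) (a b : α) : Prop :=
  a = b ∨ Pref l a b

/-- A set of pairs `xy`. It stands for a matching, and also for a subtable of an instance: a subtable
has the same agents and inherits the order of the lists, so it is determined by its edges. -/
abbrev Table (p q : ℕ) := Finset (Fin p × Fin q)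

/-- The same pairs, written as pairs `yx`. -/
def Table.swap {p q : ℕ} (E : Table p q) : Table q p := E.image Prod.swap

/-- A marriage instance with `X = Fin p` and `Y = Fin q`: every agent has a strictly ordered list (best
first) of acceptable agents of the other side, and acceptability is mutual. -/
structure Inst (p q : ℕ) where
  listX : Fin p → List (Fin q)
  listY : Fin q → List (Fin p)
  nodupX : ∀ x, (listX x).Nodup
  nodupY : ∀ y, (listY y).Nodup
  symm : ∀ x y, y ∈ listX x ↔ x ∈ listY y

variable {p q : ℕ}

/-- The same instance with the names of the two sides exchanged. -/
def Inst.swap (T : Inst p q) : Inst q p where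
  listX := T.listY
  listY := T.listX
  nodupX := T.nodupY
  nodupY := T.nodupX
  symm := fun y x => (T.symm x y).symm

/-- All edges of the instance. -/
def Inst.edges (T : Inst p q) : Table p q :=
  Finset.univ.filter fun e => e.2 ∈ T.listX e.1

/-- The pairs of `M` are pairwise disjoint. -/
def IsMatching (M : Table p q) : Prop :=
  ∀ e ∈ M, ∀ f ∈ M, e.1 = f.1 ∨ e.2 = f.2 → e = f

/-- `e = xy` blocks `M`: `y >_x M(x)` and `x >_y M(y)`, where being alone is worse than any acceptable
partner. -/
def Blocks (T : Inst p q) (e : Fin p × Fin q) (M : Table p q) : Prop :=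
  e ∈ T.edges ∧ (∀ y, (e.1, y) ∈ M → Pref (T.listX e.1) e.2 y) ∧
    ∀ x, (x, e.2) ∈ M → Pref (T.listY e.2) e.1 x

/-- The matchings of the subtable `E`. -/
def matchings (E : Table p q) : Set (Table p q) := {M | IsMatching M ∧ M ⊆ E}

/-- The stable matchings of the subtable `E` of `T`. -/
def stableMatchings (T : Inst p q) (E : Table p q) : Set (Table p q) :=
  {M | M ∈ matchings E ∧ ∀ e ∈ E, ¬ Blocks T e M}

/-- `E` is a stable table: each of its edges lies in some stable matching of `E`. -/
def IsStableTable (T : Inst p q) (E : Table p q) : Prop :=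
  ∀ e ∈ E, ∃ M ∈ stableMatchings T E, e ∈ M

/-! ### Internal stability -/

/-- The matching `M'` blocks the matching `M`. -/
def MatchingBlocks (T : Inst p q) (M' M : Table p q) : Prop := ∃ e ∈ M', Blocks T e M

def InternallyStable (T : Inst p q) (S : Set (Table p q)) : Prop :=
  S ⊆ matchings T.edges ∧ ∀ M ∈ S, ∀ M' ∈ S, ¬ MatchingBlocks T M M'

/-- The matchings of `T` that can be added to `S` without destroying internal stability. -/
def closureOf (T : Inst p q) (S : Set (Table p q)) : Set (Table p q) :=
  {M | M ∈ matchings T.edges ∧ InternallyStable T ({M} ∪ S)}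

def InternallyClosed (T : Inst p q) (S : Set (Table p q)) : Prop :=
  InternallyStable T S ∧ closureOf T S = S

/-- `S'` is an internal closure of `S`. -/
def IsInternalClosure (T : Inst p q) (S' S : Set (Table p q)) : Prop :=
  InternallyStable T S ∧ S ⊆ S' ∧ InternallyClosed T S'

/-! ### Optimal stable matchings -/

/-- `M ⪯_X M'`: every agent of `X` weakly prefers `M'` to `M`. -/
def LeX (T : Inst p q) (M M' : Table p q) : Prop :=
  ∀ x y, (x, y) ∈ M → ∃ y', (x, y') ∈ M' ∧ WPref (T.listX x) y' y

/-- `M` is the `X`-optimal stable matching of `E`. -/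
def IsXOptimal (T : Inst p q) (E M : Table p q) : Prop :=
  M ∈ stableMatchings T E ∧ ∀ M' ∈ stableMatchings T E, LeX T M' M

/-- `M` is the `Y`-optimal stable matching of `E`. -/
def IsYOptimal (T : Inst p q) (E M : Table p q) : Prop :=
  IsXOptimal T.swap E.swap M.swap

/-! ### Rotations -/

/-- A sequence `(x₀, y₀), …, (x_{r-1}, y_{r-1})` of pairs up to cyclic shifts. -/
abbrev Rotation (p q : ℕ) := Cycle (Fin p × Fin q)

theorem zip_rotate_toFinset {α : Type*} [DecidableEq α] {l l' : List α} (h : l ~r l') :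
    (l.zip (l.rotate 1)).toFinset = (l'.zip (l'.rotate 1)).toFinset := by
  obtain ⟨n, rfl⟩ := h
  have e : (l.rotate n).zip ((l.rotate n).rotate 1) = (l.zip (l.rotate 1)).rotate n := by
    rw [List.rotate_rotate, Nat.add_comm n 1, ← List.rotate_rotate]
    exact (List.zipWith_rotate_distrib _ l (l.rotate 1) n (by simp)).symm
  rw [e]
  ext a
  simp

theorem zipWith_rotate_isRotated {α β : Type*} (f : α → α → β) {l l' : List α} (h : l ~r l') :
    List.zipWith f l (l.rotate 1) ~r List.zipWith f l' (l'.rotate 1) := by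
  obtain ⟨n, rfl⟩ := h
  refine ⟨n, ?_⟩
  rw [List.rotate_rotate, Nat.add_comm n 1, ← List.rotate_rotate]
  exact List.zipWith_rotate_distrib _ l (l.rotate 1) n (by simp)

/-- The cyclically consecutive entries `((x_i, y_i), (x_{i+1}, y_{i+1}))`. -/
def links (ρ : Rotation p q) : Finset ((Fin p × Fin q) × (Fin p × Fin q)) :=
  Quotient.lift (s := List.IsRotated.setoid _) (fun l : List (Fin p × Fin q) => (l.zip (l.rotate 1)).toFinset)
    (fun _ _ h => zip_rotate_toFinset h) ρ

/-- The edges `x_i y_{i+1}`. -/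
def shifted (ρ : Rotation p q) : Table p q := (links ρ).image fun ab => (ab.1.1, ab.2.2)

/-- `E(ρ)`, consisting of the edges `x_i y_i` and `x_i y_{i+1}`. -/
def rotEdges (ρ : Rotation p q) : Table p q := ρ.toFinset ∪ shifted ρ

/-- The elimination `M / ρ`. -/
def elim (M : Table p q) (ρ : Rotation p q) : Table p q := (M \ ρ.toFinset) ∪ shifted ρ

/-- `ρ` is a generalized `X`-rotation exposed in the matching `M` within the subtable `E`. These are the
cycles `x₀ → y₁ → x₁ → ⋯ → y₀ → x₀` of the digraph `D_X(M, E)`, which has an arc `x → y` if `xy ∈ E`,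
`x >_y M(y)`, `M(x) >_x y`, and an arc `y → M(y)`. -/
def IsGenRotation (T : Inst p q) (E M : Table p q) (ρ : Rotation p q) : Prop :=
  ρ ≠ Cycle.nil ∧ ρ.Nodup ∧ rotEdges ρ ⊆ E ∧
    ∀ a b, (a, b) ∈ links ρ →
      a ∈ M ∧ Pref (T.listY b.2) a.1 b.1 ∧ Pref (T.listX a.1) a.2 b.2

/-- `ρ` is a (classical) `X`-rotation exposed in the stable matching `M` of `E`. -/
def IsRotation (T : Inst p q) (E M : Table p q) (ρ : Rotation p q) : Prop :=
  M ∈ stableMatchings T E ∧ IsGenRotation T E M ρ ∧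
    ∀ a b, (a, b) ∈ links ρ → ∀ y, (a.1, y) ∈ E → Pref (T.listX a.1) a.2 y →
      Pref (T.listX a.1) y b.2 → ∃ x, (x, y) ∈ M ∧ Pref (T.listY y) x a.1

/-- `R_X(E)`: all `X`-rotations exposed in some stable matching of `E`. -/
def rotations (T : Inst p q) (E : Table p q) : Set (Rotation p q) :=
  {ρ | ∃ M, IsRotation T E M ρ}

/-- `M' = M / ρ₁ / ⋯ / ρ_k`, where each rotation is exposed when it is eliminated. -/
inductive ElimSeq (T : Inst p q) (E : Table p q) :
    Table p q → List (Rotation p q) → Table p q → Prop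
  | nil (M : Table p q) : ElimSeq T E M [] M
  | cons (M : Table p q) (ρ : Rotation p q) (l : List (Rotation p q)) (M' : Table p q) :
      IsRotation T E M ρ → ElimSeq T E (elim M ρ) l M' → ElimSeq T E M (ρ :: l) M'

/-- `ρ' ⊏ ρ`: in each sequence of eliminations that starts from the `X`-optimal stable matching and
contains both, `ρ'` is eliminated before `ρ`. -/
def Precedes (T : Inst p q) (E : Table p q) (ρ' ρ : Rotation p q) : Prop :=
  ρ' ≠ ρ ∧ ∀ MX l M, IsXOptimal T E MX → ElimSeq T E MX l M → ρ' ∈ l → ρ ∈ l →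
    l.idxOf ρ' < l.idxOf ρ

/-- `R(ρ)`: the rotations of `E` that precede `ρ`. -/
def predecessors (T : Inst p q) (E : Table p q) (ρ : Rotation p q) : Set (Rotation p q) :=
  {ρ' | ρ' ∈ rotations T E ∧ Precedes T E ρ' ρ}

/-! ### The algorithm -/

open Classical in
/-- The subtable of the edges `xy` of `T` with `M*(y) ≥_y x ≥_y M⁰(y)` and
`M⁰(x) ≥_x y ≥_x M*(x)`. -/
noncomputable def between (T : Inst p q) (M0 Ms : Table p q) : Table p q :=
  T.edges.filter fun e =>
    ((∃ x, (x, e.2) ∈ Ms ∧ WPref (T.listY e.2) x e.1) ∧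
      (∀ x, (x, e.2) ∈ M0 → WPref (T.listY e.2) e.1 x)) ∧
    ((∃ y, (e.1, y) ∈ M0 ∧ WPref (T.listX e.1) y e.2) ∧
      (∀ y, (e.1, y) ∈ Ms → WPref (T.listX e.1) e.2 y))

/-- `ρ` runs along a cycle of the graph with edge set `M △ M'` (for matchings `M`, `M'`), with
`x_i y_i ∈ M` and `x_i y_{i+1} ∈ M'`. -/
def IsAltCycle (M M' : Table p q) (ρ : Rotation p q) : Prop :=
  ρ ≠ Cycle.nil ∧ ρ.Nodup ∧ ρ.toFinset ⊆ M \ M' ∧ shifted ρ ⊆ M' \ M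

/-- `R` is a possible output of `Dissect_Rotation(T, E, ρ)`. -/
def DissectRotation (T : Inst p q) (E : Table p q) (ρ : Rotation p q)
    (R : Finset (Rotation p q)) : Prop :=
  ∃ MX l M0, IsXOptimal T E MX ∧ (∀ ρ', ρ' ∈ l ↔ ρ' ∈ predecessors T E ρ) ∧
    ElimSeq T E MX l M0 ∧
    (((∃! ρ', IsGenRotation T (between T M0 (elim M0 ρ)) M0 ρ') ∧ R = {ρ}) ∨
      ((¬ ∃! ρ', IsGenRotation T (between T M0 (elim M0 ρ)) M0 ρ') ∧
        ∃ ρ₁, ρ₁ ≠ ρ ∧ IsGenRotation T (between T M0 (elim M0 ρ)) M0 ρ₁ ∧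
          ∀ ρ', ρ' ∈ R ↔ ρ' = ρ₁ ∨ IsAltCycle (elim M0 ρ₁) (elim M0 ρ) ρ'))

/-- The `X`-rotation `(x₁, y₀), (x₂, y₁), …, (x₀, y_{r-1})` that undoes the (generalized)
`Y`-rotation `(y₀, x₀), …, (y_{r-1}, x_{r-1})`; it has the same edges. -/
def undo (τ : Rotation q p) : Rotation p q :=
  Quotient.map' (s₁ := List.IsRotated.setoid _) (s₂ := List.IsRotated.setoid _)
    (fun l : List (Fin q × Fin p) =>
      List.zipWith (fun a b : Fin q × Fin p => (b.2, a.1)) l (l.rotate 1))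
    (fun _ _ h => zipWith_rotate_isRotated _ h) τ

inductive Side
  | X
  | Y

/-- A configuration of `Internal_Closure`: either running, with the current value `Z` of the
for-loop, the current table `T'` and the current queue of `Dissect_All`, or halted with an output. -/
inductive Config (p q : ℕ)
  | running (Z : Side) (E : Table p q) (Q : Finset (Rotation p q))
  | halted (E : Table p q)

/-- The steps of `Internal_Closure` on the instance `T`. A nonempty queue means that `Dissect_All` is
at work: it takes some `ρ` out of the queue, and if `ρ` can be dissected, the table is enlarged and the
new rotations enter the queue. With an empty queue the while-loop of the current side looks for a
generalized rotation exposed in the optimal stable matching of the other side. -/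
inductive Step (T : Inst p q) : Config p q → Config p q → Prop
  | dissect (Z : Side) (E : Table p q) (Q : Finset (Rotation p q)) (ρ : Rotation p q)
      (R : Finset (Rotation p q)) : ρ ∈ Q → DissectRotation T E ρ R → 2 ≤ R.card →
      Step T (.running Z E Q) (.running Z (E ∪ R.biUnion rotEdges) (Q.erase ρ ∪ R))
  | keep (Z : Side) (E : Table p q) (Q : Finset (Rotation p q)) (ρ : Rotation p q)
      (R : Finset (Rotation p q)) : ρ ∈ Q → DissectRotation T E ρ R → R.card < 2 →
      Step T (.running Z E Q) (.running Z E (Q.erase ρ))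
  | growX (E M : Table p q) (ρ : Rotation p q) : IsYOptimal T E M → IsGenRotation T T.edges M ρ →
      Step T (.running .X E ∅) (.running .X (E ∪ rotEdges ρ) {ρ})
  | doneX (E M : Table p q) : IsYOptimal T E M → (¬ ∃ ρ, IsGenRotation T T.edges M ρ) →
      Step T (.running .X E ∅) (.running .Y E ∅)
  | growY (E M : Table p q) (τ : Rotation q p) : IsXOptimal T E M →
      IsGenRotation T.swap T.swap.edges M.swap τ →
      Step T (.running .Y E ∅) (.running .Y (E ∪ (rotEdges τ).swap) {undo τ})
  | doneY (E M : Table p q) : IsXOptimal T E M →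
      (¬ ∃ τ, IsGenRotation T.swap T.swap.edges M.swap τ) →
      Step T (.running .Y E ∅) (.halted E)

/-- `c` is the configuration in which `Internal_Closure(T, E₀)` starts. -/
def IsStart (T : Inst p q) (E₀ : Table p q) (c : Config p q) : Prop :=
  ∃ Q : Finset (Rotation p q), (∀ ρ, ρ ∈ Q ↔ ρ ∈ rotations T E₀) ∧ c = .running .X E₀ Q

/-- Some run of `Internal_Closure(T, E₀)` halts with output `E'`. -/
def Outputs (T : Inst p q) (E₀ E' : Table p q) : Prop :=
  ∃ c, IsStart T E₀ c ∧ Relation.ReflTransGen (Step T) c (.halted E')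

/-- Every run of `Internal_Closure(T, E₀)` halts: there is no infinite run, and no run gets stuck
before it halts. -/
def AlwaysHalts (T : Inst p q) (E₀ : Table p q) : Prop :=
  (¬ ∃ r : ℕ → Config p q, IsStart T E₀ (r 0) ∧ ∀ i, Step T (r i) (r (i + 1))) ∧
    ∀ c c', IsStart T E₀ c → Relation.ReflTransGen (Step T) c c' →
      (∃ c'', Step T c' c'') ∨ ∃ E', c' = .halted E'

/-! ### Random access machines

Structured programs for a random access machine with unit costs, over natural-number variables and
arrays, with addition, truncated subtraction, comparisons and indirect addressing. -/

structure RAMState where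
  var : ℕ → ℕ
  arr : ℕ → ℕ → ℕ

inductive Expr
  | const (c : ℕ)
  | var (v : ℕ)
  | get (a : ℕ) (e : Expr)
  | add (e f : Expr)
  | sub (e f : Expr)
  | lt (e f : Expr)
  | eq (e f : Expr)

def Expr.eval (s : RAMState) : Expr → ℕ
  | .const c => c
  | .var v => s.var v
  | .get a e => s.arr a (e.eval s)
  | .add e f => e.eval s + f.eval s
  | .sub e f => e.eval s - f.eval s
  | .lt e f => if e.eval s < f.eval s then 1 else 0
  | .eq e f => if e.eval s = f.eval s then 1 else 0

/-- The number of elementary operations in the evaluation of an expression. -/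
def Expr.cost : Expr → ℕ
  | .const _ => 1
  | .var _ => 1
  | .get _ e => e.cost + 1
  | .add e f => e.cost + f.cost + 1
  | .sub e f => e.cost + f.cost + 1
  | .lt e f => e.cost + f.cost + 1
  | .eq e f => e.cost + f.cost + 1

inductive Prog
  | skip
  | assign (v : ℕ) (e : Expr)
  | store (a : ℕ) (i e : Expr)
  | seq (c d : Prog)
  | cond (e : Expr) (c d : Prog)
  | loop (e : Expr) (c : Prog)

def RAMState.setVar (s : RAMState) (v n : ℕ) : RAMState :=
  { s with var := Function.update s.var v n }

def RAMState.setArr (s : RAMState) (a i n : ℕ) : RAMState :=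
  { s with arr := Function.update s.arr a (Function.update (s.arr a) i n) }

/-- `Exec c s s' t`: started in state `s`, the program `c` halts in state `s'` after `t` steps. A
condition holds if its value is not zero; `loop e c` repeats `c` while `e` holds. -/
inductive Exec : Prog → RAMState → RAMState → ℕ → Prop
  | skip (s : RAMState) : Exec .skip s s 1
  | assign (s : RAMState) (v : ℕ) (e : Expr) :
      Exec (.assign v e) s (s.setVar v (e.eval s)) (e.cost + 1)
  | store (s : RAMState) (a : ℕ) (i e : Expr) :
      Exec (.store a i e) s (s.setArr a (i.eval s) (e.eval s)) (i.cost + e.cost + 1)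
  | seq (c d : Prog) (s s' s'' : RAMState) (t t' : ℕ) :
      Exec c s s' t → Exec d s' s'' t' → Exec (.seq c d) s s'' (t + t')
  | condTrue (e : Expr) (c d : Prog) (s s' : RAMState) (t : ℕ) :
      e.eval s ≠ 0 → Exec c s s' t → Exec (.cond e c d) s s' (e.cost + 1 + t)
  | condFalse (e : Expr) (c d : Prog) (s s' : RAMState) (t : ℕ) :
      e.eval s = 0 → Exec d s s' t → Exec (.cond e c d) s s' (e.cost + 1 + t)
  | loopTrue (e : Expr) (c : Prog) (s s' s'' : RAMState) (t t' : ℕ) :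
      e.eval s ≠ 0 → Exec c s s' t → Exec (.loop e c) s' s'' t' →
      Exec (.loop e c) s s'' (e.cost + 1 + t + t')
  | loopFalse (e : Expr) (c : Prog) (s : RAMState) :
      e.eval s = 0 → Exec (.loop e c) s s (e.cost + 1)

/-- The matrix with `r` rows, `c` columns and entries `f i j`, stored row by row. -/
def flatten (r c : ℕ) (f : Fin r → ℕ → ℕ) (k : ℕ) : ℕ :=
  if h : k / c < r then f ⟨k / c, h⟩ (k % c) else 0

/-- The entry at position `k` of a preference list: the number of that agent, counted from 1, or 0 when
the list is shorter. -/
def listEntry {m : ℕ} (l : List (Fin m)) (k : ℕ) : ℕ :=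
  match l[k]? with
  | some a => a.val + 1
  | none => 0

/-- The input: variables 0 and 1 hold `p` and `q`, arrays 0 and 1 the preference lists of the agents of
`X` and of `Y`, one row for each agent, array 2 the 0-1 incidence matrix of the subtable `E₀`.
Everything else is 0. -/
def inputState (T : Inst p q) (E₀ : Table p q) : RAMState where
  var := fun v => if v = 0 then p else if v = 1 then q else 0
  arr := fun a =>
    if a = 0 then flatten p q fun x k => listEntry (T.listX x) k
    else if a = 1 then flatten q p fun y k => listEntry (T.listY y) k
    else if a = 2 then flatten p q fun x k => if ∃ y : Fin q, y.val = k ∧ (x, y) ∈ E₀ then 1 else 0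
    else fun _ => 0

/-- Array 3 holds the 0-1 incidence matrix of the subtable `E'`. -/
def HoldsOutput (s : RAMState) (E' : Table p q) : Prop :=
  ∀ (x : Fin p) (y : Fin q), s.arr 3 (x.val * q + y.val) = if (x, y) ∈ E' then 1 else 0

end Marriage

namespace Marriage

variable {p q : ℕ}

/-! ### Ranks -/

/-- The position of `y` in the list of `x`. -/
def rkX (T : Inst p q) (x : Fin p) (y : Fin q) : ℕ := (T.listX x).idxOf y

/-- The position of `x` in the list of `y`. -/
def rkY (T : Inst p q) (y : Fin q) (x : Fin p) : ℕ := (T.listY y).idxOf x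

theorem mem_edges {T : Inst p q} {x : Fin p} {y : Fin q} : (x, y) ∈ T.edges ↔ y ∈ T.listX x := by
  simp [Inst.edges]

theorem mem_edges' {T : Inst p q} {x : Fin p} {y : Fin q} : (x, y) ∈ T.edges ↔ x ∈ T.listY y := by
  rw [mem_edges, T.symm]

theorem rkX_inj {T : Inst p q} {x : Fin p} {y y' : Fin q} (h : (x, y) ∈ T.edges)
    (e : rkX T x y = rkX T x y') : y = y' :=
  (List.idxOf_inj (mem_edges.1 h)).1 e

theorem rkY_inj {T : Inst p q} {y : Fin q} {x x' : Fin p} (h : (x, y) ∈ T.edges)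
    (e : rkY T y x = rkY T y x') : x = x' :=
  (List.idxOf_inj (mem_edges'.1 h)).1 e

theorem prefX_iff {T : Inst p q} {x : Fin p} {y y' : Fin q} (h : (x, y) ∈ T.edges)
    (h' : (x, y') ∈ T.edges) : Pref (T.listX x) y y' ↔ rkX T x y < rkX T x y' := by
  simp [Pref, rkX, mem_edges.1 h, mem_edges.1 h']

theorem prefY_iff {T : Inst p q} {y : Fin q} {x x' : Fin p} (h : (x, y) ∈ T.edges)
    (h' : (x', y) ∈ T.edges) : Pref (T.listY y) x x' ↔ rkY T y x < rkY T y x' := by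
  simp [Pref, rkY, mem_edges'.1 h, mem_edges'.1 h']

theorem wprefX_iff {T : Inst p q} {x : Fin p} {y y' : Fin q} (h : (x, y) ∈ T.edges)
    (h' : (x, y') ∈ T.edges) : WPref (T.listX x) y y' ↔ rkX T x y ≤ rkX T x y' := by
  rw [WPref, prefX_iff h h', le_iff_lt_or_eq, or_comm]
  exact or_congr_right ⟨fun e => e ▸ rfl, rkX_inj h⟩

theorem wprefY_iff {T : Inst p q} {y : Fin q} {x x' : Fin p} (h : (x, y) ∈ T.edges)
    (h' : (x', y) ∈ T.edges) : WPref (T.listY y) x x' ↔ rkY T y x ≤ rkY T y x' := by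
  rw [WPref, prefY_iff h h', le_iff_lt_or_eq, or_comm]
  exact or_congr_right ⟨fun e => e ▸ rfl, rkY_inj h⟩

/-! ### Matchings of the instance -/

/-- `M` is a matching of the instance `T`. -/
def Mat (T : Inst p q) (M : Table p q) : Prop := M ∈ matchings T.edges

theorem Mat.edge {T : Inst p q} {M : Table p q} (h : Mat T M) {e : Fin p × Fin q} (he : e ∈ M) :
    e ∈ T.edges := h.2 he

theorem Mat.uniqX {T : Inst p q} {M : Table p q} (h : Mat T M) {x : Fin p} {y y' : Fin q}
    (h1 : (x, y) ∈ M) (h2 : (x, y') ∈ M) : y = y' :=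
  (Prod.ext_iff.1 (h.1 _ h1 _ h2 (Or.inl rfl))).2

theorem Mat.uniqY {T : Inst p q} {M : Table p q} (h : Mat T M) {x x' : Fin p} {y : Fin q}
    (h1 : (x, y) ∈ M) (h2 : (x', y) ∈ M) : x = x' :=
  (Prod.ext_iff.1 (h.1 _ h1 _ h2 (Or.inr rfl))).1

theorem Mat.of_uniq {T : Inst p q} {M : Table p q} (hE : M ⊆ T.edges)
    (hX : ∀ x y y', (x, y) ∈ M → (x, y') ∈ M → y = y')
    (hY : ∀ x x' y, (x, y) ∈ M → (x', y) ∈ M → x = x') : Mat T M := by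
  refine ⟨?_, hE⟩
  rintro ⟨x, y⟩ h ⟨x', y'⟩ h' (e | e)
  · simp only at e; subst e; rw [hX _ _ _ h h']
  · simp only at e; subst e; rw [hY _ _ _ h h']

theorem not_blocks_iff {T : Inst p q} {N : Table p q} (hN : N ⊆ T.edges) {x : Fin p} {y : Fin q}
    (h : (x, y) ∈ T.edges) : ¬ Blocks T (x, y) N ↔
      (∃ y', (x, y') ∈ N ∧ rkX T x y' ≤ rkX T x y) ∨ ∃ x', (x', y) ∈ N ∧ rkY T y x' ≤ rkY T y x := by
  constructor
  · intro hb
    by_contra hc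
    push Not at hc
    refine hb ⟨h, fun y' hy' => ?_, fun x' hx' => ?_⟩
    · exact (prefX_iff h (hN hy')).2 (hc.1 y' hy')
    · exact (prefY_iff h (hN hx')).2 (hc.2 x' hx')
  · rintro (⟨y', h1, h2⟩ | ⟨x', h1, h2⟩) ⟨_, hx, hy⟩
    · have := (prefX_iff h (hN h1)).1 (hx y' h1)
      omega
    · have := (prefY_iff h (hN h1)).1 (hy x' h1)
      omega

theorem blocks_iff {T : Inst p q} {N : Table p q} (hN : N ⊆ T.edges) {x : Fin p} {y : Fin q} :
    Blocks T (x, y) N ↔ (x, y) ∈ T.edges ∧ (∀ y', (x, y') ∈ N → rkX T x y < rkX T x y') ∧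
      ∀ x', (x', y) ∈ N → rkY T y x < rkY T y x' := by
  by_cases h : (x, y) ∈ T.edges
  · rw [← not_iff_not, not_blocks_iff hN h]
    simp only [h, true_and, not_and_or, not_forall, not_lt, exists_prop]
  · exact ⟨fun hb => absurd hb.1 h, fun hb => absurd hb.1 h⟩

/-- No edge of one of the two matchings blocks the other. -/
def Compat (T : Inst p q) (M N : Table p q) : Prop :=
  (∀ e ∈ M, ¬ Blocks T e N) ∧ ∀ e ∈ N, ¬ Blocks T e M

theorem Compat.symm {T : Inst p q} {M N : Table p q} (h : Compat T M N) : Compat T N M := ⟨h.2, h.1⟩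

theorem not_blocks_self {T : Inst p q} {M : Table p q} {e : Fin p × Fin q} (he : e ∈ M) :
    ¬ Blocks T e M := by
  rintro ⟨_, h, _⟩
  have := h e.2 he
  exact absurd this.2.2 (lt_irrefl _)

theorem Compat.refl {T : Inst p q} (M : Table p q) : Compat T M M :=
  ⟨fun _ he => not_blocks_self he, fun _ he => not_blocks_self he⟩

open Classical in
/-- The counting argument behind the opposition of interests. -/
theorem opp_aux {T : Inst p q} {M N : Table p q} (hM : Mat T M) (hN : Mat T N) (h : Compat T M N)
    (A B : Table p q)
    (hA : A = N.filter fun e => ∀ y, (e.1, y) ∈ M → rkX T e.1 e.2 < rkX T e.1 y)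
    (hB : B = M.filter fun e => ∀ x, (x, e.2) ∈ N → rkY T e.2 e.1 < rkY T e.2 x) :
    B.image Prod.fst = A.image Prod.fst ∧ A.image Prod.snd = B.image Prod.snd := by
  have sub1 : B.image Prod.fst ⊆ A.image Prod.fst := by
    intro x hx
    obtain ⟨⟨x, y⟩, he, rfl⟩ := Finset.mem_image.1 hx
    rw [hB, Finset.mem_filter] at he
    rcases (not_blocks_iff hN.2 (hM.edge he.1)).1 (h.1 _ he.1) with ⟨y', h1, h2⟩ | ⟨x', h1, h2⟩
    · refine Finset.mem_image.2 ⟨(x, y'), ?_, rfl⟩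
      rw [hA, Finset.mem_filter]
      refine ⟨h1, fun y1 hy1 => ?_⟩
      obtain rfl := hM.uniqX hy1 he.1
      refine lt_of_le_of_ne h2 fun e => ?_
      obtain rfl := rkX_inj (hN.edge h1) e
      exact lt_irrefl _ (he.2 x h1)
    · have := he.2 x' h1
      simp only at this
      omega
  have sub2 : A.image Prod.snd ⊆ B.image Prod.snd := by
    intro x hx
    obtain ⟨⟨x, y⟩, he, rfl⟩ := Finset.mem_image.1 hx
    rw [hA, Finset.mem_filter] at he
    rcases (not_blocks_iff hM.2 (hN.edge he.1)).1 (h.2 _ he.1) with ⟨y', h1, h2⟩ | ⟨x', h1, h2⟩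
    · have := he.2 y' h1
      simp only at this
      omega
    · refine Finset.mem_image.2 ⟨(x', y), ?_, rfl⟩
      rw [hB, Finset.mem_filter]
      refine ⟨h1, fun y1 hy1 => ?_⟩
      obtain rfl := hN.uniqY hy1 he.1
      refine lt_of_le_of_ne h2 fun e => ?_
      obtain rfl := rkY_inj (hM.edge h1) e
      exact lt_irrefl _ (he.2 y h1)
  have c1 : (A.image Prod.snd).card = A.card := by
    refine Finset.card_image_of_injOn fun a ha b hb e => ?_
    rw [hA] at ha hb
    exact hN.1 _ (Finset.mem_filter.1 ha).1 _ (Finset.mem_filter.1 hb).1 (Or.inr e)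
  have c2 : (A.image Prod.fst).card = A.card := by
    refine Finset.card_image_of_injOn fun a ha b hb e => ?_
    rw [hA] at ha hb
    exact hN.1 _ (Finset.mem_filter.1 ha).1 _ (Finset.mem_filter.1 hb).1 (Or.inl e)
  have c3 : (B.image Prod.snd).card = B.card := by
    refine Finset.card_image_of_injOn fun a ha b hb e => ?_
    rw [hB] at ha hb
    exact hM.1 _ (Finset.mem_filter.1 ha).1 _ (Finset.mem_filter.1 hb).1 (Or.inr e)
  have c4 : (B.image Prod.fst).card = B.card := by
    refine Finset.card_image_of_injOn fun a ha b hb e => ?_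
    rw [hB] at ha hb
    exact hM.1 _ (Finset.mem_filter.1 ha).1 _ (Finset.mem_filter.1 hb).1 (Or.inl e)
  have l1 := Finset.card_le_card sub1
  have l2 := Finset.card_le_card sub2
  exact ⟨Finset.eq_of_subset_of_card_le sub1 (by omega), Finset.eq_of_subset_of_card_le sub2 (by omega)⟩

/-- Opposition of interests: an edge `xy` of `M` is compared with a compatible matching `N`. -/
theorem opp {T : Inst p q} {M N : Table p q} (hM : Mat T M) (hN : Mat T N) (h : Compat T M N)
    {x : Fin p} {y : Fin q} (he : (x, y) ∈ M) : ∃ y' x', (x, y') ∈ N ∧ (x', y) ∈ N ∧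
      ((rkX T x y' < rkX T x y ∧ rkY T y x < rkY T y x') ∨
        (rkX T x y < rkX T x y' ∧ rkY T y x' < rkY T y x) ∨ (y' = y ∧ x' = x)) := by
  classical
  obtain ⟨i1, i2⟩ := opp_aux hM hN h _ _ rfl rfl
  obtain ⟨j1, j2⟩ := opp_aux hN hM h.symm _ _ rfl rfl
  have hx : ∃ y', (x, y') ∈ N := by
    by_contra hc
    push Not at hc
    have : x ∈ Finset.image Prod.fst (M.filter fun e => ∀ y, (e.1, y) ∈ N →
        rkX T e.1 e.2 < rkX T e.1 y) :=
      Finset.mem_image.2 ⟨(x, y), Finset.mem_filter.2 ⟨he, fun y' h' => absurd h' (hc y')⟩, rfl⟩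
    rw [← j1] at this
    obtain ⟨⟨x, y'⟩, h', rfl⟩ := Finset.mem_image.1 this
    exact hc y' (Finset.mem_filter.1 h').1
  obtain ⟨y', hy'⟩ := hx
  rcases lt_trichotomy (rkX T x y') (rkX T x y) with hlt | heq | hlt
  · have m : x ∈ Finset.image Prod.fst (N.filter fun e => ∀ y, (e.1, y) ∈ M →
        rkX T e.1 e.2 < rkX T e.1 y) :=
      Finset.mem_image.2 ⟨(x, y'), Finset.mem_filter.2 ⟨hy', fun y1 h1 => by
        rw [hM.uniqX h1 he]; exact hlt⟩, rfl⟩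
    rw [← i1] at m
    obtain ⟨⟨x, y1⟩, h1, rfl⟩ := Finset.mem_image.1 m
    rw [Finset.mem_filter] at h1
    obtain rfl := hM.uniqX h1.1 he
    have m : y1 ∈ Finset.image Prod.snd (M.filter fun e => ∀ x, (x, e.2) ∈ N →
        rkY T e.2 e.1 < rkY T e.2 x) := Finset.mem_image.2 ⟨(x, y1), Finset.mem_filter.2 h1, rfl⟩
    rw [← i2] at m
    obtain ⟨⟨x', y1⟩, h2, rfl⟩ := Finset.mem_image.1 m
    rw [Finset.mem_filter] at h2
    exact ⟨y', x', hy', h2.1, Or.inl ⟨hlt, h1.2 _ h2.1⟩⟩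
  · obtain rfl := rkX_inj (hN.edge hy') heq
    exact ⟨y', x, hy', hy', Or.inr (Or.inr ⟨rfl, rfl⟩)⟩
  · have m : y ∈ Finset.image Prod.snd (M.filter fun e => ∀ y, (e.1, y) ∈ N →
        rkX T e.1 e.2 < rkX T e.1 y) :=
      Finset.mem_image.2 ⟨(x, y), Finset.mem_filter.2 ⟨he, fun y1 h1 => by
        rw [hN.uniqX h1 hy']; exact hlt⟩, rfl⟩
    rw [j2] at m
    obtain ⟨⟨x', y1⟩, h2, rfl⟩ := Finset.mem_image.1 m
    rw [Finset.mem_filter] at h2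
    exact ⟨y', x', hy', h2.1, Or.inr (Or.inl ⟨hlt, h2.2 _ he⟩)⟩

/-! ### The order of matchings -/

/-- `M` and `N` cover the same agents, every agent of `X` weakly prefers `M`, and every agent of `Y`
weakly prefers `N`. -/
def Dom (T : Inst p q) (M N : Table p q) : Prop :=
  (∀ x y, (x, y) ∈ M → ∃ y' x', (x, y') ∈ N ∧ (x', y) ∈ N ∧
    rkX T x y ≤ rkX T x y' ∧ rkY T y x' ≤ rkY T y x) ∧
  ∀ x y, (x, y) ∈ N → ∃ y' x', (x, y') ∈ M ∧ (x', y) ∈ M ∧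
    rkX T x y' ≤ rkX T x y ∧ rkY T y x ≤ rkY T y x'

theorem Dom.refl {T : Inst p q} (M : Table p q) : Dom T M M :=
  ⟨fun x y h => ⟨y, x, h, h, le_rfl, le_rfl⟩, fun x y h => ⟨y, x, h, h, le_rfl, le_rfl⟩⟩

theorem Dom.leX {T : Inst p q} {M N : Table p q} (h : Dom T M N) (hN : Mat T N) {x : Fin p}
    {y y' : Fin q} (h1 : (x, y) ∈ M) (h2 : (x, y') ∈ N) : rkX T x y ≤ rkX T x y' := by
  obtain ⟨y1, _, h3, _, h4, _⟩ := h.1 x y h1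
  rwa [hN.uniqX h2 h3]

theorem Dom.leY {T : Inst p q} {M N : Table p q} (h : Dom T M N) (hN : Mat T N) {x x' : Fin p}
    {y : Fin q} (h1 : (x, y) ∈ M) (h2 : (x', y) ∈ N) : rkY T y x' ≤ rkY T y x := by
  obtain ⟨_, x1, _, h3, _, h4⟩ := h.1 x y h1
  rwa [hN.uniqY h2 h3]

theorem Dom.trans {T : Inst p q} {M N K : Table p q}
    (h : Dom T M N) (h' : Dom T N K) : Dom T M K := by
  constructor
  · intro x y hxy
    obtain ⟨y1, x1, a, b, a', b'⟩ := h.1 x y hxy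
    obtain ⟨y2, _, c, _, c', _⟩ := h'.1 _ _ a
    obtain ⟨_, x2, _, d, _, d'⟩ := h'.1 _ _ b
    exact ⟨y2, x2, c, d, by omega, by omega⟩
  · intro x y hxy
    obtain ⟨y1, x1, a, b, a', b'⟩ := h'.2 x y hxy
    obtain ⟨y2, _, c, _, c', _⟩ := h.2 _ _ a
    obtain ⟨_, x2, _, d, _, d'⟩ := h.2 _ _ b
    exact ⟨y2, x2, c, d, by omega, by omega⟩

theorem Dom.antisymm {T : Inst p q} {M N : Table p q} (hM : Mat T M) (hN : Mat T N)
    (h : Dom T M N) (h' : Dom T N M) : M = N := by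
  have key : ∀ {M N : Table p q}, Mat T M → Mat T N → Dom T M N → Dom T N M → M ⊆ N := by
    rintro M N hM hN h h' ⟨x, y⟩ hxy
    obtain ⟨y1, x1, a, b, a', b'⟩ := h.1 x y hxy
    have := h'.leX hM a hxy
    rwa [rkX_inj (hM.edge hxy) (by omega : rkX T x y = rkX T x y1)]
  exact Finset.Subset.antisymm (key hM hN h h') (key hN hM h' h)

theorem Dom.compat {T : Inst p q} {M N : Table p q} (hM : Mat T M) (hN : Mat T N)
    (h : Dom T M N) : Compat T M N := by
  constructor
  · rintro ⟨x, y⟩ he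
    obtain ⟨y1, x1, a, b, a', b'⟩ := h.1 x y he
    exact (not_blocks_iff hN.2 (hM.edge he)).2 (Or.inr ⟨x1, b, b'⟩)
  · rintro ⟨x, y⟩ he
    obtain ⟨y1, x1, a, b, a', b'⟩ := h.2 x y he
    exact (not_blocks_iff hM.2 (hN.edge he)).2 (Or.inl ⟨y1, a, a'⟩)

theorem Compat.dom_of_leX {T : Inst p q} {M N : Table p q} (hM : Mat T M) (hN : Mat T N)
    (h : Compat T M N)
    (hle : ∀ x y y', (x, y) ∈ M → (x, y') ∈ N → rkX T x y ≤ rkX T x y') : Dom T M N := by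
  constructor
  · intro x y he
    obtain ⟨y', x', a, b, c⟩ := opp hM hN h he
    have := hle x y y' he a
    refine ⟨y', x', a, b, this, ?_⟩
    rcases c with c | c | ⟨rfl, rfl⟩ <;> omega
  · intro x y he
    obtain ⟨y', x', a, b, c⟩ := opp hN hM h.symm he
    have := hle x y' y a he
    refine ⟨y', x', a, b, this, ?_⟩
    rcases c with c | c | ⟨rfl, rfl⟩ <;> omega

open Classical in
/-- Every agent of `X` takes the worse of the partners in `M` and `N`. -/
noncomputable def meet (T : Inst p q) (M N : Table p q) : Table p q :=
  (M ∪ N).filter fun e => (e ∈ M ∧ ∀ y, (e.1, y) ∈ N → rkX T e.1 y ≤ rkX T e.1 e.2) ∨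
    (e ∈ N ∧ ∀ y, (e.1, y) ∈ M → rkX T e.1 y ≤ rkX T e.1 e.2)

open Classical in
/-- Every agent of `X` takes the better of the partners in `M` and `N`. -/
noncomputable def join (T : Inst p q) (M N : Table p q) : Table p q :=
  (M ∪ N).filter fun e => (e ∈ M ∧ ∀ y, (e.1, y) ∈ N → rkX T e.1 e.2 ≤ rkX T e.1 y) ∨
    (e ∈ N ∧ ∀ y, (e.1, y) ∈ M → rkX T e.1 e.2 ≤ rkX T e.1 y)

theorem mem_meet {T : Inst p q} {M N : Table p q} {x : Fin p} {y : Fin q} :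
    (x, y) ∈ meet T M N ↔ ((x, y) ∈ M ∧ ∀ y', (x, y') ∈ N → rkX T x y' ≤ rkX T x y) ∨
    ((x, y) ∈ N ∧ ∀ y', (x, y') ∈ M → rkX T x y' ≤ rkX T x y) := by
  simp only [meet, Finset.mem_filter, Finset.mem_union]
  tauto

theorem mem_join {T : Inst p q} {M N : Table p q} {x : Fin p} {y : Fin q} :
    (x, y) ∈ join T M N ↔ ((x, y) ∈ M ∧ ∀ y', (x, y') ∈ N → rkX T x y ≤ rkX T x y') ∨
    ((x, y) ∈ N ∧ ∀ y', (x, y') ∈ M → rkX T x y ≤ rkX T x y') := by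
  simp only [join, Finset.mem_filter, Finset.mem_union]
  tauto

theorem meet_comm {T : Inst p q} (M N : Table p q) : meet T M N = meet T N M := by
  ext ⟨x, y⟩; rw [mem_meet, mem_meet, or_comm]

theorem join_comm {T : Inst p q} (M N : Table p q) : join T M N = join T N M := by
  ext ⟨x, y⟩; rw [mem_join, mem_join, or_comm]

theorem meet_subset {T : Inst p q} (M N : Table p q) : meet T M N ⊆ M ∪ N := by
  classical exact Finset.filter_subset _ _

theorem join_subset {T : Inst p q} (M N : Table p q) : join T M N ⊆ M ∪ N := by
  classical exact Finset.filter_subset _ _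

theorem meet_mat {T : Inst p q} {M N : Table p q} (hM : Mat T M) (hN : Mat T N)
    (h : Compat T M N) : Mat T (meet T M N) := by
  refine Mat.of_uniq ((meet_subset M N).trans (Finset.union_subset hM.2 hN.2)) ?_ ?_
  · intro x y y' h1 h2
    rw [mem_meet] at h1 h2
    rcases h1 with ⟨a, a'⟩ | ⟨a, a'⟩ <;> rcases h2 with ⟨b, b'⟩ | ⟨b, b'⟩
    · exact hM.uniqX a b
    · exact rkX_inj (hM.edge a) (le_antisymm (b' _ a) (a' _ b))
    · exact rkX_inj (hN.edge a) (le_antisymm (b' _ a) (a' _ b))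
    · exact hN.uniqX a b
  · have key : ∀ {M N : Table p q}, Mat T M → Mat T N → Compat T M N → ∀ x x' y, (x, y) ∈ M →
        (x', y) ∈ N → (∀ y', (x, y') ∈ N → rkX T x y' ≤ rkX T x y) →
        (∀ y', (x', y') ∈ M → rkX T x' y' ≤ rkX T x' y) → x = x' := by
      intro M N hM hN h x x' y a b a' b'
      obtain ⟨y1, x1, c, d, e⟩ := opp hM hN h a
      obtain ⟨y2, x2, c2, d2, e2⟩ := opp hN hM h.symm b
      obtain rfl := hN.uniqY d b
      obtain rfl := hM.uniqY d2 a
      have := a' _ c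
      have := b' _ c2
      rcases e with e | e | ⟨rfl, rfl⟩
      · rcases e2 with e2 | e2 | ⟨rfl, rfl⟩
        · omega
        · omega
        · rfl
      · omega
      · rfl
    intro x x' y h1 h2
    rw [mem_meet] at h1 h2
    rcases h1 with ⟨a, a'⟩ | ⟨a, a'⟩ <;> rcases h2 with ⟨b, b'⟩ | ⟨b, b'⟩
    · exact hM.uniqY a b
    · exact key hM hN h _ _ _ a b a' b'
    · exact key hN hM h.symm _ _ _ a b a' b'
    · exact hN.uniqY a b

theorem join_mat {T : Inst p q} {M N : Table p q} (hM : Mat T M) (hN : Mat T N)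
    (h : Compat T M N) : Mat T (join T M N) := by
  refine Mat.of_uniq ((join_subset M N).trans (Finset.union_subset hM.2 hN.2)) ?_ ?_
  · intro x y y' h1 h2
    rw [mem_join] at h1 h2
    rcases h1 with ⟨a, a'⟩ | ⟨a, a'⟩ <;> rcases h2 with ⟨b, b'⟩ | ⟨b, b'⟩
    · exact hM.uniqX a b
    · exact rkX_inj (hM.edge a) (le_antisymm (a' _ b) (b' _ a))
    · exact rkX_inj (hN.edge a) (le_antisymm (a' _ b) (b' _ a))
    · exact hN.uniqX a b
  · have key : ∀ {M N : Table p q}, Mat T M → Mat T N → Compat T M N → ∀ x x' y, (x, y) ∈ M →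
        (x', y) ∈ N → (∀ y', (x, y') ∈ N → rkX T x y ≤ rkX T x y') →
        (∀ y', (x', y') ∈ M → rkX T x' y ≤ rkX T x' y') → x = x' := by
      intro M N hM hN h x x' y a b a' b'
      obtain ⟨y1, x1, c, d, e⟩ := opp hM hN h a
      obtain ⟨y2, x2, c2, d2, e2⟩ := opp hN hM h.symm b
      obtain rfl := hN.uniqY d b
      obtain rfl := hM.uniqY d2 a
      have := a' _ c
      have := b' _ c2
      rcases e with e | e | ⟨rfl, rfl⟩
      · omega
      · rcases e2 with e2 | e2 | ⟨rfl, rfl⟩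
        · omega
        · omega
        · rfl
      · rfl
    intro x x' y h1 h2
    rw [mem_join] at h1 h2
    rcases h1 with ⟨a, a'⟩ | ⟨a, a'⟩ <;> rcases h2 with ⟨b, b'⟩ | ⟨b, b'⟩
    · exact hM.uniqY a b
    · exact key hM hN h _ _ _ a b a' b'
    · exact key hN hM h.symm _ _ _ a b a' b'
    · exact hN.uniqY a b

/-- Partner of an `x` in the meet, together with the comparison with both matchings. -/
theorem meet_X {T : Inst p q} {M N : Table p q} (hM : Mat T M) (hN : Mat T N) (h : Compat T M N)
    {x : Fin p} {y : Fin q} (hx : (x, y) ∈ M) : ∃ y1, (x, y1) ∈ N ∧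
      ((rkX T x y1 ≤ rkX T x y ∧ (x, y) ∈ meet T M N) ∨
        (rkX T x y ≤ rkX T x y1 ∧ (x, y1) ∈ meet T M N)) := by
  obtain ⟨y1, _, h1, _, _⟩ := opp hM hN h hx
  refine ⟨y1, h1, ?_⟩
  rcases le_total (rkX T x y1) (rkX T x y) with hl | hl
  · exact Or.inl ⟨hl, mem_meet.2 (Or.inl ⟨hx, fun y' h' => by rwa [hN.uniqX h' h1]⟩)⟩
  · exact Or.inr ⟨hl, mem_meet.2 (Or.inr ⟨h1, fun y' h' => by rwa [hM.uniqX h' hx]⟩)⟩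

theorem join_X {T : Inst p q} {M N : Table p q} (hM : Mat T M) (hN : Mat T N) (h : Compat T M N)
    {x : Fin p} {y : Fin q} (hx : (x, y) ∈ M) : ∃ y1, (x, y1) ∈ N ∧
      ((rkX T x y1 ≤ rkX T x y ∧ (x, y1) ∈ join T M N) ∨
        (rkX T x y ≤ rkX T x y1 ∧ (x, y) ∈ join T M N)) := by
  obtain ⟨y1, _, h1, _, _⟩ := opp hM hN h hx
  refine ⟨y1, h1, ?_⟩
  rcases le_total (rkX T x y1) (rkX T x y) with hl | hl
  · exact Or.inl ⟨hl, mem_join.2 (Or.inr ⟨h1, fun y' h' => by rwa [hM.uniqX h' hx]⟩)⟩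
  · exact Or.inr ⟨hl, mem_join.2 (Or.inl ⟨hx, fun y' h' => by rwa [hN.uniqX h' h1]⟩)⟩

/-- Partner of a `y` in the meet: the better one. -/
theorem meet_Y {T : Inst p q} {M N : Table p q} (hM : Mat T M) (hN : Mat T N) (h : Compat T M N)
    {x : Fin p} {y : Fin q} (hx : (x, y) ∈ M) : ∃ x1, (x1, y) ∈ N ∧
      ((rkY T y x ≤ rkY T y x1 ∧ (x, y) ∈ meet T M N) ∨
        (rkY T y x1 ≤ rkY T y x ∧ (x1, y) ∈ meet T M N)) := by
  obtain ⟨y1, x1, h1, h2, h3⟩ := opp hM hN h hx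
  refine ⟨x1, h2, ?_⟩
  rcases h3 with h3 | h3 | ⟨rfl, rfl⟩
  · exact Or.inl ⟨h3.2.le, mem_meet.2 (Or.inl ⟨hx, fun y' h' => by rw [hN.uniqX h' h1]; exact h3.1.le⟩)⟩
  · refine Or.inr ⟨h3.2.le, mem_meet.2 (Or.inr ⟨h2, fun y' h' => ?_⟩)⟩
    obtain ⟨y2, x2, a, b, c⟩ := opp hN hM h.symm h2
    obtain rfl := hM.uniqX a h'
    obtain rfl := hM.uniqY b hx
    rcases c with c | c | ⟨rfl, rfl⟩ <;> omega
  · exact Or.inl ⟨le_rfl, mem_meet.2 (Or.inl ⟨hx, fun y' h' => by rw [hN.uniqX h' h1]⟩)⟩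

theorem join_Y {T : Inst p q} {M N : Table p q} (hM : Mat T M) (hN : Mat T N) (h : Compat T M N)
    {x : Fin p} {y : Fin q} (hx : (x, y) ∈ M) : ∃ x1, (x1, y) ∈ N ∧
      ((rkY T y x ≤ rkY T y x1 ∧ (x1, y) ∈ join T M N) ∨
        (rkY T y x1 ≤ rkY T y x ∧ (x, y) ∈ join T M N)) := by
  obtain ⟨y1, x1, h1, h2, h3⟩ := opp hM hN h hx
  refine ⟨x1, h2, ?_⟩
  rcases h3 with h3 | h3 | ⟨rfl, rfl⟩
  · refine Or.inl ⟨h3.2.le, mem_join.2 (Or.inr ⟨h2, fun y' h' => ?_⟩)⟩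
    obtain ⟨y2, x2, a, b, c⟩ := opp hN hM h.symm h2
    obtain rfl := hM.uniqX a h'
    obtain rfl := hM.uniqY b hx
    rcases c with c | c | ⟨rfl, rfl⟩ <;> omega
  · exact Or.inr ⟨h3.2.le, mem_join.2 (Or.inl ⟨hx, fun y' h' => by rw [hN.uniqX h' h1]; exact h3.1.le⟩)⟩
  · exact Or.inr ⟨le_rfl, mem_join.2 (Or.inl ⟨hx, fun y' h' => by rw [hN.uniqX h' h1]⟩)⟩

/-- An edge that blocks neither `M` nor `N` does not block their meet. -/
theorem not_blocks_meet {T : Inst p q} {M N : Table p q} (hM : Mat T M) (hN : Mat T N)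
    (h : Compat T M N) {e : Fin p × Fin q} (h1 : ¬ Blocks T e M) (h2 : ¬ Blocks T e N) :
    ¬ Blocks T e (meet T M N) := by
  obtain ⟨x, y⟩ := e
  by_cases he : (x, y) ∈ T.edges
  swap
  · exact fun hb => he hb.1
  have hK := meet_mat hM hN h
  rw [not_blocks_iff hK.2 he]
  rw [not_blocks_iff hM.2 he] at h1
  rw [not_blocks_iff hN.2 he] at h2
  have yM : ∀ x', (x', y) ∈ M → rkY T y x' ≤ rkY T y x → ∃ x', (x', y) ∈ meet T M N ∧
      rkY T y x' ≤ rkY T y x := by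
    intro x' a b
    obtain ⟨x1, c, ⟨d, d'⟩ | ⟨d, d'⟩⟩ := meet_Y hM hN h a
    exacts [⟨_, d', by omega⟩, ⟨_, d', by omega⟩]
  have yN : ∀ x', (x', y) ∈ N → rkY T y x' ≤ rkY T y x → ∃ x', (x', y) ∈ meet T M N ∧
      rkY T y x' ≤ rkY T y x := by
    intro x' a b
    rw [meet_comm]
    obtain ⟨x1, c, ⟨d, d'⟩ | ⟨d, d'⟩⟩ := meet_Y hN hM h.symm a
    exacts [⟨_, d', by omega⟩, ⟨_, d', by omega⟩]
  rcases h1 with ⟨y1, a, b⟩ | ⟨x1, a, b⟩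
  · rcases h2 with ⟨y2, a2, b2⟩ | ⟨x2, a2, b2⟩
    · obtain ⟨y3, c, ⟨d, d'⟩ | ⟨d, d'⟩⟩ := meet_X hM hN h a
      · exact Or.inl ⟨_, d', b⟩
      · obtain rfl := hN.uniqX c a2
        exact Or.inl ⟨_, d', b2⟩
    · exact Or.inr (yN x2 a2 b2)
  · exact Or.inr (yM x1 a b)

theorem not_blocks_join {T : Inst p q} {M N : Table p q} (hM : Mat T M) (hN : Mat T N)
    (h : Compat T M N) {e : Fin p × Fin q} (h1 : ¬ Blocks T e M) (h2 : ¬ Blocks T e N) :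
    ¬ Blocks T e (join T M N) := by
  obtain ⟨x, y⟩ := e
  by_cases he : (x, y) ∈ T.edges
  swap
  · exact fun hb => he hb.1
  have hK := join_mat hM hN h
  rw [not_blocks_iff hK.2 he]
  rw [not_blocks_iff hM.2 he] at h1
  rw [not_blocks_iff hN.2 he] at h2
  have xM : ∀ y', (x, y') ∈ M → rkX T x y' ≤ rkX T x y → ∃ y', (x, y') ∈ join T M N ∧
      rkX T x y' ≤ rkX T x y := by
    intro x' a b
    obtain ⟨x1, c, ⟨d, d'⟩ | ⟨d, d'⟩⟩ := join_X hM hN h a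
    exacts [⟨_, d', by omega⟩, ⟨_, d', by omega⟩]
  have xN : ∀ y', (x, y') ∈ N → rkX T x y' ≤ rkX T x y → ∃ y', (x, y') ∈ join T M N ∧
      rkX T x y' ≤ rkX T x y := by
    intro x' a b
    rw [join_comm]
    obtain ⟨x1, c, ⟨d, d'⟩ | ⟨d, d'⟩⟩ := join_X hN hM h.symm a
    exacts [⟨_, d', by omega⟩, ⟨_, d', by omega⟩]
  rcases h1 with ⟨y1, a, b⟩ | ⟨x1, a, b⟩
  · exact Or.inl (xM y1 a b)
  · rcases h2 with ⟨y2, a2, b2⟩ | ⟨x2, a2, b2⟩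
    · exact Or.inl (xN y2 a2 b2)
    · obtain ⟨y3, c, ⟨d, d'⟩ | ⟨d, d'⟩⟩ := join_Y hM hN h a
      · obtain rfl := hN.uniqY c a2
        exact Or.inr ⟨_, d', b2⟩
      · exact Or.inr ⟨_, d', b⟩

theorem Compat.meet {T : Inst p q} {M N K : Table p q} (hM : Mat T M) (hN : Mat T N)
    (h : Compat T M N) (h1 : Compat T K M) (h2 : Compat T K N) :
    Compat T K (meet T M N) := by
  refine ⟨fun e he => not_blocks_meet hM hN h (h1.1 e he) (h2.1 e he), fun e he => ?_⟩
  rcases Finset.mem_union.1 (meet_subset M N he) with h' | h'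
  exacts [h1.2 e h', h2.2 e h']

theorem Compat.join {T : Inst p q} {M N K : Table p q} (hM : Mat T M) (hN : Mat T N)
    (h : Compat T M N) (h1 : Compat T K M) (h2 : Compat T K N) :
    Compat T K (join T M N) := by
  refine ⟨fun e he => not_blocks_join hM hN h (h1.1 e he) (h2.1 e he), fun e he => ?_⟩
  rcases Finset.mem_union.1 (join_subset M N he) with h' | h'
  exacts [h1.2 e h', h2.2 e h']

theorem dom_meet_left {T : Inst p q} {M N : Table p q} (hM : Mat T M) (hN : Mat T N)
    (h : Compat T M N) : Dom T M (meet T M N) := by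
  refine (Compat.meet hM hN h (Compat.refl M) h).dom_of_leX hM (meet_mat hM hN h) ?_
  intro x y y' h1 h2
  rcases mem_meet.1 h2 with ⟨a, b⟩ | ⟨a, b⟩
  · rw [hM.uniqX a h1]
  · exact b _ h1

theorem dom_meet_right {T : Inst p q} {M N : Table p q} (hM : Mat T M) (hN : Mat T N)
    (h : Compat T M N) : Dom T N (meet T M N) := by
  rw [meet_comm]; exact dom_meet_left hN hM h.symm

theorem dom_join_left {T : Inst p q} {M N : Table p q} (hM : Mat T M) (hN : Mat T N)
    (h : Compat T M N) : Dom T (join T M N) M := by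
  refine (Compat.join hM hN h (Compat.refl M) h).symm.dom_of_leX (join_mat hM hN h) hM ?_
  intro x y y' h1 h2
  rcases mem_join.1 h1 with ⟨a, b⟩ | ⟨a, b⟩
  · rw [hM.uniqX a h2]
  · exact b _ h2

theorem dom_join_right {T : Inst p q} {M N : Table p q} (hM : Mat T M) (hN : Mat T N)
    (h : Compat T M N) : Dom T (join T M N) N := by
  rw [join_comm]; exact dom_join_left hN hM h.symm

theorem dom_meet {T : Inst p q} {M N K : Table p q} (hM : Mat T M) (hN : Mat T N) (hK : Mat T K)
    (h : Compat T M N) (h1 : Dom T M K) (h2 : Dom T N K) : Dom T (meet T M N) K := by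
  refine (Compat.meet hM hN h (h1.compat hM hK).symm (h2.compat hN hK).symm).symm.dom_of_leX
    (meet_mat hM hN h) hK fun x y y' a b => ?_
  rcases mem_meet.1 a with ⟨c, _⟩ | ⟨c, _⟩
  exacts [h1.leX hK c b, h2.leX hK c b]

theorem dom_join {T : Inst p q} {M N K : Table p q} (hM : Mat T M) (hN : Mat T N) (hK : Mat T K)
    (h : Compat T M N) (h1 : Dom T K M) (h2 : Dom T K N) : Dom T K (join T M N) := by
  refine (Compat.join hM hN h (h1.compat hK hM) (h2.compat hK hN)).dom_of_leX
    hK (join_mat hM hN h) fun x y y' a b => ?_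
  rcases mem_join.1 b with ⟨c, _⟩ | ⟨c, _⟩
  exacts [h1.leX hM a c, h2.leX hN a c]

end Marriage

namespace Marriage

variable {p q : ℕ}

/-! ### Chains of matchings -/

/-- No matching of the table `F` lies strictly between `M` and `M'`. -/
def Atomic (T : Inst p q) (F M M' : Table p q) : Prop :=
  ∀ V, Mat T V → V ⊆ F → Dom T M V → Dom T V M' → V = M ∨ V = M'

theorem Atomic.dichotomy {T : Inst p q} {F M M' N : Table p q} (hM : Mat T M) (hM' : Mat T M')
    (hN : Mat T N) (hMF : M ⊆ F) (hMF' : M' ⊆ F) (hNF : N ⊆ F) (hd : Dom T M M')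
    (ha : Atomic T F M M') (h : Compat T N M) (h' : Compat T N M') :
    (∀ x y y' z, (x, y) ∈ M → (x, y') ∈ M' → y ≠ y' → (x, z) ∈ N → rkX T x z ≤ rkX T x y) ∨
    (∀ x y y' z, (x, y) ∈ M → (x, y') ∈ M' → y ≠ y' → (x, z) ∈ N → rkX T x y' ≤ rkX T x z) := by
  have hj := join_mat hN hM' h'
  have hjc : Compat T (join T N M') M := (Compat.join hN hM' h' h.symm (hd.compat hM hM')).symm
  have hV := meet_mat hj hM hjc
  have hVF : meet T (join T N M') M ⊆ F :=
    (meet_subset _ _).trans (Finset.union_subset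
      ((join_subset _ _).trans (Finset.union_subset hNF hMF')) hMF)
  rcases ha _ hV hVF (dom_meet_right hj hM hjc)
    (dom_meet hj hM hM' hjc (dom_join_right hN hM' h') hd) with e | e
  · left
    intro x y y' z h1 h2 hne h3
    have hlt : rkX T x y < rkX T x y' :=
      lt_of_le_of_ne (hd.leX hM' h1 h2) fun e => hne (rkX_inj (hM.edge h1) e)
    obtain ⟨y1, a, b⟩ := join_X hN hM' h' h3
    obtain rfl := hM'.uniqX a h2
    rcases b with ⟨b, b'⟩ | ⟨b, b'⟩
    · have := (dom_meet_left hj hM hjc).leX hV b' (by rw [e]; exact h1)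
      omega
    · exact (dom_meet_left hj hM hjc).leX hV b' (by rw [e]; exact h1)
  · right
    intro x y y' z h1 h2 hne h3
    have hlt : rkX T x y < rkX T x y' :=
      lt_of_le_of_ne (hd.leX hM' h1 h2) fun e => hne (rkX_inj (hM.edge h1) e)
    obtain ⟨y1, a, b⟩ := meet_X hM hj hjc.symm h1
    rw [meet_comm, e] at b
    rcases b with ⟨b, b'⟩ | ⟨b, b'⟩
    · exact absurd (hM'.uniqX b' h2) hne
    · obtain rfl := hM'.uniqX b' h2
      exact (dom_join_left hN hM' h').leX hN a h3

/-- A descending chain of matchings of the table `F` from `M₀` to `M`, without gaps in `F`; the first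
argument is the set of the matchings of the chain. -/
inductive AtomChain (T : Inst p q) (F : Table p q) : Set (Table p q) → Table p q → Table p q → Prop
  | single (M : Table p q) : Mat T M → M ⊆ F → AtomChain T F {M} M M
  | snoc (S : Set (Table p q)) (M₀ M M' : Table p q) : AtomChain T F S M₀ M → Mat T M' → M' ⊆ F →
      Dom T M M' → Atomic T F M M' → AtomChain T F (insert M' S) M₀ M'

namespace AtomChain

variable {T : Inst p q} {F M₀ M : Table p q} {S : Set (Table p q)}

theorem mat (h : AtomChain T F S M₀ M) : ∀ W ∈ S, Mat T W := by
  induction h with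
  | single M h1 h2 => rintro _ rfl; exact h1
  | snoc S M₀ M M' h h1 h2 h3 h4 ih =>
    rintro W (rfl | hW)
    exacts [h1, ih W hW]

theorem subset (h : AtomChain T F S M₀ M) : ∀ W ∈ S, W ⊆ F := by
  induction h with
  | single M h1 h2 => rintro _ rfl; exact h2
  | snoc S M₀ M M' h h1 h2 h3 h4 ih =>
    rintro W (rfl | hW)
    exacts [h2, ih W hW]

theorem first_mem (h : AtomChain T F S M₀ M) : M₀ ∈ S := by
  induction h with
  | single M h1 h2 => rfl
  | snoc S M₀ M M' h h1 h2 h3 h4 ih => exact Or.inr ih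

theorem last_mem (h : AtomChain T F S M₀ M) : M ∈ S := by
  cases h with
  | single M h1 h2 => rfl
  | snoc S M₀ M M' h h1 h2 h3 h4 => exact Or.inl rfl

theorem dom_last (h : AtomChain T F S M₀ M) : ∀ W ∈ S, Dom T W M := by
  induction h with
  | single M h1 h2 => rintro _ rfl; exact Dom.refl _
  | snoc S M₀ M M' h h1 h2 h3 h4 ih =>
    rintro W (rfl | hW)
    exacts [Dom.refl _, (ih W hW).trans h3]

theorem first_dom (h : AtomChain T F S M₀ M) : ∀ W ∈ S, Dom T M₀ W := by
  induction h with
  | single M h1 h2 => rintro _ rfl; exact Dom.refl _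
  | snoc S M₀ M M' h h1 h2 h3 h4 ih =>
    rintro W (rfl | hW)
    exacts [(ih M h.last_mem).trans h3, ih W hW]

theorem compat (h : AtomChain T F S M₀ M) : ∀ W ∈ S, ∀ W' ∈ S, Compat T W W' := by
  induction h with
  | single M h1 h2 => rintro _ rfl _ rfl; exact Compat.refl _
  | snoc S M₀ M M' h h1 h2 h3 h4 ih =>
    rintro W (rfl | hW) W' (rfl | hW')
    · exact Compat.refl _
    · exact (((h.dom_last _ hW').trans h3).compat (h.mat _ hW') h1).symm
    · exact ((h.dom_last _ hW).trans h3).compat (h.mat _ hW) h1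
    · exact ih W hW W' hW'

theorem append {S' : Set (Table p q)} {M' : Table p q} (h : AtomChain T F S M₀ M)
    (h' : AtomChain T F S' M M') : AtomChain T F (S ∪ S') M₀ M' := by
  induction h' with
  | single M h1 h2 =>
    rwa [Set.union_eq_left.2 (Set.singleton_subset_iff.2 h.last_mem)]
  | snoc S' M M₁ M' h' h1 h2 h3 h4 ih =>
    rw [Set.union_insert]
    exact AtomChain.snoc _ _ _ _ (ih h) h1 h2 h3 h4

/-- A matching compatible with the whole chain has its edges on the chain, or above or below it. -/
theorem caught (h : AtomChain T F S M₀ M) {N : Table p q} (hN : Mat T N) (hNF : N ⊆ F)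
    (hc : ∀ W ∈ S, Compat T N W) {x : Fin p} {y : Fin q} (hxy : (x, y) ∈ N) :
    (∃ W ∈ S, (x, y) ∈ W) ∨ (∃ z, (x, z) ∈ M₀ ∧ rkX T x y < rkX T x z) ∨
      ∃ z, (x, z) ∈ M ∧ rkX T x z < rkX T x y := by
  induction h with
  | single M h1 h2 =>
    obtain ⟨z, _, hz, _, _⟩ := opp hN h1 (hc M rfl) hxy
    rcases lt_trichotomy (rkX T x y) (rkX T x z) with h | h | h
    · exact Or.inr (Or.inl ⟨z, hz, h⟩)
    · obtain rfl := rkX_inj (hN.edge hxy) h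
      exact Or.inl ⟨M, rfl, hz⟩
    · exact Or.inr (Or.inr ⟨z, hz, h⟩)
  | snoc S M₀ M M' h h1 h2 h3 h4 ih =>
    rcases ih fun W hW => hc W (Or.inr hW) with ⟨W, hW, h'⟩ | h' | ⟨z, hz, hlt⟩
    · exact Or.inl ⟨W, Or.inr hW, h'⟩
    · exact Or.inr (Or.inl h')
    · obtain ⟨z', _, hz', _, _⟩ := h3.1 _ _ hz
      by_cases hne : z = z'
      · subst hne
        exact Or.inr (Or.inr ⟨z, hz', hlt⟩)
      rcases h4.dichotomy (h.mat _ h.last_mem) h1 hN (h.subset _ h.last_mem) h2 hNF h3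
        (hc M (Or.inr h.last_mem)) (hc M' (Or.inl rfl)) with d | d
      · have := d x z z' y hz hz' hne hxy
        omega
      · rcases (d x z z' y hz hz' hne hxy).lt_or_eq with h' | h'
        · exact Or.inr (Or.inr ⟨z', hz', h'⟩)
        · obtain rfl := rkX_inj (h1.edge hz') h'
          exact Or.inl ⟨M', Or.inl rfl, hz'⟩

/-- An edge of a matching compatible with the chain blocks no matching compatible with the chain that
runs inside `F`. -/
theorem not_blocks (h : AtomChain T F S M₀ M) {N W : Table p q} (hN : Mat T N) (hNF : N ⊆ F)
    (hc : ∀ K ∈ S, Compat T N K) (hW : Mat T W) (hcW : ∀ K ∈ S, Compat T W K)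
    (h₀ : Dom T M₀ N) (h₁ : Dom T N M) {e : Fin p × Fin q} (he : e ∈ W) : ¬ Blocks T e N := by
  obtain ⟨x, y⟩ := e
  have hM₀ := h.mat _ h.first_mem
  have hM := h.mat _ h.last_mem
  obtain ⟨y₀, x₀, a₀, b₀, c₀⟩ := opp hW hM₀ (hcW _ h.first_mem) he
  rw [not_blocks_iff hN.2 (hW.edge he)]
  rcases lt_or_ge (rkX T x y) (rkX T x y₀) with hlt | hge
  · obtain ⟨_, x', _, a, _, b⟩ := h₀.1 _ _ b₀
    refine Or.inr ⟨x', a, ?_⟩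
    rcases c₀ with c | c | ⟨rfl, rfl⟩ <;> omega
  have key : ∀ {S M₀ M}, AtomChain T F S M₀ M → (∀ K ∈ S, Compat T N K) →
      (∀ K ∈ S, Compat T W K) → ∀ y₀ y₁, (x, y₀) ∈ M₀ → (x, y₁) ∈ M → rkX T x y₀ ≤ rkX T x y →
      rkX T x y < rkX T x y₁ → ¬ Blocks T (x, y) N := by
    intro S M₀ M h
    induction h with
    | single M h1 h2 =>
      intro _ _ y₀ y₁ a b c d
      obtain rfl := h1.uniqX a b
      omega
    | snoc S M₀ M M' h h1 h2 h3 h4 ih =>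
      intro hc hcW y₀ y' a b c d hb
      have hM := h.mat _ h.last_mem
      obtain ⟨z, _, hz, _, _, _⟩ := h3.2 _ _ b
      rcases lt_or_ge (rkX T x y) (rkX T x z) with hlt | hge
      · exact ih (fun K hK => hc K (Or.inr hK)) (fun K hK => hcW K (Or.inr hK)) y₀ z a hz c hlt hb
      have hne : z ≠ y' := by rintro rfl; omega
      rw [blocks_iff hN.2] at hb
      obtain ⟨w, _, hw, _⟩ := opp hM hN (hc _ (Or.inr h.last_mem)).symm hz
      have hbw := hb.2.1 w hw
      rcases h4.dichotomy hM h1 hN (h.subset _ h.last_mem) h2 hNF h3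
        (hc M (Or.inr h.last_mem)) (hc M' (Or.inl rfl)) with D | D
      · have := D x z y' w hz b hne hw
        omega
      · obtain ⟨_, x1, a1, b1, c1⟩ := opp hW hM (hcW M (Or.inr h.last_mem)) he
        obtain ⟨_, x2, a2, b2, c2⟩ := opp hW h1 (hcW M' (Or.inl rfl)) he
        obtain rfl := hM.uniqX a1 hz
        obtain rfl := h1.uniqX a2 b
        have l2 : rkY T y x2 < rkY T y x := by
          rcases c2 with c | c | ⟨rfl, rfl⟩ <;> omega
        have l1 : rkY T y x ≤ rkY T y x1 := by
          rcases c1 with c | c | ⟨rfl, rfl⟩ <;> omega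
        obtain ⟨y3, _, m3, _, _, _⟩ := h3.2 _ _ b2
        have hne' : y3 ≠ y := by
          rintro rfl
          rw [hM.uniqY m3 b1] at l2
          omega
        obtain ⟨w', x4, m4, m5, c5⟩ := opp h1 hN (hc M' (Or.inl rfl)).symm b2
        have := D x2 y3 y w' m3 b2 hne' m4
        have := hb.2.2 x4 m5
        rcases c5 with c | c | ⟨rfl, rfl⟩ <;> omega
  obtain ⟨y₁, _, a₁, _, _⟩ := opp hW hM (hcW _ h.last_mem) he
  rcases lt_or_ge (rkX T x y) (rkX T x y₁) with hlt | hge'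
  · exact (not_blocks_iff hN.2 (hW.edge he)).1 (key h hc hcW y₀ y₁ a₀ a₁ hge hlt)
  · obtain ⟨w, _, hw, _, hw', _⟩ := h₁.2 _ _ a₁
    exact Or.inl ⟨w, hw, by omega⟩

end AtomChain

/-! ### Stable matchings of a table -/

section Stable

variable {T : Inst p q} {E : Table p q}

theorem stable_mat (hE : E ⊆ T.edges) {M : Table p q} (h : M ∈ stableMatchings T E) : Mat T M :=
  ⟨h.1.1, h.1.2.trans hE⟩

theorem stable_compat {M N : Table p q} (h : M ∈ stableMatchings T E)
    (h' : N ∈ stableMatchings T E) : Compat T M N :=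
  ⟨fun e he => h'.2 e (h.1.2 he), fun e he => h.2 e (h'.1.2 he)⟩

theorem stable_meet (hE : E ⊆ T.edges) {M N : Table p q} (h : M ∈ stableMatchings T E)
    (h' : N ∈ stableMatchings T E) : meet T M N ∈ stableMatchings T E :=
  ⟨⟨(meet_mat (stable_mat hE h) (stable_mat hE h') (stable_compat h h')).1,
    (meet_subset M N).trans (Finset.union_subset h.1.2 h'.1.2)⟩, fun e he =>
    not_blocks_meet (stable_mat hE h) (stable_mat hE h') (stable_compat h h') (h.2 e he) (h'.2 e he)⟩

theorem stable_join (hE : E ⊆ T.edges) {M N : Table p q} (h : M ∈ stableMatchings T E)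
    (h' : N ∈ stableMatchings T E) : join T M N ∈ stableMatchings T E :=
  ⟨⟨(join_mat (stable_mat hE h) (stable_mat hE h') (stable_compat h h')).1,
    (join_subset M N).trans (Finset.union_subset h.1.2 h'.1.2)⟩, fun e he =>
    not_blocks_join (stable_mat hE h) (stable_mat hE h') (stable_compat h h') (h.2 e he) (h'.2 e he)⟩

/-- In a stable table, a matching of the table compatible with all stable matchings is stable. -/
theorem stable_of_compat (hs : IsStableTable T E) {N : Table p q} (hN : N ∈ matchings E)
    (h : ∀ M ∈ stableMatchings T E, Compat T N M) : N ∈ stableMatchings T E := by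
  refine ⟨hN, fun e he => ?_⟩
  obtain ⟨M, hM, heM⟩ := hs e he
  exact (h M hM).2 e heM

theorem internallyStable_stable (hE : E ⊆ T.edges) : InternallyStable T (stableMatchings T E) :=
  ⟨fun _ hM => stable_mat hE hM, fun _ hM _ hN ⟨e, he, hb⟩ => hN.2 e (hM.1.2 he) hb⟩

theorem internallyClosed_iff (hE : E ⊆ T.edges) : InternallyClosed T (stableMatchings T E) ↔
    ∀ N, Mat T N → (∀ M ∈ stableMatchings T E, Compat T N M) → N ∈ stableMatchings T E := by
  constructor
  · intro h N hN hc
    rw [← h.2]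
    refine ⟨hN, Set.union_subset (Set.singleton_subset_iff.2 hN) fun _ hM => stable_mat hE hM, ?_⟩
    rintro A (rfl | hA) B (rfl | hB) ⟨e, he, hb⟩
    · exact not_blocks_self he hb
    · exact (hc B hB).1 e he hb
    · exact (hc A hA).2 e he hb
    · exact hB.2 e (hA.1.2 he) hb
  · intro h
    refine ⟨internallyStable_stable hE, Set.Subset.antisymm ?_ fun M hM => ?_⟩
    · rintro N ⟨hN, hi⟩
      refine h N hN fun M hM => ⟨fun e he hb => ?_, fun e he hb => ?_⟩
      · exact hi.2 N (Or.inl rfl) M (Or.inr hM) ⟨e, he, hb⟩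
      · exact hi.2 M (Or.inr hM) N (Or.inl rfl) ⟨e, he, hb⟩
    · refine ⟨stable_mat hE hM, ?_⟩
      rw [Set.union_eq_right.2 (Set.singleton_subset_iff.2 hM)]
      exact internallyStable_stable hE

/-- The sum of the positions of the partners of the agents of `X`. -/
def rankSum (T : Inst p q) (M : Table p q) : ℕ :=
  ∑ x, ∑ y, if (x, y) ∈ M then rkX T x y else 0

theorem rank_of_mem {M : Table p q} (hM : Mat T M) {x : Fin p} {y : Fin q} (h : (x, y) ∈ M) :
    (∑ y, if (x, y) ∈ M then rkX T x y else 0) = rkX T x y := by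
  rw [Finset.sum_eq_single y]
  · rw [if_pos h]
  · intro z _ hz
    rw [if_neg fun h' => hz (hM.uniqX h' h)]
  · simp

theorem Dom.rank_le {M N : Table p q} (hM : Mat T M) (hN : Mat T N) (h : Dom T M N) (x : Fin p) :
    (∑ y, if (x, y) ∈ M then rkX T x y else 0) ≤ ∑ y, if (x, y) ∈ N then rkX T x y else 0 := by
  by_cases hx : ∃ y, (x, y) ∈ M
  · obtain ⟨y, hy⟩ := hx
    obtain ⟨y', _, a, _, b, _⟩ := h.1 _ _ hy
    rwa [rank_of_mem hM hy, rank_of_mem hN a]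
  · push Not at hx
    simp [hx]

theorem Dom.rankSum_le {M N : Table p q} (hM : Mat T M) (hN : Mat T N) (h : Dom T M N) :
    rankSum T M ≤ rankSum T N := Finset.sum_le_sum fun x _ => h.rank_le hM hN x

theorem Dom.rankSum_lt {M N : Table p q} (hM : Mat T M) (hN : Mat T N) (h : Dom T M N)
    (hne : M ≠ N) : rankSum T M < rankSum T N := by
  by_contra hc
  apply hne
  have heq : ∀ x, (∑ y, if (x, y) ∈ M then rkX T x y else 0) =
      ∑ y, if (x, y) ∈ N then rkX T x y else 0 := by
    intro x
    have := (Finset.sum_eq_sum_iff_of_le fun x (_ : x ∈ Finset.univ) => h.rank_le hM hN x).1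
      (le_antisymm (h.rankSum_le hM hN) (not_lt.1 hc))
    exact this x (Finset.mem_univ x)
  have hx : ∀ {x y y'}, (x, y) ∈ M → (x, y') ∈ N → y = y' := by
    intro x y y' a b
    refine rkX_inj (hM.edge a) ?_
    have := heq x
    rwa [rank_of_mem hM a, rank_of_mem hN b] at this
  ext ⟨x, y⟩
  constructor
  · intro hxy
    obtain ⟨y', _, a, _⟩ := h.1 _ _ hxy
    rwa [hx hxy a]
  · intro hxy
    obtain ⟨y', _, a, _⟩ := h.2 _ _ hxy
    rwa [← hx a hxy]

theorem stable_nonempty (hs : IsStableTable T E) : (stableMatchings T E).Nonempty := by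
  rcases E.eq_empty_or_nonempty with rfl | ⟨e, he⟩
  · exact ⟨∅, ⟨by simp [IsMatching], Finset.Subset.refl _⟩, by simp⟩
  · obtain ⟨M, hM, _⟩ := hs e he
    exact ⟨M, hM⟩

theorem exists_top (hE : E ⊆ T.edges) {A : Set (Table p q)} (hA : A ⊆ stableMatchings T E)
    (hne : A.Nonempty) (hj : ∀ M ∈ A, ∀ N ∈ A, join T M N ∈ A) :
    ∃ M ∈ A, ∀ N ∈ A, Dom T M N := by
  obtain ⟨M, hM, hmin⟩ := Set.exists_min_image A (rankSum T) (Set.toFinite _) hne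
  refine ⟨M, hM, fun N hN => ?_⟩
  have hM' := stable_mat hE (hA hM)
  have hN' := stable_mat hE (hA hN)
  have hc := stable_compat (hA hM) (hA hN)
  have hJ := join_mat hM' hN' hc
  have e : join T M N = M := by
    by_contra hne
    have := (dom_join_left hM' hN' hc).rankSum_lt hJ hM' hne
    have := hmin _ (hj M hM N hN)
    omega
  have := dom_join_right hM' hN' hc
  rwa [e] at this

theorem exists_bot (hE : E ⊆ T.edges) {A : Set (Table p q)} (hA : A ⊆ stableMatchings T E)
    (hne : A.Nonempty) (hj : ∀ M ∈ A, ∀ N ∈ A, meet T M N ∈ A) :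
    ∃ M ∈ A, ∀ N ∈ A, Dom T N M := by
  obtain ⟨M, hM, hmin⟩ := Set.exists_max_image A (rankSum T) (Set.toFinite _) hne
  refine ⟨M, hM, fun N hN => ?_⟩
  have hM' := stable_mat hE (hA hM)
  have hN' := stable_mat hE (hA hN)
  have hc := stable_compat (hA hM) (hA hN)
  have hJ := meet_mat hM' hN' hc
  have e : meet T M N = M := by
    by_contra hne
    have := (dom_meet_left hM' hN' hc).rankSum_lt hM' hJ (Ne.symm hne)
    have := hmin _ (hj M hM N hN)
    omega
  have := dom_meet_right hM' hN' hc
  rwa [e] at this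

theorem isXOptimal_iff (hE : E ⊆ T.edges) {M : Table p q} : IsXOptimal T E M ↔
    M ∈ stableMatchings T E ∧ ∀ N ∈ stableMatchings T E, Dom T M N := by
  refine and_congr_right fun hM => forall₂_congr fun N hN => ?_
  have hM' := stable_mat hE hM
  have hN' := stable_mat hE hN
  constructor
  · intro h
    refine (stable_compat hM hN).dom_of_leX hM' hN' fun x y y' a b => ?_
    obtain ⟨y1, c, d⟩ := h x y' b
    obtain rfl := hM'.uniqX a c
    exact (wprefX_iff (hM'.edge a) (hN'.edge b)).1 d
  · intro h x y hxy
    obtain ⟨y', _, a, _, b, _⟩ := h.2 x y hxy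
    exact ⟨y', a, (wprefX_iff (hM'.edge a) (hN'.edge hxy)).2 b⟩

end Stable

/-! ### Exchanging the sides -/

theorem mem_swap {E : Table p q} {x : Fin p} {y : Fin q} : (y, x) ∈ E.swap ↔ (x, y) ∈ E := by
  simp only [Table.swap, Finset.mem_image, Prod.exists, Prod.swap_prod_mk, Prod.mk.injEq]
  constructor
  · rintro ⟨a, b, h, rfl, rfl⟩; exact h
  · intro h; exact ⟨x, y, h, rfl, rfl⟩

theorem swap_swap (E : Table p q) : E.swap.swap = E := by
  ext ⟨x, y⟩; rw [mem_swap, mem_swap]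

theorem swap_subset {E F : Table p q} : E.swap ⊆ F.swap ↔ E ⊆ F :=
  ⟨fun h ⟨_, _⟩ he => mem_swap.1 (h (mem_swap.2 he)), fun h ⟨_, _⟩ he => mem_swap.2 (h (mem_swap.1 he))⟩

theorem swap_inj {E F : Table p q} : E.swap = F.swap ↔ E = F :=
  ⟨fun h => by rw [← swap_swap E, h, swap_swap], fun h => h ▸ rfl⟩

theorem edges_swap (T : Inst p q) : T.swap.edges = T.edges.swap := by
  ext ⟨y, x⟩; rw [mem_swap, mem_edges, mem_edges']; rfl

theorem isMatching_swap {M : Table p q} : IsMatching M.swap ↔ IsMatching M := by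
  have key : ∀ {p q : ℕ} {M : Table p q}, IsMatching M → IsMatching M.swap := by
    rintro p q M h ⟨y, x⟩ h1 ⟨y', x'⟩ h2 h3
    have := h _ (mem_swap.1 h1) _ (mem_swap.1 h2) h3.symm
    simp only [Prod.mk.injEq] at this ⊢
    exact this.symm
  refine ⟨fun h => ?_, key⟩
  have := key h
  rwa [swap_swap] at this

theorem mat_swap {T : Inst p q} {M : Table p q} : Mat T.swap M.swap ↔ Mat T M := by
  refine and_congr isMatching_swap ?_
  rw [edges_swap]; exact swap_subset

theorem blocks_swap {T : Inst p q} {M : Table p q} {x : Fin p} {y : Fin q} :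
    Blocks T.swap (y, x) M.swap ↔ Blocks T (x, y) M := by
  simp only [Blocks, edges_swap, mem_swap]
  exact and_congr_right fun _ => and_comm

theorem stable_swap {T : Inst p q} {E M : Table p q} :
    M.swap ∈ stableMatchings T.swap E.swap ↔ M ∈ stableMatchings T E := by
  refine and_congr (and_congr isMatching_swap swap_subset) ?_
  constructor
  · rintro h ⟨x, y⟩ he hb
    exact h (y, x) (mem_swap.2 he) (blocks_swap.2 hb)
  · rintro h ⟨y, x⟩ he hb
    exact h (x, y) (mem_swap.1 he) (blocks_swap.1 hb)

theorem Dom.swap {T : Inst p q} {M N : Table p q} (h : Dom T M N) : Dom T.swap N.swap M.swap := by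
  constructor
  · intro y x hxy
    obtain ⟨y', x', a, b, c, d⟩ := h.2 x y (mem_swap.1 hxy)
    exact ⟨x', y', mem_swap.2 b, mem_swap.2 a, d, c⟩
  · intro y x hxy
    obtain ⟨y', x', a, b, c, d⟩ := h.1 x y (mem_swap.1 hxy)
    exact ⟨x', y', mem_swap.2 b, mem_swap.2 a, d, c⟩

theorem dom_swap {T : Inst p q} {M N : Table p q} : Dom T.swap N.swap M.swap ↔ Dom T M N := by
  refine ⟨fun h => ?_, Dom.swap⟩
  have := h.swap
  rwa [swap_swap, swap_swap] at this

theorem isYOptimal_iff {T : Inst p q} {E : Table p q} (hE : E ⊆ T.edges) {M : Table p q} :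
    IsYOptimal T E M ↔ M ∈ stableMatchings T E ∧ ∀ N ∈ stableMatchings T E, Dom T N M := by
  rw [IsYOptimal, isXOptimal_iff (by rw [edges_swap]; exact swap_subset.2 hE), stable_swap]
  refine and_congr_right fun _ => ⟨fun h N hN => dom_swap.1 (h _ (stable_swap.2 hN)), fun h N hN => ?_⟩
  rw [← swap_swap N] at hN ⊢
  exact dom_swap.2 (h _ (stable_swap.1 hN))

theorem exists_isXOptimal {T : Inst p q} {E : Table p q} (hE : E ⊆ T.edges)
    (hs : IsStableTable T E) : ∃ M, IsXOptimal T E M := by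
  obtain ⟨M, hM, h⟩ := exists_top hE (Set.Subset.refl _) (stable_nonempty hs)
    fun _ h _ h' => stable_join hE h h'
  exact ⟨M, (isXOptimal_iff hE).2 ⟨hM, h⟩⟩

theorem exists_isYOptimal {T : Inst p q} {E : Table p q} (hE : E ⊆ T.edges)
    (hs : IsStableTable T E) : ∃ M, IsYOptimal T E M := by
  obtain ⟨M, hM, h⟩ := exists_bot hE (Set.Subset.refl _) (stable_nonempty hs)
    fun _ h _ h' => stable_meet hE h h'
  exact ⟨M, (isYOptimal_iff hE).2 ⟨hM, h⟩⟩

/-! ### The table of a chain -/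

section TableOf

variable {T : Inst p q} {F E M₀ M : Table p q} {S : Set (Table p q)}

theorem AtomChain.mem_stable (h : AtomChain T F S M₀ M) (hE : ∀ e, e ∈ E ↔ ∃ W ∈ S, e ∈ W)
    {W : Table p q} (hW : W ∈ S) : W ∈ stableMatchings T E := by
  refine ⟨⟨(h.mat W hW).1, fun e he => (hE e).2 ⟨W, hW, he⟩⟩, fun e he => ?_⟩
  obtain ⟨K, hK, heK⟩ := (hE e).1 he
  exact (h.compat W hW K hK).2 e heK

theorem AtomChain.isStableTable (h : AtomChain T F S M₀ M) (hE : ∀ e, e ∈ E ↔ ∃ W ∈ S, e ∈ W) :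
    IsStableTable T E := by
  intro e he
  obtain ⟨W, hW, heW⟩ := (hE e).1 he
  exact ⟨W, h.mem_stable hE hW, heW⟩

theorem AtomChain.table_subset (h : AtomChain T F S M₀ M) (hE : ∀ e, e ∈ E ↔ ∃ W ∈ S, e ∈ W) :
    E ⊆ T.edges := by
  intro e he
  obtain ⟨W, hW, heW⟩ := (hE e).1 he
  exact (h.mat W hW).2 heW

theorem AtomChain.dom_stable (h : AtomChain T F S M₀ M) (hE : ∀ e, e ∈ E ↔ ∃ W ∈ S, e ∈ W)
    {N : Table p q} (hN : N ∈ stableMatchings T E) : Dom T M₀ N ∧ Dom T N M := by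
  have hEd := h.table_subset hE
  have hM₀ := h.mem_stable hE h.first_mem
  have hM := h.mem_stable hE h.last_mem
  constructor
  · refine (stable_compat hM₀ hN).dom_of_leX (stable_mat hEd hM₀) (stable_mat hEd hN) ?_
    intro x y y' a b
    obtain ⟨W, hW, heW⟩ := (hE _).1 (hN.1.2 b)
    exact (h.first_dom W hW).leX (h.mat W hW) a heW
  · refine (stable_compat hN hM).dom_of_leX (stable_mat hEd hN) (stable_mat hEd hM) ?_
    intro x y y' a b
    obtain ⟨W, hW, heW⟩ := (hE _).1 (hN.1.2 a)
    exact (h.dom_last W hW).leX (stable_mat hEd hM) heW b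

/-- If the table `E` has a gapless chain of matchings that are stable in the stable table `E'`, then
all stable matchings of `E` are stable in `E'`. -/
theorem AtomChain.stable_subset {E' : Table p q} (h : AtomChain T E S M₀ M)
    (hE : ∀ e, e ∈ E ↔ ∃ W ∈ S, e ∈ W) (hE' : E' ⊆ T.edges) (hs : IsStableTable T E')
    (hS : S ⊆ stableMatchings T E') : stableMatchings T E ⊆ stableMatchings T E' := by
  intro N hN
  have hEd := h.table_subset hE
  refine ⟨⟨hN.1.1, fun e he => ?_⟩, fun e he => ?_⟩
  · obtain ⟨W, hW, heW⟩ := (hE _).1 (hN.1.2 he)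
    exact (hS hW).1.2 heW
  · obtain ⟨W, hW, heW⟩ := hs e he
    obtain ⟨d1, d2⟩ := h.dom_stable hE hN
    exact h.not_blocks (stable_mat hEd hN) hN.1.2
      (fun K hK => stable_compat hN (h.mem_stable hE hK)) (stable_mat hE' hW)
      (fun K hK => stable_compat hW (hS hK)) d1 d2 heW

/-- A gapless chain in `F` that cannot be extended in `F` gives an internally closed set, if `F` has all
the edges that matter. -/
theorem AtomChain.internallyClosed (h : AtomChain T F S M₀ M) (hE : ∀ e, e ∈ E ↔ ∃ W ∈ S, e ∈ W)
    (hF : ∀ N, Mat T N → (∀ K ∈ stableMatchings T E, Compat T N K) → N ⊆ F)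
    (htop : ∀ V, Mat T V → V ⊆ F → Dom T V M₀ → V = M₀)
    (hbot : ∀ V, Mat T V → V ⊆ F → Dom T M V → V = M) :
    InternallyClosed T (stableMatchings T E) := by
  have hEd := h.table_subset hE
  rw [internallyClosed_iff hEd]
  intro N hN hc
  refine stable_of_compat (h.isStableTable hE) ⟨hN.1, ?_⟩ hc
  rintro ⟨x, y⟩ he
  have hNF := hF N hN hc
  have hM₀ := h.mat _ h.first_mem
  have hM := h.mat _ h.last_mem
  have hc₀ := hc _ (h.mem_stable hE h.first_mem)
  have hc₁ := hc _ (h.mem_stable hE h.last_mem)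
  rw [hE]
  rcases h.caught hN hNF (fun W hW => hc W (h.mem_stable hE hW)) he with h' | ⟨z, hz, hlt⟩ | ⟨z, hz, hlt⟩
  · exact h'
  · exfalso
    have e := htop _ (join_mat hN hM₀ hc₀) ((join_subset _ _).trans
      (Finset.union_subset hNF (h.subset _ h.first_mem))) (dom_join_right hN hM₀ hc₀)
    have := (dom_join_left hN hM₀ hc₀).leX hN (by rw [e]; exact hz) he
    omega
  · exfalso
    have e := hbot _ (meet_mat hN hM hc₁) ((meet_subset _ _).trans
      (Finset.union_subset hNF (h.subset _ h.last_mem))) (dom_meet_right hN hM hc₁)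
    have := (dom_meet_left hN hM hc₁).leX (meet_mat hN hM hc₁) he (by rw [e]; exact hz)
    omega

end TableOf

end Marriage

namespace Marriage

variable {p q : ℕ}

/-! ### Links of a rotation -/

theorem mem_links_coe {l : List (Fin p × Fin q)} {a b : Fin p × Fin q} :
    (a, b) ∈ links (l : Rotation p q) ↔ ∃ i, ∃ h : i < l.length,
      l[i] = a ∧ l[(i + 1) % l.length]'(Nat.mod_lt _ (by omega)) = b := by
  change (a, b) ∈ (l.zip (l.rotate 1)).toFinset ↔ _
  rw [List.mem_toFinset, List.mem_iff_getElem]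
  constructor
  · rintro ⟨i, h, e⟩
    have hi : i < l.length := by simp at h; omega
    refine ⟨i, hi, ?_⟩
    rw [List.getElem_zip, Prod.mk.injEq, List.getElem_rotate] at e
    exact e
  · rintro ⟨i, h, e1, e2⟩
    refine ⟨i, by simpa using h, ?_⟩
    rw [List.getElem_zip, Prod.mk.injEq, List.getElem_rotate]
    exact ⟨e1, e2⟩

theorem mem_links_left {ρ : Rotation p q} {a b : Fin p × Fin q} (h : (a, b) ∈ links ρ) :
    a ∈ ρ.toFinset := by
  induction ρ using Quotient.inductionOn' with | _ l
  change (a, b) ∈ links (l : Rotation p q) at h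
  change a ∈ l.toFinset
  obtain ⟨i, hi, rfl, _⟩ := mem_links_coe.1 h
  simp

theorem mem_links_right {ρ : Rotation p q} {a b : Fin p × Fin q} (h : (a, b) ∈ links ρ) :
    b ∈ ρ.toFinset := by
  induction ρ using Quotient.inductionOn' with | _ l
  change (a, b) ∈ links (l : Rotation p q) at h
  change b ∈ l.toFinset
  obtain ⟨i, hi, _, rfl⟩ := mem_links_coe.1 h
  simp

theorem exists_link_left {ρ : Rotation p q} {a : Fin p × Fin q} (h : a ∈ ρ.toFinset) :
    ∃ b, (a, b) ∈ links ρ := by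
  induction ρ using Quotient.inductionOn' with | _ l
  change a ∈ l.toFinset at h
  obtain ⟨i, hi, rfl⟩ := List.mem_iff_getElem.1 (List.mem_toFinset.1 h)
  exact ⟨_, mem_links_coe.2 ⟨i, hi, rfl, rfl⟩⟩

theorem exists_link_right {ρ : Rotation p q} {b : Fin p × Fin q} (h : b ∈ ρ.toFinset) :
    ∃ a, (a, b) ∈ links ρ := by
  induction ρ using Quotient.inductionOn' with | _ l
  change b ∈ l.toFinset at h
  obtain ⟨i, hi, rfl⟩ := List.mem_iff_getElem.1 (List.mem_toFinset.1 h)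
  have hl : (i + l.length - 1) % l.length < l.length := Nat.mod_lt _ (by omega)
  refine ⟨l[(i + l.length - 1) % l.length], mem_links_coe.2 ⟨_, hl, rfl, ?_⟩⟩
  congr 1
  rw [Nat.mod_add_mod, show i + l.length - 1 + 1 = i + l.length by omega, Nat.add_mod_right,
    Nat.mod_eq_of_lt hi]

theorem link_right_unique {ρ : Rotation p q} (hρ : ρ.Nodup) {a b b' : Fin p × Fin q}
    (h : (a, b) ∈ links ρ) (h' : (a, b') ∈ links ρ) : b = b' := by
  induction ρ using Quotient.inductionOn' with | _ l
  change l.Nodup at hρ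
  obtain ⟨i, hi, rfl, rfl⟩ := mem_links_coe.1 h
  obtain ⟨j, hj, e, rfl⟩ := mem_links_coe.1 h'
  obtain rfl := (hρ.getElem_inj_iff).1 e
  rfl

theorem link_left_unique {ρ : Rotation p q} (hρ : ρ.Nodup) {a a' b : Fin p × Fin q}
    (h : (a, b) ∈ links ρ) (h' : (a', b) ∈ links ρ) : a = a' := by
  induction ρ using Quotient.inductionOn' with | _ l
  change l.Nodup at hρ
  obtain ⟨i, hi, rfl, rfl⟩ := mem_links_coe.1 h
  obtain ⟨j, hj, rfl, e⟩ := mem_links_coe.1 h'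
  have e := (hρ.getElem_inj_iff).1 e
  congr 1
  rcases Nat.lt_or_ge (i + 1) l.length with h1 | h1 <;>
    rcases Nat.lt_or_ge (j + 1) l.length with h2 | h2
  · rw [Nat.mod_eq_of_lt h1, Nat.mod_eq_of_lt h2] at e; omega
  · rw [Nat.mod_eq_of_lt h1, show j + 1 = l.length by omega, Nat.mod_self] at e; omega
  · rw [Nat.mod_eq_of_lt h2, show i + 1 = l.length by omega, Nat.mod_self] at e; omega
  · omega

theorem links_induction {ρ : Rotation p q} {P : Fin p × Fin q → Prop} {a : Fin p × Fin q}
    (ha : a ∈ ρ.toFinset) (h0 : P a) (hs : ∀ c d, (c, d) ∈ links ρ → P c → P d)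
    {c : Fin p × Fin q} (hc : c ∈ ρ.toFinset) : P c := by
  induction ρ using Quotient.inductionOn' with | _ l
  change a ∈ l.toFinset at ha
  change c ∈ l.toFinset at hc
  obtain ⟨i, hi, rfl⟩ := List.mem_iff_getElem.1 (List.mem_toFinset.1 ha)
  obtain ⟨j, hj, rfl⟩ := List.mem_iff_getElem.1 (List.mem_toFinset.1 hc)
  have hl : 0 < l.length := by omega
  have key : ∀ k, P (l[(i + k) % l.length]'(Nat.mod_lt _ hl)) := by
    intro k
    induction k with
    | zero => simpa [Nat.mod_eq_of_lt hi] using h0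
    | succ k ih =>
      refine hs _ _ (mem_links_coe.2 ⟨(i + k) % l.length, Nat.mod_lt _ hl, rfl, ?_⟩) ih
      congr 1
      rw [Nat.mod_add_mod, Nat.add_assoc]
  have := key (j + l.length - i)
  have e : (i + (j + l.length - i)) % l.length = j := by
    rw [show i + (j + l.length - i) = j + l.length by omega, Nat.add_mod_right, Nat.mod_eq_of_lt hj]
  simpa only [e] using this

/-- Two rotations with a common element and the same successors are equal. -/
theorem rotation_ext {ρ σ : Rotation p q} (hρ : ρ.Nodup) (hσ : σ.Nodup) {a : Fin p × Fin q}
    (ha : a ∈ ρ.toFinset) (ha' : a ∈ σ.toFinset)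
    (hs : ∀ c d, (c, d) ∈ links ρ → c ∈ σ.toFinset → (c, d) ∈ links σ) : ρ = σ := by
  induction ρ using Quotient.inductionOn' with | _ l
  induction σ using Quotient.inductionOn' with | _ l'
  change l.Nodup at hρ
  have hσ' := hσ
  change l'.Nodup at hσ
  change a ∈ l.toFinset at ha
  change a ∈ l'.toFinset at ha'
  obtain ⟨i, hi, rfl⟩ := List.mem_iff_getElem.1 (List.mem_toFinset.1 ha)
  obtain ⟨j, hj, e⟩ := List.mem_iff_getElem.1 (List.mem_toFinset.1 ha')
  have hl : 0 < l.length := by omega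
  have hl' : 0 < l'.length := by omega
  have key : ∀ k, l[(i + k) % l.length]'(Nat.mod_lt _ hl) = l'[(j + k) % l'.length]'(Nat.mod_lt _ hl') := by
    intro k
    induction k with
    | zero => simp [Nat.mod_eq_of_lt hi, Nat.mod_eq_of_lt hj, e]
    | succ k ih =>
      have h1 : (l[(i + k) % l.length]'(Nat.mod_lt _ hl),
          l[(i + (k + 1)) % l.length]'(Nat.mod_lt _ hl)) ∈ links (l : Rotation p q) :=
        mem_links_coe.2 ⟨(i + k) % l.length, Nat.mod_lt _ hl, rfl, by
          congr 1; rw [Nat.mod_add_mod, Nat.add_assoc]⟩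
      have h2 : (l'[(j + k) % l'.length]'(Nat.mod_lt _ hl'),
          l'[(j + (k + 1)) % l'.length]'(Nat.mod_lt _ hl')) ∈ links (l' : Rotation p q) :=
        mem_links_coe.2 ⟨(j + k) % l'.length, Nat.mod_lt _ hl', rfl, by
          congr 1; rw [Nat.mod_add_mod, Nat.add_assoc]⟩
      have h3 := hs _ _ h1 (by rw [ih]; change _ ∈ l'.toFinset; simp)
      rw [ih] at h3
      exact link_right_unique hσ' h3 h2
  have len : l.length = l'.length := by
    have k1 := key l.length
    have k2 := key l'.length
    have k0 := key 0
    simp only [Nat.add_mod_right, Nat.add_zero] at k0 k1 k2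
    rw [k0] at k1
    rw [← k0] at k2
    have e1 := (hσ.getElem_inj_iff).1 k1
    have e2 := (hρ.getElem_inj_iff).1 k2
    have d1 : l'.length ∣ l.length :=
      (Nat.modEq_zero_iff_dvd).1 (Nat.ModEq.add_left_cancel' j (by
        simpa [Nat.ModEq] using e1.symm))
    have d2 : l.length ∣ l'.length :=
      (Nat.modEq_zero_iff_dvd).1 (Nat.ModEq.add_left_cancel' i (by
        simpa [Nat.ModEq] using e2))
    exact Nat.dvd_antisymm d2 d1
  have rot : l.rotate i = l'.rotate j := by
    refine List.ext_getElem (by simp [len]) fun k h1 h2 => ?_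
    rw [List.getElem_rotate, List.getElem_rotate]
    have := key k
    simp only [Nat.add_comm k] at this ⊢
    exact this
  refine Quotient.sound' ?_
  exact (List.IsRotated.symm ⟨i, rfl⟩ : l.rotate i ~r l).symm.trans (rot ▸ (List.IsRotated.symm ⟨j, rfl⟩))

theorem mem_shifted {ρ : Rotation p q} {x : Fin p} {y : Fin q} :
    (x, y) ∈ shifted ρ ↔ ∃ a b, (a, b) ∈ links ρ ∧ a.1 = x ∧ b.2 = y := by
  simp only [shifted, Finset.mem_image, Prod.exists, Prod.mk.injEq]

theorem mem_shifted_of_link {ρ : Rotation p q} {a b : Fin p × Fin q} (h : (a, b) ∈ links ρ) :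
    (a.1, b.2) ∈ shifted ρ := mem_shifted.2 ⟨a, b, h, rfl, rfl⟩

theorem toFinset_nonempty {ρ : Rotation p q} (h : ρ ≠ Cycle.nil) : ∃ a, a ∈ ρ.toFinset := by
  by_contra hc
  push Not at hc
  exact h (Cycle.toFinset_eq_nil.1 (Finset.eq_empty_of_forall_notMem hc))

/-! ### Generalized rotations -/

namespace IsGenRotation

variable {T : Inst p q} {E M : Table p q} {ρ : Rotation p q}

theorem edge_left (h : IsGenRotation T E M ρ) {a b : Fin p × Fin q} (hl : (a, b) ∈ links ρ) :
    a ∈ E := h.2.2.1 (Finset.mem_union_left _ (mem_links_left hl))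

theorem edge_right (h : IsGenRotation T E M ρ) {a b : Fin p × Fin q} (hl : (a, b) ∈ links ρ) :
    b ∈ E := h.2.2.1 (Finset.mem_union_left _ (mem_links_right hl))

theorem edge_shift (h : IsGenRotation T E M ρ) {a b : Fin p × Fin q} (hl : (a, b) ∈ links ρ) :
    (a.1, b.2) ∈ E := h.2.2.1 (Finset.mem_union_right _ (mem_shifted_of_link hl))

theorem mem (h : IsGenRotation T E M ρ) {a : Fin p × Fin q} (ha : a ∈ ρ.toFinset) : a ∈ M := by
  obtain ⟨b, hb⟩ := exists_link_left ha
  exact (h.2.2.2 a b hb).1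

theorem ltX (h : IsGenRotation T E M ρ) (hE : E ⊆ T.edges) {a b : Fin p × Fin q}
    (hl : (a, b) ∈ links ρ) : rkX T a.1 a.2 < rkX T a.1 b.2 :=
  (prefX_iff (hE (h.edge_left hl)) (hE (h.edge_shift hl))).1 (h.2.2.2 a b hl).2.2

theorem ltY (h : IsGenRotation T E M ρ) (hE : E ⊆ T.edges) {a b : Fin p × Fin q}
    (hl : (a, b) ∈ links ρ) : rkY T b.2 a.1 < rkY T b.2 b.1 :=
  (prefY_iff (hE (h.edge_shift hl)) (hE (h.edge_right hl))).1 (h.2.2.2 a b hl).2.1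

theorem mono {F : Table p q} (h : IsGenRotation T E M ρ) (hEF : E ⊆ F) : IsGenRotation T F M ρ :=
  ⟨h.1, h.2.1, h.2.2.1.trans hEF, h.2.2.2⟩

end IsGenRotation

theorem IsGenRotation.of_links {T : Inst p q} {E M : Table p q} {ρ : Rotation p q}
    (hE : E ⊆ T.edges) (h1 : ρ ≠ Cycle.nil) (h2 : ρ.Nodup)
    (h : ∀ a b, (a, b) ∈ links ρ → a ∈ E ∧ (a.1, b.2) ∈ E ∧ a ∈ M ∧
      rkY T b.2 a.1 < rkY T b.2 b.1 ∧ rkX T a.1 a.2 < rkX T a.1 b.2) : IsGenRotation T E M ρ := by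
  refine ⟨h1, h2, Finset.union_subset ?_ ?_, fun a b hl => ?_⟩
  · intro a ha
    obtain ⟨b, hb⟩ := exists_link_left ha
    exact (h a b hb).1
  · rintro ⟨x, y⟩ hxy
    obtain ⟨a, b, hl, rfl, rfl⟩ := mem_shifted.1 hxy
    exact (h a b hl).2.1
  · obtain ⟨c, hc⟩ := exists_link_left (mem_links_right hl)
    have hb := (h b c hc).1
    obtain ⟨k1, k2, k3, k4, k5⟩ := h a b hl
    exact ⟨k3, (prefY_iff (hE k2) (hE hb)).2 k4, (prefX_iff (hE k1) (hE k2)).2 k5⟩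

theorem mem_elim {M : Table p q} {ρ : Rotation p q} {x : Fin p} {y : Fin q} :
    (x, y) ∈ elim M ρ ↔ ((x, y) ∈ M ∧ (x, y) ∉ ρ.toFinset) ∨
      ∃ a b, (a, b) ∈ links ρ ∧ a.1 = x ∧ b.2 = y := by
  rw [elim, Finset.mem_union, Finset.mem_sdiff, mem_shifted]

theorem mem_elim_of_link {M : Table p q} {ρ : Rotation p q} {a b : Fin p × Fin q}
    (h : (a, b) ∈ links ρ) : (a.1, b.2) ∈ elim M ρ := mem_elim.2 (Or.inr ⟨a, b, h, rfl, rfl⟩)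

theorem elim_mat {T : Inst p q} {E M : Table p q} {ρ : Rotation p q} (hE : E ⊆ T.edges)
    (hM : Mat T M) (h : IsGenRotation T E M ρ) : Mat T (elim M ρ) := by
  refine Mat.of_uniq ?_ ?_ ?_
  · rintro ⟨x, y⟩ hxy
    rcases mem_elim.1 hxy with h' | ⟨a, b, hl, rfl, rfl⟩
    exacts [hM.2 h'.1, hE (h.edge_shift hl)]
  · intro x y y' h1 h2
    rcases mem_elim.1 h1 with ⟨a1, a2⟩ | ⟨a, b, hl, rfl, rfl⟩ <;>
      rcases mem_elim.1 h2 with ⟨b1, b2⟩ | ⟨c, d, hl', e, rfl⟩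
    · exact hM.uniqX a1 b1
    · subst e
      have := hM.uniqX a1 (h.mem (mem_links_left hl'))
      subst this
      exact absurd (mem_links_left hl') a2
    · have := hM.uniqX b1 (h.mem (mem_links_left hl))
      subst this
      exact absurd (mem_links_left hl) b2
    · have e' : c = a := hM.1 _ (h.mem (mem_links_left hl')) _ (h.mem (mem_links_left hl)) (Or.inl e)
      subst e'
      rw [link_right_unique h.2.1 hl hl']
  · intro x x' y h1 h2
    rcases mem_elim.1 h1 with ⟨a1, a2⟩ | ⟨a, b, hl, rfl, rfl⟩ <;>
      rcases mem_elim.1 h2 with ⟨b1, b2⟩ | ⟨c, d, hl', rfl, e⟩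
    · exact hM.uniqY a1 b1
    · subst e
      have := hM.uniqY a1 (h.mem (mem_links_right hl'))
      subst this
      exact absurd (mem_links_right hl') a2
    · have := hM.uniqY b1 (h.mem (mem_links_right hl))
      subst this
      exact absurd (mem_links_right hl) b2
    · have e' : d = b :=
        hM.1 _ (h.mem (mem_links_right hl')) _ (h.mem (mem_links_right hl)) (Or.inr e)
      subst e'
      rw [link_left_unique h.2.1 hl hl']

theorem dom_elim {T : Inst p q} {E M : Table p q} {ρ : Rotation p q} (hE : E ⊆ T.edges)
    (h : IsGenRotation T E M ρ) : Dom T M (elim M ρ) := by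
  constructor
  · intro x y hxy
    by_cases hm : (x, y) ∈ ρ.toFinset
    · obtain ⟨b, hb⟩ := exists_link_left hm
      obtain ⟨a, ha⟩ := exists_link_right hm
      exact ⟨b.2, a.1, mem_elim_of_link hb, mem_elim_of_link ha, (h.ltX hE hb).le, (h.ltY hE ha).le⟩
    · exact ⟨y, x, mem_elim.2 (Or.inl ⟨hxy, hm⟩), mem_elim.2 (Or.inl ⟨hxy, hm⟩), le_rfl, le_rfl⟩
  · intro x y hxy
    rcases mem_elim.1 hxy with ⟨h1, h2⟩ | ⟨a, b, hl, rfl, rfl⟩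
    · exact ⟨y, x, h1, h1, le_rfl, le_rfl⟩
    · exact ⟨a.2, b.1, h.mem (mem_links_left hl), h.mem (mem_links_right hl), (h.ltX hE hl).le,
        (h.ltY hE hl).le⟩

theorem link_notMem {T : Inst p q} {E M : Table p q} {ρ : Rotation p q} (hE : E ⊆ T.edges)
    (hM : Mat T M) (h : IsGenRotation T E M ρ) {a b : Fin p × Fin q} (hl : (a, b) ∈ links ρ) :
    (a.1, b.2) ∉ M := by
  intro hc
  have := hM.uniqX (h.mem (mem_links_left hl)) hc
  have := h.ltX hE hl
  simp_all

theorem elim_ne {T : Inst p q} {E M : Table p q} {ρ : Rotation p q} (hE : E ⊆ T.edges)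
    (hM : Mat T M) (h : IsGenRotation T E M ρ) : M ≠ elim M ρ := by
  intro e
  obtain ⟨a, ha⟩ := toFinset_nonempty h.1
  obtain ⟨b, hb⟩ := exists_link_left ha
  have := mem_elim_of_link (M := M) hb
  rw [← e] at this
  exact link_notMem hE hM h hb this

/-! ### Alternating cycles -/

open Classical in
/-- The pair of `M` at the other end of the edge of `N` at `e.1`. -/
noncomputable def altNext (M N : Table p q) (e : Fin p × Fin q) : Fin p × Fin q :=
  if h : ∃ b, e ∈ M ∧ b ∈ M ∧ (e.1, b.2) ∈ N then h.choose else e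

theorem altNext_spec {T : Inst p q} {M N : Table p q} (hd : Dom T M N) {e : Fin p × Fin q}
    (he : e ∈ M) : altNext M N e ∈ M ∧ (e.1, (altNext M N e).2) ∈ N := by
  have h : ∃ b, e ∈ M ∧ b ∈ M ∧ (e.1, b.2) ∈ N := by
    obtain ⟨y', _, h1, _⟩ := hd.1 e.1 e.2 he
    obtain ⟨_, x', _, h2, _⟩ := hd.2 _ _ h1
    exact ⟨(x', y'), he, h2, h1⟩
  rw [altNext, dif_pos h]
  exact h.choose_spec.2

theorem altNext_injective {T : Inst p q} {M N : Table p q} (hM : Mat T M) (hN : Mat T N)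
    (hd : Dom T M N) : Function.Injective (altNext M N) := by
  have hn : ∀ {e}, e ∉ M → altNext M N e = e := by
    intro e he
    rw [altNext, dif_neg]
    rintro ⟨b, h, _⟩
    exact he h
  intro a b e
  by_cases ha : a ∈ M <;> by_cases hb : b ∈ M
  · have h1 := (altNext_spec hd ha).2
    have h2 := (altNext_spec hd hb).2
    rw [e] at h1
    exact hM.1 _ ha _ hb (Or.inl (hN.uniqY h1 h2))
  · have := (altNext_spec hd ha).1
    rw [e, hn hb] at this
    exact absurd this hb
  · have := (altNext_spec hd hb).1
    rw [← e, hn ha] at this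
    exact absurd this ha
  · rwa [hn ha, hn hb] at e

theorem mem_links_periodicOrbit {f : Fin p × Fin q → Fin p × Fin q} {a c d : Fin p × Fin q}
    (h : (c, d) ∈ links (Function.periodicOrbit f a)) : d = f c := by
  rw [Function.periodicOrbit] at h
  obtain ⟨i, hi, rfl, rfl⟩ := mem_links_coe.1 h
  simp only [List.getElem_map, List.getElem_range, List.length_map, List.length_range]
  rw [Function.iterate_mod_minimalPeriod_eq, Function.iterate_succ_apply']

/-- Every edge of `M \ N` lies on an alternating cycle. -/
theorem exists_altCycle {T : Inst p q} {M N : Table p q} (hM : Mat T M) (hN : Mat T N)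
    (hd : Dom T M N) {a : Fin p × Fin q} (ha : a ∈ M) (ha' : a ∉ N) :
    ∃ ρ, IsAltCycle M N ρ ∧ a ∈ ρ.toFinset := by
  have hper := (altNext_injective hM hN hd).mem_periodicPts a
  have inv : ∀ {e}, e ∈ M \ N → altNext M N e ∈ M \ N := by
    intro e he
    rw [Finset.mem_sdiff] at he ⊢
    obtain ⟨h1, h2⟩ := altNext_spec hd he.1
    refine ⟨h1, fun h3 => he.2 ?_⟩
    have := hN.uniqY h2 h3
    rwa [hM.1 _ he.1 _ h1 (Or.inl this)]
  have mem_iff : ∀ e, e ∈ (Function.periodicOrbit (altNext M N) a).toFinset ↔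
      e ∈ Function.periodicOrbit (altNext M N) a := by
    intro e
    rw [Function.periodicOrbit, Cycle.coe_toFinset, List.mem_toFinset, Cycle.mem_coe_iff]
  have ha1 : a ∈ (Function.periodicOrbit (altNext M N) a).toFinset :=
    (mem_iff a).2 (Function.self_mem_periodicOrbit hper)
  have sub : ∀ e, e ∈ (Function.periodicOrbit (altNext M N) a).toFinset → e ∈ M \ N := by
    intro e he
    refine links_induction (P := fun e => e ∈ M \ N) ha1 (Finset.mem_sdiff.2 ⟨ha, ha'⟩) ?_ he
    intro c d hl hc
    rw [mem_links_periodicOrbit hl]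
    exact inv hc
  refine ⟨_, ⟨?_, Function.nodup_periodicOrbit, sub, ?_⟩, ha1⟩
  · intro e
    rw [e] at ha1
    simp at ha1
  · rintro ⟨x, y⟩ hxy
    obtain ⟨c, d, hl, rfl, rfl⟩ := mem_shifted.1 hxy
    have hc := Finset.mem_sdiff.1 (sub c (mem_links_left hl))
    rw [mem_links_periodicOrbit hl]
    obtain ⟨h1, h2⟩ := altNext_spec hd hc.1
    refine Finset.mem_sdiff.2 ⟨h2, fun h3 => hc.2 ?_⟩
    have := hM.uniqX h3 hc.1
    rwa [this] at h2

section Alt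

variable {T : Inst p q} {M N : Table p q} {ρ : Rotation p q}

theorem IsAltCycle.isGenRotation {F : Table p q} (hF : F ⊆ T.edges) (hM : Mat T M) (hN : Mat T N)
    (hd : Dom T M N) (hMF : M ⊆ F) (hNF : N ⊆ F) (h : IsAltCycle M N ρ) :
    IsGenRotation T F M ρ := by
  refine IsGenRotation.of_links hF h.1 h.2.1 fun a b hl => ?_
  have ha := Finset.mem_sdiff.1 (h.2.2.1 (mem_links_left hl))
  have hb := Finset.mem_sdiff.1 (h.2.2.1 (mem_links_right hl))
  have hab := Finset.mem_sdiff.1 (h.2.2.2 (mem_shifted_of_link hl))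
  refine ⟨hMF ha.1, hNF hab.1, ha.1, lt_of_le_of_ne (hd.leY hN hb.1 hab.1) fun e => ?_,
    lt_of_le_of_ne (hd.leX hN ha.1 hab.1) fun e => ?_⟩
  · have := rkY_inj (hN.edge hab.1) e
    rw [this] at hab
    exact hab.2 hb.1
  · have := rkX_inj (hM.edge ha.1) e
    rw [← this] at hab
    exact hab.2 ha.1

theorem IsAltCycle.elim_subset (h : IsAltCycle M N ρ) : elim M ρ ⊆ M ∪ N :=
  Finset.union_subset (Finset.sdiff_subset.trans Finset.subset_union_left)
    ((h.2.2.2.trans Finset.sdiff_subset).trans Finset.subset_union_right)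

theorem IsAltCycle.dom_elim (hM : Mat T M) (hN : Mat T N) (hd : Dom T M N)
    (h : IsAltCycle M N ρ) : Dom T (elim M ρ) N := by
  have hg := h.isGenRotation (Finset.union_subset hM.2 hN.2) hM hN hd Finset.subset_union_left
    Finset.subset_union_right
  have hE := elim_mat (Finset.union_subset hM.2 hN.2) hM hg
  have hle : ∀ x y y', (x, y) ∈ elim M ρ → (x, y') ∈ N → rkX T x y ≤ rkX T x y' := by
    intro x y y' h1 h2
    rcases Finset.mem_union.1 (h.elim_subset h1) with h3 | h3
    · exact hd.leX hN h3 h2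
    · rw [hN.uniqX h3 h2]
  refine Compat.dom_of_leX hE hN ⟨fun e he => ?_, fun e he => ?_⟩ hle
  · rcases Finset.mem_union.1 (h.elim_subset he) with h3 | h3
    exacts [(hd.compat hM hN).1 e h3, not_blocks_self h3]
  · obtain ⟨x, y⟩ := e
    obtain ⟨y', _, a, _⟩ := hd.2 _ _ he
    obtain ⟨y1, _, b, _⟩ := (Marriage.dom_elim (Finset.union_subset hM.2 hN.2) hg).1 _ _ a
    exact (not_blocks_iff hE.2 (hN.edge he)).2 (Or.inl ⟨y1, b, hle _ _ _ b he⟩)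

theorem IsAltCycle.eq_of_common {σ : Rotation p q} (hM : Mat T M) (hN : Mat T N)
    (h : IsAltCycle M N ρ) (h' : IsAltCycle M N σ) {a : Fin p × Fin q} (ha : a ∈ ρ.toFinset)
    (ha' : a ∈ σ.toFinset) : ρ = σ := by
  refine rotation_ext h.2.1 h'.2.1 ha ha' fun c d hl hc => ?_
  obtain ⟨d', hl'⟩ := exists_link_left hc
  have h1 := Finset.mem_sdiff.1 (h.2.2.2 (mem_shifted_of_link hl))
  have h2 := Finset.mem_sdiff.1 (h'.2.2.2 (mem_shifted_of_link hl'))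
  have h3 := hN.uniqX h1.1 h2.1
  have h4 := Finset.mem_sdiff.1 (h.2.2.1 (mem_links_right hl))
  have h5 := Finset.mem_sdiff.1 (h'.2.2.1 (mem_links_right hl'))
  rwa [hM.1 _ h4.1 _ h5.1 (Or.inr h3)]

theorem IsAltCycle.elim_iff {σ : Rotation p q} (hM : Mat T M) (hN : Mat T N)
    (h : IsAltCycle M N ρ) : IsAltCycle (elim M ρ) N σ ↔ IsAltCycle M N σ ∧ σ ≠ ρ := by
  have hd1 : ∀ e, e ∈ elim M ρ \ N ↔ e ∈ M \ N ∧ e ∉ ρ.toFinset := by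
    intro e
    have h1 := @h.2.2.1 e
    have h2 := @h.2.2.2 e
    simp only [elim, Finset.mem_sdiff, Finset.mem_union] at h1 h2 ⊢
    tauto
  have hd2 : ∀ e, e ∈ N \ elim M ρ ↔ e ∈ N \ M ∧ e ∉ shifted ρ := by
    intro e
    have h1 := @h.2.2.1 e
    have h2 := @h.2.2.2 e
    simp only [elim, Finset.mem_sdiff, Finset.mem_union] at h1 h2 ⊢
    tauto
  constructor
  · intro hσ
    refine ⟨⟨hσ.1, hσ.2.1, fun e he => ((hd1 e).1 (hσ.2.2.1 he)).1,
      fun e he => ((hd2 e).1 (hσ.2.2.2 he)).1⟩, ?_⟩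
    rintro rfl
    obtain ⟨a, ha⟩ := toFinset_nonempty hσ.1
    exact ((hd1 a).1 (hσ.2.2.1 ha)).2 ha
  · rintro ⟨hσ, hne⟩
    refine ⟨hσ.1, hσ.2.1, fun e he => (hd1 e).2 ⟨hσ.2.2.1 he, fun hc => ?_⟩,
      fun e he => (hd2 e).2 ⟨hσ.2.2.2 he, fun hc => ?_⟩⟩
    · exact hne (hσ.eq_of_common hM hN h he hc)
    · obtain ⟨x, y⟩ := e
      obtain ⟨a, b, hl, rfl, rfl⟩ := mem_shifted.1 he
      obtain ⟨c, d, hl', e, e'⟩ := mem_shifted.1 hc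
      have h4 := Finset.mem_sdiff.1 (hσ.2.2.1 (mem_links_left hl))
      have h5 := Finset.mem_sdiff.1 (h.2.2.1 (mem_links_left hl'))
      have := hM.1 _ h5.1 _ h4.1 (Or.inl e)
      subst this
      exact hne (hσ.eq_of_common hM hN h (mem_links_left hl) (mem_links_left hl'))

end Alt

/-- `M' = M / ρ₁ / ⋯ / ρ_k`, where each `ρ_i` is a generalized rotation exposed when eliminated. -/
inductive GenSeq (T : Inst p q) : Table p q → List (Rotation p q) → Table p q → Prop
  | nil (M : Table p q) : GenSeq T M [] M
  | cons (M : Table p q) (ρ : Rotation p q) (l : List (Rotation p q)) (M' : Table p q) :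
      IsGenRotation T T.edges M ρ → GenSeq T (elim M ρ) l M' → GenSeq T M (ρ :: l) M'

theorem GenSeq.append {T : Inst p q} {M N K : Table p q} {l l' : List (Rotation p q)}
    (h : GenSeq T M l N) (h' : GenSeq T N l' K) : GenSeq T M (l ++ l') K := by
  induction h with
  | nil M => exact h'
  | cons M ρ l M' h1 h2 ih => exact GenSeq.cons _ _ _ _ h1 (ih h')

theorem GenSeq.mat {T : Inst p q} {M N : Table p q} {l : List (Rotation p q)}
    (h : GenSeq T M l N) (hM : Mat T M) : Mat T N := by
  induction h with
  | nil M => exact hM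
  | cons M ρ l M' h1 h2 ih => exact ih (elim_mat subset_rfl hM h1)

theorem GenSeq.dom {T : Inst p q} {M N : Table p q} {l : List (Rotation p q)}
    (h : GenSeq T M l N) (hM : Mat T M) : Dom T M N := by
  induction h with
  | nil M => exact Dom.refl M
  | cons M ρ l M' h1 h2 ih =>
    exact (dom_elim subset_rfl h1).trans (ih (elim_mat subset_rfl hM h1))

/-- Eliminating all alternating cycles leads from `M` to `N`. -/
theorem exists_genSeq_altCycles {T : Inst p q} {M N : Table p q} (hM : Mat T M) (hN : Mat T N)
    (hd : Dom T M N) : ∃ l, GenSeq T M l N ∧ ∀ ρ, ρ ∈ l ↔ IsAltCycle M N ρ := by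
  induction hk : (M \ N).card using Nat.strong_induction_on generalizing M with
  | _ k ih =>
    by_cases hsub : M ⊆ N
    · have : M = N := Finset.Subset.antisymm hsub (by
        rintro ⟨x, y⟩ h
        obtain ⟨y', _, a, _⟩ := hd.2 _ _ h
        rwa [hN.uniqX h (hsub a)])
      subst this
      refine ⟨[], GenSeq.nil M, fun ρ => ⟨fun h => absurd h (by simp), fun h => ?_⟩⟩
      obtain ⟨a, ha⟩ := toFinset_nonempty h.1
      simpa using h.2.2.1 ha
    · obtain ⟨a, ha, ha'⟩ := Finset.not_subset.1 hsub
      obtain ⟨ρ, hρ, hm⟩ := exists_altCycle hM hN hd ha ha'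
      have hg := hρ.isGenRotation subset_rfl hM hN hd hM.2 hN.2
      have hlt : (elim M ρ \ N).card < k := by
        rw [← hk]
        refine Finset.card_lt_card ⟨fun e he => ?_, fun hc => ?_⟩
        · have := @hρ.2.2.2 e
          simp only [elim, Finset.mem_sdiff, Finset.mem_union] at this he ⊢
          tauto
        · have h1 := hc (Finset.mem_sdiff.2 ⟨ha, ha'⟩)
          have := @hρ.2.2.2 a
          simp only [elim, Finset.mem_sdiff, Finset.mem_union] at this h1
          tauto
      obtain ⟨l, hl, hl'⟩ := ih _ hlt (elim_mat subset_rfl hM hg) (hρ.dom_elim hM hN hd) rfl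
      refine ⟨ρ :: l, GenSeq.cons _ _ _ _ hg hl, fun σ => ?_⟩
      rw [List.mem_cons, hl', hρ.elim_iff hM hN]
      by_cases e : σ = ρ
      · subst e; simp [hρ]
      · simp [e]

end Marriage

namespace Marriage

variable {p q : ℕ}

/-! ### Dissection -/

/-- Only `ρ` itself is a generalized rotation exposed within the edges that lie between `ρ` and its
elimination. -/
def Undissectable (T : Inst p q) (ρ : Rotation p q) : Prop :=
  ∀ ρ', IsGenRotation T (between T ρ.toFinset (shifted ρ)) ρ.toFinset ρ' → ρ' = ρ

theorem between_subset {T : Inst p q} (M N : Table p q) : between T M N ⊆ T.edges := by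
  classical exact Finset.filter_subset _ _

theorem mem_between {T : Inst p q} {M N : Table p q} (hM : Mat T M) (hN : Mat T N) {x : Fin p}
    {y : Fin q} : (x, y) ∈ between T M N ↔ (x, y) ∈ T.edges ∧
      ((∃ x', (x', y) ∈ N ∧ rkY T y x' ≤ rkY T y x) ∧ ∀ x', (x', y) ∈ M → rkY T y x ≤ rkY T y x') ∧
      ((∃ y', (x, y') ∈ M ∧ rkX T x y' ≤ rkX T x y) ∧ ∀ y', (x, y') ∈ N → rkX T x y ≤ rkX T x y') := by
  simp only [between, Finset.mem_filter]
  refine and_congr_right fun he => and_congr (and_congr ?_ ?_) (and_congr ?_ ?_)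
  · exact exists_congr fun x' => and_congr_right fun h => wprefY_iff (hN.edge h) he
  · exact forall₂_congr fun x' h => wprefY_iff he (hM.edge h)
  · exact exists_congr fun x' => and_congr_right fun h => wprefX_iff (hM.edge h) he
  · exact forall₂_congr fun x' h => wprefX_iff he (hN.edge h)

theorem mem_between_of_dom {T : Inst p q} {M V N : Table p q} (hM : Mat T M) (hV : Mat T V)
    (hN : Mat T N) (h1 : Dom T M V) (h2 : Dom T V N) {e : Fin p × Fin q} (he : e ∈ V) :
    e ∈ between T M N := by
  obtain ⟨x, y⟩ := e
  rw [mem_between hM hN]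
  obtain ⟨_, x1, _, b, _, b'⟩ := h2.1 _ _ he
  obtain ⟨y1, _, a, _, a', _⟩ := h1.2 _ _ he
  exact ⟨hV.edge he, ⟨⟨x1, b, b'⟩, fun x' h => h1.leY hV h he⟩, ⟨⟨y1, a, a'⟩, fun y' h => h2.leX hN he h⟩⟩

section Local

variable {T : Inst p q} {M : Table p q} {ρ : Rotation p q}

theorem between_local (hM : Mat T M) (h : IsGenRotation T T.edges M ρ) {a b : Fin p × Fin q}
    (ha : a ∈ ρ.toFinset) (hb : b ∈ ρ.toFinset) : (a.1, b.2) ∈ between T M (elim M ρ) ↔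
      (a.1, b.2) ∈ between T ρ.toFinset (shifted ρ) := by
  have h1 : ∀ y, (a.1, y) ∈ M ↔ (a.1, y) ∈ ρ.toFinset := fun y =>
    ⟨fun h' => by rwa [hM.uniqX h' (h.mem ha)], fun h' => h.mem h'⟩
  have h2 : ∀ x, (x, b.2) ∈ M ↔ (x, b.2) ∈ ρ.toFinset := fun x =>
    ⟨fun h' => by rwa [hM.uniqY h' (h.mem hb)], fun h' => h.mem h'⟩
  have h3 : ∀ y, (a.1, y) ∈ elim M ρ ↔ (a.1, y) ∈ shifted ρ := fun y => by
    rw [elim, Finset.mem_union, Finset.mem_sdiff, h1]; tauto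
  have h4 : ∀ x, (x, b.2) ∈ elim M ρ ↔ (x, b.2) ∈ shifted ρ := fun x => by
    rw [elim, Finset.mem_union, Finset.mem_sdiff, h2]; tauto
  simp only [between, Finset.mem_filter, h1, h2, h3, h4]

theorem IsGenRotation.between_toFinset (hM : Mat T M) (h : IsGenRotation T T.edges M ρ)
    {σ : Rotation p q} (hσ : IsGenRotation T (between T M (elim M ρ)) M σ) :
    σ.toFinset ⊆ ρ.toFinset := by
  intro a ha
  obtain ⟨b, hl⟩ := exists_link_left ha
  by_contra hc
  have h1 := (mem_between hM (elim_mat subset_rfl hM h)).1 (hσ.edge_shift hl)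
  have h2 := h1.2.2.2 a.2 (mem_elim.2 (Or.inl ⟨hσ.mem ha, hc⟩))
  have h3 := hσ.ltX (between_subset _ _) hl
  omega

theorem isGenRotation_between_iff (hM : Mat T M) (h : IsGenRotation T T.edges M ρ)
    {σ : Rotation p q} : IsGenRotation T (between T M (elim M ρ)) M σ ↔
      IsGenRotation T (between T ρ.toFinset (shifted ρ)) ρ.toFinset σ := by
  have key : ∀ {a b}, a ∈ ρ.toFinset → b ∈ ρ.toFinset → ((a.1, b.2) ∈ between T M (elim M ρ) ↔
      (a.1, b.2) ∈ between T ρ.toFinset (shifted ρ)) := fun ha hb => between_local hM h ha hb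
  constructor
  · intro hσ
    have sub := h.between_toFinset hM hσ
    refine IsGenRotation.of_links (between_subset _ _) hσ.1 hσ.2.1 fun a b hl => ?_
    have ha := sub (mem_links_left hl)
    have hb := sub (mem_links_right hl)
    exact ⟨(key ha ha).1 (hσ.edge_left hl), (key ha hb).1 (hσ.edge_shift hl), ha,
      hσ.ltY (between_subset _ _) hl, hσ.ltX (between_subset _ _) hl⟩
  · intro hσ
    refine IsGenRotation.of_links (between_subset _ _) hσ.1 hσ.2.1 fun a b hl => ?_
    have ha := hσ.mem (mem_links_left hl)
    have hb := hσ.mem (mem_links_right hl)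
    exact ⟨(key ha ha).2 (hσ.edge_left hl), (key ha hb).2 (hσ.edge_shift hl), h.mem ha,
      hσ.ltY (between_subset _ _) hl, hσ.ltX (between_subset _ _) hl⟩

theorem IsGenRotation.between_self (hM : Mat T M) (h : IsGenRotation T T.edges M ρ) :
    IsGenRotation T (between T M (elim M ρ)) M ρ := by
  have hM' := elim_mat subset_rfl hM h
  have hd := dom_elim subset_rfl h
  refine IsGenRotation.of_links (between_subset _ _) h.1 h.2.1 fun a b hl => ⟨?_, ?_,
    h.mem (mem_links_left hl), h.ltY subset_rfl hl, h.ltX subset_rfl hl⟩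
  · exact mem_between_of_dom hM hM hM' (Dom.refl _) hd (h.mem (mem_links_left hl))
  · exact mem_between_of_dom hM hM' hM' hd (Dom.refl _) (mem_elim_of_link hl)

theorem existsUnique_iff_undissectable (hM : Mat T M) (h : IsGenRotation T T.edges M ρ) :
    (∃! σ, IsGenRotation T (between T M (elim M ρ)) M σ) ↔ Undissectable T ρ := by
  constructor
  · rintro ⟨τ, _, hu⟩ σ hσ
    rw [hu σ ((isGenRotation_between_iff hM h).2 hσ), hu ρ (h.between_self hM)]
  · intro hu
    exact ⟨ρ, h.between_self hM, fun σ hσ => hu σ ((isGenRotation_between_iff hM h).1 hσ)⟩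

theorem Undissectable.atomic (hu : Undissectable T ρ) (hM : Mat T M)
    (h : IsGenRotation T T.edges M ρ) : Atomic T T.edges M (elim M ρ) := by
  intro V hV _ h1 h2
  have hM' := elim_mat subset_rfl hM h
  by_cases e : V = M
  · exact Or.inl e
  refine Or.inr ?_
  have hns : ¬ M ⊆ V := by
    intro hs
    refine e (Finset.Subset.antisymm ?_ hs)
    rintro ⟨x, y⟩ hxy
    obtain ⟨y', _, a, _⟩ := h1.2 _ _ hxy
    rwa [hV.uniqX hxy (hs a)]
  obtain ⟨a, ha, ha'⟩ := Finset.not_subset.1 hns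
  obtain ⟨σ, hσ, _⟩ := exists_altCycle hM hV h1 ha ha'
  have hg := hσ.isGenRotation (between_subset M (elim M ρ)) hM hV h1
    (fun e he => mem_between_of_dom hM hM hM' (Dom.refl _) (h1.trans h2) he)
    (fun e he => mem_between_of_dom hM hV hM' h1 h2 he)
  obtain rfl := hu σ ((isGenRotation_between_iff hM h).1 hg)
  exact Dom.antisymm hV hM' h2 (hσ.dom_elim hM hV h1)

/-- The result of eliminating a generalized rotation that lies between. -/
theorem dom_elim_between (hM : Mat T M) (h : IsGenRotation T T.edges M ρ) {σ : Rotation p q}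
    (hσ : IsGenRotation T (between T M (elim M ρ)) M σ) : Dom T (elim M σ) (elim M ρ) := by
  have hM' := elim_mat subset_rfl hM h
  have hσ' := hσ.mono (between_subset _ _)
  have hV := elim_mat subset_rfl hM hσ'
  have hd := dom_elim subset_rfl h
  have hb : ∀ {x y}, (x, y) ∈ elim M σ → (x, y) ∈ between T M (elim M ρ) := by
    intro x y hxy
    rcases mem_elim.1 hxy with h' | ⟨a, b, hl, rfl, rfl⟩
    · exact mem_between_of_dom hM hM hM' (Dom.refl _) hd h'.1
    · exact hσ.edge_shift hl
  refine Compat.dom_of_leX hV hM' ⟨?_, ?_⟩ ?_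
  · rintro ⟨x, y⟩ he
    obtain ⟨x', h1, h2⟩ := ((mem_between hM hM').1 (hb he)).2.1.1
    exact (not_blocks_iff hM'.2 (hV.edge he)).2 (Or.inr ⟨x', h1, h2⟩)
  · rintro ⟨x, y⟩ he
    obtain ⟨y1, _, a, _⟩ := hd.2 _ _ he
    obtain ⟨y2, _, b, _⟩ := (dom_elim subset_rfl hσ').1 _ _ a
    exact (not_blocks_iff hV.2 (hM'.edge he)).2
      (Or.inl ⟨y2, b, ((mem_between hM hM').1 (hb b)).2.2.2 _ he⟩)
  · intro x y y' h1 h2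
    exact ((mem_between hM hM').1 (hb h1)).2.2.2 _ h2

theorem IsGenRotation.eq_of_elim_eq (hM : Mat T M) {σ : Rotation p q}
    (h : IsGenRotation T T.edges M ρ) (hσ : IsGenRotation T T.edges M σ)
    (e : elim M ρ = elim M σ) : ρ = σ := by
  have hM' := elim_mat subset_rfl hM h
  have alt : ∀ {τ : Rotation p q}, IsGenRotation T T.edges M τ → elim M τ = elim M ρ →
      IsAltCycle M (elim M ρ) τ := by
    intro τ hτ e
    refine ⟨hτ.1, hτ.2.1, fun a ha => Finset.mem_sdiff.2 ⟨hτ.mem ha, fun hc => ?_⟩, ?_⟩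
    · obtain ⟨b, hl⟩ := exists_link_left ha
      have := mem_elim_of_link (M := M) hl
      rw [e] at this
      have h1 := hM'.uniqX hc this
      have h2 := hτ.ltX subset_rfl hl
      rw [← h1] at h2
      omega
    · rintro ⟨x, y⟩ hxy
      obtain ⟨a, b, hl, rfl, rfl⟩ := mem_shifted.1 hxy
      exact Finset.mem_sdiff.2 ⟨e ▸ mem_elim_of_link hl, link_notMem subset_rfl hM hτ hl⟩
  have h1 := alt h rfl
  have h2 := alt hσ e.symm
  obtain ⟨a, ha⟩ := toFinset_nonempty h.1
  refine h1.eq_of_common hM hM' h2 ha ?_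
  by_contra hc
  have : a ∈ elim M σ := mem_elim.2 (Or.inl ⟨h.mem ha, hc⟩)
  rw [← e] at this
  exact (Finset.mem_sdiff.1 (h1.2.2.1 ha)).2 this

end Local

/-! ### Rotations of a stable table -/

section Rot

variable {T : Inst p q} {E M : Table p q} {ρ : Rotation p q}

theorem IsRotation.genEdges (hE : E ⊆ T.edges) (h : IsRotation T E M ρ) :
    IsGenRotation T T.edges M ρ := h.2.1.mono hE

/-- No edge of the stable table lies between `y_i` and `y_{i+1}` in the list of `x_i`. -/
theorem IsRotation.noBetweenX (hE : E ⊆ T.edges) (hs : IsStableTable T E) (h : IsRotation T E M ρ)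
    {a b : Fin p × Fin q} (hl : (a, b) ∈ links ρ) {y : Fin q} (hy : (a.1, y) ∈ E) :
    rkX T a.1 y ≤ rkX T a.1 a.2 ∨ rkX T a.1 b.2 ≤ rkX T a.1 y := by
  by_contra hc
  push Not at hc
  have mM := stable_mat hE h.1
  have ha := h.2.1.mem (mem_links_left hl)
  obtain ⟨x, h1, h2⟩ := h.2.2 a b hl y hy ((prefX_iff (mM.edge ha) (hE hy)).2 hc.1)
    ((prefX_iff (hE hy) (hE (h.2.1.edge_shift hl))).2 hc.2)
  rw [prefY_iff (mM.edge h1) (hE hy)] at h2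
  obtain ⟨N, hN, hN'⟩ := hs _ hy
  obtain ⟨y', x', c1, c2, c3⟩ := opp (stable_mat hE hN) mM (stable_compat hN h.1) hN'
  obtain rfl := mM.uniqX c1 ha
  obtain rfl := mM.uniqY c2 h1
  rcases c3 with c | c | ⟨rfl, rfl⟩ <;> omega

theorem isRotation_of_noBetween (hE : E ⊆ T.edges) (hM : M ∈ stableMatchings T E)
    (h : IsGenRotation T E M ρ) (hb : ∀ a b, (a, b) ∈ links ρ → ∀ y, (a.1, y) ∈ E →
      rkX T a.1 y ≤ rkX T a.1 a.2 ∨ rkX T a.1 b.2 ≤ rkX T a.1 y) : IsRotation T E M ρ := by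
  refine ⟨hM, h, fun a b hl y hy h1 h2 => ?_⟩
  rw [prefX_iff (hE (h.edge_left hl)) (hE hy)] at h1
  rw [prefX_iff (hE hy) (hE (h.edge_shift hl))] at h2
  rcases hb a b hl y hy with h' | h' <;> omega

theorem elim_stable_of_noBetween (hE : E ⊆ T.edges) (hM : M ∈ stableMatchings T E)
    (h : IsGenRotation T E M ρ) (hb : ∀ a b, (a, b) ∈ links ρ → ∀ y, (a.1, y) ∈ E →
      rkX T a.1 y ≤ rkX T a.1 a.2 ∨ rkX T a.1 b.2 ≤ rkX T a.1 y) :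
    elim M ρ ∈ stableMatchings T E := by
  have mM := stable_mat hE hM
  have mM' := elim_mat hE mM h
  have hd := dom_elim hE h
  refine ⟨⟨mM'.1, ?_⟩, ?_⟩
  · rintro ⟨x, y⟩ hxy
    rcases mem_elim.1 hxy with h' | ⟨a, b, hl, rfl, rfl⟩
    exacts [hM.1.2 h'.1, h.edge_shift hl]
  · rintro ⟨x, y⟩ he
    rw [not_blocks_iff mM'.2 (hE he)]
    have yside : ∀ x', (x', y) ∈ M → rkY T y x' ≤ rkY T y x →
        ∃ x', (x', y) ∈ elim M ρ ∧ rkY T y x' ≤ rkY T y x := by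
      intro x' a b
      obtain ⟨_, x1, _, c, _, d⟩ := hd.1 _ _ a
      exact ⟨x1, c, by omega⟩
    rcases (not_blocks_iff mM.2 (hE he)).1 (hM.2 _ he) with ⟨y', a, b⟩ | ⟨x', a, b⟩
    · by_cases hm : (x, y') ∈ ρ.toFinset
      · obtain ⟨c, hl⟩ := exists_link_left hm
        rcases hb _ _ hl y he with h' | h'
        · obtain rfl := rkX_inj (hE he) (le_antisymm h' b)
          exact Or.inr (yside x a le_rfl)
        · exact Or.inl ⟨c.2, mem_elim_of_link hl, h'⟩
      · exact Or.inl ⟨y', mem_elim.2 (Or.inl ⟨a, hm⟩), b⟩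
    · exact Or.inr (yside x' a b)

theorem IsRotation.elim_stable (hE : E ⊆ T.edges) (hs : IsStableTable T E)
    (h : IsRotation T E M ρ) : elim M ρ ∈ stableMatchings T E :=
  elim_stable_of_noBetween hE h.1 h.2.1 fun _ _ hl _ hy => h.noBetweenX hE hs hl hy

/-- A stable matching has passed a rotation for all of its agents as soon as for one of them. -/
theorem IsRotation.passed (hE : E ⊆ T.edges) (hs : IsStableTable T E)
    (h : IsRotation T E M ρ) {N : Table p q} (hN : N ∈ stableMatchings T E) {a b : Fin p × Fin q}
    (hl : (a, b) ∈ links ρ) {w : Fin q} (hw : (a.1, w) ∈ N) (hle : rkX T a.1 b.2 ≤ rkX T a.1 w)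
    {c d : Fin p × Fin q} (hl' : (c, d) ∈ links ρ) {v : Fin q} (hv : (c.1, v) ∈ N) :
    rkX T c.1 d.2 ≤ rkX T c.1 v := by
  have mM := stable_mat hE h.1
  have mN := stable_mat hE hN
  have hM' := h.elim_stable hE hs
  have mM' := stable_mat hE hM'
  have key : ∀ c, c ∈ ρ.toFinset → ∀ d v, (c, d) ∈ links ρ → (c.1, v) ∈ N →
      rkX T c.1 d.2 ≤ rkX T c.1 v := by
    intro c hc
    refine links_induction (P := fun c => ∀ d v, (c, d) ∈ links ρ → (c.1, v) ∈ N →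
      rkX T c.1 d.2 ≤ rkX T c.1 v) (mem_links_left hl) ?_ ?_ hc
    · intro d v h1 h2
      rw [mN.uniqX h2 hw, link_right_unique h.2.1.2.1 h1 hl]
      exact hle
    · intro c d hcd ih d' v h1 h2
      rcases h.noBetweenX hE hs h1 (hN.1.2 h2) with h3 | h3
      swap
      · exact h3
      exfalso
      obtain ⟨w1, x1, e1, e2, e3⟩ := opp mM mN (stable_compat h.1 hN)
        (h.2.1.mem (mem_links_left h1))
      obtain ⟨w2, x2, f1, f2, f3⟩ := opp mM' mN (stable_compat hM' hN)
        (mem_elim_of_link (M := M) hcd)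
      obtain rfl := mN.uniqX e1 h2
      obtain rfl := mN.uniqY e2 f2
      have g1 := ih d w2 hcd f1
      have g2 := h.2.1.ltY hE hcd
      have E1 : rkY T d.2 d.1 ≤ rkY T d.2 x1 := by
        rcases e3 with e | e | ⟨_, e⟩
        · omega
        · omega
        · rw [e]
      have F1 : rkY T d.2 x1 ≤ rkY T d.2 c.1 := by
        rcases f3 with e | e | ⟨_, e⟩
        · omega
        · omega
        · rw [e]
      omega
  exact key c (mem_links_left hl') d v hl' hv

/-- No edge of the stable table lies between `x_{i+1}` and `x_i` in the list of `y_{i+1}`. -/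
theorem IsRotation.noBetweenY (hE : E ⊆ T.edges) (hs : IsStableTable T E) (h : IsRotation T E M ρ)
    {a b : Fin p × Fin q} (hl : (a, b) ∈ links ρ) {x : Fin p} (hx : (x, b.2) ∈ E) :
    rkY T b.2 x ≤ rkY T b.2 a.1 ∨ rkY T b.2 b.1 ≤ rkY T b.2 x := by
  by_contra hc
  push Not at hc
  obtain ⟨N, hN, hN'⟩ := hs _ hx
  have mM := stable_mat hE h.1
  have mN := stable_mat hE hN
  have hM' := h.elim_stable hE hs
  have mM' := stable_mat hE hM'
  obtain ⟨c, hbc⟩ := exists_link_left (mem_links_right hl)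
  obtain ⟨w1, x1, e1, e2, e3⟩ := opp mM mN (stable_compat h.1 hN)
    (h.2.1.mem (mem_links_right hl))
  obtain ⟨w2, x2, f1, f2, f3⟩ := opp mM' mN (stable_compat hM' hN) (mem_elim_of_link (M := M) hl)
  obtain rfl := mN.uniqY e2 hN'
  obtain rfl := mN.uniqY f2 hN'
  have h1 : rkX T b.1 b.2 < rkX T b.1 w1 := by
    rcases e3 with e | e | ⟨rfl, rfl⟩ <;> omega
  have h2 : rkX T b.1 c.2 ≤ rkX T b.1 w1 := by
    rcases h.noBetweenX hE hs hbc (hN.1.2 e1) with h' | h'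
    · omega
    · exact h'
  have h3 := h.passed hE hs hN hbc e1 h2 hl f1
  rcases f3 with f | f | ⟨rfl, rfl⟩ <;> omega

/-- Two rotations of a stable table with a common element are equal. -/
theorem IsRotation.eq_of_common (hE : E ⊆ T.edges) (hs : IsStableTable T E)
    (h : IsRotation T E M ρ) {N : Table p q} {σ : Rotation p q} (h' : IsRotation T E N σ)
    {a : Fin p × Fin q} (ha : a ∈ ρ.toFinset) (ha' : a ∈ σ.toFinset) : ρ = σ := by
  refine rotation_ext h.2.1.2.1 h'.2.1.2.1 ha ha' fun c d hl hc => ?_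
  obtain ⟨d', hl'⟩ := exists_link_left hc
  have e : d.2 = d'.2 := by
    refine rkX_inj (hE (h.2.1.edge_shift hl)) ?_
    have l1 := h.2.1.ltX hE hl
    have l2 := h'.2.1.ltX hE hl'
    rcases h.noBetweenX hE hs hl (h'.2.1.edge_shift hl') with h1 | h1 <;>
      rcases h'.noBetweenX hE hs hl' (h.2.1.edge_shift hl) with h2 | h2 <;> omega
  have e' : d.1 = d'.1 := by
    refine rkY_inj (y := d.2) (hE (h.2.1.edge_right hl)) ?_
    have l1 := h.2.1.ltY hE hl
    have l2 := h'.2.1.ltY hE hl'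
    have m1 : (d.1, d'.2) ∈ E := by rw [← e]; exact h.2.1.edge_right hl
    have m2 : (d'.1, d.2) ∈ E := by rw [e]; exact h'.2.1.edge_right hl'
    have n1 := h.noBetweenY hE hs hl m2
    have n2 := h'.noBetweenY hE hs hl' m1
    rw [← e] at n2 l2
    omega
  rwa [show d = d' from Prod.ext e' e]

end Rot

end Marriage

namespace Marriage

variable {p q : ℕ}

/-! ### Sequences of eliminations -/

section Seq

variable {T : Inst p q} {E : Table p q}

theorem exists_rotation_toward (hE : E ⊆ T.edges) (hs : IsStableTable T E) {M N : Table p q}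
    (hM : M ∈ stableMatchings T E) (hN : N ∈ stableMatchings T E) (hd : Dom T M N) (hne : M ≠ N) :
    ∃ ρ, IsRotation T E M ρ ∧ Dom T (elim M ρ) N := by
  obtain ⟨V, ⟨hV, hMV, hVN, hVM⟩, hmin⟩ := Set.exists_min_image
    {V | V ∈ stableMatchings T E ∧ Dom T M V ∧ Dom T V N ∧ V ≠ M} (rankSum T) (Set.toFinite _)
    ⟨N, hN, hd, Dom.refl N, hne.symm⟩
  have mM := stable_mat hE hM
  have mV := stable_mat hE hV
  have hb : ∀ x m v y, (x, m) ∈ M → (x, v) ∈ V → (x, y) ∈ E → rkX T x m < rkX T x y →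
      rkX T x y < rkX T x v → False := by
    intro x m v y h1 h2 h3 h4 h5
    obtain ⟨K, hK, hK'⟩ := hs _ h3
    have mK := stable_mat hE hK
    have cMK := stable_compat hM hK
    have hJ := stable_meet hE hM hK
    have mJ := stable_mat hE hJ
    have cJV := stable_compat hJ hV
    have hL := stable_join hE hJ hV
    have mL := stable_mat hE hL
    have e1 : (x, y) ∈ meet T M K := mem_meet.2 (Or.inr ⟨hK', fun y' h' => by
      rw [mM.uniqX h' h1]; omega⟩)
    have e2 : (x, y) ∈ join T (meet T M K) V := mem_join.2 (Or.inl ⟨e1, fun y' h' => by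
      rw [mV.uniqX h' h2]; omega⟩)
    have d2 := dom_join_right mJ mV cJV
    have n1 : join T (meet T M K) V ≠ M := by
      intro e
      rw [e] at e2
      rw [mM.uniqX h1 e2] at h4
      omega
    have n2 : join T (meet T M K) V ≠ V := by
      intro e
      rw [e] at e2
      rw [mV.uniqX h2 e2] at h5
      omega
    have := hmin _ ⟨hL, dom_join mJ mV mM cJV (dom_meet_left mM mK cMK) hMV, d2.trans hVN, n1⟩
    have := d2.rankSum_lt mL mV n2
    omega
  have hns : ¬ M ⊆ V := by
    intro h
    refine hVM (Finset.Subset.antisymm ?_ h)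
    rintro ⟨x, y⟩ hxy
    obtain ⟨y', _, a, _⟩ := hMV.2 _ _ hxy
    rwa [mV.uniqX hxy (h a)]
  obtain ⟨a, ha, ha'⟩ := Finset.not_subset.1 hns
  obtain ⟨ρ, hρ, _⟩ := exists_altCycle mM mV hMV ha ha'
  refine ⟨ρ, isRotation_of_noBetween hE hM (hρ.isGenRotation hE mM mV hMV hM.1.2 hV.1.2) ?_,
    (hρ.dom_elim mM mV hMV).trans hVN⟩
  intro a b hl y hy
  by_contra hc
  push Not at hc
  exact hb a.1 a.2 b.2 y (Finset.mem_sdiff.1 (hρ.2.2.1 (mem_links_left hl))).1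
    (Finset.mem_sdiff.1 (hρ.2.2.2 (mem_shifted_of_link hl))).1 hy hc.1 hc.2

theorem exists_elimSeq (hE : E ⊆ T.edges) (hs : IsStableTable T E) {M N : Table p q}
    (hM : M ∈ stableMatchings T E) (hN : N ∈ stableMatchings T E) (hd : Dom T M N) :
    ∃ l, ElimSeq T E M l N := by
  induction hk : rankSum T N - rankSum T M using Nat.strong_induction_on generalizing M with
  | _ k ih =>
    by_cases hne : M = N
    · subst hne; exact ⟨[], ElimSeq.nil M⟩
    · obtain ⟨ρ, hρ, hd'⟩ := exists_rotation_toward hE hs hM hN hd hne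
      have hM' := hρ.elim_stable hE hs
      have l1 := (dom_elim hE hρ.2.1).rankSum_lt (stable_mat hE hM) (stable_mat hE hM')
        (elim_ne hE (stable_mat hE hM) hρ.2.1)
      have l2 := hd'.rankSum_le (stable_mat hE hM') (stable_mat hE hN)
      obtain ⟨l, hl⟩ := ih _ (by omega) hM' hd' rfl
      exact ⟨ρ :: l, ElimSeq.cons _ _ _ _ hρ hl⟩

theorem ElimSeq.append {M N K : Table p q} {l l' : List (Rotation p q)}
    (h : ElimSeq T E M l N) (h' : ElimSeq T E N l' K) : ElimSeq T E M (l ++ l') K := by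
  induction h with
  | nil M => exact h'
  | cons M ρ l M' h1 h2 ih => exact ElimSeq.cons _ _ _ _ h1 (ih h')

theorem ElimSeq.genSeq (hE : E ⊆ T.edges) {M N : Table p q} {l : List (Rotation p q)}
    (h : ElimSeq T E M l N) : GenSeq T M l N := by
  induction h with
  | nil M => exact GenSeq.nil M
  | cons M ρ l M' h1 h2 ih => exact GenSeq.cons _ _ _ _ (h1.genEdges hE) ih

theorem ElimSeq.stable (hE : E ⊆ T.edges) (hs : IsStableTable T E) {M N : Table p q}
    {l : List (Rotation p q)} (h : ElimSeq T E M l N) (hM : M ∈ stableMatchings T E) :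
    N ∈ stableMatchings T E := by
  induction h with
  | nil M => exact hM
  | cons M ρ l M' h1 h2 ih => exact ih (h1.elim_stable hE hs)

theorem ElimSeq.dom (hE : E ⊆ T.edges) {M N : Table p q} {l : List (Rotation p q)}
    (h : ElimSeq T E M l N) (hM : M ∈ stableMatchings T E) : Dom T M N :=
  (h.genSeq hE).dom (stable_mat hE hM)

theorem ElimSeq.split {M N : Table p q} {l : List (Rotation p q)} (h : ElimSeq T E M l N)
    {ρ : Rotation p q} (hρ : ρ ∈ l) : ∃ l₁ l₂ K, l = l₁ ++ ρ :: l₂ ∧ ElimSeq T E M l₁ K ∧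
      IsRotation T E K ρ ∧ ElimSeq T E (elim K ρ) l₂ N := by
  induction h with
  | nil M => simp at hρ
  | cons M σ l M' h1 h2 ih =>
    by_cases e : ρ = σ
    · subst e
      exact ⟨[], l, M, rfl, ElimSeq.nil M, h1, h2⟩
    · obtain ⟨l₁, l₂, K, rfl, a, b, c⟩ := ih ((List.mem_cons.1 hρ).resolve_left e)
      exact ⟨σ :: l₁, l₂, K, rfl, ElimSeq.cons _ _ _ _ h1 a, b, c⟩

theorem ElimSeq.passed (hE : E ⊆ T.edges) (hs : IsStableTable T E) {M N : Table p q}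
    {l : List (Rotation p q)} (h : ElimSeq T E M l N) (hM : M ∈ stableMatchings T E)
    {ρ : Rotation p q} (hρ : ρ ∈ l) {a b : Fin p × Fin q} (hl : (a, b) ∈ links ρ) {w : Fin q}
    (hw : (a.1, w) ∈ N) : rkX T a.1 b.2 ≤ rkX T a.1 w := by
  obtain ⟨l₁, l₂, K, rfl, h1, h2, h3⟩ := h.split hρ
  exact (h3.dom hE (h2.elim_stable hE hs)).leX (stable_mat hE (h.stable hE hs hM))
    (mem_elim_of_link hl) hw

theorem ElimSeq.nodup (hE : E ⊆ T.edges) (hs : IsStableTable T E) {M N : Table p q}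
    {l : List (Rotation p q)} (h : ElimSeq T E M l N) : l.Nodup := by
  induction h with
  | nil M => exact List.nodup_nil
  | cons M ρ l M' h1 h2 ih =>
    refine List.nodup_cons.2 ⟨fun hρ => ?_, ih⟩
    obtain ⟨l₁, l₂, K, rfl, a, b, c⟩ := h2.split hρ
    obtain ⟨e, he⟩ := toFinset_nonempty h1.2.1.1
    obtain ⟨f, hl⟩ := exists_link_left he
    have := (a.dom hE (h1.elim_stable hE hs)).leX (stable_mat hE b.1) (mem_elim_of_link hl)
      (b.2.1.mem he)
    have := h1.2.1.ltX hE hl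
    omega

theorem ElimSeq.mem_of_passed (hE : E ⊆ T.edges) (hs : IsStableTable T E) {M N K : Table p q}
    {l : List (Rotation p q)} (h : ElimSeq T E M l N) (hM : M ∈ stableMatchings T E)
    {ρ : Rotation p q} (hρ : IsRotation T E K ρ) {a b : Fin p × Fin q} (hl : (a, b) ∈ links ρ)
    {m n : Fin q} (hm : (a.1, m) ∈ M) (hle : rkX T a.1 m ≤ rkX T a.1 a.2) (hn : (a.1, n) ∈ N)
    (hle' : rkX T a.1 b.2 ≤ rkX T a.1 n) : ρ ∈ l := by
  have hlt := hρ.2.1.ltX hE hl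
  induction h generalizing m with
  | nil M =>
    rw [(stable_mat hE hM).uniqX hm hn] at hle
    omega
  | cons M σ l M' h1 h2 ih =>
    have hM' := h1.elim_stable hE hs
    obtain ⟨m', _, hm', _⟩ := (dom_elim hE h1.2.1).1 _ _ hm
    rcases hρ.noBetweenX hE hs hl (hM'.1.2 hm') with h' | h'
    · exact List.mem_cons_of_mem _ (ih hM' hm' h' hn)
    · rcases mem_elim.1 hm' with ⟨h3, _⟩ | ⟨c, d, hcd, e1, e2⟩
      · rw [(stable_mat hE hM).uniqX hm h3] at hle
        omega
      · have hc : c.2 = m := by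
          refine (stable_mat hE hM).uniqX (x := c.1) (h1.2.1.mem (mem_links_left hcd)) ?_
          rw [e1]; exact hm
        have hn' := h1.noBetweenX hE hs hcd (y := a.2) (by rw [e1]; exact hρ.2.1.edge_left hl)
        rw [e1, e2, hc] at hn'
        have : a.2 = m := by
          refine rkX_inj (hE (hρ.2.1.edge_left hl)) ?_
          omega
        have hac : c = a := Prod.ext e1 (by rw [hc, this])
        subst hac
        rw [hρ.eq_of_common hE hs h1 (mem_links_left hl) (mem_links_left hcd)]
        exact List.mem_cons_self

theorem ElimSeq.mem_of_rotation (hE : E ⊆ T.edges) (hs : IsStableTable T E) {M N : Table p q}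
    {l : List (Rotation p q)} (h : ElimSeq T E M l N) (hM : IsXOptimal T E M)
    (hN : IsYOptimal T E N) {ρ : Rotation p q} (hρ : ρ ∈ rotations T E) : ρ ∈ l := by
  rw [isXOptimal_iff hE] at hM
  rw [isYOptimal_iff hE] at hN
  obtain ⟨K, hK⟩ := hρ
  obtain ⟨a, ha⟩ := toFinset_nonempty hK.2.1.1
  obtain ⟨b, hl⟩ := exists_link_left ha
  obtain ⟨m, _, hm, _, hm', _⟩ := (hM.2 K hK.1).2 _ _ (hK.2.1.mem ha)
  obtain ⟨n, _, hn, _, hn', _⟩ := (hN.2 _ (hK.elim_stable hE hs)).1 _ _ (mem_elim_of_link hl)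
  exact h.mem_of_passed hE hs hM.1 hK hl hm hm' hn hn'

theorem ElimSeq.rotation_of_mem {M N : Table p q} {l : List (Rotation p q)}
    (h : ElimSeq T E M l N) {ρ : Rotation p q} (hρ : ρ ∈ l) : ρ ∈ rotations T E := by
  obtain ⟨_, _, K, _, _, h', _⟩ := h.split hρ
  exact ⟨K, h'⟩

theorem ElimSeq.dom_of_passed (hE : E ⊆ T.edges) (hs : IsStableTable T E) {M N K : Table p q}
    {l : List (Rotation p q)} (h : ElimSeq T E M l N) (hK : K ∈ stableMatchings T E)
    (hd : Dom T M K) (hp : ∀ ρ ∈ l, ∀ a b, (a, b) ∈ links ρ → ∀ w, (a.1, w) ∈ K →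
      rkX T a.1 b.2 ≤ rkX T a.1 w) : Dom T N K := by
  induction h with
  | nil M => exact hd
  | cons M ρ l M' h1 h2 ih =>
    have hM' := h1.elim_stable hE hs
    refine ih ?_ fun σ hσ => hp σ (List.mem_cons_of_mem _ hσ)
    refine (stable_compat hM' hK).dom_of_leX (stable_mat hE hM') (stable_mat hE hK) ?_
    intro x y y' a b
    rcases mem_elim.1 a with ⟨h3, _⟩ | ⟨c, d, hcd, rfl, rfl⟩
    · exact hd.leX (stable_mat hE hK) h3 b
    · exact hp ρ List.mem_cons_self c d hcd y' b

theorem ElimSeq.end_eq (hE : E ⊆ T.edges) (hs : IsStableTable T E) {M N N' : Table p q}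
    {l l' : List (Rotation p q)} (h : ElimSeq T E M l N) (h' : ElimSeq T E M l' N')
    (hM : M ∈ stableMatchings T E) (hm : ∀ ρ, ρ ∈ l ↔ ρ ∈ l') : N = N' := by
  have hN := h.stable hE hs hM
  have hN' := h'.stable hE hs hM
  refine Dom.antisymm (stable_mat hE hN) (stable_mat hE hN') ?_ ?_
  · exact h.dom_of_passed hE hs hN' (h'.dom hE hM) fun ρ hρ a b hl w hw =>
      h'.passed hE hs hM ((hm ρ).1 hρ) hl hw
  · exact h'.dom_of_passed hE hs hN (h.dom hE hM) fun ρ hρ a b hl w hw =>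
      h.passed hE hs hM ((hm ρ).2 hρ) hl hw

theorem isXOptimal_unique (hE : E ⊆ T.edges) {M N : Table p q} (hM : IsXOptimal T E M)
    (hN : IsXOptimal T E N) : M = N := by
  rw [isXOptimal_iff hE] at hM hN
  exact Dom.antisymm (stable_mat hE hM.1) (stable_mat hE hN.1) (hM.2 _ hN.1) (hN.2 _ hM.1)

/-- The predecessors of a rotation can be eliminated, and then the rotation is exposed. -/
theorem exists_elimSeq_predecessors (hE : E ⊆ T.edges) (hs : IsStableTable T E)
    {ρ : Rotation p q} (hρ : ρ ∈ rotations T E) {MX : Table p q} (hX : IsXOptimal T E MX) :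
    ∃ l M₀, (∀ σ, σ ∈ l ↔ σ ∈ predecessors T E ρ) ∧ ElimSeq T E MX l M₀ ∧ IsRotation T E M₀ ρ := by
  obtain ⟨M₀, hM₀, htop⟩ := exists_top hE (A := {N | IsRotation T E N ρ}) (fun N hN => hN.1) hρ (by
    intro K hK K' hK'
    refine isRotation_of_noBetween hE (stable_join hE hK.1 hK'.1) ?_
      fun a b hl y hy => hK.noBetweenX hE hs hl hy
    refine IsGenRotation.of_links hE hK.2.1.1 hK.2.1.2.1 fun a b hl => ⟨hK.2.1.edge_left hl,
      hK.2.1.edge_shift hl, ?_, hK.2.1.ltY hE hl, hK.2.1.ltX hE hl⟩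
    refine mem_join.2 (Or.inl ⟨hK.2.1.mem (mem_links_left hl), fun y' h' => ?_⟩)
    rw [(stable_mat hE hK'.1).uniqX h' (hK'.2.1.mem (mem_links_left hl))])
  have hX' := (isXOptimal_iff hE).1 hX
  obtain ⟨l, hl⟩ := exists_elimSeq hE hs hX'.1 hM₀.1 (hX'.2 _ hM₀.1)
  refine ⟨l, M₀, fun σ => ⟨fun hσ => ⟨hl.rotation_of_mem hσ, ?_, ?_⟩, ?_⟩, hl, hM₀⟩
  · rintro rfl
    obtain ⟨a, ha⟩ := toFinset_nonempty hM₀.2.1.1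
    obtain ⟨b, hab⟩ := exists_link_left ha
    have := hl.passed hE hs hX'.1 hσ hab (hM₀.2.1.mem ha)
    have := hM₀.2.1.ltX hE hab
    omega
  · intro MX' l' M' hX2 hl' hσ' hρ'
    obtain rfl := isXOptimal_unique hE hX hX2
    obtain ⟨l₁, l₂, K, rfl, h1, h2, h3⟩ := hl'.split hρ'
    have hnd := hl'.nodup hE hs
    have hσ1 : σ ∈ l₁ := by
      obtain ⟨K', hK'⟩ := hl.rotation_of_mem hσ
      obtain ⟨a, ha⟩ := toFinset_nonempty hK'.2.1.1
      obtain ⟨b, hab⟩ := exists_link_left ha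
      obtain ⟨m, _, hm, _, hm', _⟩ := (hX'.2 K' hK'.1).2 _ _ (hK'.2.1.mem ha)
      obtain ⟨m1, _, hm1, _⟩ := (hX'.2 K h2.1).1 _ _ hm
      obtain ⟨m0, _, hm0, _⟩ := (hX'.2 M₀ hM₀.1).1 _ _ hm
      refine h1.mem_of_passed hE hs hX'.1 hK' hab hm hm' hm1 ?_
      have := hl.passed hE hs hX'.1 hσ hab hm0
      have := (htop K h2).leX (stable_mat hE h2.1) hm0 hm1
      omega
    have hρ1 : ρ ∉ l₁ := fun hc =>
      (List.nodup_append.1 hnd).2.2 ρ hc ρ List.mem_cons_self rfl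
    rw [List.idxOf_append_of_mem hσ1, List.idxOf_append_of_notMem hρ1]
    have := List.idxOf_lt_length_of_mem hσ1
    omega
  · rintro ⟨hσ, hne, hp⟩
    obtain ⟨MY, hY⟩ := exists_isYOptimal hE hs
    have hY' := (isYOptimal_iff hE).1 hY
    have hst := hM₀.elim_stable hE hs
    obtain ⟨l₂, hl₂⟩ := exists_elimSeq hE hs hst hY'.1 (hY'.2 _ hst)
    have hfull := hl.append (ElimSeq.cons _ _ _ _ hM₀ hl₂)
    have hlt := hp _ _ _ hX hfull (hfull.mem_of_rotation hE hs hX hY hσ) (by simp)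
    by_contra hc
    have hρl : ρ ∉ l := fun hcc =>
      (List.nodup_append.1 (hfull.nodup hE hs)).2.2 ρ hcc ρ List.mem_cons_self rfl
    rw [List.idxOf_append_of_notMem hc, List.idxOf_append_of_notMem hρl, List.idxOf_cons_self] at hlt
    omega

theorem isRotation_of_predecessors (hE : E ⊆ T.edges) (hs : IsStableTable T E)
    {ρ : Rotation p q} (hρ : ρ ∈ rotations T E) {MX M₀ : Table p q} (hX : IsXOptimal T E MX)
    {l : List (Rotation p q)} (hl : ∀ σ, σ ∈ l ↔ σ ∈ predecessors T E ρ)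
    (h : ElimSeq T E MX l M₀) : IsRotation T E M₀ ρ := by
  obtain ⟨l', M₀', hl', h', hr⟩ := exists_elimSeq_predecessors hE hs hρ hX
  rwa [h.end_eq hE hs h' hX.1 fun σ => (hl σ).trans (hl' σ).symm]

/-- The edges of a stable table, read off from a sequence of eliminations. -/
theorem ElimSeq.mem_table (hE : E ⊆ T.edges) (hs : IsStableTable T E) {M N : Table p q}
    {l : List (Rotation p q)} (h : ElimSeq T E M l N) (hM : M ∈ stableMatchings T E) {x : Fin p}
    {y m n : Fin q} (he : (x, y) ∈ E) (hm : (x, m) ∈ M) (hn : (x, n) ∈ N)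
    (h1 : rkX T x m ≤ rkX T x y) (h2 : rkX T x y ≤ rkX T x n) :
    (x, y) ∈ M ∨ ∃ ρ ∈ l, (x, y) ∈ rotEdges ρ := by
  induction h generalizing m with
  | nil M =>
    obtain rfl := (stable_mat hE hM).uniqX hm hn
    rw [rkX_inj (hE he) (le_antisymm h2 h1)]
    exact Or.inl hm
  | cons M ρ l M' h3 h4 ih =>
    have hM' := h3.elim_stable hE hs
    obtain ⟨m', _, hm', _⟩ := (dom_elim hE h3.2.1).1 _ _ hm
    rcases le_or_gt (rkX T x m') (rkX T x y) with hle | hlt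
    · rcases ih hM' hm' hn hle with h' | ⟨σ, h', h''⟩
      · rcases Finset.mem_union.1 h' with h' | h'
        · exact Or.inl (Finset.mem_sdiff.1 h').1
        · exact Or.inr ⟨ρ, List.mem_cons_self, Finset.mem_union_right _ h'⟩
      · exact Or.inr ⟨σ, List.mem_cons_of_mem _ h', h''⟩
    · rcases mem_elim.1 hm' with ⟨h5, _⟩ | ⟨a, b, hab, rfl, rfl⟩
      · rw [(stable_mat hE hM).uniqX h5 hm] at hlt
        omega
      · have hb := h3.noBetweenX hE hs hab he
        have hc := (stable_mat hE hM).uniqX hm (h3.2.1.mem (mem_links_left hab))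
        rw [← hc] at hb
        rw [rkX_inj (hE he) (by omega : rkX T a.1 y = rkX T a.1 m)]
        exact Or.inl hm

theorem ElimSeq.mem_table_iff (hE : E ⊆ T.edges) (hs : IsStableTable T E) {M N : Table p q}
    {l : List (Rotation p q)} (h : ElimSeq T E M l N) (hM : IsXOptimal T E M)
    (hN : IsYOptimal T E N) (e : Fin p × Fin q) : e ∈ E ↔ e ∈ M ∨ ∃ ρ ∈ l, e ∈ rotEdges ρ := by
  have hM' := (isXOptimal_iff hE).1 hM
  have hN' := (isYOptimal_iff hE).1 hN
  constructor
  · intro he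
    obtain ⟨x, y⟩ := e
    obtain ⟨K, hK, hK'⟩ := hs _ he
    obtain ⟨m, _, a, _, a', _⟩ := (hM'.2 K hK).2 _ _ hK'
    obtain ⟨n, _, b, _, b', _⟩ := (hN'.2 K hK).1 _ _ hK'
    exact h.mem_table hE hs hM'.1 he a b a' b'
  · rintro (he | ⟨ρ, hρ, he⟩)
    · exact hM.1.1.2 he
    · obtain ⟨K, hK⟩ := h.rotation_of_mem hρ
      exact hK.2.1.2.2.1 he

theorem IsRotation.atomic (hE : E ⊆ T.edges) (hs : IsStableTable T E) {M : Table p q}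
    {ρ : Rotation p q} (h : IsRotation T E M ρ) : Atomic T E M (elim M ρ) := by
  intro V hV hVE h1 h2
  have hM := stable_mat hE h.1
  have hM' := elim_mat hE hM h.2.1
  by_cases e : V = M
  · exact Or.inl e
  refine Or.inr ?_
  have hns : ¬ M ⊆ V := by
    intro hc
    refine e (Finset.Subset.antisymm ?_ hc)
    rintro ⟨x, y⟩ hxy
    obtain ⟨y', _, a, _⟩ := h1.2 _ _ hxy
    rwa [hV.uniqX hxy (hc a)]
  obtain ⟨a, ha, ha'⟩ := Finset.not_subset.1 hns
  obtain ⟨σ, hσ, haσ⟩ := exists_altCycle hM hV h1 ha ha'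
  have hg := hσ.isGenRotation hE hM hV h1 h.1.1.2 hVE
  have hin : ∀ c d, (c, d) ∈ links σ → ∃ d', (c, d') ∈ links ρ ∧ d'.2 = d.2 := by
    intro c d hcd
    have hc := hg.mem (mem_links_left hcd)
    have hcρ : c ∈ ρ.toFinset := by
      by_contra hcc
      have := h2.leX hM' (Finset.mem_sdiff.1 (hσ.2.2.2 (mem_shifted_of_link hcd))).1
        (mem_elim.2 (Or.inl ⟨hc, hcc⟩))
      have := hg.ltX hE hcd
      omega
    obtain ⟨d', hcd'⟩ := exists_link_left hcρ
    refine ⟨d', hcd', (rkX_inj (hE (h.2.1.edge_shift hcd')) ?_)⟩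
    have l1 := h2.leX hM' (Finset.mem_sdiff.1 (hσ.2.2.2 (mem_shifted_of_link hcd))).1
        (mem_elim_of_link hcd')
    have l2 := hg.ltX hE hcd
    have := h.noBetweenX hE hs hcd' (hg.edge_shift hcd)
    omega
  have hrot : IsRotation T E M σ := by
    refine isRotation_of_noBetween hE h.1 hg fun c d hcd y hy => ?_
    obtain ⟨d', hcd', e⟩ := hin c d hcd
    rw [← e]
    exact h.noBetweenX hE hs hcd' hy
  obtain ⟨b, hab⟩ := exists_link_left haσ
  obtain ⟨b', hab', _⟩ := hin a b hab
  obtain rfl := h.eq_of_common hE hs hrot (mem_links_left hab') haσ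
  exact Dom.antisymm hV hM' h2 (hσ.dom_elim hM hV h1)

end Seq

/-! ### The table of a sequence of generalized rotations -/

/-- `W` is one of the matchings met when the rotations of the list are eliminated from `M`. -/
def Visits : Table p q → List (Rotation p q) → Table p q → Prop
  | M, [], W => W = M
  | M, ρ :: l, W => W = M ∨ Visits (elim M ρ) l W

section Visits

variable {T : Inst p q} {E : Table p q}

theorem GenSeq.visits_first {M N : Table p q} {l : List (Rotation p q)} (_h : GenSeq T M l N) :
    Visits M l M := by
  cases l with
  | nil => rfl
  | cons ρ l => exact Or.inl rfl

theorem GenSeq.visits_last {M N : Table p q} {l : List (Rotation p q)} (h : GenSeq T M l N) :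
    Visits M l N := by
  induction h with
  | nil M => rfl
  | cons M ρ l M' h1 h2 ih => exact Or.inr ih

theorem GenSeq.visits_spec {M N : Table p q} {l : List (Rotation p q)} (h : GenSeq T M l N)
    (hM : Mat T M) {W : Table p q} (hW : Visits M l W) : Mat T W ∧ Dom T M W ∧ Dom T W N := by
  induction h with
  | nil M => obtain rfl := hW; exact ⟨hM, Dom.refl _, Dom.refl _⟩
  | cons M ρ l M' h1 h2 ih =>
    rcases hW with rfl | hW
    · exact ⟨hM, Dom.refl _, (dom_elim subset_rfl h1).trans (h2.dom (elim_mat subset_rfl hM h1))⟩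
    · obtain ⟨a, b, c⟩ := ih (elim_mat subset_rfl hM h1) hW
      exact ⟨a, (dom_elim subset_rfl h1).trans b, c⟩

theorem GenSeq.visits_compat {M N : Table p q} {l : List (Rotation p q)} (h : GenSeq T M l N)
    (hM : Mat T M) {W W' : Table p q} (hW : Visits M l W) (hW' : Visits M l W') :
    Compat T W W' := by
  induction h with
  | nil M => obtain rfl := hW; obtain rfl := hW'; exact Compat.refl _
  | cons M ρ l M' h1 h2 ih =>
    rcases hW with rfl | hW
    · obtain ⟨a, b, _⟩ := (GenSeq.cons _ _ _ _ h1 h2).visits_spec hM hW'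
      exact b.compat hM a
    · rcases hW' with rfl | hW'
      · obtain ⟨a, b, _⟩ := (GenSeq.cons _ _ _ _ h1 h2).visits_spec hM (Or.inr hW)
        exact (b.compat hM a).symm
      · exact ih (elim_mat subset_rfl hM h1) hW hW'

theorem GenSeq.visits_edges {M N : Table p q} {l : List (Rotation p q)} (h : GenSeq T M l N)
    (e : Fin p × Fin q) : (∃ W, Visits M l W ∧ e ∈ W) ↔ e ∈ M ∨ ∃ ρ ∈ l, e ∈ rotEdges ρ := by
  induction h with
  | nil M => simp [Visits]
  | cons M ρ l M' h1 h2 ih =>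
    have k1 : e ∈ elim M ρ → e ∈ M ∨ e ∈ rotEdges ρ := by
      simp only [elim, rotEdges, Finset.mem_union, Finset.mem_sdiff]; tauto
    have k2 : e ∈ rotEdges ρ → e ∈ M ∨ e ∈ elim M ρ := by
      have := fun h' => h1.mem (a := e) h'
      simp only [elim, rotEdges, Finset.mem_union, Finset.mem_sdiff]; tauto
    simp only [Visits, or_and_right, exists_or, exists_eq_left, ih, List.mem_cons]
    tauto

theorem GenSeq.visits_append {M K : Table p q} {l₁ l₂ : List (Rotation p q)}
    (h : GenSeq T M l₁ K) {W : Table p q} :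
    Visits M (l₁ ++ l₂) W ↔ Visits M l₁ W ∨ Visits K l₂ W := by
  induction h with
  | nil M =>
    refine ⟨Or.inr, ?_⟩
    rintro (rfl | h)
    · cases l₂ with
      | nil => rfl
      | cons => exact Or.inl rfl
    · exact h
  | cons M ρ l M' h1 h2 ih =>
    simp only [List.cons_append, Visits, ih, or_assoc]

/-- The matchings along a sequence of eliminations form a gapless chain. -/
theorem ElimSeq.atomChain {F : Table p q} (hE : E ⊆ T.edges) (hEF : E ⊆ F)
    (hs : IsStableTable T E) {M N : Table p q} {l : List (Rotation p q)} (h : ElimSeq T E M l N)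
    (hM : M ∈ stableMatchings T E)
    (ha : ∀ K ρ, ρ ∈ l → IsRotation T E K ρ → Atomic T F K (elim K ρ)) :
    AtomChain T F {W | Visits M l W} M N := by
  induction h with
  | nil M => exact AtomChain.single M (stable_mat hE hM) (hM.1.2.trans hEF)
  | cons M ρ l M' h1 h2 ih =>
    have hM' := h1.elim_stable hE hs
    have hS := ih hM' fun K σ hσ => ha K σ (List.mem_cons_of_mem _ hσ)
    have h3 := (AtomChain.snoc _ _ _ _ (AtomChain.single M (stable_mat hE hM) (hM.1.2.trans hEF))
      (stable_mat hE hM') (hM'.1.2.trans hEF) (dom_elim hE h1.2.1)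
      (ha M ρ List.mem_cons_self h1)).append hS
    have e : {W | Visits M (ρ :: l) W} = insert (elim M ρ) {M} ∪ {W | Visits (elim M ρ) l W} := by
      ext W
      have := (h2.genSeq hE).visits_first
      simp only [Visits, Set.mem_ofPred_eq, Set.mem_union, Set.mem_insert_iff, Set.mem_singleton_iff]
      constructor
      · rintro (h | h)
        exacts [Or.inl (Or.inr h), Or.inr h]
      · rintro ((rfl | h) | h)
        exacts [Or.inr this, Or.inl h, Or.inr h]
    rw [e]
    exact h3

/-- A sequence of generalized rotations defines a stable table, whose rotations are the members of the
sequence. -/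
theorem GenSeq.table {M N : Table p q} {l : List (Rotation p q)} (h : GenSeq T M l N)
    (hM : Mat T M) (hE : ∀ e, e ∈ E ↔ e ∈ M ∨ ∃ ρ ∈ l, e ∈ rotEdges ρ) :
    E ⊆ T.edges ∧ IsStableTable T E ∧ ElimSeq T E M l N ∧ IsXOptimal T E M ∧ IsYOptimal T E N ∧
      (∀ ρ, ρ ∈ rotations T E ↔ ρ ∈ l) ∧ ∀ W, Visits M l W → W ∈ stableMatchings T E := by
  have hE' : ∀ e, e ∈ E ↔ ∃ W, Visits M l W ∧ e ∈ W := fun e => (hE e).trans (h.visits_edges e).symm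
  have hEd : E ⊆ T.edges := by
    intro e he
    obtain ⟨W, hW, he'⟩ := (hE' e).1 he
    exact (h.visits_spec hM hW).1.2 he'
  have hst : ∀ W, Visits M l W → W ∈ stableMatchings T E := by
    intro W hW
    refine ⟨⟨(h.visits_spec hM hW).1.1, fun e he => (hE' e).2 ⟨W, hW, he⟩⟩, fun e he => ?_⟩
    obtain ⟨W', hW', he'⟩ := (hE' e).1 he
    exact (h.visits_compat hM hW hW').2 e he'
  have hs : IsStableTable T E := by
    intro e he
    obtain ⟨W, hW, he'⟩ := (hE' e).1 he
    exact ⟨W, hst W hW, he'⟩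
  have hX : IsXOptimal T E M := by
    refine (isXOptimal_iff hEd).2 ⟨hst _ h.visits_first, fun V hV => ?_⟩
    refine (stable_compat (hst _ h.visits_first) hV).dom_of_leX hM (stable_mat hEd hV) ?_
    intro x y y' a b
    obtain ⟨W, hW, hb⟩ := (hE' _).1 (hV.1.2 b)
    obtain ⟨c, d, _⟩ := h.visits_spec hM hW
    exact d.leX c a hb
  have hY : IsYOptimal T E N := by
    refine (isYOptimal_iff hEd).2 ⟨hst _ h.visits_last, fun V hV => ?_⟩
    refine (stable_compat hV (hst _ h.visits_last)).dom_of_leX (stable_mat hEd hV) (h.mat hM) ?_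
    intro x y y' a b
    obtain ⟨W, hW, hb⟩ := (hE' _).1 (hV.1.2 a)
    obtain ⟨c, _, d⟩ := h.visits_spec hM hW
    exact d.leX (h.mat hM) hb b
  have hseq : ∀ l₂ l₁ K, l = l₁ ++ l₂ → GenSeq T M l₁ K → GenSeq T K l₂ N → ElimSeq T E K l₂ N := by
    intro l₂
    induction l₂ with
    | nil =>
      intro l₁ K _ _ h2
      cases h2
      exact ElimSeq.nil _
    | cons ρ l₂ ih =>
      intro l₁ K hl h1 h2
      cases h2 with
      | cons _ _ _ _ h3 h4 =>
        have hK : K ∈ stableMatchings T E := hst K (by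
          rw [hl, h1.visits_append]; exact Or.inl h1.visits_last)
        have mK := stable_mat hEd hK
        have mK' := elim_mat subset_rfl mK h3
        have hsub : rotEdges ρ ⊆ E := fun e he =>
          (hE e).2 (Or.inr ⟨ρ, by rw [hl]; simp, he⟩)
        refine ElimSeq.cons _ _ _ _ ?_ (ih (l₁ ++ [ρ]) _ (by simp [hl])
          (h1.append (GenSeq.cons _ _ _ _ h3 (GenSeq.nil _))) h4)
        refine isRotation_of_noBetween hEd hK ⟨h3.1, h3.2.1, hsub, h3.2.2.2⟩ ?_
        intro a b hab y hy
        obtain ⟨W, hW, hyW⟩ := (hE' _).1 hy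
        rw [hl, h1.visits_append] at hW
        have hW : Visits M l₁ W ∨ W = K ∨ Visits (elim K ρ) l₂ W := hW
        rcases hW with hW | rfl | hW
        · exact Or.inl ((h1.visits_spec hM hW).2.2.leX mK hyW (h3.mem (mem_links_left hab)))
        · exact Or.inl (by rw [mK.uniqX hyW (h3.mem (mem_links_left hab))])
        · obtain ⟨c, d, _⟩ := h4.visits_spec mK' hW
          exact Or.inr (d.leX c (mem_elim_of_link hab) hyW)
  have hel := hseq l [] M rfl (GenSeq.nil M) h
  exact ⟨hEd, hs, hel, hX, hY,
    fun ρ => ⟨hel.mem_of_rotation hEd hs hX hY, hel.rotation_of_mem⟩, hst⟩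

end Visits

end Marriage

namespace Marriage

variable {p q : ℕ}

/-! ### The rotation that undoes a rotation of the other side -/

theorem links_undo {τ : Rotation q p} {u v : Fin p × Fin q} (h : (u, v) ∈ links (undo τ)) :
    ∃ a b c, (a, b) ∈ links τ ∧ (b, c) ∈ links τ ∧ u = (b.2, a.1) ∧ v = (c.2, b.1) := by
  induction τ using Quotient.inductionOn' with | _ l
  have h' : (u, v) ∈ links ((List.zipWith (fun a b : Fin q × Fin p => (b.2, a.1)) l (l.rotate 1) :
    List (Fin p × Fin q)) : Rotation p q) := h
  obtain ⟨i, hi, e1, e2⟩ := mem_links_coe.1 h'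
  have hlen : (List.zipWith (fun a b : Fin q × Fin p => (b.2, a.1)) l (l.rotate 1)).length = l.length := by
    simp
  rw [hlen] at hi
  have hl : 0 < l.length := by omega
  simp only [List.getElem_zipWith, List.getElem_rotate, hlen] at e1 e2
  exact ⟨l[i], l[(i + 1) % l.length]'(Nat.mod_lt _ hl),
    l[((i + 1) % l.length + 1) % l.length]'(Nat.mod_lt _ hl), mem_links_coe.2 ⟨i, hi, rfl, rfl⟩,
    mem_links_coe.2 ⟨(i + 1) % l.length, Nat.mod_lt _ hl, rfl, rfl⟩, e1.symm, e2.symm⟩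

theorem links_undo_of_link {τ : Rotation q p} {a b : Fin q × Fin p} (h : (a, b) ∈ links τ) :
    ∃ c, (b, c) ∈ links τ ∧ ((b.2, a.1), (c.2, b.1)) ∈ links (undo τ) := by
  induction τ using Quotient.inductionOn' with | _ l
  obtain ⟨i, hi, rfl, rfl⟩ := mem_links_coe.1 h
  have hl : 0 < l.length := by omega
  refine ⟨l[((i + 1) % l.length + 1) % l.length]'(Nat.mod_lt _ hl),
    mem_links_coe.2 ⟨(i + 1) % l.length, Nat.mod_lt _ hl, rfl, rfl⟩, ?_⟩
  change _ ∈ links ((List.zipWith (fun a b : Fin q × Fin p => (b.2, a.1)) l (l.rotate 1) :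
    List (Fin p × Fin q)) : Rotation p q)
  refine mem_links_coe.2 ⟨i, by simpa using hi, ?_, ?_⟩
  · simp only [List.getElem_zipWith, List.getElem_rotate]
  · simp only [List.getElem_zipWith, List.getElem_rotate, List.length_zipWith, List.length_rotate,
      min_self]

theorem mem_toFinset_undo {τ : Rotation q p} {u : Fin p × Fin q} :
    u ∈ (undo τ).toFinset ↔ u ∈ (shifted τ).swap := by
  obtain ⟨x, y⟩ := u
  rw [mem_swap, mem_shifted]
  constructor
  · intro h
    obtain ⟨v, hv⟩ := exists_link_left h
    obtain ⟨a, b, c, h1, h2, e1, e2⟩ := links_undo hv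
    simp only [Prod.mk.injEq] at e1
    exact ⟨a, b, h1, e1.2.symm, e1.1.symm⟩
  · rintro ⟨a, b, h1, rfl, rfl⟩
    obtain ⟨c, _, h2⟩ := links_undo_of_link h1
    exact mem_links_left h2

theorem mem_shifted_undo {τ : Rotation q p} {u : Fin p × Fin q} :
    u ∈ shifted (undo τ) ↔ u ∈ Table.swap τ.toFinset := by
  obtain ⟨x, y⟩ := u
  rw [mem_swap, mem_shifted]
  constructor
  · rintro ⟨u, v, h, rfl, rfl⟩
    obtain ⟨a, b, c, h1, h2, rfl, rfl⟩ := links_undo h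
    exact mem_links_right h1
  · intro h
    obtain ⟨a, ha⟩ := exists_link_right h
    obtain ⟨c, _, h2⟩ := links_undo_of_link ha
    exact ⟨_, _, h2, rfl, rfl⟩

theorem rotEdges_undo (τ : Rotation q p) : rotEdges (undo τ) = (rotEdges τ).swap := by
  ext ⟨x, y⟩
  simp only [rotEdges, mem_swap, Finset.mem_union, mem_toFinset_undo, mem_shifted_undo]
  exact or_comm

theorem nodup_undo {τ : Rotation q p} (hτ : τ.Nodup)
    (h : ∀ a ∈ τ.toFinset, ∀ b ∈ τ.toFinset, a.1 = b.1 → a = b) : (undo τ).Nodup := by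
  induction τ using Quotient.inductionOn' with | _ l
  change l.Nodup at hτ
  change (List.zipWith (fun a b : Fin q × Fin p => (b.2, a.1)) l (l.rotate 1)).Nodup
  rw [List.nodup_iff_injective_get]
  rintro ⟨i, hi⟩ ⟨j, hj⟩ e
  have hi' : i < l.length := by simpa using hi
  have hj' : j < l.length := by simpa using hj
  simp only [List.get_eq_getElem, List.getElem_zipWith, Prod.mk.injEq] at e
  have := h l[i] (by change _ ∈ l.toFinset; simp) l[j] (by change _ ∈ l.toFinset; simp) e.2
  exact Fin.ext ((hτ.getElem_inj_iff).1 this)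

section Undo

variable {T : Inst p q} {M : Table p q} {τ : Rotation q p}

theorem undo_mat (hM : Mat T M) (h : IsGenRotation T.swap T.swap.edges M.swap τ) :
    Mat T (elim M.swap τ).swap := by
  rw [← mat_swap, swap_swap]
  exact elim_mat subset_rfl (mat_swap.2 hM) h

theorem undo_dom (h : IsGenRotation T.swap T.swap.edges M.swap τ) :
    Dom T (elim M.swap τ).swap M := by
  rw [← dom_swap, swap_swap]
  exact dom_elim subset_rfl h

theorem undo_isGenRotation (hM : Mat T M) (h : IsGenRotation T.swap T.swap.edges M.swap τ) :
    IsGenRotation T T.edges (elim M.swap τ).swap (undo τ) := by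
  have hMs := mat_swap.2 hM
  have edge : ∀ {y x}, (y, x) ∈ T.swap.edges → (x, y) ∈ T.edges := by
    intro y x hh
    rw [edges_swap] at hh
    exact mem_swap.1 hh
  refine IsGenRotation.of_links subset_rfl ?_
    (nodup_undo h.2.1 fun a ha b hb e => hMs.1 a (h.mem ha) b (h.mem hb) (Or.inl e)) ?_
  · intro e
    obtain ⟨a, ha⟩ := toFinset_nonempty h.1
    obtain ⟨b, hb⟩ := exists_link_left ha
    obtain ⟨c, _, h2⟩ := links_undo_of_link hb
    have := mem_links_left h2
    rw [e] at this
    simp at this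
  · intro u v huv
    obtain ⟨a, b, c, h1, h2, rfl, rfl⟩ := links_undo huv
    exact ⟨edge (h.edge_shift h1), edge (h.edge_left h2), mem_swap.2 (mem_elim_of_link h1),
      h.ltX subset_rfl h2, h.ltY subset_rfl h1⟩

theorem undo_elim (hM : Mat T M) (h : IsGenRotation T.swap T.swap.edges M.swap τ) :
    elim (elim M.swap τ).swap (undo τ) = M := by
  ext ⟨x, y⟩
  have h1 : (y, x) ∈ τ.toFinset → (x, y) ∈ M := fun h' => mem_swap.1 (h.mem h')
  have h2 : (y, x) ∈ shifted τ → (x, y) ∉ M := by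
    intro h' hm
    obtain ⟨a, b, hl, rfl, rfl⟩ := mem_shifted.1 h'
    exact link_notMem subset_rfl (mat_swap.2 hM) h hl (mem_swap.2 hm)
  rw [elim, Finset.mem_union, Finset.mem_sdiff, mem_shifted_undo, mem_toFinset_undo, mem_swap,
    mem_swap, mem_swap, elim, Finset.mem_union, Finset.mem_sdiff, mem_swap]
  tauto

end Undo

/-! ### Atomic steps and dissection -/

section

variable {T : Inst p q}

theorem undissectable_of_atomic {M : Table p q} {ρ : Rotation p q} (hM : Mat T M)
    (h : IsGenRotation T T.edges M ρ) (ha : Atomic T T.edges M (elim M ρ)) : Undissectable T ρ := by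
  intro σ hσ
  rw [← isGenRotation_between_iff hM h] at hσ
  have hσ' := hσ.mono (between_subset _ _)
  have hV := elim_mat subset_rfl hM hσ'
  rcases ha _ hV hV.2 (dom_elim subset_rfl hσ') (dom_elim_between hM h hσ) with e | e
  · exact absurd e.symm (elim_ne subset_rfl hM hσ')
  · exact IsGenRotation.eq_of_elim_eq hM hσ' h e

theorem Atomic.swap {F M M' : Table p q} (h : Atomic T.swap F.swap M.swap M'.swap) :
    Atomic T F M' M := by
  intro V hV hVF h1 h2
  rcases h V.swap (mat_swap.2 hV) (swap_subset.2 hVF) h2.swap h1.swap with e | e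
  · exact Or.inr (swap_inj.1 e)
  · exact Or.inl (swap_inj.1 e)

theorem undissectable_undo {M : Table p q} {τ : Rotation q p} (hM : Mat T M)
    (h : IsGenRotation T.swap T.swap.edges M.swap τ)
    (ha : Atomic T.swap T.swap.edges M.swap (elim M.swap τ)) : Undissectable T (undo τ) := by
  refine undissectable_of_atomic (undo_mat hM h) (undo_isGenRotation hM h) ?_
  rw [undo_elim hM h]
  apply Atomic.swap
  rwa [swap_swap, ← edges_swap]

/-- If the chain of a stable table is part of a longer chain, its stable matchings stay stable. -/
theorem stable_subset_of_visits {E E' MX MY M N : Table p q} {l l' : List (Rotation p q)}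
    (hE : E ⊆ T.edges) (hs : IsStableTable T E) (h : ElimSeq T E MX l MY) (hX : IsXOptimal T E MX)
    (hY : IsYOptimal T E MY) (h' : GenSeq T M l' N) (hM : Mat T M)
    (hE' : ∀ e, e ∈ E' ↔ e ∈ M ∨ ∃ ρ ∈ l', e ∈ rotEdges ρ)
    (hv : ∀ W, Visits MX l W → Visits M l' W) :
    stableMatchings T E ⊆ stableMatchings T E' := by
  obtain ⟨h1, h2, -, -, -, -, h3⟩ := h'.table hM hE'
  have hc := h.atomChain hE subset_rfl hs hX.1 fun K ρ _ hK => hK.atomic hE hs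
  refine hc.stable_subset (fun e => ?_) h1 h2 fun W hW => h3 W (hv W hW)
  rw [h.mem_table_iff hE hs hX hY]
  exact ((h.genSeq hE).visits_edges e).symm

/-- The parts of a run that concern a single table. -/
structure Inv (T : Inst p q) (E : Table p q) (Q : Finset (Rotation p q)) : Prop where
  edges : E ⊆ T.edges
  stable : IsStableTable T E
  queue : ∀ ρ ∈ Q, ρ ∈ rotations T E
  rest : ∀ ρ ∈ rotations T E, ρ ∉ Q → Undissectable T ρ

theorem IsAltCycle.of_elim_ne {M : Table p q} (hM : Mat T M) {ρ σ : Rotation p q}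
    (hσ : IsGenRotation T T.edges M σ) {N : Table p q} (h : IsAltCycle (elim M σ) N ρ) : ρ ≠ σ := by
  rintro rfl
  obtain ⟨a, ha⟩ := toFinset_nonempty hσ.1
  obtain ⟨b, hl⟩ := exists_link_left ha
  have h1 := (Finset.mem_sdiff.1 (h.2.2.1 ha)).1
  have h2 := (elim_mat subset_rfl hM hσ).uniqX h1 (mem_elim_of_link hl)
  have := hσ.ltX subset_rfl hl
  rw [← h2] at this
  omega

theorem GenSeq.eq_of_nil {M N : Table p q} (h : GenSeq T M [] N) : M = N := by
  generalize hl : ([] : List (Rotation p q)) = l at h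
  cases h with
  | nil => rfl
  | cons => cases hl

theorem isYOptimal_unique {E M N : Table p q} (hE : E ⊆ T.edges) (hM : IsYOptimal T E M)
    (hN : IsYOptimal T E N) : M = N := by
  rw [isYOptimal_iff hE] at hM hN
  exact Dom.antisymm (stable_mat hE hM.1) (stable_mat hE hN.1) (hN.2 _ hM.1) (hM.2 _ hN.1)

/-- What an application of `Dissect_Rotation` to a rotation of the table does. -/
theorem dissect_spec {E : Table p q} (hE : E ⊆ T.edges) (hs : IsStableTable T E)
    {ρ : Rotation p q} (hρ : ρ ∈ rotations T E) {R : Finset (Rotation p q)}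
    (h : DissectRotation T E ρ R) : (R = {ρ} ∧ Undissectable T ρ) ∨
      (2 ≤ R.card ∧ E ∪ R.biUnion rotEdges ⊆ T.edges ∧ IsStableTable T (E ∪ R.biUnion rotEdges) ∧
        (∀ σ, σ ∈ rotations T (E ∪ R.biUnion rotEdges) ↔ (σ ∈ rotations T E ∧ σ ≠ ρ) ∨ σ ∈ R) ∧
        stableMatchings T E ⊆ stableMatchings T (E ∪ R.biUnion rotEdges) ∧
        E.card < (E ∪ R.biUnion rotEdges).card ∧
        (∀ M, IsXOptimal T E M → IsXOptimal T (E ∪ R.biUnion rotEdges) M) ∧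
        ∀ M, IsYOptimal T E M → IsYOptimal T (E ∪ R.biUnion rotEdges) M) := by
  obtain ⟨MX, l, M₀, hX, hl, hel, hcase⟩ := h
  have hr := isRotation_of_predecessors hE hs hρ hX hl hel
  have hM₀ := stable_mat hE hr.1
  have hg := hr.genEdges hE
  rcases hcase with ⟨hu, rfl⟩ | ⟨hu, ρ₁, hne, hg₁, hR⟩
  · exact Or.inl ⟨rfl, (existsUnique_iff_undissectable hM₀ hg).1 hu⟩
  right
  have hg₁' := hg₁.mono (between_subset _ _)
  have hM₁ := elim_mat subset_rfl hM₀ hg₁'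
  have hMs := elim_mat subset_rfl hM₀ hg
  have hd := dom_elim_between hM₀ hg hg₁
  have hne' : elim M₀ ρ₁ ≠ elim M₀ ρ := fun e => hne (hg₁'.eq_of_elim_eq hM₀ hg e)
  obtain ⟨l₂, hl₂, hal⟩ := exists_genSeq_altCycles hM₁ hMs hd
  obtain ⟨MY, hY⟩ := exists_isYOptimal hE hs
  have hst := hr.elim_stable hE hs
  obtain ⟨l₃, hl₃⟩ := exists_elimSeq hE hs hst ((isYOptimal_iff hE).1 hY).1 (((isYOptimal_iff hE).1 hY).2 _ hst)
  have old := hel.append (ElimSeq.cons _ _ _ _ hr hl₃)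
  have new := (hel.genSeq hE).append (GenSeq.cons _ _ _ _ hg₁' (hl₂.append (hl₃.genSeq hE)))
  have hMX := stable_mat hE hX.1
  have hv : ∀ W, Visits MX (l ++ ρ :: l₃) W → Visits MX (l ++ ρ₁ :: (l₂ ++ l₃)) W := by
    intro W
    rw [(hel.genSeq hE).visits_append, (hel.genSeq hE).visits_append, Visits, Visits,
      hl₂.visits_append]
    tauto
  have hrot : ∀ σ, σ ∈ rotations T E ↔ σ ∈ l ++ ρ :: l₃ :=
    fun σ => ⟨old.mem_of_rotation hE hs hX hY, old.rotation_of_mem⟩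
  have hmem : ∀ e, e ∈ E ∪ R.biUnion rotEdges ↔
      e ∈ MX ∨ ∃ σ ∈ l ++ ρ₁ :: (l₂ ++ l₃), e ∈ rotEdges σ := by
    intro e
    constructor
    · intro he
      rcases Finset.mem_union.1 he with he | he
      · rw [old.mem_table_iff hE hs hX hY, ← (old.genSeq hE).visits_edges] at he
        obtain ⟨W, hW, he⟩ := he
        exact (new.visits_edges e).1 ⟨W, hv W hW, he⟩
      · obtain ⟨σ, hσ, he⟩ := Finset.mem_biUnion.1 he
        refine Or.inr ⟨σ, ?_, he⟩
        rw [hR, ← hal] at hσ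
        simp only [List.mem_append, List.mem_cons]
        tauto
    · rintro (he | ⟨σ, hσ, he⟩)
      · exact Finset.mem_union_left _ (hX.1.1.2 he)
      · have key : σ ∈ rotations T E ∨ σ ∈ R := by
          rw [hrot, hR, ← hal]
          simp only [List.mem_append, List.mem_cons] at hσ ⊢
          tauto
        rcases key with ⟨K, hK⟩ | h'
        · exact Finset.mem_union_left _ (hK.2.1.2.2.1 he)
        · exact Finset.mem_union_right _ (Finset.mem_biUnion.2 ⟨σ, h', he⟩)
  obtain ⟨t1, t2, -, tX, tY, t6, t7⟩ := new.table hMX hmem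
  refine ⟨?_, t1, t2, fun σ => ?_, ?_, ?_, fun M hM => ?_, fun M hM => ?_⟩
  · obtain ⟨σ, hσ⟩ : ∃ σ, IsAltCycle (elim M₀ ρ₁) (elim M₀ ρ) σ := by
      by_contra hno
      cases l₂ with
      | nil => exact hne' hl₂.eq_of_nil
      | cons σ l₂ => exact hno ⟨σ, (hal σ).1 List.mem_cons_self⟩
    have : ({ρ₁, σ} : Finset (Rotation p q)) ⊆ R := by
      intro τ hτ
      rw [hR]
      rcases Finset.mem_insert.1 hτ with rfl | hτ
      · exact Or.inl rfl
      · rw [Finset.mem_singleton.1 hτ]; exact Or.inr hσ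
    rw [← Finset.card_pair (IsAltCycle.of_elim_ne hM₀ hg₁' hσ).symm]
    exact Finset.card_le_card this
  · rw [t6, hrot, hR, ← hal]
    have hnd := old.nodup hE hs
    rw [List.nodup_append] at hnd
    have n1 : ρ ∉ l := fun h' => hnd.2.2 ρ h' ρ List.mem_cons_self rfl
    have n2 := (List.nodup_cons.1 hnd.2.1).1
    have n3 : σ ∈ l → σ ≠ ρ := by rintro h' rfl; exact n1 h'
    have n4 : σ ∈ l₃ → σ ≠ ρ := by rintro h' rfl; exact n2 h'
    simp only [List.mem_append, List.mem_cons]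
    tauto
  · exact stable_subset_of_visits hE hs old hX hY new hMX hmem hv
  · refine Finset.card_lt_card ⟨Finset.subset_union_left, fun hc => ?_⟩
    have hW : Visits MX (l ++ ρ₁ :: (l₂ ++ l₃)) (elim M₀ ρ₁) := by
      rw [(hel.genSeq hE).visits_append, Visits, hl₂.visits_append]
      exact Or.inr (Or.inr (Or.inl hl₂.visits_first))
    rcases hr.atomic hE hs _ hM₁ ((t7 _ hW).1.2.trans hc) (dom_elim subset_rfl hg₁') hd with e | e
    · exact elim_ne subset_rfl hM₀ hg₁' e.symm
    · exact hne' e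
  · rwa [isXOptimal_unique hE hM hX]
  · rwa [isYOptimal_unique hE hM hY]

/-- `Dissect_Rotation` keeps a rotation that cannot be dissected. -/
theorem Undissectable.dissectRotation {E : Table p q} (hE : E ⊆ T.edges) (hs : IsStableTable T E)
    {ρ : Rotation p q} (hρ : ρ ∈ rotations T E) (hu : Undissectable T ρ) :
    DissectRotation T E ρ {ρ} := by
  obtain ⟨MX, hX⟩ := exists_isXOptimal hE hs
  obtain ⟨l, M₀, h1, h2, h3⟩ := exists_elimSeq_predecessors hE hs hρ hX
  exact ⟨MX, l, M₀, hX, h1, h2, Or.inl ⟨(existsUnique_iff_undissectable (stable_mat hE h3.1)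
    (h3.genEdges hE)).2 hu, rfl⟩⟩

/-- `Dissect_Rotation` may choose any other generalized rotation that lies between. -/
theorem exists_dissectRotation {E : Table p q} (hE : E ⊆ T.edges) (hs : IsStableTable T E)
    {ρ ρ₁ : Rotation p q} (hρ : ρ ∈ rotations T E) (hne : ρ₁ ≠ ρ)
    (h₁ : IsGenRotation T (between T ρ.toFinset (shifted ρ)) ρ.toFinset ρ₁) :
    ∃ R M₀, DissectRotation T E ρ R ∧ 2 ≤ R.card ∧ IsRotation T E M₀ ρ ∧
      IsGenRotation T (between T M₀ (elim M₀ ρ)) M₀ ρ₁ ∧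
      ∀ σ, σ ∈ R ↔ σ = ρ₁ ∨ IsAltCycle (elim M₀ ρ₁) (elim M₀ ρ) σ := by
  obtain ⟨MX, hX⟩ := exists_isXOptimal hE hs
  obtain ⟨l, M₀, h1, h2, h3⟩ := exists_elimSeq_predecessors hE hs hρ hX
  have hM₀ := stable_mat hE h3.1
  have hg := h3.genEdges hE
  have hg₁ := (isGenRotation_between_iff hM₀ hg).2 h₁
  have hg₁' := hg₁.mono (between_subset _ _)
  obtain ⟨l₂, hl₂, hal⟩ := exists_genSeq_altCycles (elim_mat subset_rfl hM₀ hg₁')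
    (elim_mat subset_rfl hM₀ hg) (dom_elim_between hM₀ hg hg₁)
  have hR : ∀ σ, σ ∈ insert ρ₁ l₂.toFinset ↔
      σ = ρ₁ ∨ IsAltCycle (elim M₀ ρ₁) (elim M₀ ρ) σ := by
    intro σ
    rw [Finset.mem_insert, List.mem_toFinset, hal]
  have hu : ¬ Undissectable T ρ := fun hu => hne (hu ρ₁ h₁)
  have hD : DissectRotation T E ρ (insert ρ₁ l₂.toFinset) :=
    ⟨MX, l, M₀, hX, h1, h2, Or.inr ⟨fun h => hu ((existsUnique_iff_undissectable hM₀ hg).1 h), ρ₁, hne,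
      hg₁, hR⟩⟩
  refine ⟨_, M₀, hD, ?_, h3, hg₁, hR⟩
  rcases dissect_spec hE hs hρ hD with h | h
  · exact absurd h.2 hu
  · exact h.1

/-- Adding a generalized rotation exposed in the last matching. -/
theorem grow_spec {E M : Table p q} (hE : E ⊆ T.edges) (hs : IsStableTable T E)
    (hM : IsYOptimal T E M) {ρ : Rotation p q} (hρ : IsGenRotation T T.edges M ρ) :
    E ∪ rotEdges ρ ⊆ T.edges ∧ IsStableTable T (E ∪ rotEdges ρ) ∧
      (∀ σ, σ ∈ rotations T (E ∪ rotEdges ρ) ↔ σ ∈ rotations T E ∨ σ = ρ) ∧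
      stableMatchings T E ⊆ stableMatchings T (E ∪ rotEdges ρ) ∧
      E.card < (E ∪ rotEdges ρ).card ∧
      (∀ N, IsXOptimal T E N → IsXOptimal T (E ∪ rotEdges ρ) N) ∧
      IsYOptimal T (E ∪ rotEdges ρ) (elim M ρ) := by
  obtain ⟨MX, hX⟩ := exists_isXOptimal hE hs
  have hM' := (isYOptimal_iff hE).1 hM
  have hMm := stable_mat hE hM'.1
  obtain ⟨l, hl⟩ := exists_elimSeq hE hs hX.1 hM'.1 (hM'.2 _ hX.1)
  have new := (hl.genSeq hE).append (GenSeq.cons _ _ _ _ hρ (GenSeq.nil _))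
  have hMX := stable_mat hE hX.1
  have hrot : ∀ σ, σ ∈ rotations T E ↔ σ ∈ l :=
    fun σ => ⟨hl.mem_of_rotation hE hs hX hM, hl.rotation_of_mem⟩
  have hmem : ∀ e, e ∈ E ∪ rotEdges ρ ↔ e ∈ MX ∨ ∃ σ ∈ l ++ [ρ], e ∈ rotEdges σ := by
    intro e
    rw [Finset.mem_union, hl.mem_table_iff hE hs hX hM]
    simp only [List.mem_append, List.mem_singleton, or_and_right, exists_or, exists_eq_left, or_assoc]
  obtain ⟨t1, t2, -, tX, tY, t6, t7⟩ := new.table hMX hmem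
  refine ⟨t1, t2, fun σ => ?_, ?_, ?_, fun N hN => ?_, tY⟩
  · rw [t6, hrot]; simp
  · refine stable_subset_of_visits hE hs hl hX hM new hMX hmem fun W hW => ?_
    rw [(hl.genSeq hE).visits_append]
    exact Or.inl hW
  · refine Finset.card_lt_card ⟨Finset.subset_union_left, fun hc => ?_⟩
    have hW := t7 _ new.visits_last
    have hd := dom_elim subset_rfl hρ
    have hW' : elim M ρ ∈ stableMatchings T E :=
      ⟨⟨hW.1.1, hW.1.2.trans hc⟩, fun e he => hW.2 e (Finset.mem_union_left _ he)⟩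
    exact elim_ne subset_rfl hMm hρ
      (Dom.antisymm hMm (elim_mat subset_rfl hMm hρ) hd (hM'.2 _ hW'))
  · rwa [isXOptimal_unique hE hN hX]

/-- Adding the rotation that leads from a better matching to the first one. -/
theorem growY_spec {E M : Table p q} (hE : E ⊆ T.edges) (hs : IsStableTable T E)
    (hM : IsXOptimal T E M) {τ : Rotation q p} (hτ : IsGenRotation T.swap T.swap.edges M.swap τ) :
    E ∪ (rotEdges τ).swap ⊆ T.edges ∧ IsStableTable T (E ∪ (rotEdges τ).swap) ∧
      (∀ σ, σ ∈ rotations T (E ∪ (rotEdges τ).swap) ↔ σ ∈ rotations T E ∨ σ = undo τ) ∧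
      stableMatchings T E ⊆ stableMatchings T (E ∪ (rotEdges τ).swap) ∧
      E.card < (E ∪ (rotEdges τ).swap).card ∧
      (∀ N, IsYOptimal T E N → IsYOptimal T (E ∪ (rotEdges τ).swap) N) ∧
      IsXOptimal T (E ∪ (rotEdges τ).swap) (elim M.swap τ).swap := by
  obtain ⟨MY, hY⟩ := exists_isYOptimal hE hs
  have hM' := (isXOptimal_iff hE).1 hM
  have hY' := (isYOptimal_iff hE).1 hY
  have hMm := stable_mat hE hM.1
  obtain ⟨l, hl⟩ := exists_elimSeq hE hs hM.1 hY'.1 (hM'.2 _ hY'.1)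
  have hW₀ := undo_mat hMm hτ
  have hg := undo_isGenRotation hMm hτ
  have he := undo_elim hMm hτ
  have hd := undo_dom hτ
  have new : GenSeq T (elim M.swap τ).swap (undo τ :: l) MY :=
    GenSeq.cons _ _ _ _ hg (by rw [he]; exact hl.genSeq hE)
  have hrot : ∀ σ, σ ∈ rotations T E ↔ σ ∈ l :=
    fun σ => ⟨hl.mem_of_rotation hE hs hM hY, hl.rotation_of_mem⟩
  have hv : ∀ W, Visits M l W → Visits (elim M.swap τ).swap (undo τ :: l) W := by
    intro W hW
    rw [Visits, he]
    exact Or.inr hW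
  have hmem : ∀ e, e ∈ E ∪ (rotEdges τ).swap ↔
      e ∈ (elim M.swap τ).swap ∨ ∃ σ ∈ undo τ :: l, e ∈ rotEdges σ := by
    intro e
    rw [← rotEdges_undo, Finset.mem_union, hl.mem_table_iff hE hs hM hY]
    simp only [List.mem_cons, or_and_right, exists_or, exists_eq_left]
    have k1 : e ∈ M → e ∈ (elim M.swap τ).swap ∨ e ∈ rotEdges (undo τ) := by
      intro h1
      rw [← he] at h1
      simp only [elim, rotEdges, Finset.mem_union, Finset.mem_sdiff] at h1 ⊢
      tauto
    have k2 : e ∈ (elim M.swap τ).swap → e ∈ M ∨ e ∈ rotEdges (undo τ) := by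
      intro h1
      nth_rewrite 1 [← he]
      simp only [elim, rotEdges, Finset.mem_union, Finset.mem_sdiff] at h1 ⊢
      tauto
    generalize (∃ ρ ∈ l, e ∈ rotEdges ρ) = P
    tauto
  obtain ⟨t1, t2, -, tX, tY, t6, t7⟩ := new.table hW₀ hmem
  refine ⟨t1, t2, fun σ => ?_, ?_, ?_, fun N hN => ?_, tX⟩
  · rw [t6, hrot, List.mem_cons]; exact or_comm
  · exact stable_subset_of_visits hE hs hl hM hY new hW₀ hmem hv
  · refine Finset.card_lt_card ⟨Finset.subset_union_left, fun hc => ?_⟩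
    have hW := tX.1
    have hW' : (elim M.swap τ).swap ∈ stableMatchings T E :=
      ⟨⟨hW.1.1, hW.1.2.trans hc⟩, fun e he => hW.2 e (Finset.mem_union_left _ he)⟩
    have e1 := Dom.antisymm hW₀ hMm hd (hM'.2 _ hW')
    have := elim_ne subset_rfl hW₀ hg
    rw [he] at this
    exact this e1
  · rwa [isYOptimal_unique hE hN hY]

end

end Marriage

namespace Marriage

variable {p q : ℕ}

/-! ### Runs of the algorithm -/

section Runs

variable {T : Inst p q}

theorem eq_of_no_genRotation {N V : Table p q} (hN : Mat T N) (hV : Mat T V) (hd : Dom T N V)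
    (hno : ¬ ∃ ρ, IsGenRotation T T.edges N ρ) : V = N := by
  by_contra hne
  have hns : ¬ N ⊆ V := by
    intro hs
    refine hne (Finset.Subset.antisymm ?_ hs)
    rintro ⟨x, y⟩ hxy
    obtain ⟨y', _, a, _⟩ := hd.2 _ _ hxy
    rwa [hV.uniqX hxy (hs a)]
  obtain ⟨a, ha, ha'⟩ := Finset.not_subset.1 hns
  obtain ⟨σ, hσ, _⟩ := exists_altCycle hN hV hd ha ha'
  exact hno ⟨σ, hσ.isGenRotation subset_rfl hN hV hd hN.2 hV.2⟩

/-- A table whose rotations cannot be dissected and that cannot be extended at either end. -/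
theorem internallyClosed_of_final {E M N : Table p q} (h : Inv T E ∅) (hX : IsXOptimal T E M)
    (hY : IsYOptimal T E N) (hM : ¬ ∃ τ, IsGenRotation T.swap T.swap.edges M.swap τ)
    (hN : ¬ ∃ ρ, IsGenRotation T T.edges N ρ) : InternallyClosed T (stableMatchings T E) := by
  have hY' := (isYOptimal_iff h.edges).1 hY
  have hMm := stable_mat h.edges hX.1
  have hNm := stable_mat h.edges hY'.1
  obtain ⟨l, hl⟩ := exists_elimSeq h.edges h.stable hX.1 hY'.1 (hY'.2 _ hX.1)
  have hc := hl.atomChain h.edges h.edges h.stable hX.1 fun K ρ _ hK =>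
    (h.rest ρ ⟨K, hK⟩ (Finset.notMem_empty _)).atomic (stable_mat h.edges hK.1) (hK.genEdges h.edges)
  refine hc.internallyClosed (fun e => ?_) (fun V hV _ => hV.2) (fun V hV _ hd => ?_)
    fun V hV _ hd => eq_of_no_genRotation hNm hV hd hN
  · rw [hl.mem_table_iff h.edges h.stable hX hY]
    exact ((hl.genSeq h.edges).visits_edges e).symm
  · exact swap_inj.1 (eq_of_no_genRotation (mat_swap.2 hMm) (mat_swap.2 hV) hd.swap hM)

/-- The invariant of the algorithm. -/
def Good (T : Inst p q) (E₀ : Table p q) : Config p q → Prop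
  | .running Z E Q => Inv T E Q ∧ stableMatchings T E₀ ⊆ stableMatchings T E ∧
      (Z = .Y → ∀ M, IsYOptimal T E M → ¬ ∃ ρ, IsGenRotation T T.edges M ρ)
  | .halted E => E ⊆ T.edges ∧ stableMatchings T E₀ ⊆ stableMatchings T E ∧
      InternallyClosed T (stableMatchings T E)

theorem Good.start {E₀ : Table p q} (hE : E₀ ⊆ T.edges) (hs : IsStableTable T E₀) {c : Config p q}
    (h : IsStart T E₀ c) : Good T E₀ c := by
  obtain ⟨Q, hQ, rfl⟩ := h
  exact ⟨⟨hE, hs, fun ρ h => (hQ ρ).1 h, fun ρ h h' => absurd ((hQ ρ).2 h) h'⟩, subset_rfl,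
    fun h => by cases h⟩

theorem Good.step {E₀ : Table p q} {c c' : Config p q} (h : Good T E₀ c) (hs : Step T c c') :
    Good T E₀ c' := by
  cases hs with
  | dissect Z E Q ρ R hρ hD hR =>
    obtain ⟨hi, hS, hZ⟩ := h
    rcases dissect_spec hi.edges hi.stable (hi.queue ρ hρ) hD with ⟨rfl, _⟩ | h'
    · simp at hR
    obtain ⟨-, h1, h2, h3, h4, -, -, h5⟩ := h'
    refine ⟨⟨h1, h2, fun σ hσ => (h3 σ).2 ?_, fun σ hσ hn => ?_⟩, hS.trans h4, fun hz M hM => ?_⟩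
    · rcases Finset.mem_union.1 hσ with h | h
      · exact Or.inl ⟨hi.queue σ (Finset.mem_of_mem_erase h), Finset.ne_of_mem_erase h⟩
      · exact Or.inr h
    · rw [Finset.mem_union, Finset.mem_erase, not_or, not_and] at hn
      rcases (h3 σ).1 hσ with h | h
      · exact hi.rest σ h.1 (hn.1 h.2)
      · exact absurd h hn.2
    · obtain ⟨MY, hY⟩ := exists_isYOptimal hi.edges hi.stable
      rw [isYOptimal_unique h1 hM (h5 _ hY)]
      exact hZ hz MY hY
  | keep Z E Q ρ R hρ hD hR =>
    obtain ⟨hi, hS, hZ⟩ := h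
    rcases dissect_spec hi.edges hi.stable (hi.queue ρ hρ) hD with ⟨rfl, hu⟩ | h'
    · refine ⟨⟨hi.edges, hi.stable, fun σ hσ => hi.queue σ (Finset.mem_of_mem_erase hσ),
        fun σ hσ hn => ?_⟩, hS, hZ⟩
      rw [Finset.mem_erase, not_and] at hn
      by_cases e : σ = ρ
      · rw [e]; exact hu
      · exact hi.rest σ hσ (hn e)
    · have := h'.1
      omega
  | growX E M ρ hM hρ =>
    obtain ⟨hi, hS, hZ⟩ := h
    obtain ⟨h1, h2, h3, h4, -⟩ := grow_spec hi.edges hi.stable hM hρ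
    refine ⟨⟨h1, h2, fun σ hσ => (h3 σ).2 (Or.inr (Finset.mem_singleton.1 hσ)), fun σ hσ hn => ?_⟩,
      hS.trans h4, fun h => by cases h⟩
    exact hi.rest σ (((h3 σ).1 hσ).resolve_right fun e => hn (Finset.mem_singleton.2 e))
      (Finset.notMem_empty _)
  | doneX E M hM hno =>
    obtain ⟨hi, hS, hZ⟩ := h
    refine ⟨hi, hS, fun _ N hN => ?_⟩
    rwa [isYOptimal_unique hi.edges hN hM]
  | growY E M τ hM hτ =>
    obtain ⟨hi, hS, hZ⟩ := h
    obtain ⟨h1, h2, h3, h4, -, h5, -⟩ := growY_spec hi.edges hi.stable hM hτ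
    refine ⟨⟨h1, h2, fun σ hσ => (h3 σ).2 (Or.inr (Finset.mem_singleton.1 hσ)), fun σ hσ hn => ?_⟩,
      hS.trans h4, fun _ N hN => ?_⟩
    · exact hi.rest σ (((h3 σ).1 hσ).resolve_right fun e => hn (Finset.mem_singleton.2 e))
        (Finset.notMem_empty _)
    · obtain ⟨MY, hY⟩ := exists_isYOptimal hi.edges hi.stable
      rw [isYOptimal_unique h1 hN (h5 _ hY)]
      exact hZ rfl MY hY
  | doneY E M hM hno =>
    obtain ⟨hi, hS, hZ⟩ := h
    obtain ⟨MY, hY⟩ := exists_isYOptimal hi.edges hi.stable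
    exact ⟨hi.edges, hS, internallyClosed_of_final hi hM hY hno (hZ rfl MY hY)⟩

theorem Good.reach {E₀ : Table p q} {c c' : Config p q} (h : Good T E₀ c)
    (hs : Relation.ReflTransGen (Step T) c c') : Good T E₀ c' := by
  induction hs with
  | refl => exact h
  | tail _ h2 ih => exact ih.step h2

/-- Every step decreases this measure. -/
def Config.measure (T : Inst p q) : Config p q → ℕ ×ₗ ℕ ×ₗ ℕ
  | .running .X E Q => toLex (2, toLex (T.edges.card - E.card, Q.card))
  | .running .Y E Q => toLex (1, toLex (T.edges.card - E.card, Q.card))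
  | .halted _ => toLex (0, toLex (0, 0))

theorem Config.measure_running_lt (Z : Side) {E E' : Table p q} {Q Q' : Finset (Rotation p q)}
    (h : T.edges.card - E'.card < T.edges.card - E.card ∨
      T.edges.card - E'.card = T.edges.card - E.card ∧ Q'.card < Q.card) :
    Config.measure T (.running Z E' Q') < Config.measure T (.running Z E Q) := by
  cases Z <;>
  · rw [Config.measure, Config.measure, Prod.Lex.toLex_lt_toLex]
    exact Or.inr ⟨rfl, Prod.Lex.toLex_lt_toLex.2 h⟩

theorem Good.measure_lt {E₀ : Table p q} {c c' : Config p q} (h : Good T E₀ c) (hs : Step T c c') :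
    Config.measure T c' < Config.measure T c := by
  have key : ∀ {E E' : Table p q}, E' ⊆ T.edges → E.card < E'.card →
      T.edges.card - E'.card < T.edges.card - E.card := by
    intro E E' h1 h2
    have := Finset.card_le_card h1
    omega
  cases hs with
  | dissect Z E Q ρ R hρ hD hR =>
    obtain ⟨hi, hS, hZ⟩ := h
    rcases dissect_spec hi.edges hi.stable (hi.queue ρ hρ) hD with ⟨rfl, _⟩ | h'
    · simp at hR
    exact Config.measure_running_lt Z (Or.inl (key h'.2.1 h'.2.2.2.2.2.1))
  | keep Z E Q ρ R hρ hD hR =>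
    exact Config.measure_running_lt Z (Or.inr ⟨rfl, Finset.card_erase_lt_of_mem hρ⟩)
  | growX E M ρ hM hρ =>
    obtain ⟨h1, -, -, -, h5, -⟩ := grow_spec h.1.edges h.1.stable hM hρ
    exact Config.measure_running_lt .X (Or.inl (key h1 h5))
  | doneX E M hM hno => exact Prod.Lex.toLex_lt_toLex.2 (Or.inl (Nat.lt_succ_self _))
  | growY E M τ hM hτ =>
    obtain ⟨h1, -, -, -, h5, -⟩ := growY_spec h.1.edges h.1.stable hM hτ
    exact Config.measure_running_lt .Y (Or.inl (key h1 h5))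
  | doneY E M hM hno => exact Prod.Lex.toLex_lt_toLex.2 (Or.inl (Nat.lt_succ_self _))

theorem Good.progress {E₀ : Table p q} {c : Config p q} (h : Good T E₀ c) :
    (∃ c', Step T c c') ∨ ∃ E', c = .halted E' := by
  cases c with
  | halted E => exact Or.inr ⟨E, rfl⟩
  | running Z E Q =>
    left
    obtain ⟨hi, hS, hZ⟩ := h
    rcases Q.eq_empty_or_nonempty with rfl | ⟨ρ, hρ⟩
    · cases Z with
      | X =>
        obtain ⟨M, hM⟩ := exists_isYOptimal hi.edges hi.stable
        by_cases hx : ∃ ρ, IsGenRotation T T.edges M ρ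
        · obtain ⟨ρ, hρ⟩ := hx
          exact ⟨_, Step.growX E M ρ hM hρ⟩
        · exact ⟨_, Step.doneX E M hM hx⟩
      | Y =>
        obtain ⟨M, hM⟩ := exists_isXOptimal hi.edges hi.stable
        by_cases hx : ∃ τ, IsGenRotation T.swap T.swap.edges M.swap τ
        · obtain ⟨τ, hτ⟩ := hx
          exact ⟨_, Step.growY E M τ hM hτ⟩
        · exact ⟨_, Step.doneY E M hM hx⟩
    · by_cases hu : Undissectable T ρ
      · exact ⟨_, Step.keep Z E Q ρ _ hρ (hu.dissectRotation hi.edges hi.stable (hi.queue ρ hρ))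
          (by simp)⟩
      · rw [Undissectable] at hu
        push Not at hu
        obtain ⟨ρ₁, h1, h2⟩ := hu
        obtain ⟨R, _, h3, h4, _⟩ :=
          exists_dissectRotation hi.edges hi.stable (hi.queue ρ hρ) h2 h1
        exact ⟨_, Step.dissect Z E Q ρ R hρ h3 h4⟩

theorem alwaysHalts {E₀ : Table p q} (hE : E₀ ⊆ T.edges) (hs : IsStableTable T E₀) :
    AlwaysHalts T E₀ := by
  refine ⟨?_, fun c c' hc h => ((Good.start hE hs hc).reach h).progress⟩
  rintro ⟨r, h0, h1⟩
  have hg : ∀ i, Good T E₀ (r i) := by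
    intro i
    induction i with
    | zero => exact Good.start hE hs h0
    | succ i ih => exact ih.step (h1 i)
  exact not_strictAnti_of_wellFoundedLT (fun i => Config.measure T (r i))
    (strictAnti_nat_of_succ_lt fun i => (hg i).measure_lt (h1 i))

theorem Outputs.spec {E₀ E' : Table p q} (hE : E₀ ⊆ T.edges) (hs : IsStableTable T E₀)
    (h : Outputs T E₀ E') : E' ⊆ T.edges ∧
      IsInternalClosure T (stableMatchings T E') (stableMatchings T E₀) := by
  obtain ⟨c, hc, hr⟩ := h
  obtain ⟨h1, h2, h3⟩ := (Good.start hE hs hc).reach hr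
  exact ⟨h1, internallyStable_stable hE, h2, h3⟩

end Runs

end Marriage

namespace Marriage

variable {p q : ℕ}

/-! ### Searching for the next rotation -/

/-- `y` may be the next partner of `x`, when only the agents `x' ∈ L` can still get worse. -/
def IsCand (T : Inst p q) (A M : Table p q) (L : Finset (Fin p)) (x : Fin p) (y : Fin q) : Prop :=
  (x, y) ∈ A ∧ (∃ m, (x, m) ∈ M ∧ rkX T x m < rkX T x y) ∧
    ∃ z ∈ L, (z, y) ∈ M ∧ rkY T y x < rkY T y z

/-- `L` contains all `x` that get worse in some matching below `M` with edges from `A`. -/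
structure Alive (T : Inst p q) (A M : Table p q) (L : Finset (Fin p)) : Prop where
  matched : ∀ x ∈ L, ∃ y, (x, y) ∈ M
  moved : ∀ V, Mat T V → V ⊆ A ∪ M → Dom T M V → ∀ x y, (x, y) ∈ V → (x, y) ∉ M → x ∈ L

/-- No matching below `M` with edges from `A` has `x` between `M` and `M'`. -/
def Next (T : Inst p q) (A M M' : Table p q) : Prop :=
  ∀ V, Mat T V → V ⊆ A ∪ M → Dom T M V → ∀ x y y', (x, y) ∈ V → (x, y') ∈ M' →
    (x, y) ∈ M ∨ rkX T x y' ≤ rkX T x y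

section Search

variable {T : Inst p q} {A M : Table p q} {L : Finset (Fin p)}

theorem Alive.isCand (h : Alive T A M L) (hM : Mat T M) {V : Table p q} (hV : Mat T V)
    (hVA : V ⊆ A ∪ M) (hd : Dom T M V) {x : Fin p} {y : Fin q} (hxy : (x, y) ∈ V)
    (hn : (x, y) ∉ M) : IsCand T A M L x y := by
  obtain ⟨m, z, h1, h2, h3, h4⟩ := hd.2 _ _ hxy
  have hxz : x ≠ z := by rintro rfl; exact hn h2
  obtain ⟨y2, _, h5, _⟩ := hd.1 _ _ h2
  refine ⟨(Finset.mem_union.1 (hVA hxy)).resolve_right hn, ⟨m, h1, lt_of_le_of_ne h3 fun e => ?_⟩,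
    z, h.moved V hV hVA hd z y2 h5 fun h6 => ?_, h2, lt_of_le_of_ne h4 fun e => ?_⟩
  · rw [rkX_inj (hM.edge h1) e] at h1
    exact hn h1
  · rw [hM.uniqX h6 h2] at h5
    exact hxz (hV.uniqY hxy h5)
  · exact hxz (rkY_inj (hV.edge hxy) e)

theorem Alive.erase (h : Alive T A M L) (hM : Mat T M) {x : Fin p}
    (hx : ∀ y, ¬ IsCand T A M L x y) : Alive T A M (L.erase x) := by
  refine ⟨fun z hz => h.matched z (Finset.mem_of_mem_erase hz), fun V hV hVA hd z y hz hn => ?_⟩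
  refine Finset.mem_erase.2 ⟨?_, h.moved V hV hVA hd z y hz hn⟩
  rintro rfl
  exact hx y (h.isCand hM hV hVA hd hz hn)

theorem Alive.eq_of_empty (h : Alive T A M ∅) (hM : Mat T M) {V : Table p q} (hV : Mat T V)
    (hVA : V ⊆ A ∪ M) (hd : Dom T M V) : V = M := by
  have hsub : V ⊆ M := by
    rintro ⟨x, y⟩ hxy
    by_contra hn
    exact absurd (h.moved V hV hVA hd x y hxy hn) (Finset.notMem_empty _)
  refine Finset.Subset.antisymm hsub ?_
  rintro ⟨x, y⟩ hxy
  obtain ⟨y', _, h2, _⟩ := hd.1 _ _ hxy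
  rwa [hM.uniqX hxy (hsub h2)]

theorem alive_all (hM : ∀ x, x ∈ L ↔ ∃ y, (x, y) ∈ M) : Alive T A M L := by
  refine ⟨fun x hx => (hM x).1 hx, fun V hV _ hd x y hxy _ => ?_⟩
  obtain ⟨y', _, h1, _⟩ := hd.2 _ _ hxy
  exact (hM x).2 ⟨y', h1⟩

theorem exists_rotation_of_isCand (hA : A ⊆ T.edges) (hM : Mat T M) (h : Alive T A M L)
    {nx : Fin p → Fin q} {f : Fin p → Fin p} (hc : ∀ x ∈ L, IsCand T A M L x (nx x))
    (hmin : ∀ x ∈ L, ∀ y, IsCand T A M L x y → rkX T x (nx x) ≤ rkX T x y)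
    (hf : ∀ x ∈ L, (f x, nx x) ∈ M) {a : Fin p} (ha : a ∈ L) {k : ℕ} (hk : 0 < k)
    (hp : f^[k] a = a) : ∃ σ, IsGenRotation T T.edges M σ ∧ shifted σ ⊆ A ∧
      (∀ e ∈ σ.toFinset, e.1 ∈ L) ∧ Next T A M (elim M σ) ∧ Alive T A (elim M σ) L ∧
      ∀ x y, (x, y) ∈ elim M σ ↔
        ((∃ i, f^[i] a = x) ∧ y = nx x) ∨ ((¬ ∃ i, f^[i] a = x) ∧ (x, y) ∈ M) := by
  have hfL : ∀ x ∈ L, f x ∈ L := by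
    intro x hx
    obtain ⟨_, _, z, hz, h1, _⟩ := hc x hx
    rwa [hM.uniqY (hf x hx) h1]
  have hit : ∀ i, f^[i] a ∈ L := by
    intro i
    induction i with
    | zero => exact ha
    | succ i ih => rw [Function.iterate_succ_apply']; exact hfL _ ih
  obtain ⟨m, hm⟩ := h.matched a ha
  set g : Fin p × Fin q → Fin p × Fin q := fun e => (f e.1, nx e.1) with hg
  have g1 : ∀ i, (g^[i] (a, m)).1 = f^[i] a := by
    intro i
    induction i with
    | zero => rfl
    | succ i ih => rw [Function.iterate_succ_apply', Function.iterate_succ_apply', ← ih]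
  have gM : ∀ i, g^[i] (a, m) ∈ M := by
    intro i
    cases i with
    | zero => exact hm
    | succ i =>
      rw [Function.iterate_succ_apply']
      have := hf _ (hit i)
      rw [← g1] at this
      exact this
  have hper : (a, m) ∈ Function.periodicPts g := by
    refine ⟨k, hk, hM.1 _ (gM k) _ hm (Or.inl ?_)⟩
    rw [g1, hp]
  have mem_iff : ∀ e, e ∈ (Function.periodicOrbit g (a, m)).toFinset ↔ ∃ i, g^[i] (a, m) = e := by
    intro e
    rw [← Function.mem_periodicOrbit_iff hper, Function.periodicOrbit, Cycle.coe_toFinset,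
      List.mem_toFinset, Cycle.mem_coe_iff]
  have hlink : ∀ c d, (c, d) ∈ links (Function.periodicOrbit g (a, m)) →
      c.1 ∈ L ∧ c ∈ M ∧ d = (f c.1, nx c.1) := by
    intro c d hl
    obtain ⟨i, rfl⟩ := (mem_iff c).1 (mem_links_left hl)
    refine ⟨?_, gM i, mem_links_periodicOrbit hl⟩
    rw [g1]
    exact hit i
  have hgen : IsGenRotation T T.edges M (Function.periodicOrbit g (a, m)) := by
    refine IsGenRotation.of_links subset_rfl ?_ Function.nodup_periodicOrbit fun c d hl => ?_
    · intro e
      have := (mem_iff (a, m)).2 ⟨0, rfl⟩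
      rw [e] at this
      simp at this
    · obtain ⟨h1, h2, rfl⟩ := hlink c d hl
      obtain ⟨h3, ⟨m', h4, h5⟩, z, _, h6, h7⟩ := hc _ h1
      rw [hM.uniqX h4 h2] at h5
      rw [← hM.uniqY (hf _ h1) h6] at h7
      exact ⟨hM.2 h2, hA h3, h2, h7, h5⟩
  have hsh : shifted (Function.periodicOrbit g (a, m)) ⊆ A := by
    rintro ⟨x, y⟩ hxy
    obtain ⟨c, d, hl, rfl, rfl⟩ := mem_shifted.1 hxy
    obtain ⟨h1, -, rfl⟩ := hlink c d hl
    exact (hc _ h1).1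
  have hinL : ∀ e ∈ (Function.periodicOrbit g (a, m)).toFinset, e.1 ∈ L := by
    intro e he
    obtain ⟨i, rfl⟩ := (mem_iff e).1 he
    rw [g1]
    exact hit i
  refine ⟨_, hgen, hsh, hinL, ?_, ⟨?_, ?_⟩, ?_⟩
  · intro V hV hVA hd x y y' hy hy'
    by_cases hn : (x, y) ∈ M
    · exact Or.inl hn
    right
    rcases mem_elim.1 hy' with ⟨h1, _⟩ | ⟨c, d, hl, rfl, rfl⟩
    · exact hd.leX hV h1 hy
    · obtain ⟨h1, -, rfl⟩ := hlink c d hl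
      exact hmin _ h1 _ (h.isCand hM hV hVA hd hy hn)
  · intro x hx
    obtain ⟨y, hy⟩ := h.matched x hx
    obtain ⟨y', _, h1, _⟩ := (dom_elim subset_rfl hgen).1 _ _ hy
    exact ⟨y', h1⟩
  · intro V hV hVA hd x y hxy hn
    by_cases hxM : (x, y) ∈ M
    · have : (x, y) ∈ (Function.periodicOrbit g (a, m)).toFinset := by
        by_contra hh
        exact hn (mem_elim.2 (Or.inl ⟨hxM, hh⟩))
      exact hinL _ this
    · refine h.moved V hV (fun e he => ?_) ((dom_elim subset_rfl hgen).trans hd) x y hxy hxM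
      rcases Finset.mem_union.1 (hVA he) with h1 | h1
      · exact Finset.mem_union_left _ h1
      · rcases Finset.mem_union.1 h1 with h2 | h2
        · exact Finset.mem_union_right _ (Finset.mem_sdiff.1 h2).1
        · exact Finset.mem_union_left _ (hsh h2)
  · intro x y
    have hx : (∃ i, f^[i] a = x) ↔ ∃ y, (x, y) ∈ (Function.periodicOrbit g (a, m)).toFinset := by
      constructor
      · rintro ⟨i, rfl⟩
        refine ⟨(g^[i] (a, m)).2, (mem_iff _).2 ⟨i, ?_⟩⟩
        rw [← g1]
      · rintro ⟨y, hy⟩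
        obtain ⟨i, e⟩ := (mem_iff _).1 hy
        exact ⟨i, by rw [← g1, e]⟩
    have key : ∀ c d, (c, d) ∈ links (Function.periodicOrbit g (a, m)) → d.2 = nx c.1 := by
      intro c d hl
      rw [(hlink c d hl).2.2]
    rw [hx, mem_elim]
    constructor
    · rintro (⟨h1, h2⟩ | ⟨c, d, hl, rfl, rfl⟩)
      · refine Or.inr ⟨?_, h1⟩
        rintro ⟨y', hy'⟩
        rw [hM.uniqX h1 (hgen.mem hy')] at h2
        exact h2 hy'
      · exact Or.inl ⟨⟨c.2, mem_links_left hl⟩, key c d hl⟩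
    · rintro (⟨⟨y', hy'⟩, rfl⟩ | ⟨h1, h2⟩)
      · obtain ⟨d, hl⟩ := exists_link_left hy'
        exact Or.inr ⟨_, d, hl, rfl, key _ d hl⟩
      · exact Or.inl ⟨h2, fun h3 => h1 ⟨y, h3⟩⟩

theorem Next.atomic (hM : Mat T M) {σ : Rotation p q} (hσ : IsGenRotation T T.edges M σ)
    (h : Next T A M (elim M σ)) : Atomic T (A ∪ M) M (elim M σ) := by
  intro V hV hVA h1 h2
  have hM' := elim_mat subset_rfl hM hσ
  by_cases e : V = M
  · exact Or.inl e
  refine Or.inr ?_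
  have hns : ¬ M ⊆ V := by
    intro hs
    refine e (Finset.Subset.antisymm ?_ hs)
    rintro ⟨x, y⟩ hxy
    obtain ⟨y', _, a, _⟩ := h1.2 _ _ hxy
    rwa [hV.uniqX hxy (hs a)]
  obtain ⟨a, ha, ha'⟩ := Finset.not_subset.1 hns
  obtain ⟨τ, hτ, haτ⟩ := exists_altCycle hM hV h1 ha ha'
  have hg := hτ.isGenRotation subset_rfl hM hV h1 hM.2 hV.2
  have hin : ∀ c d, (c, d) ∈ links τ → (c, d) ∈ links σ := by
    intro c d hcd
    have hc := hg.mem (mem_links_left hcd)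
    have hd := Finset.mem_sdiff.1 (hτ.2.2.2 (mem_shifted_of_link hcd))
    have hcσ : c ∈ σ.toFinset := by
      by_contra hcc
      have := h2.leX hM' hd.1 (mem_elim.2 (Or.inl ⟨hc, hcc⟩))
      have := hg.ltX subset_rfl hcd
      omega
    obtain ⟨d', hcd'⟩ := exists_link_left hcσ
    have l1 := h2.leX hM' hd.1 (mem_elim_of_link hcd')
    have l2 := (h V hV hVA h1 _ _ _ hd.1 (mem_elim_of_link hcd')).resolve_left hd.2
    have e2 := rkX_inj (hV.edge hd.1) (le_antisymm l1 l2)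
    have : d = d' := hM.1 _ (hg.mem (mem_links_right hcd)) _ (hσ.mem (mem_links_right hcd'))
      (Or.inr e2)
    rwa [this]
  obtain ⟨b, hab⟩ := exists_link_left haτ
  obtain rfl := rotation_ext hτ.2.1 hσ.2.1 haτ (mem_links_left (hin a b hab)) fun c d hl _ => hin c d hl
  exact Dom.antisymm hV hM' h2 (hτ.dom_elim hM hV h1)

/-- In a stable table, the next matching comes from a rotation. -/
theorem Next.isRotation {E : Table p q} (hE : E ⊆ T.edges) (hs : IsStableTable T E)
    (hM : M ∈ stableMatchings T E) {σ : Rotation p q} (hσ : IsGenRotation T T.edges M σ)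
    (hsh : shifted σ ⊆ E) (h : Next T E M (elim M σ)) : IsRotation T E M σ := by
  have hMm := stable_mat hE hM
  refine isRotation_of_noBetween hE hM ?_ fun a b hl y hy => ?_
  · refine IsGenRotation.of_links hE hσ.1 hσ.2.1 fun a b hl => ⟨hM.1.2 (hσ.mem (mem_links_left hl)),
      hsh (mem_shifted_of_link hl), hσ.mem (mem_links_left hl), hσ.ltY subset_rfl hl,
      hσ.ltX subset_rfl hl⟩
  · by_cases hlt : rkX T a.1 y ≤ rkX T a.1 a.2
    · exact Or.inl hlt
    right
    have ha := hσ.mem (mem_links_left hl)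
    obtain ⟨K, hK, hyK⟩ := hs _ hy
    have hKm := stable_mat hE hK
    have hc := stable_compat hM hK
    have hV := stable_meet hE hM hK
    have hmem : (a.1, y) ∈ meet T M K := by
      refine mem_meet.2 (Or.inr ⟨hyK, fun y' hy' => ?_⟩)
      rw [hMm.uniqX hy' ha]
      omega
    refine (h _ (stable_mat hE hV) (hV.1.2.trans Finset.subset_union_left)
      (dom_meet_left hMm hKm hc) _ _ _ hmem (mem_elim_of_link hl)).resolve_left fun h' => ?_
    rw [hMm.uniqX h' ha] at hlt
    omega

end Search

end Marriage

namespace Marriage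

variable {p q : ℕ}

/-! ### Dissecting one rotation after the other -/

section Lockstep

variable {T : Inst p q} {M N : Table p q} {A σ : Rotation p q}

theorem isAltCycle_elim_self (hM : Mat T M) (h : IsGenRotation T T.edges M σ) {τ : Rotation p q} :
    IsAltCycle M (elim M σ) τ ↔ τ = σ := by
  have hσ : IsAltCycle M (elim M σ) σ := by
    have hn : ∀ e ∈ shifted σ, e ∉ M := by
      rintro ⟨x, y⟩ he
      obtain ⟨a, b, hl, rfl, rfl⟩ := mem_shifted.1 he
      exact link_notMem subset_rfl hM h hl
    refine ⟨h.1, h.2.1, fun e he => Finset.mem_sdiff.2 ⟨h.mem he, fun h' => ?_⟩,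
      fun e he => Finset.mem_sdiff.2 ⟨Finset.mem_union_right _ he, hn e he⟩⟩
    rcases Finset.mem_union.1 h' with h' | h'
    · exact (Finset.mem_sdiff.1 h').2 he
    · exact hn e h' (h.mem he)
  constructor
  · intro hτ
    obtain ⟨a, ha⟩ := toFinset_nonempty hτ.1
    have h1 := Finset.mem_sdiff.1 (hτ.2.2.1 ha)
    have h2 : a ∈ σ.toFinset := by
      by_contra hc
      exact h1.2 (Finset.mem_union_left _ (Finset.mem_sdiff.2 ⟨h1.1, hc⟩))
    exact hτ.eq_of_common hM (elim_mat subset_rfl hM h) hσ ha h2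
  · rintro rfl
    exact hσ

/-- The cycles of `M / σ △ M / A` depend on `σ` and `A` only. -/
theorem isAltCycle_elim_elim_congr {M₀ : Table p q} (hM : Mat T M) (hM₀ : Mat T M₀)
    (hA : IsGenRotation T T.edges M A) (hA₀ : IsGenRotation T T.edges M₀ A)
    (hσ : IsGenRotation T T.edges M σ) (hσ₀ : IsGenRotation T T.edges M₀ σ)
    (hsub : σ.toFinset ⊆ A.toFinset) {B : Rotation p q} :
    IsAltCycle (elim M σ) (elim M A) B ↔ IsAltCycle (elim M₀ σ) (elim M₀ A) B := by
  have hn : ∀ {K : Table p q} {ρ : Rotation p q}, Mat T K → IsGenRotation T T.edges K ρ →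
      ∀ e ∈ shifted ρ, e ∉ K := by
    rintro K ρ hK h ⟨x, y⟩ he
    obtain ⟨a, b, hl, rfl, rfl⟩ := mem_shifted.1 he
    exact link_notMem subset_rfl hK h hl
  have key : ∀ {K : Table p q}, Mat T K → IsGenRotation T T.edges K A →
      IsGenRotation T T.edges K σ →
      elim K σ \ elim K A = ((A.toFinset \ σ.toFinset) ∪ shifted σ) \ shifted A ∧
      elim K A \ elim K σ = shifted A \ shifted σ := by
    intro K hK h1 h2
    constructor
    · ext e
      have a1 := hn hK h1 e
      have a2 := hn hK h2 e
      have a3 := h1.mem (a := e)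
      have a4 := @hsub e
      simp only [elim, Finset.mem_sdiff, Finset.mem_union]
      tauto
    · ext e
      have a1 := hn hK h1 e
      have a2 := hn hK h2 e
      have a3 := h1.mem (a := e)
      have a4 := @hsub e
      simp only [elim, Finset.mem_sdiff, Finset.mem_union]
      tauto
  rw [IsAltCycle, IsAltCycle, (key hM hA hσ).1, (key hM hA hσ).2, (key hM₀ hA₀ hσ₀).1,
    (key hM₀ hA₀ hσ₀).2]

/-- Replacing the cycle `A` by a smaller rotation `σ` leaves the other cycles as they are. -/
theorem isAltCycle_elim_iff (hM : Mat T M) (hN : Mat T N) (hd : Dom T M N)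
    (hA : IsAltCycle M N A) (hσ : IsGenRotation T T.edges M σ) (hsub : σ.toFinset ⊆ A.toFinset)
    (hd' : Dom T (elim M σ) (elim M A)) {B : Rotation p q} :
    IsAltCycle (elim M σ) N B ↔
      (IsAltCycle M N B ∧ B ≠ A) ∨ IsAltCycle (elim M σ) (elim M A) B := by
  have hgA := hA.isGenRotation subset_rfl hM hN hd hM.2 hN.2
  have hM' := elim_mat subset_rfl hM hσ
  have hMA := elim_mat subset_rfl hM hgA
  have hdA := hA.dom_elim hM hN hd
  have hs : ∀ e ∈ shifted σ, e ∈ N → e ∈ shifted A := by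
    rintro ⟨x, y⟩ he heN
    obtain ⟨a, b, hl, rfl, rfl⟩ := mem_shifted.1 he
    obtain ⟨c, hl'⟩ := exists_link_left (hsub (mem_links_left hl))
    have h1 := mem_shifted_of_link hl'
    have := hN.uniqX heN (Finset.mem_sdiff.1 (hA.2.2.2 h1)).1
    rwa [this]
  have sub : ∀ e, (e ∈ elim M σ \ elim M A → e ∈ elim M σ \ N) ∧
      (e ∈ elim M A \ elim M σ → e ∈ N \ elim M σ) ∧
      (e ∈ elim M A \ N → e ∈ elim M σ \ N) ∧ (e ∈ N \ elim M A → e ∈ N \ elim M σ) := by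
    intro e
    have a1 := @hsub e
    have a2 := hs e
    have a3 := @hA.2.2.1 e
    have a4 := @hA.2.2.2 e
    simp only [elim, Finset.mem_sdiff, Finset.mem_union] at a3 a4 ⊢
    tauto
  rw [← hA.elim_iff hM hN]
  have d1 : IsAltCycle (elim M σ) (elim M A) B → IsAltCycle (elim M σ) N B := fun h =>
    ⟨h.1, h.2.1, fun e he => (sub e).1 (h.2.2.1 he), fun e he => (sub e).2.1 (h.2.2.2 he)⟩
  have d2 : IsAltCycle (elim M A) N B → IsAltCycle (elim M σ) N B := fun h =>
    ⟨h.1, h.2.1, fun e he => (sub e).2.2.1 (h.2.2.1 he), fun e he => (sub e).2.2.2 (h.2.2.2 he)⟩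
  refine ⟨fun hB => ?_, fun h => h.elim d2 d1⟩
  obtain ⟨a, ha⟩ := toFinset_nonempty hB.1
  have h1 := Finset.mem_sdiff.1 (hB.2.2.1 ha)
  by_cases h2 : a ∈ elim M A
  · obtain ⟨C, hC, haC⟩ := exists_altCycle hMA hN hdA h2 h1.2
    left
    have hC' : IsAltCycle (elim M σ) N C := ⟨hC.1, hC.2.1, fun e he => (sub e).2.2.1 (hC.2.2.1 he),
      fun e he => (sub e).2.2.2 (hC.2.2.2 he)⟩
    rwa [hB.eq_of_common hM' hN hC' ha haC]
  · obtain ⟨C, hC, haC⟩ := exists_altCycle hM' hMA hd' h1.1 h2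
    right
    have hC' : IsAltCycle (elim M σ) N C := ⟨hC.1, hC.2.1, fun e he => (sub e).1 (hC.2.2.1 he),
      fun e he => (sub e).2.1 (hC.2.2.2 he)⟩
    rwa [hB.eq_of_common hM' hN hC' ha haC]

/-- The edges between `M` and `N` at the `x` of the cycle `A`. -/
noncomputable def cycleTable (T : Inst p q) (M N : Table p q) (L : Finset (Fin p)) : Table p q :=
  (between T M N).filter fun e => e.1 ∈ L

theorem alive_cycleTable {L : Finset (Fin p)} (hL : ∀ x ∈ L, ∃ y, (x, y) ∈ M) :
    Alive T (cycleTable T M N L) M L := by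
  refine ⟨hL, fun V _ hVA _ x y hxy hn => ?_⟩
  exact (Finset.mem_filter.1 ((Finset.mem_union.1 (hVA hxy)).resolve_right hn)).2

theorem isCand_cycleTable (hM : Mat T M) (hN : Mat T N) (hd : Dom T M N) (hA : IsAltCycle M N A)
    {L : Finset (Fin p)} (hL : ∀ x, x ∈ L ↔ ∃ y, (x, y) ∈ A.toFinset) {x : Fin p} (hx : x ∈ L) :
    ∃ y, IsCand T (cycleTable T M N L) M L x y := by
  obtain ⟨m, hm⟩ := (hL x).1 hx
  obtain ⟨b, hl⟩ := exists_link_left hm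
  have hg := hA.isGenRotation subset_rfl hM hN hd hM.2 hN.2
  refine ⟨b.2, Finset.mem_filter.2 ⟨?_, hx⟩, ⟨m, hg.mem hm, hg.ltX subset_rfl hl⟩, b.1,
    (hL _).2 ⟨_, mem_links_right hl⟩, hg.mem (mem_links_right hl), hg.ltY subset_rfl hl⟩
  exact mem_between_of_dom hM hN hN hd (Dom.refl _)
    (Finset.mem_sdiff.1 (hA.2.2.2 (mem_shifted_of_link hl))).1

/-- The next rotation inside the cycle `A` cannot be dissected. -/
theorem undissectable_of_cycleTable (hM : Mat T M) (hN : Mat T N) (hd : Dom T M N)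
    (hA : IsAltCycle M N A) {L : Finset (Fin p)} (hL : ∀ x, x ∈ L ↔ ∃ y, (x, y) ∈ A.toFinset)
    (hσ : IsGenRotation T T.edges M σ) (hsh : shifted σ ⊆ cycleTable T M N L)
    (hσL : ∀ e ∈ σ.toFinset, e.1 ∈ L) (hn : Next T (cycleTable T M N L) M (elim M σ)) :
    σ.toFinset ⊆ A.toFinset ∧ IsGenRotation T (between T M (elim M A)) M σ ∧ Undissectable T σ := by
  have hg := hA.isGenRotation subset_rfl hM hN hd hM.2 hN.2
  have hMA := elim_mat subset_rfl hM hg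
  have hM' := elim_mat subset_rfl hM hσ
  have hsub : σ.toFinset ⊆ A.toFinset := by
    rintro ⟨x, y⟩ he
    obtain ⟨y', hy'⟩ := (hL _).1 (hσL _ he)
    rwa [hM.uniqX (hσ.mem he) (hg.mem hy')]
  have hsame : ∀ {a b}, a ∈ A.toFinset → b ∈ A.toFinset → (a.1, b.2) ∈ between T M N →
      (a.1, b.2) ∈ between T M (elim M A) := by
    intro a b ha hb h
    obtain ⟨h1, ⟨⟨x', hx', h2⟩, h3⟩, h4, h5⟩ := (mem_between hM hN).1 h
    refine (mem_between hM hMA).2 ⟨h1, ⟨⟨x', ?_, h2⟩, h3⟩, h4, fun y' hy' => ?_⟩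
    · obtain ⟨c, hl⟩ := exists_link_right hb
      have h6 := mem_shifted_of_link hl
      rw [hN.uniqY hx' (Finset.mem_sdiff.1 (hA.2.2.2 h6)).1]
      exact Finset.mem_union_right _ h6
    · obtain ⟨c, hl⟩ := exists_link_left ha
      rw [hMA.uniqX hy' (mem_elim_of_link hl)]
      exact h5 _ (Finset.mem_sdiff.1 (hA.2.2.2 (mem_shifted_of_link hl))).1
  have hb : IsGenRotation T (between T M (elim M A)) M σ := by
    refine IsGenRotation.of_links (between_subset _ _) hσ.1 hσ.2.1 fun a b hl => ⟨?_, ?_,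
      hσ.mem (mem_links_left hl), hσ.ltY subset_rfl hl, hσ.ltX subset_rfl hl⟩
    · exact mem_between_of_dom hM hM hMA (Dom.refl _) (dom_elim subset_rfl hg)
        (hσ.mem (mem_links_left hl))
    · exact hsame (hsub (mem_links_left hl)) (hsub (mem_links_right hl))
        (Finset.mem_filter.1 (hsh (mem_shifted_of_link hl))).1
  refine ⟨hsub, hb, undissectable_of_atomic hM hσ ?_⟩
  have hdN := (dom_elim_between hM hg hb).trans (hA.dom_elim hM hN hd)
  intro V hV _ h1 h2
  refine hn.atomic hM hσ V hV ?_ h1 h2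
  rintro ⟨x, y⟩ he
  by_cases hxM : (x, y) ∈ M
  · exact Finset.mem_union_right _ hxM
  refine Finset.mem_union_left _ (Finset.mem_filter.2 ⟨mem_between_of_dom hM hV hN h1
    (h2.trans hdN) he, ?_⟩)
  obtain ⟨m, _, h3, _, h4, _⟩ := h1.2 _ _ he
  have hxm : (x, m) ∈ σ.toFinset := by
    by_contra hc
    have := h2.leX hM' he (mem_elim.2 (Or.inl ⟨h3, hc⟩))
    have e := rkX_inj (hM.edge h3) (le_antisymm h4 this)
    exact hxM (e ▸ h3)
  exact hσL (x, m) hxm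

end Lockstep

/-- The configuration in which the rotations of `E₀` up to `N` have been dissected as far as `M`. -/
structure Dissecting (T : Inst p q) (E₀ MX M N : Table p q) (l : List (Rotation p q)) (E : Table p q)
    (Q : Finset (Rotation p q)) : Prop where
  reach : ∃ c, IsStart T E₀ c ∧ Relation.ReflTransGen (Step T) c (.running .X E Q)
  seq : ElimSeq T E₀ MX l N
  mat : Mat T M
  above : Dom T MX M
  below : Dom T M N
  queue : ∀ σ, σ ∈ Q ↔ IsAltCycle M N σ ∨ (σ ∈ rotations T E₀ ∧ σ ∉ l)
  xopt : ∀ K, IsXOptimal T E₀ K → IsXOptimal T E K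
  yopt : ∀ K, IsYOptimal T E₀ K → IsYOptimal T E K
  sub : M ⊆ E
  sub₀ : E₀ ⊆ E

section Phase

variable {T : Inst p q} {E₀ MX : Table p q}

theorem exists_start (hE : E₀ ⊆ T.edges) (hs : IsStableTable T E₀) (hX : IsXOptimal T E₀ MX) :
    ∃ Q, Dissecting T E₀ MX MX MX [] E₀ Q := by
  obtain ⟨MY, hY⟩ := exists_isYOptimal hE hs
  have hY' := (isYOptimal_iff hE).1 hY
  obtain ⟨l, hl⟩ := exists_elimSeq hE hs hX.1 hY'.1 (hY'.2 _ hX.1)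
  have hrot : ∀ σ, σ ∈ l.toFinset ↔ σ ∈ rotations T E₀ := fun σ => by
    rw [List.mem_toFinset]
    exact ⟨hl.rotation_of_mem, hl.mem_of_rotation hE hs hX hY⟩
  refine ⟨l.toFinset, ⟨_, ⟨l.toFinset, hrot, rfl⟩, .refl⟩, ElimSeq.nil _, stable_mat hE hX.1,
    Dom.refl _, Dom.refl _, fun σ => ?_, fun K h => h, fun K h => h, hX.1.1.2, subset_rfl⟩
  rw [hrot]
  constructor
  · exact fun h => Or.inr ⟨h, List.not_mem_nil⟩
  · rintro (h | h)
    · obtain ⟨a, ha⟩ := toFinset_nonempty h.1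
      simpa using h.2.2.1 ha
    · exact h.1

variable {M N E : Table p q} {l : List (Rotation p q)} {Q : Finset (Rotation p q)}

theorem Dissecting.inv (hE : E₀ ⊆ T.edges) (hs : IsStableTable T E₀)
    (h : Dissecting T E₀ MX M N l E Q) : Inv T E Q := by
  obtain ⟨c, hc, hr⟩ := h.reach
  exact ((Good.start hE hs hc).reach hr).1

/-- Passing to the next rotation of `E₀`. -/
theorem Dissecting.next (hE : E₀ ⊆ T.edges) (hs : IsStableTable T E₀)
    (h : Dissecting T E₀ MX N N l E Q) {σ : Rotation p q} (hσ : IsRotation T E₀ N σ) :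
    Dissecting T E₀ MX N (elim N σ) (l ++ [σ]) E Q := by
  have hseq := h.seq.append (ElimSeq.cons _ _ _ _ hσ (ElimSeq.nil _))
  refine ⟨h.reach, hseq, h.mat, h.above, dom_elim hE hσ.2.1, fun τ => ?_, h.xopt, h.yopt, h.sub,
    h.sub₀⟩
  have hnd := hseq.nodup hE hs
  have hn : σ ∉ l := fun h' => (List.nodup_append.1 hnd).2.2 σ h' σ (by simp) rfl
  have hno : ¬ IsAltCycle N N τ := by
    intro h'
    obtain ⟨a, ha⟩ := toFinset_nonempty h'.1
    simpa using h'.2.2.1 ha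
  have hr : σ ∈ rotations T E₀ := ⟨N, hσ⟩
  rw [h.queue, isAltCycle_elim_self h.mat (hσ.genEdges hE), List.mem_append, List.mem_singleton]
  by_cases e : τ = σ
  · subst e; simp [hn, hr]
  · simp [e, hno]

/-- An undissectable rotation of the queue is kept. -/
theorem reach_keep {c : Config p q} (h : Relation.ReflTransGen (Step T) c (.running .X E Q))
    (hi : Inv T E Q) {σ : Rotation p q} (hσ : σ ∈ Q) (hu : Undissectable T σ) :
    Relation.ReflTransGen (Step T) c (.running .X E (Q.erase σ)) :=
  h.tail (Step.keep .X E Q σ {σ} hσ (hu.dissectRotation hi.edges hi.stable (hi.queue σ hσ)) (by simp))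

/-- Splitting off the next rotation inside a cycle. -/
theorem Dissecting.refine (hE : E₀ ⊆ T.edges) (hs : IsStableTable T E₀) (hX : IsXOptimal T E₀ MX)
    (h : Dissecting T E₀ MX M N l E Q) {A σ : Rotation p q} (hA : IsAltCycle M N A)
    {L : Finset (Fin p)} (hL : ∀ x, x ∈ L ↔ ∃ y, (x, y) ∈ A.toFinset)
    (hσ : IsGenRotation T T.edges M σ) (hsh : shifted σ ⊆ cycleTable T M N L)
    (hσL : ∀ e ∈ σ.toFinset, e.1 ∈ L) (hn : Next T (cycleTable T M N L) M (elim M σ)) :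
    ∃ Q', Dissecting T E₀ MX (elim M σ) N l (E ∪ elim M σ) Q' ∧ Dom T (elim M σ) N := by
  have hNs := h.seq.stable hE hs hX.1
  have hN := stable_mat hE hNs
  have hM := h.mat
  have hd := h.below
  have hgA := hA.isGenRotation subset_rfl hM hN hd hM.2 hN.2
  obtain ⟨hsub, hb, hu⟩ := undissectable_of_cycleTable hM hN hd hA hL hσ hsh hσL hn
  have hd1 := dom_elim_between hM hgA hb
  have hdN := hd1.trans (hA.dom_elim hM hN hd)
  have hi := h.inv hE hs
  have hAQ : A ∈ Q := (h.queue A).2 (Or.inl hA)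
  have hM' := elim_mat subset_rfl hM hσ
  have hMA := elim_mat subset_rfl hM hgA
  have passed : ∀ {τ : Rotation p q}, IsGenRotation T T.edges M τ → Dom T (elim M τ) N →
      ¬ (τ ∈ rotations T E₀ ∧ τ ∉ l) := by
    rintro τ hτ hτN ⟨⟨K, hK⟩, hτl⟩
    obtain ⟨a, ha⟩ := toFinset_nonempty hτ.1
    obtain ⟨b, hab⟩ := exists_link_left ha
    obtain ⟨m, _, h1, _, h2, _⟩ := h.above.2 _ _ (hτ.mem ha)
    obtain ⟨n, _, h3, _, h4, _⟩ := hτN.1 _ _ (mem_elim_of_link hab)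
    exact hτl (h.seq.mem_of_passed hE hs hX.1 hK hab h1 h2 h3 h4)
  have hAp := passed hgA (hA.dom_elim hM hN hd)
  have hσp := passed hσ hdN
  have hab := h.above.trans (dom_elim subset_rfl hσ)
  obtain ⟨c, hc, hr⟩ := h.reach
  have hNE : N ⊆ E := hNs.1.2.trans h.sub₀
  by_cases e : σ = A
  · subst e
    have hsubE : elim M σ ⊆ E := hA.elim_subset.trans (Finset.union_subset h.sub hNE)
    rw [Finset.union_eq_left.2 hsubE]
    refine ⟨Q.erase σ, ⟨⟨c, hc, reach_keep hr hi hAQ hu⟩, h.seq, hM', hab, hdN, fun τ => ?_, h.xopt,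
      h.yopt, hsubE, h.sub₀⟩, hdN⟩
    rw [Finset.mem_erase, h.queue, hA.elim_iff hM hN]
    by_cases e : τ = σ
    · subst e
      simp only [ne_eq, not_true_eq_false, false_and, and_false, false_or, false_iff]
      exact hAp
    · simp [e]
  · have h₁ := (isGenRotation_between_iff hM hgA).1 hb
    obtain ⟨R, M₀, hD, hR2, hr₀, hb₀, hR⟩ :=
      exists_dissectRotation hi.edges hi.stable (hi.queue A hAQ) e h₁
    have hM₀ := stable_mat hi.edges hr₀.1
    have hcongr : ∀ τ, τ ∈ R ↔ τ = σ ∨ IsAltCycle (elim M σ) (elim M A) τ := fun τ => by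
      rw [hR, isAltCycle_elim_elim_congr hM hM₀ hgA (hr₀.genEdges hi.edges) hσ
        (hb₀.mono (between_subset _ _)) hsub]
    have hMAE : elim M A ⊆ E := hA.elim_subset.trans (Finset.union_subset h.sub hNE)
    have hEq : E ∪ R.biUnion rotEdges = E ∪ elim M σ := by
      apply Finset.Subset.antisymm
      · refine Finset.union_subset Finset.subset_union_left fun e he => ?_
        obtain ⟨τ, hτ, he⟩ := Finset.mem_biUnion.1 he
        rw [Finset.mem_union]
        rcases (hcongr τ).1 hτ with rfl | hτ
        · rcases Finset.mem_union.1 he with he | he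
          · exact Or.inl (h.sub (hσ.mem he))
          · exact Or.inr (Finset.mem_union_right _ he)
        · rcases Finset.mem_union.1 he with he | he
          · exact Or.inr (Finset.mem_sdiff.1 (hτ.2.2.1 he)).1
          · exact Or.inl (hMAE (Finset.mem_sdiff.1 (hτ.2.2.2 he)).1)
      · refine Finset.union_subset Finset.subset_union_left fun e he => ?_
        rcases Finset.mem_union.1 he with he | he
        · exact Finset.mem_union_left _ (h.sub (Finset.mem_sdiff.1 he).1)
        · exact Finset.mem_union_right _ (Finset.mem_biUnion.2 ⟨σ, (hcongr σ).2 (Or.inl rfl),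
            Finset.mem_union_right _ he⟩)
    have hr' := hr.tail (Step.dissect .X E Q A R hAQ hD hR2)
    have hi' : Inv T (E ∪ R.biUnion rotEdges) (Q.erase A ∪ R) :=
      ((Good.start hE hs hc).reach hr').1
    have hσR : σ ∈ Q.erase A ∪ R := Finset.mem_union_right _ ((hcongr σ).2 (Or.inl rfl))
    have hr'' := reach_keep hr' hi' hσR hu
    rcases dissect_spec hi.edges hi.stable (hi.queue A hAQ) hD with ⟨rfl, _⟩ | hspec
    · simp at hR2
    obtain ⟨-, -, -, -, -, -, s1, s2⟩ := hspec
    rw [hEq] at hr'' s1 s2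
    refine ⟨_, ⟨⟨c, hc, hr''⟩, h.seq, hM', hab, hdN, fun τ => ?_, fun K hK => s1 K (h.xopt K hK),
      fun K hK => s2 K (h.yopt K hK), Finset.subset_union_right,
      h.sub₀.trans Finset.subset_union_left⟩, hdN⟩
    have n1 : ¬ IsAltCycle (elim M σ) (elim M A) σ := fun h' => IsAltCycle.of_elim_ne hM hσ h' rfl
    have n2 : ¬ IsAltCycle M N σ := by
      intro h'
      obtain ⟨a, ha⟩ := toFinset_nonempty hσ.1
      exact e (h'.eq_of_common hM hN hA ha (hsub ha))
    rw [isAltCycle_elim_iff hM hN hd hA hσ hsub hd1, Finset.mem_erase, Finset.mem_union,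
      Finset.mem_erase, hcongr, h.queue]
    by_cases e1 : τ = σ
    · subst e1
      simp only [n1, n2, ne_eq, not_true_eq_false, false_and, or_false, false_or, false_iff]
      exact hσp
    · by_cases e2 : τ = A
      · subst e2
        simp [e1, hAp]
      · simp only [e1, e2, ne_eq, not_false_eq_true, true_and, and_true, false_or]
        tauto

/-- When no rotation of `E₀` is left, the queue is empty. -/
theorem Dissecting.finish (hE : E₀ ⊆ T.edges) (hs : IsStableTable T E₀) (hX : IsXOptimal T E₀ MX)
    (h : Dissecting T E₀ MX N N l E Q) (ha : Alive T E₀ N ∅) : Q = ∅ ∧ IsYOptimal T E₀ N := by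
  have hNs := h.seq.stable hE hs hX.1
  obtain ⟨MY, hY⟩ := exists_isYOptimal hE hs
  have hY' := (isYOptimal_iff hE).1 hY
  have hMY : MY = N := ha.eq_of_empty h.mat (stable_mat hE hY'.1)
    (hY'.1.1.2.trans Finset.subset_union_left) (hY'.2 _ hNs)
  subst hMY
  refine ⟨Finset.eq_empty_of_forall_notMem fun σ hσ => ?_, hY⟩
  rcases (h.queue σ).1 hσ with h' | ⟨h', hn⟩
  · obtain ⟨a, ha⟩ := toFinset_nonempty h'.1
    simpa using h'.2.2.1 ha
  · exact hn (h.seq.mem_of_rotation hE hs hX hY h')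

end Phase

/-! ### Extending the chain at its two ends -/

section Extend

variable {T : Inst p q} {E₀ : Table p q}

/-- The chain is being extended downwards from `M`. -/
structure Descending (T : Inst p q) (E₀ MX M E : Table p q) : Prop where
  reach : ∃ c, IsStart T E₀ c ∧ Relation.ReflTransGen (Step T) c (.running .X E ∅)
  xopt : IsXOptimal T E MX
  yopt : IsYOptimal T E M

/-- The chain is being extended upwards from `M`. -/
structure Ascending (T : Inst p q) (E₀ M E : Table p q) : Prop where
  reach : ∃ c, IsStart T E₀ c ∧ Relation.ReflTransGen (Step T) c (.running .Y E ∅)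
  xopt : IsXOptimal T E M

theorem Descending.step (hE : E₀ ⊆ T.edges) (hs : IsStableTable T E₀) {MX M E : Table p q}
    (h : Descending T E₀ MX M E) {σ : Rotation p q} (hσ : IsGenRotation T T.edges M σ)
    (hn : Next T T.edges M (elim M σ)) : Descending T E₀ MX (elim M σ) (E ∪ elim M σ) := by
  obtain ⟨c, hc, hr⟩ := h.reach
  have hi : Inv T E ∅ := ((Good.start hE hs hc).reach hr).1
  have hM' := (isYOptimal_iff hi.edges).1 h.yopt
  have hM := stable_mat hi.edges hM'.1
  obtain ⟨-, -, -, -, -, g1, g2⟩ := grow_spec hi.edges hi.stable h.yopt hσ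
  have hEq : E ∪ rotEdges σ = E ∪ elim M σ := by
    ext e
    have a1 := hσ.mem (a := e)
    have a2 := @hM'.1.1.2 e
    simp only [rotEdges, elim, Finset.mem_union, Finset.mem_sdiff]
    tauto
  have hu : Undissectable T σ := by
    refine undissectable_of_atomic hM hσ ?_
    have := hn.atomic hM hσ
    rwa [Finset.union_eq_left.2 hM.2] at this
  have hr' := hr.tail (Step.growX E M σ h.yopt hσ)
  have hi' : Inv T (E ∪ rotEdges σ) {σ} := ((Good.start hE hs hc).reach hr').1
  have hr'' := reach_keep hr' hi' (Finset.mem_singleton_self σ) hu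
  rw [hEq] at hr'' g1 g2
  rw [Finset.erase_singleton] at hr''
  exact ⟨⟨c, hc, hr''⟩, g1 _ h.xopt, g2⟩

theorem Descending.done {MX M E : Table p q} (hE : E₀ ⊆ T.edges) (hs : IsStableTable T E₀)
    (h : Descending T E₀ MX M E) (ha : Alive T T.edges M ∅) : Ascending T E₀ MX E := by
  obtain ⟨c, hc, hr⟩ := h.reach
  have hi : Inv T E ∅ := ((Good.start hE hs hc).reach hr).1
  have hM := stable_mat hi.edges ((isYOptimal_iff hi.edges).1 h.yopt).1
  refine ⟨⟨c, hc, hr.tail (Step.doneX E M h.yopt ?_)⟩, h.xopt⟩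
  rintro ⟨ρ, hρ⟩
  have hV := elim_mat subset_rfl hM hρ
  exact elim_ne subset_rfl hM hρ (ha.eq_of_empty hM hV (hV.2.trans Finset.subset_union_left)
    (dom_elim subset_rfl hρ)).symm

theorem Ascending.step (hE : E₀ ⊆ T.edges) (hs : IsStableTable T E₀) {M E : Table p q}
    (h : Ascending T E₀ M E) {τ : Rotation q p} (hτ : IsGenRotation T.swap T.swap.edges M.swap τ)
    (hn : Next T.swap T.swap.edges M.swap (elim M.swap τ)) :
    Ascending T E₀ (elim M.swap τ).swap (E ∪ (elim M.swap τ).swap) := by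
  obtain ⟨c, hc, hr⟩ := h.reach
  have hi : Inv T E ∅ := ((Good.start hE hs hc).reach hr).1
  have hM := stable_mat hi.edges h.xopt.1
  have hMs := mat_swap.2 hM
  obtain ⟨-, -, -, -, -, -, g2⟩ := growY_spec hi.edges hi.stable h.xopt hτ
  have hEq : E ∪ (rotEdges τ).swap = E ∪ (elim M.swap τ).swap := by
    ext ⟨x, y⟩
    have a1 : (y, x) ∈ τ.toFinset → (x, y) ∈ M := fun h' => mem_swap.1 (hτ.mem h')
    have a2 := @h.xopt.1.1.2 (x, y)
    simp only [rotEdges, elim, Finset.mem_union, Finset.mem_sdiff, mem_swap]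
    tauto
  have hu : Undissectable T (undo τ) := by
    refine undissectable_undo hM hτ ?_
    have := hn.atomic hMs hτ
    rwa [Finset.union_eq_left.2 hMs.2] at this
  have hr' := hr.tail (Step.growY E M τ h.xopt hτ)
  have hi' : Inv T (E ∪ (rotEdges τ).swap) {undo τ} := ((Good.start hE hs hc).reach hr').1
  have hr'' := hr'.tail (Step.keep .Y _ _ (undo τ) {undo τ} (Finset.mem_singleton_self _)
    (hu.dissectRotation hi'.edges hi'.stable (hi'.queue _ (Finset.mem_singleton_self _))) (by simp))
  rw [hEq] at hr'' g2
  rw [Finset.erase_singleton] at hr''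
  exact ⟨⟨c, hc, hr''⟩, g2⟩

theorem Ascending.done {M E : Table p q} (hE : E₀ ⊆ T.edges) (hs : IsStableTable T E₀)
    (h : Ascending T E₀ M E) (ha : Alive T.swap T.swap.edges M.swap ∅) : Outputs T E₀ E := by
  obtain ⟨c, hc, hr⟩ := h.reach
  have hi : Inv T E ∅ := ((Good.start hE hs hc).reach hr).1
  have hM := mat_swap.2 (stable_mat hi.edges h.xopt.1)
  refine ⟨c, hc, hr.tail (Step.doneY E M h.xopt ?_)⟩
  rintro ⟨ρ, hρ⟩
  have hV := elim_mat subset_rfl hM hρ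
  exact elim_ne subset_rfl hM hρ (ha.eq_of_empty hM hV (hV.2.trans Finset.subset_union_left)
    (dom_elim subset_rfl hρ)).symm

end Extend

end Marriage

namespace Marriage

@[simp]
theorem RAMState.setVar_self (s : RAMState) (v n : ℕ) : (s.setVar v n).var v = n := by
  simp [RAMState.setVar]

theorem RAMState.setVar_ne (s : RAMState) {v w : ℕ} (n : ℕ) (h : w ≠ v) :
    (s.setVar v n).var w = s.var w := by
  simp [RAMState.setVar, h]

@[simp]
theorem RAMState.setVar_arr (s : RAMState) (v n : ℕ) : (s.setVar v n).arr = s.arr := rfl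

@[simp]
theorem RAMState.setArr_var (s : RAMState) (a i n : ℕ) : (s.setArr a i n).var = s.var := rfl

theorem RAMState.setArr_ne (s : RAMState) {a b : ℕ} (i n : ℕ) (h : b ≠ a) :
    (s.setArr a i n).arr b = s.arr b := by
  simp [RAMState.setArr, h]

theorem RAMState.setArr_arr (s : RAMState) (a i n j : ℕ) :
    (s.setArr a i n).arr a j = if j = i then n else s.arr a j := by
  simp [RAMState.setArr, Function.update_apply]

theorem Expr.eval_lt_ne {e f : Expr} {s : RAMState} :
    (Expr.lt e f).eval s ≠ 0 ↔ e.eval s < f.eval s := by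
  simp [Expr.eval]

theorem Expr.eval_eq_ne {e f : Expr} {s : RAMState} :
    (Expr.eq e f).eval s ≠ 0 ↔ e.eval s = f.eval s := by
  simp [Expr.eval]

/-! ### Bounded loops

Programs whose loops run over `0, …, n - 1` for one of the variables `n = 0, 1`, with a total semantics. -/

inductive FProg
  | skip
  | assign (v : ℕ) (e : Expr)
  | store (a : ℕ) (i e : Expr)
  | seq (c d : FProg)
  | cond (e : Expr) (c d : FProg)
  | upto (v n : ℕ) (c : FProg)

namespace FProg

def compile : FProg → Prog
  | skip => .skip
  | assign v e => .assign v e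
  | store a i e => .store a i e
  | seq c d => .seq c.compile d.compile
  | cond e c d => .cond e c.compile d.compile
  | .upto v n c => .seq (.assign v (.const 0)) (.loop (.lt (.var v) (.var n))
      (.seq c.compile (.assign v (.add (.var v) (.const 1)))))

/-- The states at the beginning of the rounds of a loop. -/
def rounds (f : RAMState → RAMState) (v : ℕ) (s : RAMState) : ℕ → RAMState
  | 0 => s.setVar v 0
  | i + 1 => (f (rounds f v s i)).setVar v (i + 1)

def run : FProg → RAMState → RAMState
  | skip, s => s
  | assign v e, s => s.setVar v (e.eval s)
  | store a i e, s => s.setArr a (i.eval s) (e.eval s)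
  | seq c d, s => d.run (c.run s)
  | cond e c d, s => if e.eval s ≠ 0 then c.run s else d.run s
  | .upto v n c, s => rounds c.run v s (s.var n)

theorem run_cond_pos {e : Expr} {c d : FProg} {s : RAMState} (h : e.eval s ≠ 0) :
    (cond e c d).run s = c.run s := if_pos h

theorem run_cond_neg {e : Expr} {c d : FProg} {s : RAMState} (h : ¬ e.eval s ≠ 0) :
    (cond e c d).run s = d.run s := if_neg h

def writesVar : FProg → ℕ → Bool
  | skip, _ => false
  | assign v _, w => v == w
  | store _ _ _, _ => false
  | seq c d, w => c.writesVar w || d.writesVar w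
  | cond _ c d, w => c.writesVar w || d.writesVar w
  | .upto v _ c, w => v == w || c.writesVar w

def writesArr : FProg → ℕ → Bool
  | skip, _ => false
  | assign _ _, _ => false
  | store a _ _, b => a == b
  | seq c d, w => c.writesArr w || d.writesArr w
  | cond _ c d, w => c.writesArr w || d.writesArr w
  | .upto _ _ c, w => c.writesArr w

/-- The loops run up to the variables 0 and 1, which are never written, and the body of a loop does not
write its counter. -/
def wf : FProg → Bool
  | skip => true
  | assign v _ => 2 ≤ v
  | store _ _ _ => true
  | seq c d => c.wf && d.wf
  | cond _ c d => c.wf && d.wf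
  | .upto v n c => 2 ≤ v && n < 2 && c.wf && !c.writesVar v

def depth : FProg → ℕ
  | skip => 0
  | assign _ _ => 0
  | store _ _ _ => 0
  | seq c d => max c.depth d.depth
  | cond _ c d => max c.depth d.depth
  | .upto _ _ c => c.depth + 1

/-- The factor in the bound for the running time. -/
def factor : FProg → ℕ
  | skip => 1
  | assign _ e => e.cost + 1
  | store _ i e => i.cost + e.cost + 1
  | seq c d => c.factor + d.factor
  | cond e c d => e.cost + 1 + c.factor + d.factor
  | .upto _ _ c => c.factor + 14

theorem run_var (c : FProg) {w : ℕ} (h : c.writesVar w = false) (s : RAMState) :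
    (c.run s).var w = s.var w := by
  induction c generalizing s with
  | skip => rfl
  | assign v e =>
    have : w ≠ v := by rintro rfl; simp [writesVar] at h
    simp [run, RAMState.setVar, this]
  | store a i e => rfl
  | seq c d ihc ihd =>
    simp only [writesVar, Bool.or_eq_false_iff] at h
    rw [run, ihd h.2, ihc h.1]
  | cond e c d ihc ihd =>
    simp only [writesVar, Bool.or_eq_false_iff] at h
    rw [run]
    split_ifs
    exacts [ihc h.1 s, ihd h.2 s]
  | upto v n c ih =>
    simp only [writesVar, Bool.or_eq_false_iff] at h
    have hv : w ≠ v := by rintro rfl; simp at h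
    rw [run]
    induction s.var n with
    | zero => simp [rounds, RAMState.setVar, hv]
    | succ i ihi =>
      rw [rounds, RAMState.setVar_ne _ _ hv, ih h.2, ihi]

theorem run_arr (c : FProg) {a : ℕ} (h : c.writesArr a = false) (s : RAMState) :
    (c.run s).arr a = s.arr a := by
  induction c generalizing s with
  | skip => rfl
  | assign v e => rfl
  | store b i e =>
    have : a ≠ b := by rintro rfl; simp [writesArr] at h
    simp [run, RAMState.setArr, this]
  | seq c d ihc ihd =>
    simp only [writesArr, Bool.or_eq_false_iff] at h
    rw [run, ihd h.2, ihc h.1]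
  | cond e c d ihc ihd =>
    simp only [writesArr, Bool.or_eq_false_iff] at h
    rw [run]
    split_ifs
    exacts [ihc h.1 s, ihd h.2 s]
  | upto v n c ih =>
    rw [run]
    induction s.var n with
    | zero => rfl
    | succ i ihi =>
      rw [rounds, RAMState.setVar_arr, ih h, ihi]

/-- The invariant rule for loops. -/
theorem run_upto {v n : ℕ} {c : FProg} {s : RAMState} (I : ℕ → RAMState → Prop)
    (h0 : I 0 (s.setVar v 0))
    (hs : ∀ i t, i < s.var n → t.var v = i →
      (∀ w, w ≠ v → c.writesVar w = false → t.var w = s.var w) →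
      (∀ a, c.writesArr a = false → t.arr a = s.arr a) → I i t →
      I (i + 1) ((c.run t).setVar v (i + 1))) : I (s.var n) ((FProg.upto v n c).run s) := by
  have key : ∀ i, i ≤ s.var n → (rounds c.run v s i).var v = i ∧
      (∀ w, w ≠ v → c.writesVar w = false → (rounds c.run v s i).var w = s.var w) ∧
      (∀ a, c.writesArr a = false → (rounds c.run v s i).arr a = s.arr a) ∧
      I i (rounds c.run v s i) := by
    intro i
    induction i with
    | zero =>
      intro _
      refine ⟨by simp [rounds, RAMState.setVar], fun w hw _ => ?_, fun a _ => rfl, h0⟩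
      simp [rounds, RAMState.setVar, hw]
    | succ i ih =>
      intro hi
      obtain ⟨h1, h2, h3, h4⟩ := ih (by omega)
      refine ⟨by simp [rounds, RAMState.setVar], fun w hw hc => ?_, fun a ha => ?_,
        hs i _ (by omega) h1 h2 h3 h4⟩
      · rw [rounds, RAMState.setVar_ne _ _ hw, c.run_var hc, h2 w hw hc]
      · rw [rounds, RAMState.setVar_arr, c.run_arr ha, h3 a ha]
  exact (key _ le_rfl).2.2.2

theorem writesVar_of_wf {c : FProg} (h : c.wf = true) {w : ℕ} (hw : w < 2) :
    c.writesVar w = false := by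
  induction c with
  | skip => rfl
  | assign v e => simp [wf] at h; simp [FProg.writesVar]; omega
  | store a i e => rfl
  | seq c d ihc ihd =>
    simp only [wf, Bool.and_eq_true] at h
    simp [FProg.writesVar, ihc h.1, ihd h.2]
  | cond e c d ihc ihd =>
    simp only [wf, Bool.and_eq_true] at h
    simp [FProg.writesVar, ihc h.1, ihd h.2]
  | upto v n c ih =>
    simp only [wf, Bool.and_eq_true, decide_eq_true_eq] at h
    simp only [FProg.writesVar, ih h.1.2, Bool.or_false, beq_eq_false_iff_ne]
    omega

/-- The compiled program does what the semantics says, in polynomial time. -/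
theorem exec_compile (c : FProg) (h : c.wf = true) {b : ℕ} (s : RAMState) (h0 : s.var 0 ≤ b)
    (h1 : s.var 1 ≤ b) :
    ∃ t, t ≤ c.factor * (b + 1) ^ c.depth ∧ Exec c.compile s (c.run s) t := by
  have mono : ∀ {k m n : ℕ}, m ≤ n → k * (b + 1) ^ m ≤ k * (b + 1) ^ n := fun hmn =>
    Nat.mul_le_mul_left _ (Nat.pow_le_pow_right (by omega) hmn)
  have one : ∀ n, 1 ≤ (b + 1) ^ n := fun n => Nat.one_le_pow _ _ (by omega)
  induction c generalizing s with
  | skip => exact ⟨1, by simp [factor, depth], Exec.skip s⟩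
  | assign v e => exact ⟨_, by simp [factor, depth], Exec.assign s v e⟩
  | store a i e => exact ⟨_, by simp [factor, depth], Exec.store s a i e⟩
  | seq c d ihc ihd =>
    simp only [wf, Bool.and_eq_true] at h
    obtain ⟨t, ht, hc⟩ := ihc h.1 s h0 h1
    obtain ⟨t', ht', hd⟩ := ihd h.2 (c.run s) (by rwa [c.run_var (writesVar_of_wf h.1 (by omega))])
      (by rwa [c.run_var (writesVar_of_wf h.1 (by omega))])
    refine ⟨t + t', ?_, Exec.seq _ _ _ _ _ _ _ hc hd⟩
    rw [factor, depth, add_mul]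
    exact add_le_add (ht.trans (mono (le_max_left _ _))) (ht'.trans (mono (le_max_right _ _)))
  | cond e c d ihc ihd =>
    simp only [wf, Bool.and_eq_true] at h
    have k1 : e.cost + 1 ≤ (e.cost + 1) * (b + 1) ^ max c.depth d.depth :=
      Nat.le_mul_of_pos_right _ (one _)
    by_cases he : e.eval s ≠ 0
    · obtain ⟨t, ht, hc⟩ := ihc h.1 s h0 h1
      refine ⟨e.cost + 1 + t, ?_, ?_⟩
      · have := ht.trans (mono (le_max_left c.depth d.depth))
        rw [factor, depth, add_mul, add_mul]
        omega
      · rw [run, if_pos he]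
        exact Exec.condTrue _ _ _ _ _ _ he hc
    · obtain ⟨t, ht, hc⟩ := ihd h.2 s h0 h1
      refine ⟨e.cost + 1 + t, ?_, ?_⟩
      · have := ht.trans (mono (le_max_right c.depth d.depth))
        rw [factor, depth, add_mul, add_mul]
        omega
      · rw [run, if_neg he]
        exact Exec.condFalse _ _ _ _ _ _ (not_not.1 he) hc
  | upto v n c ih =>
    simp only [wf, Bool.and_eq_true, decide_eq_true_eq, Bool.not_eq_true'] at h
    obtain ⟨⟨⟨hv, hn⟩, hc⟩, hw⟩ := h
    have hnv : n ≠ v := by omega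
    have hnb : s.var n ≤ b := by
      interval_cases n <;> assumption
    have fr : ∀ i, (rounds c.run v s i).var v = i ∧ ∀ w < 2, (rounds c.run v s i).var w = s.var w := by
      intro i
      induction i with
      | zero =>
        refine ⟨by simp [rounds, RAMState.setVar], fun w hw => ?_⟩
        have : w ≠ v := by omega
        simp [rounds, RAMState.setVar, this]
      | succ i ihi =>
        refine ⟨by simp [rounds, RAMState.setVar], fun w hw => ?_⟩
        have : w ≠ v := by omega
        rw [rounds, RAMState.setVar_ne _ _ this, c.run_var (writesVar_of_wf hc hw), ihi.2 w hw]
    set D := c.factor * (b + 1) ^ c.depth with hD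
    have body : ∀ j, j ≤ s.var n → ∃ t, t ≤ j * (D + 8) + 4 ∧
        Exec (.loop (.lt (.var v) (.var n)) (.seq c.compile (.assign v (.add (.var v) (.const 1)))))
          (rounds c.run v s (s.var n - j)) (rounds c.run v s (s.var n)) t := by
      intro j
      induction j with
      | zero =>
        intro _
        refine ⟨4, by omega, Exec.loopFalse _ _ _ ?_⟩
        rw [Nat.sub_zero]
        by_contra h'
        have := Expr.eval_lt_ne.1 h'
        rw [Expr.eval, Expr.eval, (fr _).1, (fr _).2 n hn] at this
        omega
      | succ j ihj =>
        intro hj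
        obtain ⟨t', ht', he'⟩ := ihj (by omega)
        set i := s.var n - (j + 1) with hi
        have hi' : s.var n - j = i + 1 := by omega
        obtain ⟨t, ht, he⟩ := ih hc (rounds c.run v s i) (by rw [(fr i).2 0 (by omega)]; exact h0)
          (by rw [(fr i).2 1 (by omega)]; exact h1)
        have hx : Exec (.assign v (.add (.var v) (.const 1))) (c.run (rounds c.run v s i))
            (rounds c.run v s (i + 1)) 4 := by
          have := Exec.assign (c.run (rounds c.run v s i)) v (.add (.var v) (.const 1))
          simp only [Expr.eval, Expr.cost] at this
          rwa [c.run_var hw, (fr i).1] at this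
        rw [hi'] at he'
        refine ⟨_, ?_, Exec.loopTrue _ _ _ _ _ _ _ ?_ (Exec.seq _ _ _ _ _ _ _ he hx) he'⟩
        · simp only [Expr.cost]
          rw [add_mul]
          omega
        · rw [Expr.eval_lt_ne, Expr.eval, Expr.eval, (fr _).1, (fr _).2 n hn]
          omega
    obtain ⟨t, ht, he⟩ := body (s.var n) le_rfl
    rw [Nat.sub_self] at he
    refine ⟨_, ?_, Exec.seq _ _ _ _ _ _ _ (Exec.assign s v (.const 0)) he⟩
    simp only [Expr.cost, factor, depth]
    have hb : s.var n * (D + 8) ≤ b * (D + 8) := Nat.mul_le_mul_right _ hnb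
    have e1 : (c.factor + 14) * (b + 1) ^ (c.depth + 1) =
        D * (b + 1) + 14 * ((b + 1) ^ c.depth * (b + 1)) := by rw [hD]; ring
    have e2 : b + 1 ≤ (b + 1) ^ c.depth * (b + 1) := Nat.le_mul_of_pos_left _ (one _)
    rw [e1]
    have e3 : D * (b + 1) = b * D + D := by ring
    have e4 : b * (D + 8) = b * D + 8 * b := by ring
    omega

/-! #### Renaming -/

def renameE (f g : ℕ → ℕ) : Expr → Expr
  | .const c => .const c
  | .var v => .var (f v)
  | .get a e => .get (g a) (renameE f g e)
  | .add e e' => .add (renameE f g e) (renameE f g e')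
  | .sub e e' => .sub (renameE f g e) (renameE f g e')
  | .lt e e' => .lt (renameE f g e) (renameE f g e')
  | .eq e e' => .eq (renameE f g e) (renameE f g e')

def rename (f g : ℕ → ℕ) : FProg → FProg
  | skip => skip
  | assign v e => assign (f v) (renameE f g e)
  | store a i e => store (g a) (renameE f g i) (renameE f g e)
  | seq c d => seq (c.rename f g) (d.rename f g)
  | cond e c d => cond (renameE f g e) (c.rename f g) (d.rename f g)
  | .upto v n c => .upto (f v) (f n) (c.rename f g)

end FProg

/-- The state seen under other names. -/
def RAMState.view (f g : ℕ → ℕ) (s : RAMState) : RAMState := ⟨s.var ∘ f, s.arr ∘ g⟩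

theorem RAMState.view_setVar {f : ℕ → ℕ} (hf : Function.Injective f) (g : ℕ → ℕ) (s : RAMState)
    (v n : ℕ) : (s.setVar (f v) n).view f g = (s.view f g).setVar v n := by
  simp only [RAMState.view, RAMState.setVar, RAMState.mk.injEq, and_true]
  exact Function.update_comp_eq_of_injective _ hf _ _

theorem RAMState.view_setArr (f : ℕ → ℕ) {g : ℕ → ℕ} (hg : Function.Injective g) (s : RAMState)
    (a i n : ℕ) : (s.setArr (g a) i n).view f g = (s.view f g).setArr a i n := by
  simp only [RAMState.view, RAMState.setArr, RAMState.mk.injEq, true_and]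
  exact Function.update_comp_eq_of_injective _ hg _ _

namespace FProg

theorem eval_renameE (f g : ℕ → ℕ) (e : Expr) (s : RAMState) :
    (renameE f g e).eval s = e.eval (s.view f g) := by
  induction e with
  | const c => rfl
  | var v => rfl
  | get a e ih => simp only [renameE, Expr.eval, ih]; rfl
  | add e e' ih ih' => simp only [renameE, Expr.eval, ih, ih']
  | sub e e' ih ih' => simp only [renameE, Expr.eval, ih, ih']
  | lt e e' ih ih' => simp only [renameE, Expr.eval, ih, ih']
  | eq e e' ih ih' => simp only [renameE, Expr.eval, ih, ih']

theorem run_rename {f g : ℕ → ℕ} (hf : Function.Injective f) (hg : Function.Injective g) (c : FProg)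
    (s : RAMState) : ((c.rename f g).run s).view f g = c.run (s.view f g) := by
  induction c generalizing s with
  | skip => rfl
  | assign v e => rw [rename, run, RAMState.view_setVar hf, eval_renameE]; rfl
  | store a i e => rw [rename, run, RAMState.view_setArr f hg, eval_renameE, eval_renameE]; rfl
  | seq c d ihc ihd => rw [rename, run, ihd, ihc]; rfl
  | cond e c d ihc ihd =>
    rw [rename, run, run, eval_renameE]
    split_ifs
    exacts [ihc s, ihd s]
  | upto v n c ih =>
    rw [rename, run, run]
    change RAMState.view f g (rounds _ _ _ (s.var (f n))) = rounds _ _ _ (s.var (f n))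
    induction s.var (f n) with
    | zero => exact RAMState.view_setVar hf g s v 0
    | succ i ihi => rw [rounds, rounds, RAMState.view_setVar hf, ih, ihi]

end FProg

end Marriage

namespace Marriage

variable {p q : ℕ}

/-! ### Expressions and codes -/

namespace Expr

def pred (e : Expr) : Expr := .sub e (.const 1)

def succ (e : Expr) : Expr := .add e (.const 1)

def not (e : Expr) : Expr := .eq e (.const 0)

def and (e f : Expr) : Expr := .lt (.const 1) (.add (.lt (.const 0) e) (.lt (.const 0) f))

def le (e f : Expr) : Expr := .lt e (succ f)

theorem eval_pred {e : Expr} {s : RAMState} : (pred e).eval s = e.eval s - 1 := rfl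

theorem eval_succ {e : Expr} {s : RAMState} : (succ e).eval s = e.eval s + 1 := rfl

theorem eval_not {e : Expr} {s : RAMState} : (not e).eval s ≠ 0 ↔ e.eval s = 0 := eval_eq_ne

theorem eval_and {e f : Expr} {s : RAMState} :
    (and e f).eval s ≠ 0 ↔ e.eval s ≠ 0 ∧ f.eval s ≠ 0 := by
  rw [and, eval_lt_ne]
  change 1 < (if 0 < e.eval s then 1 else 0) + (if 0 < f.eval s then 1 else 0) ↔ _
  split_ifs <;> omega

theorem eval_le {e f : Expr} {s : RAMState} : (le e f).eval s ≠ 0 ↔ e.eval s ≤ f.eval s := by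
  rw [le, eval_lt_ne, eval_succ]
  omega

theorem eval_add {e f : Expr} {s : RAMState} :
    (Expr.add e f).eval s ≠ 0 ↔ e.eval s ≠ 0 ∨ f.eval s ≠ 0 := by
  simp only [Expr.eval]
  omega

end Expr

/-- The array `a` holds the partners of the `x`, counted from 1. -/
def CodesM (a : ℕ → ℕ) (M : Table p q) : Prop :=
  ∀ x : Fin p, a x ≤ q ∧ ∀ y : Fin q, a x = y + 1 ↔ (x, y) ∈ M

/-- The array `a` holds the incidence matrix of `A`. -/
def CodesT (a : ℕ → ℕ) (A : Table p q) : Prop :=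
  ∀ (x : Fin p) (y : Fin q), a (x * q + y) = if (x, y) ∈ A then 1 else 0

/-- The array `a` holds the characteristic function of `L`. -/
def CodesS (a : ℕ → ℕ) (L : Finset (Fin p)) : Prop := ∀ x : Fin p, a x = if x ∈ L then 1 else 0

theorem CodesM.cases {a : ℕ → ℕ} {M : Table p q} (h : CodesM a M) (x : Fin p) :
    (a x = 0 ∧ ∀ y, (x, y) ∉ M) ∨ ∃ y : Fin q, a x = y + 1 ∧ (x, y) ∈ M := by
  obtain ⟨h1, h2⟩ := h x
  rcases Nat.eq_zero_or_pos (a x) with h0 | h0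
  · exact Or.inl ⟨h0, fun y hy => by have := (h2 y).2 hy; omega⟩
  · have : a x = (⟨a x - 1, by omega⟩ : Fin q) + 1 := by simp only; omega
    exact Or.inr ⟨_, this, (h2 _).1 this⟩

theorem CodesM.eq {a : ℕ → ℕ} {M : Table p q} (h : CodesM a M) {x : Fin p} {y : Fin q}
    (hy : (x, y) ∈ M) : a x = y + 1 := ((h x).2 y).2 hy

theorem CodesM.swap_eq {a : ℕ → ℕ} {M : Table p q} (h : CodesM a M.swap) {x : Fin p} {y : Fin q}
    (hy : (x, y) ∈ M) : a y = x + 1 := h.eq (mem_swap.2 hy)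

theorem CodesM.intro {a : ℕ → ℕ} {M : Table p q} (hM : ∀ x y y', (x, y) ∈ M → (x, y') ∈ M → y = y')
    (h : ∀ x : Fin p, (a x = 0 ∧ ∀ y, (x, y) ∉ M) ∨ ∃ y : Fin q, a x = y + 1 ∧ (x, y) ∈ M) :
    CodesM a M := by
  intro x
  rcases h x with ⟨h1, h2⟩ | ⟨y, h1, h2⟩
  · exact ⟨by omega, fun y => ⟨fun h => by omega, fun h => absurd h (h2 y)⟩⟩
  · refine ⟨by have := y.2; omega, fun y' => ⟨fun h => ?_, fun h => ?_⟩⟩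
    · have : y = y' := Fin.ext (by omega)
      exact this ▸ h2
    · rw [hM x y' y h h2, h1]

theorem CodesT.ne_zero {a : ℕ → ℕ} {A : Table p q} (h : CodesT a A) (x : Fin p) (y : Fin q) :
    a (x * q + y) ≠ 0 ↔ (x, y) ∈ A := by
  rw [h]
  split_ifs with h' <;> simp [h']

theorem CodesS.ne_zero {a : ℕ → ℕ} {L : Finset (Fin p)} (h : CodesS a L) (x : Fin p) :
    a x ≠ 0 ↔ x ∈ L := by
  rw [h]
  split_ifs with h' <;> simp [h']

theorem matrix_index_inj {x x' : Fin p} {y y' : Fin q}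
    (h : (x : ℕ) * q + y = x' * q + y') : x = x' ∧ y = y' := by
  have hq : 0 < q := y.pos
  have h1 : ((x : ℕ) * q + y) / q = x := by
    rw [Nat.mul_comm, Nat.mul_add_div hq, Nat.div_eq_of_lt y.2, Nat.add_zero]
  have h2 : ((x' : ℕ) * q + y') / q = x' := by
    rw [Nat.mul_comm, Nat.mul_add_div hq, Nat.div_eq_of_lt y'.2, Nat.add_zero]
  have h3 : (x : ℕ) = x' := by rw [← h1, h, h2]
  exact ⟨Fin.ext h3, Fin.ext (by rw [h3] at h; omega)⟩

/-- The data of the instance: the sizes, the offsets of the rows, and the ranks counted from 1. -/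
structure Base (T : Inst p q) (s : RAMState) : Prop where
  var0 : s.var 0 = p
  var1 : s.var 1 = q
  rowX : ∀ x : Fin p, s.arr 4 x = x * q
  rowY : ∀ y : Fin q, s.arr 5 y = y * p
  rankX : ∀ (x : Fin p) (y : Fin q),
    s.arr 6 (x * q + y) = if (x, y) ∈ T.edges then rkX T x y + 1 else 0
  rankY : ∀ (x : Fin p) (y : Fin q),
    s.arr 7 (y * p + x) = if (x, y) ∈ T.edges then rkY T y x + 1 else 0

theorem Base.congr {T : Inst p q} {s t : RAMState} (h : Base T s) (h0 : t.var 0 = s.var 0)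
    (h1 : t.var 1 = s.var 1) (h4 : t.arr 4 = s.arr 4) (h5 : t.arr 5 = s.arr 5)
    (h6 : t.arr 6 = s.arr 6) (h7 : t.arr 7 = s.arr 7) : Base T t :=
  ⟨h0.trans h.var0, h1.trans h.var1, h4 ▸ h.rowX, h5 ▸ h.rowY, h6 ▸ h.rankX, h7 ▸ h.rankY⟩

theorem Base.rankX_eq {T : Inst p q} {s : RAMState} (h : Base T s) {x : Fin p} {y : Fin q}
    (he : (x, y) ∈ T.edges) : s.arr 6 (x * q + y) = rkX T x y + 1 := by
  rw [h.rankX, if_pos he]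

theorem Base.rankY_eq {T : Inst p q} {s : RAMState} (h : Base T s) {x : Fin p} {y : Fin q}
    (he : (x, y) ∈ T.edges) : s.arr 7 (y * p + x) = rkY T y x + 1 := by
  rw [h.rankY, if_pos he]

/-! ### Choosing the best partner -/

/-- The entry of the matrix `a` at `x`, `e`. -/
def atX (a : ℕ) (e : Expr) : Expr := .get a (.add (.get 4 (.var 4)) e)

/-- The entry of the matrix `a` at `y`, `e`. -/
def atY (a : ℕ) (e : Expr) : Expr := .get a (.add (.get 5 (.var 5)) e)

open FProg in
/-- Find the best `y` for `x` that satisfies the condition `e`. -/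
def argmin (e : Expr) : FProg :=
  seq (assign 7 (.const 0)) (upto 5 1 (cond
    (.and e (.add (.not (.var 7)) (.lt (atX 6 (.var 5)) (atX 6 (.pred (.var 7))))))
    (assign 7 (.succ (.var 5))) skip))

theorem argmin_spec {T : Inst p q} {s : RAMState} (hB : Base T s) {e : Expr} {x : Fin p}
    (hx : s.var 4 = x) (P : Fin q → Prop) (hP : ∀ y, P y → (x, y) ∈ T.edges)
    (he : ∀ (t : RAMState) (y : Fin q), t.arr = s.arr → t.var 4 = x → t.var 5 = y →
      (e.eval t ≠ 0 ↔ P y)) :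
    (((argmin e).run s).var 7 = 0 ∧ ∀ y, ¬ P y) ∨ ∃ y : Fin q, ((argmin e).run s).var 7 = y + 1 ∧
      P y ∧ ∀ y', P y' → rkX T x y ≤ rkX T x y' := by
  have key := FProg.run_upto (v := 5) (n := 1) (s := s.setVar 7 0)
    (c := .cond (.and e (.add (.not (.var 7)) (.lt (atX 6 (.var 5)) (atX 6 (.pred (.var 7))))))
      (.assign 7 (.succ (.var 5))) .skip)
    (fun i t => (t.var 7 = 0 ∧ ∀ y : Fin q, (y : ℕ) < i → ¬ P y) ∨ ∃ y : Fin q, t.var 7 = y + 1 ∧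
      P y ∧ ∀ y' : Fin q, (y' : ℕ) < i → P y' → rkX T x y ≤ rkX T x y')
    (Or.inl ⟨rfl, fun y hy => absurd hy (Nat.not_lt_zero _)⟩) ?_
  · have hq : (s.setVar 7 0).var 1 = q := hB.var1
    rw [hq] at key
    rcases key with ⟨h1, h2⟩ | ⟨y, h1, h2, h3⟩
    · exact Or.inl ⟨h1, fun y => h2 y y.2⟩
    · exact Or.inr ⟨y, h1, h2, fun y' => h3 y' y'.2⟩
  · intro i t hi hti hv ha hI
    have hq : i < q := by rw [← hB.var1]; exact hi
    have harr : t.arr = s.arr := funext fun a => ha a rfl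
    have h4 : t.var 4 = x := (hv 4 (by decide) rfl).trans hx
    have he' := he t ⟨i, hq⟩ harr h4 hti
    have hrk : ∀ y : Fin q, P y → t.arr 6 (x * q + y) = rkX T x y + 1 := fun y hy => by
      rw [harr, hB.rankX_eq (hP y hy)]
    have hrow : t.arr 4 x = x * q := by rw [harr, hB.rowX]
    have split : ∀ y' : Fin q, (y' : ℕ) < i + 1 → (y' : ℕ) < i ∨ y' = ⟨i, hq⟩ := fun y' h => by
      rcases Nat.lt_succ_iff_lt_or_eq.1 h with h | h
      · exact Or.inl h
      · exact Or.inr (Fin.ext h)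
    have hcond : (Expr.and e (.add (.not (.var 7)) (.lt (atX 6 (.var 5)) (atX 6 (.pred (.var 7)))))).eval
        t ≠ 0 ↔ P ⟨i, hq⟩ ∧ (t.var 7 = 0 ∨ t.arr 6 (x * q + i) < t.arr 6 (x * q + (t.var 7 - 1))) := by
      rw [Expr.eval_and, he', Expr.eval_add, Expr.eval_not, Expr.eval_lt_ne]
      simp only [atX, Expr.eval, h4, hti, hrow, Expr.eval_pred]
    by_cases hc : P ⟨i, hq⟩ ∧ (t.var 7 = 0 ∨ t.arr 6 (x * q + i) < t.arr 6 (x * q + (t.var 7 - 1)))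
    · rw [FProg.run_cond_pos (hcond.2 hc)]
      right
      refine ⟨⟨i, hq⟩, ?_, hc.1, fun y' hy' hP' => ?_⟩
      · rw [RAMState.setVar_ne _ _ (by decide), FProg.run, RAMState.setVar_self, Expr.eval_succ]
        simp only [Expr.eval, hti]
      · rcases split y' hy' with h | rfl
        · rcases hI with ⟨h1, h2⟩ | ⟨y, h1, h2, h3⟩
          · exact absurd hP' (h2 y' h)
          · have hlt := hc.2.resolve_left (by omega)
            rw [h1, Nat.add_sub_cancel, hrk y h2, hrk ⟨i, hq⟩ hc.1] at hlt
            have := h3 y' h hP'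
            omega
        · exact le_rfl
    · rw [FProg.run_cond_neg fun h => hc (hcond.1 h), FProg.run]
      simp only [RAMState.setVar_ne t (i + 1) (show (7 : ℕ) ≠ 5 by decide)]
      rcases hI with ⟨h1, h2⟩ | ⟨y, h1, h2, h3⟩
      · refine Or.inl ⟨h1, fun y' hy' hP' => ?_⟩
        rcases split y' hy' with h | rfl
        · exact h2 y' h hP'
        · exact hc ⟨hP', Or.inl h1⟩
      · refine Or.inr ⟨y, h1, h2, fun y' hy' hP' => ?_⟩
        rcases split y' hy' with h | rfl
        · exact h3 y' h hP'
        · by_contra hlt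
          refine hc ⟨hP', Or.inr ?_⟩
          rw [h1, Nat.add_sub_cancel, hrk y h2, hrk _ hP']
          omega

/-! ### Following a map -/

theorem iterate_lt {f : Fin p → Fin p} {a x : Fin p} (h : ∃ i, f^[i] a = x) :
    ∃ i < p, f^[i] a = x := by
  classical
  refine ⟨Nat.find h, ?_, Nat.find_spec h⟩
  by_contra hlt
  obtain ⟨i, j, hij, e⟩ : ∃ i j : Fin (p + 1), i < j ∧ f^[i] a = f^[j] a := by
    obtain ⟨i, j, hne, e⟩ := Fintype.exists_ne_map_eq_of_card_lt
      (fun i : Fin (p + 1) => f^[i] a) (by simp)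
    rcases lt_or_gt_of_ne hne with h | h
    · exact ⟨i, j, h, e⟩
    · exact ⟨j, i, h, e.symm⟩
  have hj : (j : ℕ) ≤ Nat.find h := by have := j.2; omega
  have hs := Nat.find_spec h
  have e2 : f^[Nat.find h - j + i] a = x := by
    rw [Function.iterate_add_apply, e, ← Function.iterate_add_apply, Nat.sub_add_cancel hj, hs]
  have hij' : (i : ℕ) < j := hij
  exact Nat.find_min h (by omega) e2

theorem iterate_periodic (f : Fin p → Fin p) (a : Fin p) :
    ∃ k, 0 < k ∧ f^[k] (f^[p] a) = f^[p] a := by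
  obtain ⟨i, hi, e⟩ := iterate_lt (f := f) (a := a) ⟨p, rfl⟩
  exact ⟨p - i, by omega, by
    nth_rewrite 1 [← e]
    rw [← Function.iterate_add_apply, Nat.sub_add_cancel hi.le]⟩

open FProg in
/-- Replace the variable 10 repeatedly by the value of `e`. -/
def follow (e : Expr) : FProg := upto 6 0 (assign 10 e)

open FProg in
/-- Fill the array `a` with the values of `e`. -/
def fill (v n a : ℕ) (e : Expr) : FProg := upto v n (store a (.var v) e)

open FProg in
/-- Mark in the array `a` all values that the variable 10 takes. -/
def orbit (a : ℕ) (e : Expr) : FProg :=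
  seq (fill 6 0 a (.const 0))
    (upto 6 0 (seq (store a (.var 10) (.const 1)) (assign 10 e)))

theorem follow_spec {s : RAMState} (hp : s.var 0 = p) {e : Expr} {f : Fin p → Fin p}
    {S : Fin p → Prop} (hS : ∀ x, S x → S (f x))
    (he : ∀ (t : RAMState) (x : Fin p), t.arr = s.arr → t.var 10 = x → S x → e.eval t = f x)
    {x : Fin p} (hx : s.var 10 = x) (hxS : S x) :
    ((follow e).run s).var 10 = f^[p] x := by
  have hit : ∀ i, S (f^[i] x) := fun i => by
    induction i with
    | zero => exact hxS
    | succ i ih => rw [Function.iterate_succ_apply']; exact hS _ ih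
  have key := FProg.run_upto (v := 6) (n := 0) (s := s) (c := .assign 10 e)
    (fun i t => t.var 10 = f^[i] x) hx ?_
  · rwa [hp] at key
  · intro i t _ _ _ ha hI
    rw [RAMState.setVar_ne _ _ (by decide), FProg.run, RAMState.setVar_self,
      he t _ (funext fun a => ha a rfl) hI (hit i), Function.iterate_succ_apply']

theorem fill_spec {s : RAMState} {v n a : ℕ} {e : Expr} {g : ℕ → ℕ}
    (he : ∀ (t : RAMState) (i : ℕ), i < s.var n → (∀ b ≠ a, t.arr b = s.arr b) → t.var v = i →
      e.eval t = g i) {i : ℕ} (hi : i < s.var n) : ((fill v n a e).run s).arr a i = g i := by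
  have key := FProg.run_upto (v := v) (n := n) (s := s) (c := .store a (.var v) e)
    (fun i t => ∀ j < i, t.arr a j = g j) (fun j hj => absurd hj (Nat.not_lt_zero _)) ?_
  · exact key i hi
  · intro i t hin hi _ ha hI j hj
    rw [RAMState.setVar_arr, FProg.run, RAMState.setArr_arr]
    rw [he t i hin (fun b hb => ha b (by simpa [FProg.writesArr] using hb.symm)) hi]
    simp only [Expr.eval, hi]
    split_ifs with h
    · rw [h]
    · exact hI j (by omega)

theorem orbit_spec {s : RAMState} (hp : s.var 0 = p) {a : ℕ} {e : Expr} {f : Fin p → Fin p}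
    {S : Fin p → Prop} (hS : ∀ x, S x → S (f x))
    (he : ∀ (t : RAMState) (x : Fin p), (∀ b ≠ a, t.arr b = s.arr b) → t.var 10 = x → S x →
      e.eval t = f x) {x : Fin p} (hx : s.var 10 = x) (hxS : S x) (z : Fin p) :
    ((∃ i, f^[i] x = z) → ((orbit a e).run s).arr a z = 1) ∧
      ((¬ ∃ i, f^[i] x = z) → ((orbit a e).run s).arr a z = 0) := by
  have hit : ∀ i, S (f^[i] x) := fun i => by
    induction i with
    | zero => exact hxS
    | succ i ih => rw [Function.iterate_succ_apply']; exact hS _ ih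
  set s₁ := (fill 6 0 a (.const 0)).run s with hs₁
  have h0 : s₁.var 0 = p := by rw [hs₁, FProg.run_var _ rfl, hp]
  have h10 : s₁.var 10 = x := by rw [hs₁, FProg.run_var _ rfl, hx]
  have hb : ∀ b ≠ a, s₁.arr b = s.arr b := fun b hb => FProg.run_arr _ (by
    simpa [fill, FProg.writesArr] using hb.symm) _
  have key := FProg.run_upto (v := 6) (n := 0) (s := s₁)
    (c := .seq (.store a (.var 10) (.const 1)) (.assign 10 e))
    (fun i t => t.var 10 = f^[i] x ∧ ∀ z : Fin p, ((∃ j < i, f^[j] x = z) → t.arr a z = 1) ∧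
      ((¬ ∃ j < i, f^[j] x = z) → t.arr a z = 0)) ⟨h10, fun z => ⟨fun h => ?_, fun _ => ?_⟩⟩ ?_
  · obtain ⟨-, h⟩ := key
    rw [h0] at h
    refine ⟨fun hz => (h z).1 (iterate_lt hz), fun hz => (h z).2 fun ⟨i, _, hi⟩ => hz ⟨i, hi⟩⟩
  · obtain ⟨j, hj, _⟩ := h
    omega
  · rw [RAMState.setVar_arr]
    exact fill_spec (g := fun _ => 0) (fun _ _ _ _ _ => rfl) (by rw [hp]; exact z.2)
  · rintro i t _ _ _ ha ⟨hI, hI'⟩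
    have hev : e.eval ((FProg.store a (.var 10) (.const 1)).run t) = f (f^[i] x) := by
      refine he _ _ (fun b hba => ?_) hI (hit i)
      rw [FProg.run, RAMState.setArr_ne _ _ _ hba, ha b (by simpa [FProg.writesArr] using hba.symm),
        hb b hba]
    refine ⟨?_, fun z => ?_⟩
    · rw [RAMState.setVar_ne _ _ (by decide), FProg.run, FProg.run, RAMState.setVar_self, hev,
        Function.iterate_succ_apply']
    · have hval : (((FProg.seq (.store a (.var 10) (.const 1)) (.assign 10 e)).run t).setVar 6
          (i + 1)).arr a z = if (z : ℕ) = f^[i] x then 1 else t.arr a z := by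
        rw [RAMState.setVar_arr, FProg.run, FProg.run, RAMState.setVar_arr, FProg.run,
          RAMState.setArr_arr]
        simp only [Expr.eval, hI]
      rw [hval]
      split_ifs with hz
      · refine ⟨fun _ => rfl, fun h => absurd ⟨i, by omega, (Fin.ext hz).symm⟩ h⟩
      · refine ⟨fun h => (hI' z).1 ?_, fun h => (hI' z).2 ?_⟩
        · obtain ⟨j, hj, e⟩ := h
          refine ⟨j, ?_, e⟩
          rcases Nat.lt_succ_iff_lt_or_eq.1 hj with h' | h'
          · exact h'
          · rw [h'] at e
            exact absurd (congrArg Fin.val e).symm hz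
        · rintro ⟨j, hj, e⟩
          exact h ⟨j, by omega, e⟩

end Marriage

namespace Marriage

variable {p q : ℕ}

/-! ### The search for the next rotation, as a program -/

/-- The data of the search. -/
structure Pre (T : Inst p q) (A M : Table p q) (L : Finset (Fin p)) (s : RAMState) : Prop where
  base : Base T s
  mx : CodesM (s.arr 8) M
  my : CodesM (s.arr 9) M.swap
  alive : CodesS (s.arr 10) L
  tab : CodesT (s.arr 13) A

/-- `y` is a candidate for `x`. -/
def candE : Expr :=
  .and (atX 13 (.var 5)) (.and (.lt (atX 6 (.pred (.get 8 (.var 4)))) (atX 6 (.var 5)))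
    (.and (.get 9 (.var 5)) (.and (.get 10 (.pred (.get 9 (.var 5))))
      (.lt (atY 7 (.var 4)) (atY 7 (.pred (.get 9 (.var 5))))))))

open FProg in
/-- Compute the best candidates; the variables 8 and 9 report an agent without candidate and an agent
that is alive. -/
def scan : FProg :=
  seq (assign 8 (.const 0)) (seq (assign 9 (.const 0)) (upto 4 0 (cond (.get 10 (.var 4))
    (seq (argmin candE) (seq (store 11 (.var 4) (.var 7))
      (seq (cond (.var 7) skip (assign 8 (.succ (.var 4)))) (assign 9 (.succ (.var 4)))))) skip)))

/-- The successor of `e` in the digraph of best candidates. -/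
def succE : Expr := .pred (.get 9 (.pred (.get 11 (.var 10))))

open FProg in
/-- Move the marked agents to their best candidates. -/
def move : FProg :=
  upto 4 0 (cond (.get 12 (.var 4)) (seq (store 8 (.var 4) (.get 11 (.var 4)))
    (store 9 (.pred (.get 11 (.var 4))) (.succ (.var 4)))) skip)

open FProg in
/-- Find a cycle and move along it. -/
def advance : FProg :=
  seq (assign 10 (.pred (.var 9))) (seq (follow succE) (seq (orbit 12 succE) move))

open FProg in
def step : FProg :=
  seq scan (cond (.var 8) (store 10 (.pred (.var 8)) (.const 0)) (cond (.var 9) advance skip))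

section

variable {T : Inst p q} {A M : Table p q} {L : Finset (Fin p)} {s : RAMState}

theorem Pre.congr {t : RAMState} (h : Pre T A M L s) (hB : Base T t) (h8 : t.arr 8 = s.arr 8)
    (h9 : t.arr 9 = s.arr 9) (h10 : t.arr 10 = s.arr 10) (h13 : t.arr 13 = s.arr 13) :
    Pre T A M L t :=
  ⟨hB, h8 ▸ h.mx, h9 ▸ h.my, h10 ▸ h.alive, h13 ▸ h.tab⟩

theorem candE_eval (h : Pre T A M L s) (hA : A ⊆ T.edges) (hM : Mat T M) {x : Fin p} {m : Fin q}
    (hm : (x, m) ∈ M) {t : RAMState} {y : Fin q} (ht : t.arr = s.arr) (h4 : t.var 4 = x)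
    (h5 : t.var 5 = y) : candE.eval t ≠ 0 ↔ IsCand T A M L x y := by
  have rX : s.arr 4 x = x * q := h.base.rowX x
  have rY : s.arr 5 y = y * p := h.base.rowY y
  have emx : s.arr 8 x - 1 = m := by rw [h.mx.eq hm, Nat.add_sub_cancel]
  simp only [candE, Expr.eval_and, Expr.eval_lt_ne]
  simp only [atX, atY, Expr.eval, Expr.eval_pred, ht, h4, h5, rX, rY, emx]
  rw [h.tab.ne_zero, IsCand]
  refine and_congr_right fun hxy => ?_
  rw [h.base.rankX_eq (hM.edge hm), h.base.rankX_eq (hA hxy), h.base.rankY_eq (hA hxy)]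
  refine and_congr ?_ ?_
  · constructor
    · exact fun hlt => ⟨m, hm, by omega⟩
    · rintro ⟨m', hm', hlt⟩
      rw [hM.uniqX hm' hm] at hlt
      omega
  · rcases h.my.cases y with ⟨h0, hno⟩ | ⟨z, hz, hzM⟩
    · refine ⟨fun hc => absurd h0 hc.1, ?_⟩
      rintro ⟨z, -, hz, -⟩
      exact absurd (mem_swap.2 hz) (hno z)
    · have hzM' := mem_swap.1 hzM
      rw [hz, Nat.add_sub_cancel, h.alive.ne_zero, h.base.rankY_eq (hM.edge hzM')]
      constructor
      · rintro ⟨-, h1, h2⟩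
        exact ⟨z, h1, hzM', by omega⟩
      · rintro ⟨z', h1, h2, h3⟩
        obtain rfl := hM.uniqY h2 hzM'
        exact ⟨by omega, h1, by omega⟩

/-- `y` is the best candidate for `x`. -/
def IsBest (T : Inst p q) (A M : Table p q) (L : Finset (Fin p)) (x : Fin p) (y : Fin q) : Prop :=
  IsCand T A M L x y ∧ ∀ y', IsCand T A M L x y' → rkX T x y ≤ rkX T x y'

theorem scan_spec (h : Pre T A M L s) (hA : A ⊆ T.edges) (hM : Mat T M)
    (hL : ∀ x ∈ L, ∃ y, (x, y) ∈ M) :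
    (((scan.run s).var 8 = 0 ∧ ∀ x ∈ L, ∃ y : Fin q, (scan.run s).arr 11 x = y + 1 ∧
        IsBest T A M L x y) ∨
      ∃ x ∈ L, (scan.run s).var 8 = x + 1 ∧ ∀ y, ¬ IsCand T A M L x y) ∧
    (((scan.run s).var 9 = 0 ∧ L = ∅) ∨ ∃ x ∈ L, (scan.run s).var 9 = x + 1) := by
  have key := FProg.run_upto (v := 4) (n := 0) (s := (s.setVar 8 0).setVar 9 0)
    (c := .cond (.get 10 (.var 4)) (.seq (argmin candE) (.seq (.store 11 (.var 4) (.var 7))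
      (.seq (.cond (.var 7) .skip (.assign 8 (.succ (.var 4)))) (.assign 9 (.succ (.var 4)))))) .skip)
    (fun i t => ((t.var 8 = 0 ∧ ∀ x ∈ L, (x : ℕ) < i → ∃ y : Fin q, t.arr 11 x = y + 1 ∧
        IsBest T A M L x y) ∨
      ∃ x ∈ L, t.var 8 = x + 1 ∧ ∀ y, ¬ IsCand T A M L x y) ∧
      ((t.var 9 = 0 ∧ ∀ x ∈ L, i ≤ (x : ℕ)) ∨ ∃ x ∈ L, t.var 9 = x + 1))
    ⟨Or.inl ⟨rfl, fun x _ hx => absurd hx (Nat.not_lt_zero _)⟩, Or.inl ⟨rfl, fun x _ => Nat.zero_le _⟩⟩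
    ?_
  · have hp : ((s.setVar 8 0).setVar 9 0).var 0 = p := h.base.var0
    rw [hp] at key
    refine ⟨key.1.imp (fun h => ⟨h.1, fun x hx => h.2 x hx x.2⟩) id, key.2.imp (fun h => ⟨h.1, ?_⟩) id⟩
    refine Finset.eq_empty_of_forall_notMem fun x hx => ?_
    have := h.2 x hx
    have := x.2
    omega
  · rintro i t hi hti hv ha ⟨hI1, hI2⟩
    have hip : i < p := by rw [← h.base.var0]; exact hi
    have hpre : Pre T A M L t := h.congr (h.base.congr (hv 0 (by decide) rfl) (hv 1 (by decide) rfl)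
      (ha 4 rfl) (ha 5 rfl) (ha 6 rfl) (ha 7 rfl)) (ha 8 rfl) (ha 9 rfl) (ha 10 rfl) (ha 13 rfl)
    have hcond : (Expr.get 10 (.var 4)).eval t ≠ 0 ↔ (⟨i, hip⟩ : Fin p) ∈ L := by
      rw [← hpre.alive.ne_zero ⟨i, hip⟩]
      simp only [Expr.eval, hti]
    by_cases hx : (⟨i, hip⟩ : Fin p) ∈ L
    · rw [FProg.run_cond_pos (hcond.2 hx)]
      obtain ⟨m, hm⟩ := hL _ hx
      have ham := argmin_spec hpre.base (e := candE) (x := ⟨i, hip⟩) hti (IsCand T A M L ⟨i, hip⟩)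
        (fun y hy => hA hy.1) fun t' y h1 h2 h3 => candE_eval hpre hA hM hm h1 h2 h3
      set t' := (argmin candE).run t with ht'
      have v4 : t'.var 4 = i := by rw [ht', FProg.run_var _ rfl, hti]
      have v8 : t'.var 8 = t.var 8 := FProg.run_var _ rfl _
      have a11 : t'.arr 11 = t.arr 11 := FProg.run_arr _ rfl _
      have hrun : (FProg.seq (argmin candE) (.seq (.store 11 (.var 4) (.var 7))
          (.seq (.cond (.var 7) .skip (.assign 8 (.succ (.var 4)))) (.assign 9 (.succ (.var 4)))))).run t =
          ((FProg.cond (.var 7) .skip (.assign 8 (.succ (.var 4)))).run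
            (t'.setArr 11 i (t'.var 7))).setVar 9 (i + 1) := by
        change ((FProg.cond (.var 7) .skip (.assign 8 (.succ (.var 4)))).run
          (t'.setArr 11 (t'.var 4) (t'.var 7))).setVar 9 (((FProg.cond (.var 7) .skip
          (.assign 8 (.succ (.var 4)))).run (t'.setArr 11 (t'.var 4) (t'.var 7))).var 4 + 1) = _
        rw [v4, FProg.run_var (.cond (.var 7) .skip (.assign 8 (.succ (.var 4)))) rfl,
          RAMState.setArr_var, v4]
      rw [hrun]
      refine ⟨?_, Or.inr ⟨⟨i, hip⟩, hx, ?_⟩⟩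
      · rw [RAMState.setVar_ne _ _ (by decide), RAMState.setVar_ne _ _ (by decide),
          RAMState.setVar_arr, RAMState.setVar_arr, FProg.run_arr _ rfl]
        rcases ham with ⟨h7, hno⟩ | ⟨y, h7, hy⟩
        · right
          refine ⟨⟨i, hip⟩, hx, ?_, hno⟩
          rw [FProg.run_cond_neg (by simp [Expr.eval, h7]), FProg.run, RAMState.setVar_self,
            Expr.eval_succ]
          simp only [Expr.eval, RAMState.setArr_var, v4]
        · rw [FProg.run_cond_pos (by simp [Expr.eval, h7]), FProg.run, RAMState.setArr_var, v8]
          refine hI1.imp (fun h' => ⟨h'.1, fun x hxL hlt => ?_⟩) id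
          simp only [RAMState.setArr_arr]
          split_ifs with hxi
          · obtain rfl : x = ⟨i, hip⟩ := Fin.ext hxi
            exact ⟨y, h7, hy⟩
          · rw [a11]
            exact h'.2 x hxL (by omega)
      · rw [RAMState.setVar_ne _ _ (by decide), RAMState.setVar_self]
    · rw [FProg.run_cond_neg fun h' => hx (hcond.1 h'), FProg.run]
      rw [RAMState.setVar_ne _ _ (by decide), RAMState.setVar_ne _ _ (by decide), RAMState.setVar_arr]
      refine ⟨hI1.imp (fun h' => ⟨h'.1, fun x hxL hlt => h'.2 x hxL ?_⟩) id,
        hI2.imp (fun h' => ⟨h'.1, fun x hxL => ?_⟩) id⟩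
      · have : (x : ℕ) ≠ i := fun e => hx ((Fin.ext e : x = ⟨i, hip⟩) ▸ hxL)
        exact Nat.lt_of_le_of_ne (h'.2 x hxL) (Ne.symm this)
      · have : (x : ℕ) ≠ i := fun e => hx ((Fin.ext e : x = ⟨i, hip⟩) ▸ hxL)
        omega

theorem move_spec (hp : s.var 0 = p) {C : Fin p → Prop} {nx : Fin p → ℕ}
    (h12 : ∀ x : Fin p, s.arr 12 x ≠ 0 ↔ C x) (h11 : ∀ x, C x → s.arr 11 x = nx x + 1)
    (hinj : ∀ x x', C x → C x' → nx x = nx x' → x = x') :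
    (∀ x : Fin p, (C x → (move.run s).arr 8 x = nx x + 1) ∧
      (¬ C x → (move.run s).arr 8 x = s.arr 8 x)) ∧
    (∀ x, C x → (move.run s).arr 9 (nx x) = x + 1) ∧
    ∀ y, (∀ x, C x → nx x ≠ y) → (move.run s).arr 9 y = s.arr 9 y := by
  have key := FProg.run_upto (v := 4) (n := 0) (s := s)
    (c := .cond (.get 12 (.var 4)) (.seq (.store 8 (.var 4) (.get 11 (.var 4)))
      (.store 9 (.pred (.get 11 (.var 4))) (.succ (.var 4)))) .skip)
    (fun i t => (∀ x : Fin p, ((x : ℕ) < i → C x → t.arr 8 x = nx x + 1) ∧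
      (¬ C x → t.arr 8 x = s.arr 8 x)) ∧
      (∀ x : Fin p, (x : ℕ) < i → C x → t.arr 9 (nx x) = x + 1) ∧
      ∀ y, (∀ x, C x → nx x ≠ y) → t.arr 9 y = s.arr 9 y)
    ⟨fun x => ⟨fun hx => absurd hx (Nat.not_lt_zero _), fun _ => rfl⟩,
      fun x hx => absurd hx (Nat.not_lt_zero _), fun _ _ => rfl⟩ ?_
  · rw [hp] at key
    exact ⟨fun x => ⟨(key.1 x).1 x.2, (key.1 x).2⟩, fun x => key.2.1 x x.2, key.2.2⟩
  · rintro i t hi hti hv ha ⟨hI1, hI2, hI3⟩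
    have hip : i < p := by rw [← hp]; exact hi
    have hcond : (Expr.get 12 (.var 4)).eval t ≠ 0 ↔ C ⟨i, hip⟩ := by
      rw [← h12 ⟨i, hip⟩]
      simp only [Expr.eval, hti, ha 12 rfl]
    have split : ∀ x : Fin p, (x : ℕ) < i + 1 → (x : ℕ) < i ∨ x = ⟨i, hip⟩ := fun x h => by
      rcases Nat.lt_succ_iff_lt_or_eq.1 h with h | h
      · exact Or.inl h
      · exact Or.inr (Fin.ext h)
    by_cases hC : C ⟨i, hip⟩
    · have h11' : t.arr 11 i = nx ⟨i, hip⟩ + 1 := by rw [ha 11 rfl]; exact h11 _ hC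
      rw [FProg.run_cond_pos (hcond.2 hC)]
      have hrun : (FProg.seq (.store 8 (.var 4) (.get 11 (.var 4)))
          (.store 9 (.pred (.get 11 (.var 4))) (.succ (.var 4)))).run t =
          (t.setArr 8 i (nx ⟨i, hip⟩ + 1)).setArr 9 (nx ⟨i, hip⟩) (i + 1) := by
        rw [FProg.run, FProg.run, FProg.run]
        simp only [Expr.eval, Expr.eval_pred, Expr.eval_succ, RAMState.setArr_var, hti, h11']
        rw [RAMState.setArr_ne _ _ _ (by decide), h11', Nat.add_sub_cancel]
      rw [hrun, RAMState.setVar_arr]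
      have a8 : ∀ j, ((t.setArr 8 i (nx ⟨i, hip⟩ + 1)).setArr 9 (nx ⟨i, hip⟩) (i + 1)).arr 8 j =
          if j = i then nx ⟨i, hip⟩ + 1 else t.arr 8 j := fun j => by
        rw [RAMState.setArr_ne _ _ _ (by decide), RAMState.setArr_arr]
      have a9 : ∀ j, ((t.setArr 8 i (nx ⟨i, hip⟩ + 1)).setArr 9 (nx ⟨i, hip⟩) (i + 1)).arr 9 j =
          if j = nx ⟨i, hip⟩ then i + 1 else t.arr 9 j := fun j => by
        rw [RAMState.setArr_arr, RAMState.setArr_ne _ _ _ (by decide)]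
      refine ⟨fun x => ⟨fun hlt hx => ?_, fun hx => ?_⟩, fun x hlt hx => ?_, fun y hy => ?_⟩
      · rw [a8]
        rcases split x hlt with h | rfl
        · rw [if_neg (by omega), (hI1 x).1 h hx]
        · rw [if_pos rfl]
      · rw [a8, if_neg, (hI1 x).2 hx]
        intro e
        exact hx ((Fin.ext e : x = ⟨i, hip⟩) ▸ hC)
      · rw [a9]
        rcases split x hlt with h | rfl
        · rw [if_neg, hI2 x h hx]
          intro e
          have := congrArg Fin.val (hinj _ _ hx hC e)
          simp only at this
          omega
        · rw [if_pos rfl]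
      · rw [a9, if_neg, hI3 y hy]
        intro e
        exact hy _ hC e.symm
    · rw [FProg.run_cond_neg fun h' => hC (hcond.1 h'), FProg.run, RAMState.setVar_arr]
      refine ⟨fun x => ⟨fun hlt hx => ?_, (hI1 x).2⟩, fun x hlt hx => ?_, hI3⟩
      · rcases split x hlt with h | rfl
        · exact (hI1 x).1 h hx
        · exact absurd hx hC
      · rcases split x hlt with h | rfl
        · exact hI2 x h hx
        · exact absurd hx hC

/-- What can happen in a step of the search. -/
inductive Outcome (T : Inst p q) (A M : Table p q) (L : Finset (Fin p)) :
    Table p q → Finset (Fin p) → Prop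
  | stay : L = ∅ → Outcome T A M L M L
  | drop (x : Fin p) : x ∈ L → (∀ y, ¬ IsCand T A M L x y) → Outcome T A M L M (L.erase x)
  | move (σ : Rotation p q) : IsGenRotation T T.edges M σ → shifted σ ⊆ A →
      (∀ e ∈ σ.toFinset, e.1 ∈ L) → Next T A M (elim M σ) → Alive T A (elim M σ) L →
      Outcome T A M L (elim M σ) L

theorem advance_spec (h : Pre T A M L s) (hA : A ⊆ T.edges) (hM : Mat T M) (hL : Alive T A M L)
    (h11 : ∀ x ∈ L, ∃ y : Fin q, s.arr 11 x = y + 1 ∧ IsBest T A M L x y) {x₀ : Fin p} (hx₀ : x₀ ∈ L)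
    (h9 : s.var 9 = x₀ + 1) :
    ∃ M', Outcome T A M L M' L ∧ Pre T A M' L (advance.run s) := by
  classical
  have hnx : ∀ x, ∃ y : Fin q, x ∈ L → s.arr 11 x = y + 1 ∧ IsBest T A M L x y := by
    intro x
    obtain ⟨y₀, _⟩ := hL.matched _ hx₀
    by_cases hx : x ∈ L
    · obtain ⟨y, hy⟩ := h11 x hx
      exact ⟨y, fun _ => hy⟩
    · exact ⟨y₀, fun h => absurd h hx⟩
  choose nx hnx using hnx
  have hf : ∀ x, ∃ z : Fin p, x ∈ L → z ∈ L ∧ (z, nx x) ∈ M := by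
    intro x
    by_cases hx : x ∈ L
    · obtain ⟨z, hz, hzM, _⟩ := (hnx x hx).2.1.2.2
      exact ⟨z, fun _ => ⟨hz, hzM⟩⟩
    · exact ⟨x, fun h => absurd h hx⟩
  choose f hf using hf
  have hfe : ∀ (t : RAMState) (x : Fin p), t.arr 9 = s.arr 9 → t.arr 11 = s.arr 11 → t.var 10 = x →
      x ∈ L → succE.eval t = f x := by
    intro t x a9 a11 hx hxL
    rw [succE, Expr.eval_pred]
    simp only [Expr.eval, Expr.eval_pred, hx, a9, a11]
    rw [(hnx x hxL).1, Nat.add_sub_cancel, h.my.swap_eq (hf x hxL).2, Nat.add_sub_cancel]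
  set s₁ := (FProg.assign 10 (.pred (.var 9))).run s with hs₁
  have v10 : s₁.var 10 = x₀ := by
    rw [hs₁, FProg.run, RAMState.setVar_self, Expr.eval_pred]
    simp only [Expr.eval, h9, Nat.add_sub_cancel]
  have p1 : s₁.var 0 = p := h.base.var0
  have hfollow := follow_spec p1 (e := succE) (f := f) (S := fun x => x ∈ L) (fun x hx => (hf x hx).1)
    (fun t x ht hx hxL => hfe t x (by rw [ht]; rfl) (by rw [ht]; rfl) hx hxL) v10 hx₀
  set s₂ := (follow succE).run s₁ with hs₂
  set a := f^[p] x₀ with ha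
  have haL : a ∈ L := by
    have : ∀ i, f^[i] x₀ ∈ L := fun i => by
      induction i with
      | zero => exact hx₀
      | succ i ih => rw [Function.iterate_succ_apply']; exact (hf _ ih).1
    exact this p
  obtain ⟨k, hk, hper⟩ := iterate_periodic f x₀
  have arr2 : ∀ b, s₂.arr b = s.arr b := fun b => by rw [hs₂, FProg.run_arr _ rfl]; rfl
  have p2 : s₂.var 0 = p := by rw [hs₂, FProg.run_var _ rfl, p1]
  have horb := orbit_spec p2 (a := 12) (e := succE) (f := f) (S := fun x => x ∈ L)
    (fun x hx => (hf x hx).1)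
    (fun t x ht hx hxL => hfe t x (by rw [ht 9 (by decide), arr2]) (by rw [ht 11 (by decide), arr2])
      hx hxL) hfollow haL
  set s₃ := (orbit 12 succE).run s₂ with hs₃
  have arr3 : ∀ b, b ≠ 12 → s₃.arr b = s.arr b := fun b hb => by
    rw [hs₃, FProg.run_arr, arr2]
    have : ¬ 12 = b := fun h => hb h.symm
    simp [orbit, fill, FProg.writesArr, this]
  have p3 : s₃.var 0 = p := by rw [hs₃, FProg.run_var _ rfl, p2]
  have orbL : ∀ x, (∃ i, f^[i] a = x) → x ∈ L := by
    rintro x ⟨i, rfl⟩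
    induction i with
    | zero => exact haL
    | succ i ih => rw [Function.iterate_succ_apply']; exact (hf _ ih).1
  obtain ⟨σ, hσ, hσA, hσL, hnext, halive, helim⟩ := exists_rotation_of_isCand hA hM hL
    (fun x hx => (hnx x hx).2.1) (fun x hx => (hnx x hx).2.2) (fun x hx => (hf x hx).2) haL hk hper
  have hM' := elim_mat subset_rfl hM hσ
  have hmv := move_spec p3 (C := fun x => ∃ i, f^[i] a = x) (nx := fun x => (nx x : ℕ)) (fun x => by
      by_cases hx : ∃ i, f^[i] a = x
      · simp [(horb x).1 hx, hx]
      · simp [(horb x).2 hx, hx])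
    (fun x hx => by rw [arr3 11 (by decide)]; exact (hnx x (orbL x hx)).1)
    (fun x x' hx hx' e => hM'.uniqY ((helim x _).2 (Or.inl ⟨hx, rfl⟩))
      ((helim x' _).2 (Or.inl ⟨hx', Fin.ext e⟩)))
  have hrun : advance.run s = move.run s₃ := rfl
  have fr : ∀ b, b ≠ 8 → b ≠ 9 → b ≠ 12 → (advance.run s).arr b = s.arr b := fun b h8 h9 h12 => by
    have e8 : ¬ 8 = b := fun h => h8 h.symm
    have e9 : ¬ 9 = b := fun h => h9 h.symm
    rw [hrun, FProg.run_arr, arr3 b h12]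
    simp [move, FProg.writesArr, e8, e9]
  refine ⟨elim M σ, Outcome.move σ hσ hσA hσL hnext halive, ⟨?_, ?_, ?_, ?_, ?_⟩⟩
  · exact h.base.congr (FProg.run_var _ rfl _) (FProg.run_var _ rfl _) (fr 4 (by decide) (by decide)
      (by decide)) (fr 5 (by decide) (by decide) (by decide)) (fr 6 (by decide) (by decide)
      (by decide)) (fr 7 (by decide) (by decide) (by decide))
  · rw [hrun]
    refine CodesM.intro (fun x y y' => hM'.uniqX) fun x => ?_
    by_cases hx : ∃ i, f^[i] a = x
    · exact Or.inr ⟨nx x, (hmv.1 x).1 hx, (helim _ _).2 (Or.inl ⟨hx, rfl⟩)⟩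
    · rw [(hmv.1 x).2 hx, arr3 8 (by decide)]
      rcases h.mx.cases x with ⟨h0, hno⟩ | ⟨y, hy, hyM⟩
      · refine Or.inl ⟨h0, fun y hy => ?_⟩
        rcases (helim _ _).1 hy with h' | h'
        exacts [hx h'.1, hno y h'.2]
      · exact Or.inr ⟨y, hy, (helim _ _).2 (Or.inr ⟨hx, hyM⟩)⟩
  · rw [hrun]
    refine CodesM.intro (fun y x x' h1 h2 => hM'.uniqY (mem_swap.1 h1) (mem_swap.1 h2)) fun y => ?_
    by_cases hy : ∃ x, (∃ i, f^[i] a = x) ∧ nx x = y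
    · obtain ⟨x, hx, rfl⟩ := hy
      exact Or.inr ⟨x, hmv.2.1 x hx, mem_swap.2 ((helim _ _).2 (Or.inl ⟨hx, rfl⟩))⟩
    · rw [hmv.2.2 y (fun x hx e => hy ⟨x, hx, Fin.ext e⟩), arr3 9 (by decide)]
      rcases h.my.cases y with ⟨h0, hno⟩ | ⟨x, hx, hxM⟩
      · refine Or.inl ⟨h0, fun x hx => ?_⟩
        rcases (helim _ _).1 (mem_swap.1 hx) with h' | h'
        exacts [hy ⟨x, h'.1, h'.2.symm⟩, hno x (mem_swap.2 h'.2)]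
      · obtain ⟨_, x', _, hx', _⟩ := (dom_elim subset_rfl hσ).1 _ _ (mem_swap.1 hxM)
        rcases (helim _ _).1 hx' with h' | h'
        · exact absurd ⟨x', h'.1, h'.2.symm⟩ hy
        · obtain rfl := hM.uniqY h'.2 (mem_swap.1 hxM)
          exact Or.inr ⟨x', hx, mem_swap.2 hx'⟩
  · rw [fr 10 (by decide) (by decide) (by decide)]; exact h.alive
  · rw [fr 13 (by decide) (by decide) (by decide)]; exact h.tab

theorem step_spec (h : Pre T A M L s) (hA : A ⊆ T.edges) (hM : Mat T M) (hL : Alive T A M L) :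
    ∃ M' L', Outcome T A M L M' L' ∧ Pre T A M' L' (step.run s) := by
  obtain ⟨h1, h2⟩ := scan_spec h hA hM hL.matched
  set s₁ := scan.run s with hs₁
  have hpre : Pre T A M L s₁ := h.congr (h.base.congr (FProg.run_var _ rfl _) (FProg.run_var _ rfl _)
    (FProg.run_arr _ rfl _) (FProg.run_arr _ rfl _) (FProg.run_arr _ rfl _) (FProg.run_arr _ rfl _))
    (FProg.run_arr _ rfl _) (FProg.run_arr _ rfl _) (FProg.run_arr _ rfl _) (FProg.run_arr _ rfl _)
  have hrun : step.run s = (FProg.cond (.var 8) (.store 10 (.pred (.var 8)) (.const 0))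
      (.cond (.var 9) advance .skip)).run s₁ := rfl
  rw [hrun]
  rcases h1 with ⟨h8, h11⟩ | ⟨x, hx, h8, hno⟩
  · rw [FProg.run_cond_neg (by simp [Expr.eval, h8])]
    rcases h2 with ⟨h9, hem⟩ | ⟨x, hx, h9⟩
    · rw [FProg.run_cond_neg (by simp [Expr.eval, h9]), FProg.run]
      exact ⟨M, L, Outcome.stay hem, hpre⟩
    · rw [FProg.run_cond_pos (by simp [Expr.eval, h9])]
      obtain ⟨M', h3, h4⟩ := advance_spec hpre hA hM hL h11 hx h9
      exact ⟨M', L, h3, h4⟩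
  · rw [FProg.run_cond_pos (by simp [Expr.eval, h8]), FProg.run]
    refine ⟨M, L.erase x, Outcome.drop x hx hno, ⟨hpre.base.congr rfl rfl rfl rfl rfl rfl, hpre.mx,
      hpre.my, fun z => ?_, hpre.tab⟩⟩
    rw [RAMState.setArr_arr, Expr.eval_pred]
    simp only [Expr.eval, h8, Nat.add_sub_cancel, Finset.mem_erase]
    by_cases e : z = x
    · subst e; simp
    · rw [if_neg fun h' => e (Fin.ext h'), hpre.alive z]
      simp [e]

end

end Marriage

namespace Marriage

variable {p q : ℕ}

/-! ### Tables as matrices -/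

open FProg in
/-- Fill the matrix `a` with the values of `e`. -/
def fillT (a : ℕ) (e : Expr) : FProg :=
  upto 4 0 (upto 5 1 (store a (.add (.get 4 (.var 4)) (.var 5)) e))

theorem fillT_spec {s : RAMState} (h0 : s.var 0 = p) (h1 : s.var 1 = q)
    (h4 : ∀ x : Fin p, s.arr 4 x = x * q) {a : ℕ} (ha : 4 ≠ a) {e : Expr} {g : Fin p → Fin q → ℕ}
    (he : ∀ (t : RAMState) (x : Fin p) (y : Fin q), (∀ b ≠ a, t.arr b = s.arr b) → t.var 4 = x →
      t.var 5 = y → e.eval t = g x y) (x : Fin p) (y : Fin q) :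
    ((fillT a e).run s).arr a (x * q + y) = g x y := by
  have key := FProg.run_upto (v := 4) (n := 0) (s := s)
    (c := .upto 5 1 (.store a (.add (.get 4 (.var 4)) (.var 5)) e))
    (fun i t => ∀ x : Fin p, (x : ℕ) < i → ∀ y : Fin q, t.arr a (x * q + y) = g x y)
    (fun j hj => absurd hj (Nat.not_lt_zero _)) ?_
  · exact key x (by rw [h0]; exact x.2) y
  · intro i t hi hti hv hat hI
    have hip : i < p := by omega
    have hat' : ∀ b ≠ a, t.arr b = s.arr b := fun b hb =>
      hat b (by simpa [FProg.writesArr] using hb.symm)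
    have key := FProg.run_upto (v := 5) (n := 1) (s := t)
      (c := .store a (.add (.get 4 (.var 4)) (.var 5)) e)
      (fun j t => ∀ (x : Fin p) (y : Fin q), ((x : ℕ) < i ∨ (x : ℕ) = i ∧ (y : ℕ) < j) →
        t.arr a (x * q + y) = g x y)
      (fun x y h => h.elim (fun h => hI x h y) fun h => absurd h.2 (Nat.not_lt_zero _)) ?_
    · have hq : t.var 1 = q := (hv 1 (by decide) rfl).trans h1
      rw [hq] at key
      intro x hx y
      rw [RAMState.setVar_arr]
      refine key x y ?_
      rcases Nat.lt_succ_iff_lt_or_eq.1 hx with h | h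
      · exact Or.inl h
      · exact Or.inr ⟨h, y.2⟩
    · intro j u hj huj hv' hau hI' x y hxy
      have hjq : j < q := by rwa [(hv 1 (by decide) rfl).trans h1] at hj
      have hau' : ∀ b ≠ a, u.arr b = s.arr b := fun b hb =>
        (hau b (by simpa [FProg.writesArr] using hb.symm)).trans (hat' b hb)
      have u4 : u.var 4 = i := (hv' 4 (by decide) rfl).trans hti
      rw [RAMState.setVar_arr, FProg.run, RAMState.setArr_arr,
        he u ⟨i, hip⟩ ⟨j, hjq⟩ hau' u4 huj]
      have hidx : (Expr.add (.get 4 (.var 4)) (.var 5)).eval u =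
          ((⟨i, hip⟩ : Fin p) : ℕ) * q + ((⟨j, hjq⟩ : Fin q) : ℕ) := by
        simp only [Expr.eval, u4, huj, hau' 4 ha]
        rw [← h4 ⟨i, hip⟩]
      rw [hidx]
      split_ifs with hc
      · obtain ⟨rfl, rfl⟩ := matrix_index_inj hc
        rfl
      · refine hI' x y (hxy.imp id fun h => ⟨h.1, ?_⟩)
        have : (y : ℕ) ≠ j := by
          intro e
          apply hc
          simp only [h.1, e]
        omega

open FProg in
/-- Add the current matching to the output. -/
def record : FProg :=
  upto 4 0 (cond (.get 8 (.var 4)) (store 18 (.add (.get 4 (.var 4)) (.pred (.get 8 (.var 4))))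
    (.const 1)) skip)

theorem record_spec {s : RAMState} (h0 : s.var 0 = p) (h4 : ∀ x : Fin p, s.arr 4 x = x * q)
    {M E : Table p q} (hM : CodesM (s.arr 8) M) (hE : CodesT (s.arr 18) E) :
    CodesT ((record.run s).arr 18) (E ∪ M) := by
  have key := FProg.run_upto (v := 4) (n := 0) (s := s)
    (c := .cond (.get 8 (.var 4)) (.store 18 (.add (.get 4 (.var 4)) (.pred (.get 8 (.var 4))))
      (.const 1)) .skip)
    (fun i t => ∀ (x : Fin p) (y : Fin q), t.arr 18 (x * q + y) =
      if (x, y) ∈ E ∨ (x, y) ∈ M ∧ (x : ℕ) < i then 1 else 0) (fun x y => ?_) ?_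
  · intro x y
    have := key x y
    rw [h0] at this
    rw [record, this]
    simp
  · rw [RAMState.setVar_arr, hE]
    simp
  · intro i t hi hti hv ha hI x y
    have hip : i < p := by omega
    have hmx : t.arr 8 = s.arr 8 := ha 8 rfl
    rcases hM.cases ⟨i, hip⟩ with ⟨hz, hno⟩ | ⟨m, hm, hmM⟩
    · rw [FProg.run_cond_neg (by simpa [Expr.eval, hti, hmx] using hz), FProg.run,
        RAMState.setVar_arr, hI]
      refine if_congr (or_congr_right (and_congr_right fun hxy => ?_)) rfl rfl
      have : (x : ℕ) ≠ i := by
        intro e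
        obtain rfl : x = ⟨i, hip⟩ := Fin.ext e
        exact hno y hxy
      omega
    · have hm' : s.arr 8 i = m + 1 := hm
      rw [FProg.run_cond_pos (by simp [Expr.eval, hti, hmx, hm']), FProg.run, RAMState.setVar_arr,
        RAMState.setArr_arr]
      have hidx : (Expr.add (.get 4 (.var 4)) (.pred (.get 8 (.var 4)))).eval t =
          ((⟨i, hip⟩ : Fin p) : ℕ) * q + (m : ℕ) := by
        rw [Expr.eval, Expr.eval_pred]
        simp only [Expr.eval, hti, hmx, hm', Nat.add_sub_cancel, ha 4 rfl]
        rw [← h4 ⟨i, hip⟩]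
      rw [hidx]
      split_ifs with h1 h2 h2
      · rfl
      · obtain ⟨rfl, rfl⟩ := matrix_index_inj h1
        exact absurd (Or.inr ⟨hmM, Nat.lt_succ_self _⟩) h2
      · rw [hI, if_pos]
        refine h2.imp id fun h => ⟨h.1, ?_⟩
        have : (x : ℕ) ≠ i := by
          intro e
          obtain rfl : x = ⟨i, hip⟩ := Fin.ext e
          have hy := hM.eq h.1
          have : (y : ℕ) = m := by omega
          exact h1 (by rw [this])
        omega
      · rw [hI, if_neg]
        exact fun h => h2 (h.imp id fun h => ⟨h.1, by omega⟩)

/-! ### Preparing the ranks -/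

open FProg in
/-- The offsets of the rows. -/
def rows : FProg :=
  seq (assign 13 (.const 0)) (upto 4 0 (seq (store 4 (.var 4) (.var 13))
    (assign 13 (.add (.var 13) (.var 1)))))

theorem rows_spec {s : RAMState} (h0 : s.var 0 = p) (h1 : s.var 1 = q) (x : Fin p) :
    (rows.run s).arr 4 x = x * q := by
  have key := FProg.run_upto (v := 4) (n := 0) (s := s.setVar 13 0)
    (c := .seq (.store 4 (.var 4) (.var 13)) (.assign 13 (.add (.var 13) (.var 1))))
    (fun i t => t.var 13 = i * q ∧ ∀ x < i, t.arr 4 x = x * q)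
    ⟨by simp [RAMState.setVar], fun j hj => absurd hj (Nat.not_lt_zero _)⟩ ?_
  · exact key.2 x (by rw [RAMState.setVar_ne _ _ (by decide), h0]; exact x.2)
  · rintro i t hi hti hv _ ⟨hI, hI'⟩
    have hq : t.var 1 = q := (hv 1 (by decide) rfl).trans h1
    refine ⟨?_, fun x hx => ?_⟩
    · rw [RAMState.setVar_ne _ _ (by decide), FProg.run, FProg.run, RAMState.setVar_self]
      simp only [FProg.run, Expr.eval, RAMState.setArr_var, hI, hq]
      ring
    · rw [RAMState.setVar_arr, FProg.run, FProg.run, RAMState.setVar_arr, FProg.run,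
        RAMState.setArr_arr]
      simp only [Expr.eval, hti, hI]
      split_ifs with h
      · rw [h]
      · exact hI' x (by omega)

open FProg in
/-- The inverse of the preference lists. -/
def ranks : FProg :=
  upto 4 0 (upto 5 1 (cond (atX 0 (.var 5))
    (store 6 (.add (.get 4 (.var 4)) (.pred (atX 0 (.var 5)))) (.succ (.var 5))) skip))

theorem listEntry_eq_zero {m : ℕ} {l : List (Fin m)} {k : ℕ} :
    listEntry l k = 0 ↔ l.length ≤ k := by
  rw [listEntry]
  rcases h : l[k]? with _ | a
  · simpa using h
  · simp only [Nat.add_eq_zero_iff, one_ne_zero, and_false, false_iff, not_le]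
    exact (List.getElem?_eq_some_iff.1 h).1

theorem listEntry_eq {m : ℕ} {l : List (Fin m)} (hl : l.Nodup) {k : ℕ} {a : Fin m} :
    listEntry l k = a + 1 ↔ a ∈ l ∧ l.idxOf a = k := by
  rw [listEntry]
  rcases h : l[k]? with _ | b
  · simp only [Nat.right_eq_add, Nat.add_eq_zero_iff, one_ne_zero, and_false, false_iff, not_and]
    intro ha e
    have := List.idxOf_lt_length_iff.2 ha
    have : l.length ≤ k := by simpa using h
    omega
  · obtain ⟨hk, rfl⟩ := List.getElem?_eq_some_iff.1 h
    simp only [Nat.add_right_cancel_iff]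
    constructor
    · intro e
      rw [← Fin.ext e]
      exact ⟨List.getElem_mem hk, hl.idxOf_getElem k hk⟩
    · rintro ⟨ha, rfl⟩
      simp

theorem ranks_spec {T : Inst p q} {s : RAMState} (h0 : s.var 0 = p) (h1 : s.var 1 = q)
    (h4 : ∀ x : Fin p, s.arr 4 x = x * q)
    (hl : ∀ (x : Fin p) (k : ℕ), k < q → s.arr 0 (x * q + k) = listEntry (T.listX x) k)
    (h6 : ∀ k, s.arr 6 k = 0) (x : Fin p) (y : Fin q) :
    (ranks.run s).arr 6 (x * q + y) = if (x, y) ∈ T.edges then rkX T x y + 1 else 0 := by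
  have key := FProg.run_upto (v := 4) (n := 0) (s := s)
    (c := .upto 5 1 (.cond (atX 0 (.var 5))
      (.store 6 (.add (.get 4 (.var 4)) (.pred (atX 0 (.var 5)))) (.succ (.var 5))) .skip))
    (fun i t => ∀ (x : Fin p) (y : Fin q), t.arr 6 (x * q + y) =
      if (x, y) ∈ T.edges ∧ (x : ℕ) < i then rkX T x y + 1 else 0) ?_ ?_
  · have := key x y
    rw [h0] at this
    rw [ranks, this]
    simp
  · intro x y
    rw [RAMState.setVar_arr, h6]
    simp
  · intro i t hi hti hv ha hI
    have hip : i < p := by omega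
    have hq : t.var 1 = q := (hv 1 (by decide) rfl).trans h1
    have key := FProg.run_upto (v := 5) (n := 1) (s := t)
      (c := .cond (atX 0 (.var 5))
        (.store 6 (.add (.get 4 (.var 4)) (.pred (atX 0 (.var 5)))) (.succ (.var 5))) .skip)
      (fun j t => ∀ (x : Fin p) (y : Fin q), t.arr 6 (x * q + y) =
        if (x, y) ∈ T.edges ∧ ((x : ℕ) < i ∨ (x : ℕ) = i ∧ rkX T x y < j) then rkX T x y + 1 else 0)
      ?_ ?_
    · rw [hq] at key
      intro x y
      rw [RAMState.setVar_arr, key x y]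
      refine if_congr (and_congr_right fun he => ?_) rfl rfl
      have hlt : rkX T x y < q := by
        have h2 := List.idxOf_lt_length_iff.2 (mem_edges.1 he)
        have h3 := (T.nodupX x).length_le_card
        rw [Fintype.card_fin] at h3
        exact h2.trans_le h3
      omega
    · intro x y
      rw [RAMState.setVar_arr, hI]
      simp
    · intro j u hj huj hv' hau hI' x y
      have hjq : j < q := by rwa [hq] at hj
      have u4 : u.var 4 = i := (hv' 4 (by decide) rfl).trans hti
      have hval : (atX 0 (.var 5)).eval u = listEntry (T.listX ⟨i, hip⟩) j := by
        simp only [atX, Expr.eval, u4, huj, hau 4 rfl, hau 0 rfl, ha 4 rfl, ha 0 rfl]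
        rw [h4 ⟨i, hip⟩, hl ⟨i, hip⟩ j hjq]
      by_cases hz : listEntry (T.listX ⟨i, hip⟩) j = 0
      · rw [FProg.run_cond_neg (by simpa [hval] using hz), FProg.run, RAMState.setVar_arr, hI']
        refine if_congr (and_congr_right fun he => or_congr_right (and_congr_right fun hx => ?_)) rfl rfl
        obtain rfl : x = ⟨i, hip⟩ := Fin.ext hx
        have h2 := List.idxOf_lt_length_iff.2 (mem_edges.1 he)
        have h3 := listEntry_eq_zero.1 hz
        change (T.listX _).idxOf y < j ↔ (T.listX _).idxOf y < j + 1
        omega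
      · have hlen : j < (T.listX ⟨i, hip⟩).length := by
          by_contra h
          exact hz (listEntry_eq_zero.2 (by omega))
        set m := (T.listX ⟨i, hip⟩)[j] with hm
        have hent : listEntry (T.listX ⟨i, hip⟩) j = m + 1 :=
          (listEntry_eq (T.nodupX _)).2 ⟨List.getElem_mem hlen, (T.nodupX _).idxOf_getElem j hlen⟩
        have hmj : ∀ y, (y ∈ T.listX ⟨i, hip⟩ ∧ rkX T ⟨i, hip⟩ y = j) ↔ m = y := by
          intro y
          rw [rkX, ← listEntry_eq (T.nodupX _), hent]
          simp [Fin.ext_iff]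
        rw [FProg.run_cond_pos (by rw [hval]; exact hz), FProg.run, RAMState.setVar_arr,
          RAMState.setArr_arr]
        have hidx : (Expr.add (.get 4 (.var 4)) (.pred (atX 0 (.var 5)))).eval u =
            ((⟨i, hip⟩ : Fin p) : ℕ) * q + (m : ℕ) := by
          rw [Expr.eval, Expr.eval_pred, hval, hent, Nat.add_sub_cancel]
          simp only [Expr.eval, u4, hau 4 rfl, ha 4 rfl]
          rw [← h4 ⟨i, hip⟩]
        have hj1 : (Expr.succ (.var 5)).eval u = j + 1 := by rw [Expr.eval_succ, Expr.eval, huj]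
        rw [hidx, hj1]
        split_ifs with g1 g2 g2
        · obtain ⟨rfl, rfl⟩ := matrix_index_inj g1
          rw [((hmj m).2 rfl).2]
        · obtain ⟨rfl, rfl⟩ := matrix_index_inj g1
          have := (hmj m).2 rfl
          exact absurd ⟨mem_edges.2 this.1, Or.inr ⟨rfl, by omega⟩⟩ g2
        · rw [hI', if_pos]
          refine ⟨g2.1, g2.2.imp id fun h => ⟨h.1, ?_⟩⟩
          obtain rfl : x = ⟨i, hip⟩ := Fin.ext h.1
          have : rkX T ⟨i, hip⟩ y ≠ j := by
            intro e
            have := (hmj y).1 ⟨mem_edges.1 g2.1, e⟩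
            exact g1 (by rw [this])
          omega
        · rw [hI', if_neg]
          exact fun h => g2 ⟨h.1, h.2.imp id fun h => ⟨h.1, by omega⟩⟩

/-! ### The first matching -/

open FProg in
/-- Compute the `X`-optimal matching of the table in array 2. -/
def firstMatching : FProg :=
  seq (upto 4 0 (seq (argmin (atX 2 (.var 5))) (store 11 (.var 4) (.var 7))))
    (seq (fill 4 0 12 (.get 11 (.var 4))) (seq (fill 4 0 8 (.const 0))
      (seq (fill 5 1 9 (.const 0)) move)))

theorem mem_xOptimal_iff {T : Inst p q} {E M : Table p q} (hE : E ⊆ T.edges)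
    (hs : IsStableTable T E) (hM : IsXOptimal T E M) {x : Fin p} {y : Fin q} :
    (x, y) ∈ M ↔ (x, y) ∈ E ∧ ∀ y', (x, y') ∈ E → rkX T x y ≤ rkX T x y' := by
  have hM' := (isXOptimal_iff hE).1 hM
  have hMm := stable_mat hE hM.1
  constructor
  · refine fun h => ⟨hM.1.1.2 h, fun y' hy' => ?_⟩
    obtain ⟨K, hK, hyK⟩ := hs _ hy'
    exact (hM'.2 K hK).leX (stable_mat hE hK) h hyK
  · rintro ⟨h, hmin⟩
    obtain ⟨K, hK, hyK⟩ := hs _ h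
    obtain ⟨m, _, hm, _, hle, _⟩ := (hM'.2 K hK).2 _ _ hyK
    have := hmin m (hM.1.1.2 hm)
    rwa [rkX_inj (hE h) (le_antisymm this hle)]

theorem firstMatching_spec {T : Inst p q} {E M : Table p q} (hE : E ⊆ T.edges) (hs : IsStableTable T E)
    (hM : IsXOptimal T E M) {s : RAMState} (hB : Base T s) (h2 : CodesT (s.arr 2) E) :
    CodesM ((firstMatching.run s).arr 8) M ∧ CodesM ((firstMatching.run s).arr 9) M.swap := by
  have hMm := stable_mat hE hM.1
  set s₁ := (FProg.upto 4 0 (.seq (argmin (atX 2 (.var 5))) (.store 11 (.var 4) (.var 7)))).run s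
    with hs₁
  have h11 : CodesM (s₁.arr 11) M := by
    refine CodesM.intro (fun x y y' => hMm.uniqX) ?_
    have key := FProg.run_upto (v := 4) (n := 0) (s := s)
      (c := .seq (argmin (atX 2 (.var 5))) (.store 11 (.var 4) (.var 7)))
      (fun i t => ∀ x : Fin p, (x : ℕ) < i → (t.arr 11 x = 0 ∧ ∀ y, (x, y) ∉ M) ∨
        ∃ y : Fin q, t.arr 11 x = y + 1 ∧ (x, y) ∈ M)
      (fun j hj => absurd hj (Nat.not_lt_zero _)) ?_
    · exact fun x => key x (by rw [hB.var0]; exact x.2)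
    · intro i t hi hti hv ha hI x hx
      have hip : i < p := by rw [← hB.var0]; exact hi
      have hBt : Base T t := hB.congr (hv 0 (by decide) rfl) (hv 1 (by decide) rfl) (ha 4 rfl)
        (ha 5 rfl) (ha 6 rfl) (ha 7 rfl)
      have ham := argmin_spec hBt (e := atX 2 (.var 5)) (x := ⟨i, hip⟩) hti
        (fun y => ((⟨i, hip⟩ : Fin p), y) ∈ E) (fun y hy => hE hy) fun t' y g1 g2 g3 => by
          rw [← h2.ne_zero]
          simp only [atX, Expr.eval, g1, g2, g3, ha 2 rfl]
          rw [hBt.rowX ⟨i, hip⟩]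
      set t' := (argmin (atX 2 (.var 5))).run t with ht'
      have v4 : t'.var 4 = i := by rw [ht', FProg.run_var _ rfl, hti]
      have a11 : t'.arr 11 = t.arr 11 := FProg.run_arr _ rfl _
      have hval : (((FProg.seq (argmin (atX 2 (.var 5))) (.store 11 (.var 4) (.var 7))).run t).setVar 4
          (i + 1)).arr 11 x = if (x : ℕ) = i then t'.var 7 else t.arr 11 x := by
        change (t'.setArr 11 (t'.var 4) (t'.var 7)).arr 11 x = _
        rw [RAMState.setArr_arr, v4, a11]
      rw [hval]
      split_ifs with hxi
      · obtain rfl : x = ⟨i, hip⟩ := Fin.ext hxi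
        rcases ham with ⟨h7, hno⟩ | ⟨y, h7, hy⟩
        · exact Or.inl ⟨h7, fun y hy => hno y (hM.1.1.2 hy)⟩
        · exact Or.inr ⟨y, h7, (mem_xOptimal_iff hE hs hM).2 hy⟩
      · exact hI x (by omega)
  set s₂ := (fill 4 0 12 (.get 11 (.var 4))).run s₁ with hs₂
  set s₃ := (fill 4 0 8 (.const 0)).run s₂ with hs₃
  set s₄ := (fill 5 1 9 (.const 0)).run s₃ with hs₄
  have v1 : s₁.var 0 = p := by rw [hs₁, FProg.run_var _ rfl, hB.var0]
  have v2 : s₂.var 0 = p := by rw [hs₂, FProg.run_var _ rfl, v1]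
  have v3 : s₃.var 1 = q := by
    rw [hs₃, FProg.run_var _ rfl, hs₂, FProg.run_var _ rfl, hs₁, FProg.run_var _ rfl, hB.var1]
  have v4 : s₄.var 0 = p := by rw [hs₄, FProg.run_var _ rfl, hs₃, FProg.run_var _ rfl, v2]
  have a11 : s₄.arr 11 = s₁.arr 11 := by
    rw [hs₄, FProg.run_arr _ rfl, hs₃, FProg.run_arr _ rfl, hs₂, FProg.run_arr _ rfl]
  have a12 : ∀ x : Fin p, s₄.arr 12 x = s₁.arr 11 x := by
    intro x
    rw [hs₄, FProg.run_arr _ rfl, hs₃, FProg.run_arr _ rfl]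
    refine fill_spec (g := fun i => s₁.arr 11 i) (fun t i _ ht hv => ?_) (by rw [v1]; exact x.2)
    simp only [Expr.eval, hv]
    rw [ht 11 (by decide)]
  have a8 : ∀ x : Fin p, s₄.arr 8 x = 0 := by
    intro x
    rw [hs₄, FProg.run_arr _ rfl]
    exact fill_spec (g := fun _ => 0) (fun _ _ _ _ _ => rfl) (by rw [v2]; exact x.2)
  have a9 : ∀ y : Fin q, s₄.arr 9 y = 0 := fun y =>
    fill_spec (g := fun _ => 0) (fun _ _ _ _ _ => rfl) (by rw [v3]; exact y.2)
  have hrun : firstMatching.run s = move.run s₄ := rfl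
  have hC : ∀ x : Fin p, s₄.arr 12 x ≠ 0 ↔ ∃ y, (x, y) ∈ M := by
    intro x
    rw [a12]
    rcases h11.cases x with ⟨h0, hno⟩ | ⟨y, hy, hyM⟩
    · exact ⟨fun h => absurd h0 h, fun ⟨y, hy⟩ => absurd hy (hno y)⟩
    · exact ⟨fun _ => ⟨y, hyM⟩, fun _ => by omega⟩
  have hmv := move_spec v4 (C := fun x => ∃ y, (x, y) ∈ M) (nx := fun x => s₁.arr 11 x - 1) hC
    (fun x ⟨y, hy⟩ => by rw [a11, h11.eq hy, Nat.add_sub_cancel])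
    (fun x x' ⟨y, hy⟩ ⟨y', hy'⟩ e => by
      rw [h11.eq hy, h11.eq hy', Nat.add_sub_cancel, Nat.add_sub_cancel] at e
      obtain rfl := Fin.ext e
      exact hMm.uniqY hy hy')
  rw [hrun]
  constructor
  · refine CodesM.intro (fun x y y' => hMm.uniqX) fun x => ?_
    by_cases hx : ∃ y, (x, y) ∈ M
    · obtain ⟨y, hy⟩ := hx
      refine Or.inr ⟨y, ?_, hy⟩
      rw [(hmv.1 x).1 ⟨y, hy⟩, h11.eq hy, Nat.add_sub_cancel]
    · refine Or.inl ⟨?_, fun y hy => hx ⟨y, hy⟩⟩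
      rw [(hmv.1 x).2 hx, a8]
  · refine CodesM.intro (fun y x x' h1 h2 => hMm.uniqY (mem_swap.1 h1) (mem_swap.1 h2)) fun y => ?_
    by_cases hy : ∃ x, (x, y) ∈ M
    · obtain ⟨x, hx⟩ := hy
      refine Or.inr ⟨x, ?_, mem_swap.2 hx⟩
      have := hmv.2.1 x ⟨y, hx⟩
      rwa [h11.eq hx, Nat.add_sub_cancel] at this
    · refine Or.inl ⟨?_, fun x hx => hy ⟨x, mem_swap.1 hx⟩⟩
      rw [hmv.2.2 y, a9]
      rintro x ⟨y', hy'⟩ e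
      rw [h11.eq hy', Nat.add_sub_cancel] at e
      obtain rfl := Fin.ext e
      exact hy ⟨x, hy'⟩

end Marriage

namespace Marriage

variable {p q : ℕ}

theorem CodesM.congr {a b : ℕ → ℕ} {M : Table p q} (h : CodesM a M) (hab : ∀ x : Fin p, b x = a x) :
    CodesM b M := fun x => by rw [hab]; exact h x

theorem CodesS.congr {a b : ℕ → ℕ} {L : Finset (Fin p)} (h : CodesS a L)
    (hab : ∀ x : Fin p, b x = a x) : CodesS b L := fun x => by rw [hab]; exact h x

theorem Expr.eval_and_ite {e f : Expr} {s : RAMState} {P : Prop} [Decidable P]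
    (h : (Expr.and e f).eval s ≠ 0 ↔ P) : (Expr.and e f).eval s = if P then 1 else 0 := by
  have h01 : (Expr.and e f).eval s = 0 ∨ (Expr.and e f).eval s = 1 := by
    rw [Expr.and, Expr.eval]
    split_ifs <;> simp
  split_ifs with hP
  · exact h01.resolve_left (h.2 hP)
  · exact not_not.1 fun h' => hP (h.1 h')

open FProg in
/-- Exchange the arrays `a` and `b`. -/
def swapArr (v n a b : ℕ) : FProg :=
  seq (fill v n 19 (.get a (.var v))) (seq (fill v n a (.get b (.var v)))
    (fill v n b (.get 19 (.var v))))

theorem swapArr_spec {s : RAMState} {v n a b : ℕ} (hv : n ≠ v) (hab : a ≠ b) (ha : a ≠ 19)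
    (hb : b ≠ 19) {i : ℕ} (hi : i < s.var n) : ((swapArr v n a b).run s).arr a i = s.arr b i ∧
      ((swapArr v n a b).run s).arr b i = s.arr a i := by
  set s₁ := (fill v n 19 (.get a (.var v))).run s with hs₁
  set s₂ := (fill v n a (.get b (.var v))).run s₁ with hs₂
  have hrun : (swapArr v n a b).run s = (fill v n b (.get 19 (.var v))).run s₂ := rfl
  have hvv : ∀ c e t, ((fill v n c e).run t).var n = t.var n := fun c e t =>
    FProg.run_var _ (by simpa [fill, FProg.writesVar] using hv.symm) _
  have fr : ∀ {c d : ℕ} (e t), c ≠ d → ((fill v n c e).run t).arr d = t.arr d := fun e t hcd =>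
    FProg.run_arr _ (by simpa [fill, FProg.writesArr] using hcd) _
  have n1 : s₁.var n = s.var n := hvv _ _ _
  have n2 : s₂.var n = s.var n := (hvv _ _ _).trans n1
  have e1 : s₁.arr 19 i = s.arr a i := fill_spec (g := s.arr a)
    (fun t i _ ht hv => by simp only [Expr.eval, hv]; rw [ht a ha]) hi
  have e2 : s₂.arr a i = s₁.arr b i := fill_spec (g := s₁.arr b)
    (fun t i _ ht hv => by simp only [Expr.eval, hv]; rw [ht b hab.symm]) (by rwa [n1])
  have e3 : ((fill v n b (.get 19 (.var v))).run s₂).arr b i = s₂.arr 19 i :=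
    fill_spec (g := s₂.arr 19)
    (fun t i _ ht hv => by simp only [Expr.eval, hv]; rw [ht 19 hb.symm]) (by rwa [n2])
  rw [hrun, e3, fr _ _ hab.symm, e2, hs₂, fr _ _ ha, e1, hs₁, fr _ _ hb.symm]
  exact ⟨rfl, rfl⟩

/-! ### Dissecting, as a program -/

/-- The state of the first phase. -/
structure Ph (T : Inst p q) (E₀ M N : Table p q) (L : Finset (Fin p)) (E : Table p q)
    (s : RAMState) : Prop where
  base : Base T s
  tab : CodesT (s.arr 2) E₀
  mx : CodesM (s.arr 8) M
  my : CodesM (s.arr 9) M.swap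
  nx : CodesM (s.arr 15) N
  ny : CodesM (s.arr 16) N.swap
  alive : CodesS (s.arr 17) L
  out : CodesT (s.arr 18) E

open FProg in
/-- Find an agent with different partners in the two matchings. -/
def findDiff : FProg :=
  seq (assign 11 (.const 0)) (upto 4 0 (cond (.eq (.get 8 (.var 4)) (.get 15 (.var 4))) skip
    (assign 11 (.succ (.var 4)))))

open FProg in
/-- Move the lower matching along the next rotation of the table in array 2. -/
def nextP : FProg :=
  seq (fill 4 0 10 (.get 17 (.var 4))) (seq (fillT 13 (atX 2 (.var 5))) (seq step
    (seq (fill 4 0 17 (.get 10 (.var 4))) (seq (swapArr 4 0 8 15) (swapArr 5 1 9 16)))))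

/-- `x` belongs to the cycle, and `y` lies between the two matchings for `x` and conversely. -/
def betweenE : Expr :=
  .and (.and (atX 6 (.var 5)) (.and
    (.and (.and (.get 16 (.var 5)) (.le (atY 7 (.pred (.get 16 (.var 5)))) (atY 7 (.var 4))))
      (.add (.not (.get 9 (.var 5))) (.le (atY 7 (.var 4)) (atY 7 (.pred (.get 9 (.var 5)))))))
    (.and (.and (.get 8 (.var 4)) (.le (atX 6 (.pred (.get 8 (.var 4)))) (atX 6 (.var 5))))
      (.add (.not (.get 15 (.var 4))) (.le (atX 6 (.var 5)) (atX 6 (.pred (.get 15 (.var 4)))))))))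
    (.get 10 (.var 4))

open FProg in
/-- Move the upper matching along the next rotation inside a cycle. -/
def refineP : FProg :=
  seq (assign 10 (.pred (.var 11))) (seq (orbit 10 (.pred (.get 9 (.pred (.get 15 (.var 10))))))
    (seq (fillT 13 betweenE) (seq step record)))

open FProg in
def dissectBody : FProg := seq findDiff (cond (.var 11) refineP nextP)

section

variable {T : Inst p q} {E₀ M N E : Table p q} {L : Finset (Fin p)} {s : RAMState}

theorem findDiff_spec (h0 : s.var 0 = p) :
    ((findDiff.run s).var 11 = 0 ∧ ∀ x : Fin p, s.arr 8 x = s.arr 15 x) ∨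
      ∃ x : Fin p, (findDiff.run s).var 11 = x + 1 ∧ s.arr 8 x ≠ s.arr 15 x := by
  have key := FProg.run_upto (v := 4) (n := 0) (s := s.setVar 11 0)
    (c := .cond (.eq (.get 8 (.var 4)) (.get 15 (.var 4))) .skip (.assign 11 (.succ (.var 4))))
    (fun i t => (t.var 11 = 0 ∧ ∀ x : Fin p, (x : ℕ) < i → s.arr 8 x = s.arr 15 x) ∨
      ∃ x : Fin p, t.var 11 = x + 1 ∧ s.arr 8 x ≠ s.arr 15 x)
    (Or.inl ⟨rfl, fun x hx => absurd hx (Nat.not_lt_zero _)⟩) ?_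
  · exact key.imp (fun h => ⟨h.1, fun x => h.2 x (by rw [RAMState.setVar_ne _ _ (by decide), h0]; exact x.2)⟩) id
  · intro i t hi hti hv ha hI
    have hip : i < p := by rw [← h0]; exact hi
    have hcond : (Expr.eq (.get 8 (.var 4)) (.get 15 (.var 4))).eval t ≠ 0 ↔ s.arr 8 i = s.arr 15 i := by
      rw [Expr.eval_eq_ne]
      simp only [Expr.eval, hti, ha 8 rfl, ha 15 rfl]
      rfl
    by_cases hc : s.arr 8 i = s.arr 15 i
    · rw [FProg.run_cond_pos (hcond.2 hc), FProg.run, RAMState.setVar_ne _ _ (by decide)]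
      refine hI.imp (fun h => ⟨h.1, fun x hx => ?_⟩) id
      by_cases e : (x : ℕ) = i
      · rw [e, hc]
      · exact h.2 x (by omega)
    · rw [FProg.run_cond_neg fun h => hc (hcond.1 h), FProg.run, RAMState.setVar_ne _ _ (by decide)]
      refine Or.inr ⟨⟨i, hip⟩, ?_, hc⟩
      rw [RAMState.setVar_self, Expr.eval_succ, Expr.eval, hti]

theorem nextP_spec (h : Ph T E₀ N N L E s) (hE : E₀ ⊆ T.edges) (hN : Mat T N)
    (hL : Alive T E₀ N L) :
    ∃ N' L', Outcome T E₀ N L N' L' ∧ Ph T E₀ N N' L' E (nextP.run s) := by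
  obtain ⟨s₁, hs₁⟩ : ∃ t, t = (fill 4 0 10 (.get 17 (.var 4))).run s := ⟨_, rfl⟩
  obtain ⟨s₂, hs₂⟩ : ∃ t, t = (fillT 13 (atX 2 (.var 5))).run s₁ := ⟨_, rfl⟩
  have fr1 : ∀ a, (fill 4 0 10 (.get 17 (.var 4))).writesArr a = false → s₁.arr a = s.arr a :=
    fun a ha => by rw [hs₁, FProg.run_arr _ ha]
  have fr2 : ∀ a, (fillT 13 (atX 2 (.var 5))).writesArr a = false → s₂.arr a = s₁.arr a :=
    fun a ha => by rw [hs₂, FProg.run_arr _ ha]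
  have hB₁ : Base T s₁ := h.base.congr (by rw [hs₁, FProg.run_var _ rfl])
    (by rw [hs₁, FProg.run_var _ rfl]) (fr1 4 rfl) (fr1 5 rfl) (fr1 6 rfl) (fr1 7 rfl)
  have hB₂ : Base T s₂ := hB₁.congr (by rw [hs₂, FProg.run_var _ rfl])
    (by rw [hs₂, FProg.run_var _ rfl]) (fr2 4 rfl) (fr2 5 rfl) (fr2 6 rfl) (fr2 7 rfl)
  have hpre : Pre T E₀ N L s₂ := by
    refine ⟨hB₂, ?_, ?_, ?_, ?_⟩
    · rw [fr2 8 rfl, fr1 8 rfl]; exact h.mx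
    · rw [fr2 9 rfl, fr1 9 rfl]; exact h.my
    · refine h.alive.congr fun x => ?_
      rw [fr2 10 rfl, hs₁]
      exact fill_spec (g := s.arr 17) (fun t i _ ht hv => by
        simp only [Expr.eval, hv]; rw [ht 17 (by decide)]) (by rw [h.base.var0]; exact x.2)
    · intro x y
      rw [← h.tab x y, hs₂]
      refine fillT_spec hB₁.var0 hB₁.var1 hB₁.rowX (by decide)
        (g := fun x y => s.arr 2 (x * q + y)) (fun t x y ht h4 h5 => ?_) x y
      simp only [atX, Expr.eval, h4, h5]
      rw [ht 4 (by decide), hB₁.rowX, ht 2 (by decide), fr1 2 rfl]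
  obtain ⟨N', L', hout, hpre'⟩ := step_spec hpre hE hN hL
  refine ⟨N', L', hout, ?_⟩
  have fr3 : ∀ a, step.writesArr a = false → (step.run s₂).arr a = s₂.arr a :=
    fun a ha => FProg.run_arr _ ha _
  obtain ⟨s₃, hs₃⟩ : ∃ t, t = step.run s₂ := ⟨_, rfl⟩
  rw [← hs₃] at hpre' fr3
  obtain ⟨s₄, hs₄⟩ : ∃ t, t = (fill 4 0 17 (.get 10 (.var 4))).run s₃ := ⟨_, rfl⟩
  obtain ⟨s₅, hs₅⟩ : ∃ t, t = (swapArr 4 0 8 15).run s₄ := ⟨_, rfl⟩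
  obtain ⟨s₆, hs₆⟩ : ∃ t, t = (swapArr 5 1 9 16).run s₅ := ⟨_, rfl⟩
  have hrun : nextP.run s = s₆ := by rw [hs₆, hs₅, hs₄, hs₃, hs₂, hs₁]; rfl
  have fr4 : ∀ a, (fill 4 0 17 (.get 10 (.var 4))).writesArr a = false → s₄.arr a = s₃.arr a :=
    fun a ha => by rw [hs₄, FProg.run_arr _ ha]
  have fr5 : ∀ a, (swapArr 4 0 8 15).writesArr a = false → s₅.arr a = s₄.arr a :=
    fun a ha => by rw [hs₅, FProg.run_arr _ ha]
  have fr6 : ∀ a, (swapArr 5 1 9 16).writesArr a = false → s₆.arr a = s₅.arr a :=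
    fun a ha => by rw [hs₆, FProg.run_arr _ ha]
  have v4 : s₄.var 0 = p := by rw [hs₄, FProg.run_var _ rfl, hpre'.base.var0]
  have v5 : s₅.var 1 = q := by
    rw [hs₅, FProg.run_var _ rfl, hs₄, FProg.run_var _ rfl, hpre'.base.var1]
  have sw1 : ∀ x : Fin p, s₅.arr 8 x = s₄.arr 15 x ∧ s₅.arr 15 x = s₄.arr 8 x := fun x => by
    rw [hs₅]
    exact swapArr_spec (by decide) (by decide) (by decide) (by decide) (by rw [v4]; exact x.2)
  have sw2 : ∀ y : Fin q, s₆.arr 9 y = s₅.arr 16 y ∧ s₆.arr 16 y = s₅.arr 9 y := fun y => by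
    rw [hs₆]
    exact swapArr_spec (by decide) (by decide) (by decide) (by decide) (by rw [v5]; exact y.2)
  have frs : ∀ a, nextP.writesArr a = false → s₆.arr a = s.arr a := fun a ha => by
    rw [← hrun, FProg.run_arr _ ha]
  have hB₆ : Base T s₆ := h.base.congr (by rw [← hrun, FProg.run_var _ rfl])
    (by rw [← hrun, FProg.run_var _ rfl]) (frs 4 rfl) (frs 5 rfl) (frs 6 rfl) (frs 7 rfl)
  rw [hrun]
  refine ⟨hB₆, ?_, ?_, ?_, ?_, ?_, ?_, ?_⟩
  · rw [frs 2 rfl]; exact h.tab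
  · refine h.nx.congr fun x => ?_
    rw [fr6 8 rfl, (sw1 x).1, fr4 15 rfl, fr3 15 rfl, fr2 15 rfl, fr1 15 rfl]
  · refine h.ny.congr fun y => ?_
    rw [(sw2 y).1, fr5 16 rfl, fr4 16 rfl, fr3 16 rfl, fr2 16 rfl, fr1 16 rfl]
  · refine hpre'.mx.congr fun x => ?_
    rw [fr6 15 rfl, (sw1 x).2, fr4 8 rfl]
  · refine hpre'.my.congr fun y => ?_
    rw [(sw2 y).2, fr5 9 rfl, fr4 9 rfl]
  · refine hpre'.alive.congr fun x => ?_
    rw [fr6 17 rfl, fr5 17 rfl, hs₄]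
    exact fill_spec (g := s₃.arr 10) (fun t i _ ht hv => by
      simp only [Expr.eval, hv]; rw [ht 10 (by decide)]) (by rw [hpre'.base.var0]; exact x.2)
  · rw [frs 18 rfl]; exact h.out

theorem betweenE_eval (hB : Base T s) (hM : Mat T M) (hN : Mat T N) (h8 : CodesM (s.arr 8) M)
    (h9 : CodesM (s.arr 9) M.swap) (h15 : CodesM (s.arr 15) N) (h16 : CodesM (s.arr 16) N.swap)
    (h10 : CodesS (s.arr 10) L) {t : RAMState} (ht : ∀ a ≠ 13, t.arr a = s.arr a) {x : Fin p}
    {y : Fin q} (h4 : t.var 4 = x) (h5 : t.var 5 = y) :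
    betweenE.eval t = if (x, y) ∈ cycleTable T M N L then 1 else 0 := by
  refine Expr.eval_and_ite ?_
  rw [cycleTable, Finset.mem_filter, mem_between hM hN]
  simp only [Expr.eval_and, Expr.eval_add, Expr.eval_not, Expr.eval_le]
  simp only [atX, atY, Expr.eval, Expr.eval_pred, h4, h5, ht 4 (by decide), ht 5 (by decide), ht 6 (by decide),
    ht 7 (by decide), ht 8 (by decide), ht 9 (by decide), ht 10 (by decide), ht 15 (by decide),
    ht 16 (by decide), hB.rowX, hB.rowY]
  rw [h10.ne_zero]
  have hedge : s.arr 6 (x * q + y) ≠ 0 ↔ (x, y) ∈ T.edges := by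
    rw [hB.rankX]
    split_ifs with h <;> simp [h]
  rw [hedge]
  refine and_congr (and_congr_right fun he => ?_) Iff.rfl
  rw [hB.rankX_eq he, hB.rankY_eq he]
  refine and_congr (and_congr ?_ ?_) (and_congr ?_ ?_)
  · rcases h16.cases y with ⟨h0, hno⟩ | ⟨z, hz, hzN⟩
    · exact ⟨fun h => absurd h0 h.1, fun ⟨z, hz, _⟩ => absurd (mem_swap.2 hz) (hno z)⟩
    · have hzN' := mem_swap.1 hzN
      rw [hz, Nat.add_sub_cancel, hB.rankY_eq (hN.edge hzN')]
      constructor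
      · exact fun h => ⟨z, hzN', by omega⟩
      · rintro ⟨z', hz', hle⟩
        rw [hN.uniqY hz' hzN'] at hle
        omega
  · rcases h9.cases y with ⟨h0, hno⟩ | ⟨z, hz, hzM⟩
    · exact ⟨fun _ z hz => absurd (mem_swap.2 hz) (hno z), fun _ => Or.inl h0⟩
    · have hzM' := mem_swap.1 hzM
      rw [hz, Nat.add_sub_cancel, hB.rankY_eq (hM.edge hzM')]
      constructor
      · intro h z' hz'
        rw [hM.uniqY hz' hzM']
        omega
      · intro h
        have := h z hzM'
        omega
  · rcases h8.cases x with ⟨h0, hno⟩ | ⟨m, hm, hmM⟩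
    · exact ⟨fun h => absurd h0 h.1, fun ⟨m, hm, _⟩ => absurd hm (hno m)⟩
    · rw [hm, Nat.add_sub_cancel, hB.rankX_eq (hM.edge hmM)]
      constructor
      · exact fun h => ⟨m, hmM, by omega⟩
      · rintro ⟨m', hm', hle⟩
        rw [hM.uniqX hm' hmM] at hle
        omega
  · rcases h15.cases x with ⟨h0, hno⟩ | ⟨m, hm, hmN⟩
    · exact ⟨fun _ m hm => absurd hm (hno m), fun _ => Or.inl h0⟩
    · rw [hm, Nat.add_sub_cancel, hB.rankX_eq (hN.edge hmN)]
      constructor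
      · intro h m' hm'
        rw [hN.uniqX hm' hmN]
        omega
      · intro h
        have := h m hmN
        omega

theorem refineP_spec (h : Ph T E₀ M N L E s) (hM : Mat T M) (hN : Mat T N) (hd : Dom T M N)
    {x₀ : Fin p} (h11 : s.var 11 = x₀ + 1) (hne : s.arr 8 x₀ ≠ s.arr 15 x₀) :
    ∃ A σ C, IsAltCycle M N A ∧ (∀ x, x ∈ C ↔ ∃ y, (x, y) ∈ A.toFinset) ∧
      IsGenRotation T T.edges M σ ∧ shifted σ ⊆ cycleTable T M N C ∧ (∀ e ∈ σ.toFinset, e.1 ∈ C) ∧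
      Next T (cycleTable T M N C) M (elim M σ) ∧
      Ph T E₀ (elim M σ) N L (E ∪ elim M σ) (refineP.run s) := by
  classical
  obtain ⟨m₀, hm₀, hm₀N⟩ : ∃ m, (x₀, m) ∈ M ∧ (x₀, m) ∉ N := by
    rcases h.mx.cases x₀ with ⟨h0, hno⟩ | ⟨m, hm, hmM⟩
    · rcases h.nx.cases x₀ with ⟨h0', _⟩ | ⟨n, _, hn⟩
      · exact absurd (h0.trans h0'.symm) hne
      · obtain ⟨m, _, hm, _⟩ := hd.2 _ _ hn
        exact absurd hm (hno m)
    · exact ⟨m, hmM, fun hN' => hne (hm.trans (h.nx.eq hN').symm)⟩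
  obtain ⟨A, hA, haA⟩ := exists_altCycle hM hN hd hm₀ hm₀N
  have hgA := hA.isGenRotation subset_rfl hM hN hd hM.2 hN.2
  have hf : ∀ x, ∃ z : Fin p, (∃ y, (x, y) ∈ M) → ∃ n, (x, n) ∈ N ∧ (z, n) ∈ M := by
    intro x
    by_cases hx : ∃ y, (x, y) ∈ M
    · obtain ⟨y, hy⟩ := hx
      obtain ⟨n, _, hn, _⟩ := hd.1 _ _ hy
      obtain ⟨_, z, _, hz, _⟩ := hd.2 _ _ hn
      exact ⟨z, fun _ => ⟨n, hn, hz⟩⟩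
    · exact ⟨x, fun h => absurd h hx⟩
  choose f hf using hf
  have hlf : ∀ a b, (a, b) ∈ links A → f a.1 = b.1 := by
    intro a b hl
    obtain ⟨n, hn, hz⟩ := hf a.1 ⟨a.2, hgA.mem (mem_links_left hl)⟩
    have h1 := (Finset.mem_sdiff.1 (hA.2.2.2 (mem_shifted_of_link hl))).1
    rw [hN.uniqX hn h1] at hz
    exact hM.uniqY hz (hgA.mem (mem_links_right hl))
  have hC : ∀ x, (∃ i, f^[i] x₀ = x) ↔ ∃ y, (x, y) ∈ A.toFinset := by
    intro x
    constructor
    · rintro ⟨i, rfl⟩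
      induction i with
      | zero => exact ⟨m₀, haA⟩
      | succ i ih =>
        obtain ⟨y, hy⟩ := ih
        obtain ⟨b, hl⟩ := exists_link_left hy
        rw [Function.iterate_succ_apply', hlf _ _ hl]
        exact ⟨b.2, mem_links_right hl⟩
    · rintro ⟨y, hy⟩
      refine links_induction (P := fun e => ∃ i, f^[i] x₀ = e.1) haA ⟨0, rfl⟩ ?_ hy
      rintro c d hl ⟨i, hi⟩
      exact ⟨i + 1, by rw [Function.iterate_succ_apply', hi, hlf _ _ hl]⟩
  set C : Finset (Fin p) := Finset.univ.filter fun x => ∃ y, (x, y) ∈ A.toFinset with hCdef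
  have hCmem : ∀ x, x ∈ C ↔ ∃ y, (x, y) ∈ A.toFinset := fun x => by simp [hCdef]
  set s₁ := (FProg.assign 10 (.pred (.var 11))).run s with hs₁
  have v10 : s₁.var 10 = x₀ := by
    rw [hs₁, FProg.run, RAMState.setVar_self, Expr.eval_pred, Expr.eval, h11, Nat.add_sub_cancel]
  have p1 : s₁.var 0 = p := h.base.var0
  have horb := orbit_spec p1 (a := 10) (e := .pred (.get 9 (.pred (.get 15 (.var 10))))) (f := f)
    (S := fun x => ∃ y, (x, y) ∈ M) (fun x hx => by
      obtain ⟨n, _, hz⟩ := hf x hx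
      exact ⟨n, hz⟩)
    (fun t x ht hx hxM => by
      obtain ⟨n, hn, hz⟩ := hf x hxM
      have a15 : t.arr 15 = s.arr 15 := ht 15 (by decide)
      have a9 : t.arr 9 = s.arr 9 := ht 9 (by decide)
      rw [Expr.eval_pred]
      simp only [Expr.eval, Expr.eval_pred, hx, a9, a15]
      rw [h.nx.eq hn, Nat.add_sub_cancel, h.my.swap_eq hz, Nat.add_sub_cancel]) v10 ⟨m₀, hm₀⟩
  set s₂ := (orbit 10 (.pred (.get 9 (.pred (.get 15 (.var 10)))))).run s₁ with hs₂
  have fr2 : ∀ a, a ≠ 10 → s₂.arr a = s.arr a := fun a ha => by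
    have : ¬ 10 = a := fun h => ha h.symm
    rw [hs₂, FProg.run_arr _ (by simp [orbit, fill, FProg.writesArr, this])]
    rfl
  have hB₂ : Base T s₂ := h.base.congr (FProg.run_var _ rfl _) (FProg.run_var _ rfl _)
    (FProg.run_arr _ rfl _) (FProg.run_arr _ rfl _) (FProg.run_arr _ rfl _) (FProg.run_arr _ rfl _)
  have a10 : CodesS (s₂.arr 10) C := by
    intro x
    split_ifs with hx
    · exact (horb x).1 ((hC x).2 ((hCmem x).1 hx))
    · exact (horb x).2 fun h => hx ((hCmem x).2 ((hC x).1 h))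
  set s₃ := (fillT 13 betweenE).run s₂ with hs₃
  have hB₃ : Base T s₃ := hB₂.congr (FProg.run_var _ rfl _) (FProg.run_var _ rfl _)
    (FProg.run_arr _ rfl _) (FProg.run_arr _ rfl _) (FProg.run_arr _ rfl _) (FProg.run_arr _ rfl _)
  have fr3 : ∀ a, a ≠ 13 → s₃.arr a = s₂.arr a := fun a ha => by
    have : ¬ 13 = a := fun h => ha h.symm
    rw [hs₃, FProg.run_arr _ (by simp [fillT, FProg.writesArr, this])]
  have hpre : Pre T (cycleTable T M N C) M C s₃ := by
    refine ⟨hB₃, ?_, ?_, ?_, ?_⟩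
    · rw [fr3 8 (by decide), fr2 8 (by decide)]; exact h.mx
    · rw [fr3 9 (by decide), fr2 9 (by decide)]; exact h.my
    · rw [fr3 10 (by decide)]; exact a10
    · intro x y
      refine fillT_spec hB₂.var0 hB₂.var1 hB₂.rowX (by decide)
        (g := fun x y => if (x, y) ∈ cycleTable T M N C then 1 else 0) (fun t x y ht h4 h5 => ?_) x y
      exact betweenE_eval hB₂ hM hN (by rw [fr2 8 (by decide)]; exact h.mx)
        (by rw [fr2 9 (by decide)]; exact h.my) (by rw [fr2 15 (by decide)]; exact h.nx)
        (by rw [fr2 16 (by decide)]; exact h.ny) a10 ht h4 h5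
  have hCM : ∀ x ∈ C, ∃ y, (x, y) ∈ M := fun x hx => by
    obtain ⟨y, hy⟩ := (hCmem x).1 hx
    exact ⟨y, hgA.mem hy⟩
  obtain ⟨M', L', hout, hpre'⟩ := step_spec hpre
    ((Finset.filter_subset _ _).trans (between_subset _ _)) hM (alive_cycleTable hCM)
  have hx₀C : x₀ ∈ C := (hCmem x₀).2 ⟨m₀, haA⟩
  cases hout with
  | stay he => rw [he] at hx₀C; exact absurd hx₀C (Finset.notMem_empty _)
  | drop x hx hno =>
    obtain ⟨y, hy⟩ := isCand_cycleTable hM hN hd hA hCmem hx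
    exact absurd hy (hno y)
  | move σ hσ hσA hσC hnext _ =>
    refine ⟨A, σ, C, hA, hCmem, hσ, hσA, hσC, hnext, ?_⟩
    have hrun : refineP.run s = record.run (step.run s₃) := rfl
    have fr : ∀ a, refineP.writesArr a = false → (refineP.run s).arr a = s.arr a :=
      fun a ha => FProg.run_arr _ ha _
    refine ⟨h.base.congr (FProg.run_var _ rfl _) (FProg.run_var _ rfl _) (fr _ rfl) (fr _ rfl)
      (fr _ rfl) (fr _ rfl), ?_, ?_, ?_, ?_, ?_, ?_, ?_⟩
    · rw [fr 2 rfl]; exact h.tab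
    · rw [hrun, FProg.run_arr _ rfl]; exact hpre'.mx
    · rw [hrun, FProg.run_arr _ rfl]; exact hpre'.my
    · rw [fr 15 rfl]; exact h.nx
    · rw [fr 16 rfl]; exact h.ny
    · rw [fr 17 rfl]; exact h.alive
    · rw [hrun]
      refine record_spec hpre'.base.var0 hpre'.base.rowX hpre'.mx ?_
      rw [FProg.run_arr _ rfl, fr3 18 (by decide), fr2 18 (by decide)]
      exact h.out

end

end Marriage

namespace Marriage

variable {p q : ℕ}

/-! ### The main loops -/

open FProg in
/-- Run `c` as often as `3 * p * q` times. -/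
def often (c : FProg) : FProg := upto 2 0 (upto 3 1 (seq c (seq c c)))

theorem often_run {c : FProg} {s : RAMState} (h0 : s.var 0 = p) (h1 : s.var 1 = q)
    (hc : c.writesVar 1 = false) (I : ℕ → RAMState → Prop)
    (hI : ∀ k t v n, 2 ≤ v → I k t → I k (t.setVar v n)) (hs : ∀ k t, I k t → I (k + 1) (c.run t))
    (h : I 0 s) : I (3 * (p * q)) ((often c).run s) := by
  have key := FProg.run_upto (v := 2) (n := 0) (s := s) (c := .upto 3 1 (.seq c (.seq c c)))
    (fun i t => I (3 * (i * q)) t) (by rw [Nat.zero_mul]; exact hI _ _ _ _ le_rfl h) ?_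
  · rwa [h0] at key
  · intro i t _ _ hv _ hit
    have ht1 : t.var 1 = q := by
      rw [hv 1 (by decide) (by simp [FProg.writesVar, hc]), h1]
    refine hI _ _ _ _ le_rfl ?_
    have key := FProg.run_upto (v := 3) (n := 1) (s := t) (c := .seq c (.seq c c))
      (fun j u => I (3 * (i * q) + 3 * j) u) (hI _ _ _ _ (by decide) hit) ?_
    · rw [ht1] at key
      rwa [show 3 * ((i + 1) * q) = 3 * (i * q) + 3 * q by ring]
    · intro j u _ _ _ _ hju
      refine hI _ _ _ _ (by decide) ?_
      exact hs _ _ (hs _ _ (hs _ _ hju))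

/-- A loop that decreases a measure until it is done is done in the end. -/
theorem often_spec {α : Type*} {c : FProg} {s : RAMState} (h0 : s.var 0 = p) (h1 : s.var 1 = q)
    (hc : c.writesVar 1 = false) (R : α → RAMState → Prop) (D : α → Prop) (μ : α → ℕ)
    (hR : ∀ a t v n, 2 ≤ v → R a t → R a (t.setVar v n))
    (hs : ∀ a t, R a t → ∃ b, R b (c.run t) ∧ (D a ∧ D b ∨ ¬ D a ∧ μ b < μ a))
    {a : α} (h : R a s) (hμ : μ a ≤ 3 * (p * q)) : ∃ b, R b ((often c).run s) ∧ D b := by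
  obtain ⟨b, hb, hk⟩ := often_run h0 h1 hc (fun k t => ∃ b, R b t ∧ (D b ∨ μ b + k ≤ 3 * (p * q)))
    (fun k t v n hv ⟨b, hb, hk⟩ => ⟨b, hR b t v n hv hb, hk⟩) (fun k t ⟨b, hb, hk⟩ => by
      obtain ⟨b', hb', ⟨-, hD⟩ | ⟨hD, hlt⟩⟩ := hs b t hb
      · exact ⟨_, hb', Or.inl hD⟩
      · have := hk.resolve_left hD
        exact ⟨b', hb', Or.inr (by omega)⟩) ⟨a, h, Or.inr (by omega)⟩
  refine ⟨b, hb, by_contra fun hD => ?_⟩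
  obtain ⟨b', -, ⟨hD', -⟩ | ⟨-, hlt⟩⟩ := hs b _ hb
  · exact hD hD'
  · have := hk.resolve_left hD
    omega

theorem rankSum_le {T : Inst p q} {M : Table p q} (hM : Mat T M) : rankSum T M ≤ p * q := by
  calc rankSum T M ≤ ∑ _x : Fin p, q := Finset.sum_le_sum fun x _ => ?_
    _ = p * q := by simp
  by_cases hx : ∃ y, (x, y) ∈ M
  · obtain ⟨y, hy⟩ := hx
    rw [rank_of_mem hM hy]
    have h2 := List.idxOf_lt_length_iff.2 (mem_edges.1 (hM.edge hy))
    have h3 := (T.nodupX x).length_le_card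
    rw [Fintype.card_fin] at h3
    exact (h2.trans_le h3).le
  · push Not at hx
    simp [hx]

theorem Alive.card_le {T : Inst p q} {A M : Table p q} {L : Finset (Fin p)} (h : Alive T A M L) :
    L.card ≤ p * q := by
  rcases L.eq_empty_or_nonempty with rfl | ⟨x, hx⟩
  · simp
  · obtain ⟨y, _⟩ := h.matched x hx
    calc L.card ≤ p := by simpa using L.card_le_univ
      _ ≤ p * q := Nat.le_mul_of_pos_right _ y.pos

theorem CodesM.unique {a : ℕ → ℕ} {M N : Table p q} (hM : CodesM a M) (hN : CodesM a N) : M = N := by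
  ext ⟨x, y⟩
  rw [← (hM x).2, (hN x).2]

theorem Base.setVar {T : Inst p q} {s : RAMState} (h : Base T s) {v n : ℕ} (hv : 2 ≤ v) :
    Base T (s.setVar v n) :=
  h.congr (RAMState.setVar_ne _ _ (by omega)) (RAMState.setVar_ne _ _ (by omega)) rfl rfl rfl rfl

theorem IsGenRotation.rankSum_lt {T : Inst p q} {M : Table p q} {σ : Rotation p q} (hM : Mat T M)
    (hσ : IsGenRotation T T.edges M σ) : rankSum T M < rankSum T (elim M σ) :=
  (dom_elim subset_rfl hσ).rankSum_lt hM (elim_mat subset_rfl hM hσ) (elim_ne subset_rfl hM hσ)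

theorem IsGenRotation.exists_mem {T : Inst p q} {A M : Table p q} {σ : Rotation p q}
    (hσ : IsGenRotation T A M σ) : ∃ e, e ∈ σ.toFinset := toFinset_nonempty hσ.1

section

variable {T : Inst p q} {E₀ MX : Table p q}

theorem dissectBody_spec (hE : E₀ ⊆ T.edges) (hs : IsStableTable T E₀) (hX : IsXOptimal T E₀ MX)
    {M N E : Table p q} {L : Finset (Fin p)} {l : List (Rotation p q)} {Q : Finset (Rotation p q)}
    {s : RAMState} (hD : Dissecting T E₀ MX M N l E Q) (hL : Alive T E₀ N L) (h : Ph T E₀ M N L E s) :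
    ∃ M' N' L' E', ((∃ l Q, Dissecting T E₀ MX M' N' l E' Q) ∧ Alive T E₀ N' L' ∧
      Ph T E₀ M' N' L' E' (dissectBody.run s)) ∧
      ((M = N ∧ L = ∅) ∧ (M' = N' ∧ L' = ∅) ∨ ¬ (M = N ∧ L = ∅) ∧
        L'.card + (p * q - rankSum T M') + (p * q - rankSum T N') <
          L.card + (p * q - rankSum T M) + (p * q - rankSum T N)) := by
  have hN := hD.seq.stable hE hs hX.1
  have hNm := stable_mat hE hN
  have hfr : ∀ a, (findDiff.run s).arr a = s.arr a := fun a => FProg.run_arr _ rfl _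
  have h' : Ph T E₀ M N L E (findDiff.run s) := by
    refine ⟨h.base.congr (FProg.run_var _ rfl _) (FProg.run_var _ rfl _) (hfr _) (hfr _) (hfr _)
      (hfr _), ?_, ?_, ?_, ?_, ?_, ?_, ?_⟩ <;> rw [hfr]
    exacts [h.tab, h.mx, h.my, h.nx, h.ny, h.alive, h.out]
  rcases findDiff_spec h.base.var0 with ⟨h11, heq⟩ | ⟨x₀, h11, hne⟩
  · have hrun : dissectBody.run s = nextP.run (findDiff.run s) :=
      FProg.run_cond_neg (e := .var 11) (by simpa [Expr.eval] using h11)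
    obtain rfl : N = M := (h.nx.congr heq).unique h.mx
    rw [hrun]
    obtain ⟨N', L', hout, hP⟩ := nextP_spec h' hE hNm hL
    cases hout with
    | stay he => exact ⟨N, N, L, E, ⟨⟨l, Q, hD⟩, hL, hP⟩, Or.inl ⟨⟨rfl, he⟩, rfl, he⟩⟩
    | drop x hx hno =>
      refine ⟨N, N, _, E, ⟨⟨l, Q, hD⟩, hL.erase hNm hno, hP⟩, Or.inr ⟨fun ⟨_, e⟩ => ?_, ?_⟩⟩
      · rw [e] at hx
        exact Finset.notMem_empty _ hx
      · have := Finset.card_erase_lt_of_mem hx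
        omega
    | move σ hσ hσA hσL hnext halive =>
      have hrot := Next.isRotation hE hs hN hσ hσA hnext
      refine ⟨N, _, L, E, ⟨⟨_, _, hD.next hE hs hrot⟩, halive, hP⟩, Or.inr ⟨fun ⟨_, e⟩ => ?_, ?_⟩⟩
      · obtain ⟨f, hf⟩ := hσ.exists_mem
        have := hσL f hf
        rw [e] at this
        exact Finset.notMem_empty _ this
      · have := hσ.rankSum_lt hNm
        have := rankSum_le (elim_mat subset_rfl hNm hσ)
        omega
  · have hrun : dissectBody.run s = refineP.run (findDiff.run s) :=
      FProg.run_cond_pos (e := .var 11) (by simp [Expr.eval, h11])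
    rw [hrun]
    obtain ⟨A, σ, C, hA, hC, hσ, hsh, hσC, hnext, hP⟩ := refineP_spec h' hD.mat hNm hD.below h11
      (by rwa [hfr, hfr])
    obtain ⟨Q', hD', _⟩ := hD.refine hE hs hX hA hC hσ hsh hσC hnext
    refine ⟨_, N, L, _, ⟨⟨l, Q', hD'⟩, hL, hP⟩, Or.inr ⟨?_, ?_⟩⟩
    · rintro ⟨rfl, _⟩
      rcases h.mx.cases x₀ with ⟨h0, hno⟩ | ⟨y, hy, hyM⟩
      · rcases h.nx.cases x₀ with ⟨h0', _⟩ | ⟨y, _, hyM⟩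
        · exact hne (h0.trans h0'.symm)
        · exact hno y hyM
      · exact hne (hy.trans (h.nx.eq hyM).symm)
    · have := hσ.rankSum_lt hD.mat
      have := rankSum_le (elim_mat subset_rfl hD.mat hσ)
      omega

/-- The first phase dissects all rotations of `E₀`. -/
theorem often_dissectBody_spec (hE : E₀ ⊆ T.edges) (hs : IsStableTable T E₀)
    (hX : IsXOptimal T E₀ MX) {L : Finset (Fin p)} {s : RAMState} (hL : Alive T E₀ MX L)
    (h : Ph T E₀ MX MX L E₀ s) :
    ∃ N E, Descending T E₀ MX N E ∧ Ph T E₀ N N ∅ E ((often dissectBody).run s) := by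
  obtain ⟨⟨M, N, L, E⟩, ⟨⟨l, Q, hD⟩, ha, hP⟩, hMN, hLe⟩ := often_spec
    (α := Table p q × Table p q × Finset (Fin p) × Table p q) h.base.var0 h.base.var1
    (c := dissectBody) rfl
    (fun a t => (∃ l Q, Dissecting T E₀ MX a.1 a.2.1 l a.2.2.2 Q) ∧ Alive T E₀ a.2.1 a.2.2.1 ∧
      Ph T E₀ a.1 a.2.1 a.2.2.1 a.2.2.2 t) (fun a => a.1 = a.2.1 ∧ a.2.2.1 = ∅)
    (fun a => a.2.2.1.card + (p * q - rankSum T a.1) + (p * q - rankSum T a.2.1))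
    (fun a t v n hv ⟨h1, h2, h3⟩ => ⟨h1, h2, h3.base.setVar hv, h3.tab, h3.mx, h3.my, h3.nx, h3.ny,
      h3.alive, h3.out⟩)
    (fun a t ⟨⟨l, Q, hD⟩, ha, hP⟩ => by
      obtain ⟨M', N', L', E', g1, g2⟩ := dissectBody_spec hE hs hX hD ha hP
      exact ⟨(M', N', L', E'), g1, g2⟩)
    (a := (MX, MX, L, E₀)) ⟨⟨[], exists_start hE hs hX⟩, hL, h⟩
    (by have := hL.card_le; dsimp only; omega)
  dsimp only at hMN hLe hD ha hP
  subst hMN hLe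
  obtain ⟨rfl, hY⟩ := hD.finish hE hs hX ha
  exact ⟨_, E, ⟨hD.reach, hD.xopt _ hX, hD.yopt _ hY⟩, hP⟩

end

/-! ### Extending the chain, as a program -/

open FProg in
/-- Move the matching along rotations of the whole table, as long as possible. -/
def extend : FProg :=
  seq (fill 4 0 10 (.lt (.const 0) (.get 8 (.var 4)))) (seq (fillT 13 (.lt (.const 0) (atX 6 (.var 5))))
    (often (seq step record)))

theorem CodesM.fill_alive {M : Table p q} {s : RAMState} (h0 : s.var 0 = p) {a : ℕ} (ha : 8 ≠ a)
    (h : CodesM (s.arr 8) M) : ∃ L : Finset (Fin p), (∀ x, x ∈ L ↔ ∃ y, (x, y) ∈ M) ∧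
      CodesS (((fill 4 0 a (.lt (.const 0) (.get 8 (.var 4)))).run s).arr a) L := by
  classical
  refine ⟨Finset.univ.filter fun x => ∃ y, (x, y) ∈ M, fun x => by simp, fun x => ?_⟩
  rw [fill_spec (g := fun i => if 0 < s.arr 8 i then 1 else 0) (fun t i _ ht hv => by
    simp only [Expr.eval, hv]; rw [ht 8 ha]) (by rw [h0]; exact x.2)]
  refine if_congr ?_ rfl rfl
  rw [Finset.mem_filter]
  rcases h.cases x with ⟨h0, hno⟩ | ⟨y, hy, hyM⟩
  · simp [h0, hno]
  · exact ⟨fun _ => ⟨Finset.mem_univ _, y, hyM⟩, fun _ => by omega⟩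

theorem extend_spec {T : Inst p q} (G : Table p q → Table p q → Prop) (hG : ∀ M F, G M F → Mat T M)
    (hGm : ∀ M F, G M F → G M (F ∪ M))
    (hGs : ∀ M F σ, G M F → IsGenRotation T T.edges M σ → Next T T.edges M (elim M σ) →
      G (elim M σ) (F ∪ elim M σ)) {M F : Table p q} {s : RAMState} (h : G M F) (hB : Base T s)
    (hmx : CodesM (s.arr 8) M) (hmy : CodesM (s.arr 9) M.swap) (hF : CodesT (s.arr 18) F) :
    ∃ M' F', G M' F' ∧ Alive T T.edges M' ∅ ∧ CodesT ((extend.run s).arr 18) F' := by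
  obtain ⟨L, hL, hcL⟩ := hmx.fill_alive hB.var0 (a := 10) (by decide)
  obtain ⟨s₁, hs₁⟩ : ∃ t, t = (fill 4 0 10 (.lt (.const 0) (.get 8 (.var 4)))).run s := ⟨_, rfl⟩
  obtain ⟨s₂, hs₂⟩ : ∃ t, t = (fillT 13 (.lt (.const 0) (atX 6 (.var 5)))).run s₁ := ⟨_, rfl⟩
  have hrun : extend.run s = (often (.seq step record)).run s₂ := by rw [hs₂, hs₁]; rfl
  rw [← hs₁] at hcL
  have fr1 : ∀ a, (fill 4 0 10 (.lt (.const 0) (.get 8 (.var 4)))).writesArr a = false →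
    s₁.arr a = s.arr a := fun a ha => by rw [hs₁, FProg.run_arr _ ha]
  have fr2 : ∀ a, (fillT 13 (.lt (.const 0) (atX 6 (.var 5)))).writesArr a = false →
    s₂.arr a = s₁.arr a := fun a ha => by rw [hs₂, FProg.run_arr _ ha]
  have hB₁ : Base T s₁ := hB.congr (by rw [hs₁, FProg.run_var _ rfl])
    (by rw [hs₁, FProg.run_var _ rfl]) (fr1 4 rfl) (fr1 5 rfl) (fr1 6 rfl) (fr1 7 rfl)
  have hB₂ : Base T s₂ := hB₁.congr (by rw [hs₂, FProg.run_var _ rfl])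
    (by rw [hs₂, FProg.run_var _ rfl]) (fr2 4 rfl) (fr2 5 rfl) (fr2 6 rfl) (fr2 7 rfl)
  have hpre : Pre T T.edges M L s₂ := by
    refine ⟨hB₂, ?_, ?_, ?_, fun x y => ?_⟩
    · rw [fr2 8 rfl, fr1 8 rfl]; exact hmx
    · rw [fr2 9 rfl, fr1 9 rfl]; exact hmy
    · rw [fr2 10 rfl]; exact hcL
    · rw [hs₂]
      refine fillT_spec hB₁.var0 hB₁.var1 hB₁.rowX (by decide)
        (g := fun x y => if (x, y) ∈ T.edges then 1 else 0) (fun t x y ht h4 h5 => ?_) x y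
      simp only [atX, Expr.eval, h4, h5]
      rw [ht 4 (by decide), hB₁.rowX, ht 6 (by decide), hB₁.rankX]
      split_ifs <;> simp_all
  obtain ⟨⟨M', L', F'⟩, ⟨g1, g2, g3, g4⟩, hLe⟩ := often_spec
    (α := Table p q × Finset (Fin p) × Table p q) hB₂.var0 hB₂.var1 (c := .seq step record) rfl
    (fun a t => G a.1 a.2.2 ∧ Alive T T.edges a.1 a.2.1 ∧ Pre T T.edges a.1 a.2.1 t ∧
      CodesT (t.arr 18) a.2.2) (fun a => a.2.1 = ∅)
    (fun a => a.2.1.card + (p * q - rankSum T a.1))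
    (fun a t v n hv ⟨h1, h2, h3, h4⟩ => ⟨h1, h2, ⟨h3.base.setVar hv, h3.mx, h3.my, h3.alive, h3.tab⟩,
      h4⟩)
    (fun a t hR => by
      obtain ⟨M, L, F⟩ := a
      obtain ⟨g1, g2, g3, g4⟩ := hR
      dsimp only at g1 g2 g3 g4
      obtain ⟨M', L', hout, hpre'⟩ := step_spec g3 subset_rfl (hG _ _ g1) g2
      have f18 : (step.run t).arr 18 = t.arr 18 := FProg.run_arr _ rfl _
      have hc : CodesT ((record.run (step.run t)).arr 18) (F ∪ M') :=
        record_spec hpre'.base.var0 hpre'.base.rowX hpre'.mx (by rw [f18]; exact g4)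
      have hpre'' : Pre T T.edges M' L' (record.run (step.run t)) := by
        have fr : ∀ a, record.writesArr a = false →
            (record.run (step.run t)).arr a = (step.run t).arr a := fun a ha => FProg.run_arr _ ha _
        refine ⟨hpre'.base.congr (FProg.run_var _ rfl _) (FProg.run_var _ rfl _) (fr 4 rfl) (fr 5 rfl)
          (fr 6 rfl) (fr 7 rfl), ?_, ?_, ?_, ?_⟩
        · rw [fr 8 rfl]; exact hpre'.mx
        · rw [fr 9 rfl]; exact hpre'.my
        · rw [fr 10 rfl]; exact hpre'.alive
        · rw [fr 13 rfl]; exact hpre'.tab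
      refine ⟨(M', L', F ∪ M'), ?_⟩
      cases hout with
      | stay he => exact ⟨⟨hGm _ _ g1, g2, hpre'', hc⟩, Or.inl ⟨he, he⟩⟩
      | drop x hx hno =>
        refine ⟨⟨hGm _ _ g1, g2.erase (hG _ _ g1) hno, hpre'', hc⟩, Or.inr ⟨fun e => ?_, ?_⟩⟩
        · dsimp only at e
          rw [e] at hx
          exact Finset.notMem_empty _ hx
        · have := Finset.card_erase_lt_of_mem hx
          dsimp only
          omega
      | move σ hσ hσA hσL hnext halive =>
        refine ⟨⟨hGs _ _ _ g1 hσ hnext, halive, hpre'', hc⟩, Or.inr ⟨fun e => ?_, ?_⟩⟩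
        · obtain ⟨f, hf⟩ := hσ.exists_mem
          have := hσL f hf
          dsimp only at e
          rw [e] at this
          exact Finset.notMem_empty _ this
        · have := hσ.rankSum_lt (hG _ _ g1)
          have := rankSum_le (elim_mat subset_rfl (hG _ _ g1) hσ)
          dsimp only
          omega)
    (a := (M, L, F)) ⟨h, alive_all hL, hpre, by rw [fr2 18 rfl, fr1 18 rfl]; exact hF⟩
    (by have := (alive_all (T := T) (A := T.edges) hL).card_le; dsimp only; omega)
  dsimp only at hLe g2
  rw [hLe] at g2
  exact ⟨M', F', g1, g2, by rw [hrun]; exact g4⟩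

end Marriage

namespace Marriage

variable {p q : ℕ}

/-! ### The complete program -/

/-- Exchange the variables that hold the sizes of the two sides. -/
def swapV : Equiv.Perm ℕ := Equiv.swap 0 1

/-- Exchange the arrays that belong to the two sides. -/
def swapA : Equiv.Perm ℕ :=
  Equiv.swap 0 1 * Equiv.swap 4 5 * Equiv.swap 6 7 * Equiv.swap 8 9 * Equiv.swap 14 18

/-- The program with the two sides exchanged. -/
def FProg.mirror (c : FProg) : FProg := c.rename swapV swapA

theorem FProg.run_mirror_arr (c : FProg) (s : RAMState) (a : ℕ) :
    (c.mirror.run s).arr (swapA a) = (c.run (s.view swapV swapA)).arr a := by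
  rw [← FProg.run_rename swapV.injective swapA.injective]
  rfl

theorem Base.mirror {T : Inst p q} {s : RAMState} (h : Base T s) :
    Base T.swap (s.view swapV swapA) := by
  refine ⟨h.var1, h.var0, h.rowY, h.rowX, fun y x => ?_, fun y x => ?_⟩
  · refine (h.rankY x y).trans (if_congr ?_ rfl rfl)
    rw [edges_swap, mem_swap]
  · refine (h.rankX x y).trans (if_congr ?_ rfl rfl)
    rw [edges_swap, mem_swap]

open FProg in
def prepare : FProg := seq rows (seq rows.mirror (seq ranks ranks.mirror))

theorem flatten_eq {r c : ℕ} {f : Fin r → ℕ → ℕ} (x : Fin r) {k : ℕ} (hk : k < c) :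
    flatten r c f (x * c + k) = f x k := by
  have h1 : ((x : ℕ) * c + k) / c = x := by
    rw [Nat.mul_comm, Nat.mul_add_div (by omega), Nat.div_eq_of_lt hk, Nat.add_zero]
  have h2 : ((x : ℕ) * c + k) % c = k := by
    rw [Nat.mul_comm, Nat.mul_add_mod, Nat.mod_eq_of_lt hk]
  rw [flatten, dif_pos (by rw [h1]; exact x.2), h2]
  congr 1
  exact Fin.ext h1

theorem codesT_inputState {T : Inst p q} {E₀ : Table p q} : CodesT ((inputState T E₀).arr 2) E₀ := by
  intro x y
  refine (flatten_eq (f := fun x k => if ∃ y : Fin q, y.val = k ∧ (x, y) ∈ E₀ then 1 else 0) x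
    y.2).trans (if_congr ⟨?_, fun h => ⟨y, rfl, h⟩⟩ rfl rfl)
  rintro ⟨y', e, h⟩
  rwa [Fin.ext e] at h

theorem prepare_spec {T : Inst p q} {E₀ : Table p q} : Base T (prepare.run (inputState T E₀)) := by
  obtain ⟨s, hs⟩ : ∃ t, t = inputState T E₀ := ⟨_, rfl⟩
  have v0 : s.var 0 = p := by rw [hs]; rfl
  have v1 : s.var 1 = q := by rw [hs]; rfl
  have l0 : ∀ (x : Fin p) (k : ℕ), k < q → s.arr 0 (x * q + k) = listEntry (T.listX x) k :=
    fun x k hk => by rw [hs]; exact flatten_eq (f := fun x k => listEntry (T.listX x) k) x hk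
  have l1 : ∀ (y : Fin q) (k : ℕ), k < p → s.arr 1 (y * p + k) = listEntry (T.swap.listX y) k :=
    fun y k hk => by rw [hs]; exact flatten_eq (f := fun y k => listEntry (T.listY y) k) y hk
  have z6 : ∀ k, s.arr 6 k = 0 := fun k => by rw [hs]; rfl
  have z7 : ∀ k, s.arr 7 k = 0 := fun k => by rw [hs]; rfl
  rw [← hs]
  obtain ⟨s₁, hs₁⟩ : ∃ t, t = rows.run s := ⟨_, rfl⟩
  obtain ⟨s₂, hs₂⟩ : ∃ t, t = rows.mirror.run s₁ := ⟨_, rfl⟩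
  obtain ⟨s₃, hs₃⟩ : ∃ t, t = ranks.run s₂ := ⟨_, rfl⟩
  obtain ⟨s₄, hs₄⟩ : ∃ t, t = ranks.mirror.run s₃ := ⟨_, rfl⟩
  have hrun : prepare.run s = s₄ := by rw [hs₄, hs₃, hs₂, hs₁]; rfl
  have fv1 : ∀ v, rows.writesVar v = false → s₁.var v = s.var v :=
    fun v h => by rw [hs₁, FProg.run_var _ h]
  have fv2 : ∀ v, rows.mirror.writesVar v = false → s₂.var v = s₁.var v :=
    fun v h => by rw [hs₂, FProg.run_var _ h]
  have fv3 : ∀ v, ranks.writesVar v = false → s₃.var v = s₂.var v :=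
    fun v h => by rw [hs₃, FProg.run_var _ h]
  have fv4 : ∀ v, ranks.mirror.writesVar v = false → s₄.var v = s₃.var v :=
    fun v h => by rw [hs₄, FProg.run_var _ h]
  have fa1 : ∀ v, rows.writesArr v = false → s₁.arr v = s.arr v :=
    fun v h => by rw [hs₁, FProg.run_arr _ h]
  have fa2 : ∀ v, rows.mirror.writesArr v = false → s₂.arr v = s₁.arr v :=
    fun v h => by rw [hs₂, FProg.run_arr _ h]
  have fa3 : ∀ v, ranks.writesArr v = false → s₃.arr v = s₂.arr v :=
    fun v h => by rw [hs₃, FProg.run_arr _ h]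
  have fa4 : ∀ v, ranks.mirror.writesArr v = false → s₄.arr v = s₃.arr v :=
    fun v h => by rw [hs₄, FProg.run_arr _ h]
  have r4 : ∀ x : Fin p, s₁.arr 4 x = x * q := fun x => by rw [hs₁]; exact rows_spec v0 v1 x
  have r5 : ∀ y : Fin q, s₂.arr 5 y = y * p := fun y => by
    rw [hs₂]
    refine (congrFun (FProg.run_mirror_arr rows s₁ 4) y).trans (rows_spec ?_ ?_ y)
    · exact (fv1 1 rfl).trans v1
    · exact (fv1 0 rfl).trans v0
  have k6 := fun x y => ranks_spec (T := T) (s := s₂) (by rw [fv2 0 rfl, fv1 0 rfl, v0])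
    (by rw [fv2 1 rfl, fv1 1 rfl, v1]) (by rw [fa2 4 rfl]; exact r4)
    (by rw [fa2 0 rfl, fa1 0 rfl]; exact l0) (by rw [fa2 6 rfl, fa1 6 rfl]; exact z6) x y
  have k7 := fun y x => ranks_spec (T := T.swap) (s := s₃.view swapV swapA)
    ((show s₃.var 1 = q by rw [fv3 1 rfl, fv2 1 rfl, fv1 1 rfl, v1]))
    ((show s₃.var 0 = p by rw [fv3 0 rfl, fv2 0 rfl, fv1 0 rfl, v0]))
    (show ∀ y : Fin q, s₃.arr 5 y = y * p by rw [fa3 5 rfl]; exact r5)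
    (show ∀ (y : Fin q) (k : ℕ), k < p → s₃.arr 1 (y * p + k) = listEntry (T.swap.listX y) k by
      rw [fa3 1 rfl, fa2 1 rfl, fa1 1 rfl]; exact l1)
    (show ∀ k, s₃.arr 7 k = 0 by rw [fa3 7 rfl, fa2 7 rfl, fa1 7 rfl]; exact z7) y x
  rw [hrun]
  refine ⟨?_, ?_, ?_, ?_, fun x y => ?_, fun x y => ?_⟩
  · rw [fv4 0 rfl, fv3 0 rfl, fv2 0 rfl, fv1 0 rfl, v0]
  · rw [fv4 1 rfl, fv3 1 rfl, fv2 1 rfl, fv1 1 rfl, v1]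
  · rw [fa4 4 rfl, fa3 4 rfl, fa2 4 rfl]; exact r4
  · rw [fa4 5 rfl, fa3 5 rfl]; exact r5
  · rw [fa4 6 rfl, hs₃]; exact k6 x y
  · rw [hs₄]
    refine (congrFun (FProg.run_mirror_arr ranks s₃ 6) _).trans ((k7 y x).trans (if_congr ?_ rfl rfl))
    rw [edges_swap, mem_swap]

open FProg in
/-- Copy the first matching and the given table. -/
def copy : FProg :=
  seq (fill 4 0 15 (.get 8 (.var 4))) (seq (fill 5 1 16 (.get 9 (.var 5)))
    (seq (fill 4 0 17 (.lt (.const 0) (.get 8 (.var 4)))) (fillT 18 (atX 2 (.var 5)))))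

theorem copy_spec {T : Inst p q} {E₀ M : Table p q} {s : RAMState} (hB : Base T s)
    (h2 : CodesT (s.arr 2) E₀) (hmx : CodesM (s.arr 8) M) (hmy : CodesM (s.arr 9) M.swap) :
    ∃ L, Alive T E₀ M L ∧ Ph T E₀ M M L E₀ (copy.run s) := by
  obtain ⟨s₁, hs₁⟩ : ∃ t, t = (fill 4 0 15 (.get 8 (.var 4))).run s := ⟨_, rfl⟩
  obtain ⟨s₂, hs₂⟩ : ∃ t, t = (fill 5 1 16 (.get 9 (.var 5))).run s₁ := ⟨_, rfl⟩
  obtain ⟨s₃, hs₃⟩ : ∃ t, t = (fill 4 0 17 (.lt (.const 0) (.get 8 (.var 4)))).run s₂ := ⟨_, rfl⟩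
  obtain ⟨s₄, hs₄⟩ : ∃ t, t = (fillT 18 (atX 2 (.var 5))).run s₃ := ⟨_, rfl⟩
  have hrun : copy.run s = s₄ := by rw [hs₄, hs₃, hs₂, hs₁]; rfl
  have fa1 : ∀ v, (fill 4 0 15 (.get 8 (.var 4))).writesArr v = false → s₁.arr v = s.arr v :=
    fun v h => by rw [hs₁, FProg.run_arr _ h]
  have fa2 : ∀ v, (fill 5 1 16 (.get 9 (.var 5))).writesArr v = false → s₂.arr v = s₁.arr v :=
    fun v h => by rw [hs₂, FProg.run_arr _ h]
  have fa3 : ∀ v, (fill 4 0 17 (.lt (.const 0) (.get 8 (.var 4)))).writesArr v = false →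
    s₃.arr v = s₂.arr v := fun v h => by rw [hs₃, FProg.run_arr _ h]
  have fa4 : ∀ v, (fillT 18 (atX 2 (.var 5))).writesArr v = false → s₄.arr v = s₃.arr v :=
    fun v h => by rw [hs₄, FProg.run_arr _ h]
  have v1 : s₁.var 1 = q := by rw [hs₁, FProg.run_var _ rfl, hB.var1]
  have v2 : s₂.var 0 = p := by rw [hs₂, FProg.run_var _ rfl, hs₁, FProg.run_var _ rfl, hB.var0]
  have hB₃ : Base T s₃ := hB.congr
    (by rw [hs₃, FProg.run_var _ rfl, hs₂, FProg.run_var _ rfl, hs₁, FProg.run_var _ rfl])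
    (by rw [hs₃, FProg.run_var _ rfl, hs₂, FProg.run_var _ rfl, hs₁, FProg.run_var _ rfl])
    (by rw [fa3 4 rfl, fa2 4 rfl, fa1 4 rfl]) (by rw [fa3 5 rfl, fa2 5 rfl, fa1 5 rfl])
    (by rw [fa3 6 rfl, fa2 6 rfl, fa1 6 rfl]) (by rw [fa3 7 rfl, fa2 7 rfl, fa1 7 rfl])
  have hB₄ : Base T s₄ := hB₃.congr (by rw [hs₄, FProg.run_var _ rfl])
    (by rw [hs₄, FProg.run_var _ rfl]) (fa4 4 rfl) (fa4 5 rfl) (fa4 6 rfl) (fa4 7 rfl)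
  have m8 : CodesM (s₂.arr 8) M := by rw [fa2 8 rfl, fa1 8 rfl]; exact hmx
  obtain ⟨L, hL, hcL⟩ := m8.fill_alive v2 (a := 17) (by decide)
  rw [← hs₃] at hcL
  rw [hrun]
  refine ⟨L, alive_all hL, hB₄, ?_, ?_, ?_, ?_, ?_, ?_, ?_⟩
  · rw [fa4 2 rfl, fa3 2 rfl, fa2 2 rfl, fa1 2 rfl]; exact h2
  · rw [fa4 8 rfl, fa3 8 rfl]; exact m8
  · rw [fa4 9 rfl, fa3 9 rfl, fa2 9 rfl, fa1 9 rfl]; exact hmy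
  · refine hmx.congr fun x => ?_
    rw [fa4 15 rfl, fa3 15 rfl, fa2 15 rfl, hs₁]
    exact fill_spec (g := s.arr 8) (fun t i _ ht hv => by
      simp only [Expr.eval, hv]; rw [ht 8 (by decide)]) (by rw [hB.var0]; exact x.2)
  · refine hmy.congr fun y => ?_
    rw [fa4 16 rfl, fa3 16 rfl, hs₂, ← fa1 9 rfl]
    exact fill_spec (g := s₁.arr 9) (fun t i _ ht hv => by
      simp only [Expr.eval, hv]; rw [ht 9 (by decide)]) (by rw [v1]; exact y.2)
  · rw [fa4 17 rfl]; exact hcL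
  · intro x y
    rw [← h2 x y, hs₄]
    refine fillT_spec hB₃.var0 hB₃.var1 hB₃.rowX (by decide)
      (g := fun x y => s.arr 2 (x * q + y)) (fun t x y ht h4 h5 => ?_) x y
    simp only [atX, Expr.eval, h4, h5]
    rw [ht 4 (by decide), hB₃.rowX, ht 2 (by decide), fa3 2 rfl, fa2 2 rfl, fa1 2 rfl]

/-- Join the tables found in the two directions. -/
def unite : FProg :=
  fillT 3 (.lt (.const 0) (.add (atX 18 (.var 5)) (atY 14 (.var 4))))

theorem unite_spec {T : Inst p q} {E : Table p q} {F : Table q p} {s : RAMState} (hB : Base T s)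
    (hE : CodesT (s.arr 18) E) (hF : CodesT (s.arr 14) F) : HoldsOutput (unite.run s) (E ∪ F.swap) := by
  intro x y
  refine fillT_spec hB.var0 hB.var1 hB.rowX (by decide)
    (g := fun x y => if (x, y) ∈ E ∪ F.swap then 1 else 0) (fun t x y ht h4 h5 => ?_) x y
  simp only [atX, atY, Expr.eval, h4, h5]
  rw [ht 4 (by decide), hB.rowX, ht 18 (by decide), hE, ht 5 (by decide), hB.rowY, ht 14 (by decide),
    hF]
  refine if_congr ?_ rfl rfl
  rw [Finset.mem_union, mem_swap]
  split_ifs <;> simp_all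

open FProg in
/-- A random access program for `Internal_Closure`. -/
def closureProg : FProg :=
  seq prepare (seq firstMatching (seq copy (seq (often dissectBody) (seq extend (seq firstMatching
    (seq extend.mirror unite))))))

theorem Descending.mat_sub {T : Inst p q} {E₀ MX M E : Table p q} (hE : E₀ ⊆ T.edges)
    (hs : IsStableTable T E₀) (h : Descending T E₀ MX M E) : Mat T M ∧ M ⊆ E := by
  obtain ⟨c, hc, hr⟩ := h.reach
  have hi : Inv T E ∅ := ((Good.start hE hs hc).reach hr).1
  have hM := ((isYOptimal_iff hi.edges).1 h.yopt).1
  exact ⟨stable_mat hi.edges hM, hM.1.2⟩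

theorem Ascending.mat_sub {T : Inst p q} {E₀ M E : Table p q} (hE : E₀ ⊆ T.edges)
    (hs : IsStableTable T E₀) (h : Ascending T E₀ M E) : Mat T M ∧ M ⊆ E := by
  obtain ⟨c, hc, hr⟩ := h.reach
  have hi : Inv T E ∅ := ((Good.start hE hs hc).reach hr).1
  exact ⟨stable_mat hi.edges h.xopt.1, h.xopt.1.1.2⟩

theorem union_swap_union (E : Table p q) (F M : Table q p) :
    E ∪ (F ∪ M).swap = E ∪ F.swap ∪ M.swap := by
  rw [Finset.union_assoc]
  congr 1
  exact Finset.image_union _ _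

theorem closureProg_spec {T : Inst p q} {E₀ : Table p q} (hE : E₀ ⊆ T.edges)
    (hs : IsStableTable T E₀) :
    ∃ E', Outputs T E₀ E' ∧ HoldsOutput (closureProg.run (inputState T E₀)) E' := by
  obtain ⟨MX, hX⟩ := exists_isXOptimal hE hs
  obtain ⟨s₀, hs₀⟩ : ∃ t, t = inputState T E₀ := ⟨_, rfl⟩
  obtain ⟨s₁, hs₁⟩ : ∃ t, t = prepare.run s₀ := ⟨_, rfl⟩
  obtain ⟨s₂, hs₂⟩ : ∃ t, t = firstMatching.run s₁ := ⟨_, rfl⟩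
  obtain ⟨s₃, hs₃⟩ : ∃ t, t = copy.run s₂ := ⟨_, rfl⟩
  obtain ⟨s₄, hs₄⟩ : ∃ t, t = (often dissectBody).run s₃ := ⟨_, rfl⟩
  obtain ⟨s₅, hs₅⟩ : ∃ t, t = extend.run s₄ := ⟨_, rfl⟩
  obtain ⟨s₆, hs₆⟩ : ∃ t, t = firstMatching.run s₅ := ⟨_, rfl⟩
  obtain ⟨s₇, hs₇⟩ : ∃ t, t = extend.mirror.run s₆ := ⟨_, rfl⟩
  have hrun : closureProg.run (inputState T E₀) = unite.run s₇ := by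
    rw [hs₇, hs₆, hs₅, hs₄, hs₃, hs₂, hs₁, hs₀]; rfl
  have fa1 : ∀ v, prepare.writesArr v = false → s₁.arr v = s₀.arr v :=
    fun v h => by rw [hs₁, FProg.run_arr _ h]
  have fa2 : ∀ v, firstMatching.writesArr v = false → s₂.arr v = s₁.arr v :=
    fun v h => by rw [hs₂, FProg.run_arr _ h]
  have fa3 : ∀ v, copy.writesArr v = false → s₃.arr v = s₂.arr v :=
    fun v h => by rw [hs₃, FProg.run_arr _ h]
  have fa4 : ∀ v, (often dissectBody).writesArr v = false → s₄.arr v = s₃.arr v :=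
    fun v h => by rw [hs₄, FProg.run_arr _ h]
  have fa5 : ∀ v, extend.writesArr v = false → s₅.arr v = s₄.arr v :=
    fun v h => by rw [hs₅, FProg.run_arr _ h]
  have fa6 : ∀ v, firstMatching.writesArr v = false → s₆.arr v = s₅.arr v :=
    fun v h => by rw [hs₆, FProg.run_arr _ h]
  have fa7 : ∀ v, extend.mirror.writesArr v = false → s₇.arr v = s₆.arr v :=
    fun v h => by rw [hs₇, FProg.run_arr _ h]
  have hB₁ : Base T s₁ := by rw [hs₁, hs₀]; exact prepare_spec
  have t₁ : CodesT (s₁.arr 2) E₀ := by rw [fa1 2 rfl, hs₀]; exact codesT_inputState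
  have hB₂ : Base T s₂ := hB₁.congr (by rw [hs₂, FProg.run_var _ rfl])
    (by rw [hs₂, FProg.run_var _ rfl]) (fa2 4 rfl) (fa2 5 rfl) (fa2 6 rfl) (fa2 7 rfl)
  have hM₂ := firstMatching_spec hE hs hX hB₁ t₁
  rw [← hs₂] at hM₂
  obtain ⟨L, hL, hP⟩ := copy_spec hB₂ (by rw [fa2 2 rfl]; exact t₁) hM₂.1 hM₂.2
  rw [← hs₃] at hP
  obtain ⟨N, E₁, hD, hP₄⟩ := often_dissectBody_spec hE hs hX hL hP
  rw [← hs₄] at hP₄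
  obtain ⟨N', E₂, hD₂, ha₂, hc₂⟩ := extend_spec (T := T) (fun M F => Descending T E₀ MX M F)
    (fun M F h => (h.mat_sub hE hs).1)
    (fun M F h => by rwa [Finset.union_eq_left.2 (h.mat_sub hE hs).2])
    (fun M F σ h hσ hn => h.step hE hs hσ hn) hD hP₄.base hP₄.mx hP₄.my hP₄.out
  rw [← hs₅] at hc₂
  have hA := hD₂.done hE hs ha₂
  have hB₅ : Base T s₅ := hP₄.base.congr (by rw [hs₅, FProg.run_var _ rfl])
    (by rw [hs₅, FProg.run_var _ rfl]) (fa5 4 rfl) (fa5 5 rfl) (fa5 6 rfl) (fa5 7 rfl)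
  have hM₆ := firstMatching_spec hE hs hX hB₅ (by rw [fa5 2 rfl]; exact hP₄.tab)
  rw [← hs₆] at hM₆
  have hB₆ : Base T s₆ := hB₅.congr (by rw [hs₆, FProg.run_var _ rfl])
    (by rw [hs₆, FProg.run_var _ rfl]) (fa6 4 rfl) (fa6 5 rfl) (fa6 6 rfl) (fa6 7 rfl)
  have hB₇ : Base T s₇ := hB₆.congr (by rw [hs₇, FProg.run_var _ rfl])
    (by rw [hs₇, FProg.run_var _ rfl]) (fa7 4 rfl) (fa7 5 rfl) (fa7 6 rfl) (fa7 7 rfl)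
  have z14 : ∀ k, s₆.arr 14 k = 0 := fun k => by
    rw [fa6 14 rfl, fa5 14 rfl, fa4 14 rfl, fa3 14 rfl, fa2 14 rfl, fa1 14 rfl, hs₀]; rfl
  obtain ⟨K, F, hA₃, ha₃, hc₃⟩ := extend_spec (T := T.swap) (M := MX.swap) (F := ∅)
    (s := s₆.view swapV swapA)
    (fun M F => Ascending T E₀ M.swap (E₂ ∪ F.swap)) 
    (fun M F h => by rw [← swap_swap M]; exact mat_swap.2 (h.mat_sub hE hs).1)
    (fun M F h => by
      rwa [union_swap_union, Finset.union_eq_left.2 (h.mat_sub hE hs).2])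
    (fun M F σ h hσ hn => by
      have := h.step hE hs (τ := σ) (by rwa [swap_swap]) (by rwa [swap_swap])
      rwa [swap_swap, ← union_swap_union] at this)
    (by rwa [swap_swap, show (∅ : Table q p).swap = ∅ from rfl, Finset.union_empty]) hB₆.mirror hM₆.2
    (by rw [swap_swap]; exact hM₆.1) (fun y x => by
      rw [if_neg (Finset.notMem_empty _)]; exact z14 _)
  have hc₇ : CodesT (s₇.arr 14) F := by
    have := FProg.run_mirror_arr extend s₆ 18
    rw [← this, ← hs₇] at hc₃
    exact hc₃
  refine ⟨_, hA₃.done hE hs (by rwa [swap_swap]), ?_⟩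
  rw [hrun]
  exact unite_spec hB₇ (by rw [fa7 18 rfl, fa6 18 rfl]; exact hc₂) hc₇

theorem exists_closureProg : ∃ (P : Prog) (C : ℕ), ∀ (p q : ℕ) (T : Inst p q) (E₀ : Table p q),
    E₀ ⊆ T.edges → IsStableTable T E₀ → ∃ (s : RAMState) (t : ℕ) (E' : Table p q),
      Exec P (inputState T E₀) s t ∧ t ≤ C * (p + q) ^ 4 + C ∧ HoldsOutput s E' ∧
        Outputs T E₀ E' := by
  refine ⟨closureProg.compile, closureProg.factor * 16, fun p q T E₀ hE hs => ?_⟩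
  obtain ⟨E', h1, h2⟩ := closureProg_spec hE hs
  obtain ⟨t, ht, hx⟩ := closureProg.exec_compile (by rfl) (b := p + q) (inputState T E₀)
    (show p ≤ p + q by omega) (show q ≤ p + q by omega)
  refine ⟨_, t, E', hx, ht.trans ?_, h2, h1⟩
  rw [show closureProg.depth = 4 by rfl]
  generalize closureProg.factor = k
  have key : (p + q + 1) ^ 4 ≤ 16 * (p + q) ^ 4 + 16 := by
    rcases Nat.eq_zero_or_pos (p + q) with h | h
    · simp [h]
    · calc (p + q + 1) ^ 4 ≤ (2 * (p + q)) ^ 4 := Nat.pow_le_pow_left (by omega) 4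
        _ = 16 * (p + q) ^ 4 := by ring
        _ ≤ _ := by omega
  calc k * (p + q + 1) ^ 4 ≤ k * (16 * (p + q) ^ 4 + 16) := Nat.mul_le_mul_left _ key
    _ = k * 16 * (p + q) ^ 4 + k * 16 := by ring


end Marriage
/-- `Internal_Closure` is correct: on a stable subtable `E₀` of a marriage instance `T`, every run halts
and every output `E'` is a subtable of `T` for which the stable matchings of `E'` form an internal
closure of those of `E₀`. It runs in time `O(n ^ 4)` with `n = p + q` agents: a fixed program for a
random access machine halts within that time and finds an output of `Internal_Closure`. -/
theorem mainTheorem2 :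
    (∀ (p q : ℕ) (T : Marriage.Inst p q) (E₀ : Marriage.Table p q),
      E₀ ⊆ T.edges → Marriage.IsStableTable T E₀ →
        Marriage.AlwaysHalts T E₀ ∧
        ∀ E' : Marriage.Table p q, Marriage.Outputs T E₀ E' →
          E' ⊆ T.edges ∧
          Marriage.IsInternalClosure T
            (Marriage.stableMatchings T E') (Marriage.stableMatchings T E₀)) ∧
    ∃ (P : Marriage.Prog) (C : ℕ),
      ∀ (p q : ℕ) (T : Marriage.Inst p q) (E₀ : Marriage.Table p q),
        E₀ ⊆ T.edges → Marriage.IsStableTable T E₀ →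
          ∃ (s : Marriage.RAMState) (t : ℕ) (E' : Marriage.Table p q),
            Marriage.Exec P (Marriage.inputState T E₀) s t ∧
            t ≤ C * (p + q) ^ 4 + C ∧
            Marriage.HoldsOutput s E' ∧
            Marriage.Outputs T E₀ E' ∧
            E' ⊆ T.edges ∧
            Marriage.IsInternalClosure T
              (Marriage.stableMatchings T E') (Marriage.stableMatchings T E₀) := by
  refine ⟨fun p q T E₀ hE hs => ⟨Marriage.alwaysHalts hE hs, fun E' h =>
    Marriage.Outputs.spec hE hs h⟩, ?_⟩
  obtain ⟨P, C, h⟩ := Marriage.exists_closureProg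
  refine ⟨P, C, fun p q T E₀ hE hs => ?_⟩
  obtain ⟨s, t, E', h1, h2, h3, h4⟩ := h p q T E₀ hE hs
  exact ⟨s, t, E', h1, h2, h3, h4, Marriage.Outputs.spec hE hs h4⟩
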